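/- Let $X$ be a compact connected complex manifold of dimension $n$, let $\omega$ be a Kähler form on $X$, and let $\mu$ be a smooth, strictly positive volume form on $X$. Write $dd^c=\frac{i}{2\pi}\partial\bar\partial$ and $I_\mu(u)=\int_X u\,d\mu$. A $C^{1,1}$-subgeodesic is a family $(u_t)_{0\le t\le 1}$ of functions on $X$ such that $U(x,\tau)=u_{\mathrm{Re}\,\tau}(x)$ is continuous on $X\times\{0\le \mathrm{Re}\,\tau\le 1\}$ and $\pi^*\omega+dd^cU$ is a positive current on $X\times\{0<\mathrm{Re}\,\tau<1\}$ whose coefficients are bounded up to the boundary (i.e. it is bounded above by a constant times $\pi^*\omega+\frac i2 d\tau\wedge d\bar\tau$), where $\pi$ is the projection to $X$. Put $\omega_t=\omega+dd^cu_t$, a positive current on $X$. Let $\mathcal H$ be the space of smooth functions $u$ on $X$ with $\omega_u=\omega+dd^cu>0$. For $u,v\in\mathcal H$ the Mabuchi distance $d(\omega_u,\omega_v)$ is the infimum of the lengths $\int_0^1\big(\int_X(\dot\varphi_t-b_t)^2\,\omega_{\varphi_t}^n\big)^{1/2}dt$ of smooth curves $(\varphi_t)_{0\le t\le1}$ in $\mathcal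 H$ with $\omega_{\varphi_0}=\omega_u$ and $\omega_{\varphi_1}=\omega_v$, where $b_t$ is the average of $\dot\varphi_t$ with respect to $\omega_{\varphi_t}^n$; it is extended to continuous $\omega$-plurisubharmonic potentials by continuity under uniform convergence of the potentials. **Proposition 4.1.** $I_\mu$ is strictly convex along $C^{1,1}$-subgeodesics in the following sense. Let $(u_t)_{0\le t\le1}$ be a $C^{1,1}$-subgeodesic and $f(t)=I_\mu(u_t)$. Then $f$ is differentiable (one-sidedly at the end points) and convex on $[0,1]$, and if $f$ is affine on $[0,1]$, then $\omega_t$ does not depend on $t\in[0,1]$. More precisely, there is a constant $\delta>0$, depending only on $\mu$, $\omega$ and $X$, such that for every $C^{1,1}$-subgeodesic $(u_t)_{0\le t\le1}$ and all constants $C>0$ and $A\ge0$ with $\omega_t\le C\omega$ for all $t\in[0,1]$ and $\mu\ge A\omega^n$, $$f'(1)-f'(0)\ \ge\ \frac{\delta A}{C^{n+1}}\,d(\omega_0,\omega_1)^2 .$$ -/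

import Mathlib

open Set Filter Topology MeasureTheory
open scoped Manifold ContDiff

noncomputable section

/-- The model space `ℂⁿ` (its volume is Lebesgue measure). -/
abbrev Cn (n : ℕ) : Type := Fin n → ℂ

/-- The real `(1,1)`-form `dd^c f = (i/2π) ∂∂̄ f` of a function `f` on a complex vector space,
evaluated at the point `p` on the vectors `v, w`. In particular
`ddc f p v (i v) = (1/π) ∑ f_{j k̄} v_j v̄_k`. -/
def ddc {V : Type*} [NormedAddCommGroup V] [NormedSpace ℂ V] (f : V → ℝ) (p v w : V) : ℝ :=
  (iteratedFDeriv ℝ 2 f p ![Complex.I • v, w] - iteratedFDeriv ℝ 2 f p ![v, Complex.I • w]) /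
    (4 * Real.pi)

/-- Test functions: smooth with compact support in the set `W`. -/
def IsTestFunction {V : Type*} [NormedAddCommGroup V] [NormedSpace ℂ V]
    (W : Set V) (χ : V → ℝ) : Prop :=
  ContDiff ℝ ∞ χ ∧ HasCompactSupport χ ∧ tsupport χ ⊆ W

section Manifold

variable {n : ℕ} {X : Type*} [TopologicalSpace X] [ChartedSpace (Cn n) X]

/-- The expression, in a chart `e`, of a field of real bilinear forms on the tangent spaces:
the pull-back under `e⁻¹`, at the point `z` of `ℂⁿ`, evaluated on `v, w`. -/
def chartForm
    (θ : ∀ x : X, TangentSpace 𝓘(ℂ, Cn n) x →ₗ[ℝ] TangentSpace 𝓘(ℂ, Cn n) x →ₗ[ℝ] ℝ)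
    (e : OpenPartialHomeomorph X (Cn n)) (z v w : Cn n) : ℝ :=
  θ (e.symm z) (mfderiv 𝓘(ℂ, Cn n) 𝓘(ℂ, Cn n) e.symm z v)
    (mfderiv 𝓘(ℂ, Cn n) 𝓘(ℂ, Cn n) e.symm z w)

variable (n X) in
/-- A Kähler form: a smooth, real, positive, closed `(1,1)`-form. -/
structure KahlerForm where
  form : ∀ x : X, TangentSpace 𝓘(ℂ, Cn n) x →ₗ[ℝ] TangentSpace 𝓘(ℂ, Cn n) x →ₗ[ℝ] ℝ
  alternating : ∀ x v, form x v v = 0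
  type_one_one : ∀ x v w, form x (Complex.I • v) (Complex.I • w) = form x v w
  positive : ∀ x v, v ≠ 0 → 0 < form x v (Complex.I • v)
  smooth : ∀ e ∈ atlas (Cn n) X, ∀ v w : Cn n,
    ContDiffOn ℝ ∞ (fun z => chartForm form e z v w) e.target
  closed : ∀ e ∈ atlas (Cn n) X, ∀ z ∈ e.target, ∀ a b c : Cn n,
    fderiv ℝ (fun y => chartForm form e y b c) z a
      + fderiv ℝ (fun y => chartForm form e y c a) z b
      + fderiv ℝ (fun y => chartForm form e y a b) z c = 0

/-- The Kähler form `Ω` in the chart `e`. -/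
def KahlerForm.coord (Ω : KahlerForm n X) (e : OpenPartialHomeomorph X (Cn n))
    (z v w : Cn n) : ℝ :=
  chartForm Ω.form e z v w

/-- `Ω_u = Ω + dd^c u` in the chart `e`, for a smooth function `u`. -/
def KahlerForm.potForm (Ω : KahlerForm n X) (u : X → ℝ) (e : OpenPartialHomeomorph X (Cn n))
    (z v w : Cn n) : ℝ :=
  Ω.coord e z v w + ddc (fun y => u (e.symm y)) z v w

/-- The space `ℋ(X, Ω)` of smooth Kähler potentials: `u` is smooth and `Ω + dd^c u > 0`. -/
def KahlerForm.IsPotential (Ω : KahlerForm n X) (u : X → ℝ) : Prop :=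
  ContMDiff 𝓘(ℝ, Cn n) 𝓘(ℝ) ∞ u ∧
  ∀ e ∈ atlas (Cn n) X, ∀ z ∈ e.target, ∀ v : Cn n, v ≠ 0 → 0 < Ω.potForm u e z v (Complex.I • v)

/-! ### Currents, tested against functions supported in charts -/

/-- The coefficient `(v, w)` of the current `Ω_u = Ω + dd^c u` in the chart `e`, as a
distribution applied to the test function `χ`. -/
def KahlerForm.currentPair (Ω : KahlerForm n X) (u : X → ℝ)
    (e : OpenPartialHomeomorph X (Cn n)) (χ : Cn n → ℝ) (v w : Cn n) : ℝ :=
  ∫ z, (Ω.coord e z v w * χ z + u (e.symm z) * ddc χ z v w)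

/-- `Ω_u = Ω_v` as currents on `X`. -/
def KahlerForm.SameCurrent (Ω : KahlerForm n X) (u v : X → ℝ) : Prop :=
  ∀ e ∈ atlas (Cn n) X, ∀ χ : Cn n → ℝ, IsTestFunction e.target χ →
    ∀ a b : Cn n, Ω.currentPair u e χ a b = Ω.currentPair v e χ a b

/-- `Ω_u ≤ C Ω` as currents on `X`. -/
def KahlerForm.CurrentLE (Ω : KahlerForm n X) (u : X → ℝ) (C : ℝ) : Prop :=
  ∀ e ∈ atlas (Cn n) X, ∀ χ : Cn n → ℝ, IsTestFunction e.target χ → (∀ z, 0 ≤ χ z) →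
    ∀ v : Cn n, Ω.currentPair u e χ v (Complex.I • v) ≤
      C * ∫ z, Ω.coord e z v (Complex.I • v) * χ z

/-- The strip `D = {0 < Re τ < 1}`. -/
def strip : Set ℂ := {τ | 0 < τ.re ∧ τ.re < 1}

/-- The coefficient `(V, W)` of the current `π^* Ω + dd^c U` on `X × D`, where
`U(x, τ) = u_{Re τ}(x)`, in the product of the chart `e` and the coordinate `τ`. -/
def KahlerForm.stripPair (Ω : KahlerForm n X) (u : ℝ → X → ℝ)
    (e : OpenPartialHomeomorph X (Cn n)) (χ : Cn n × ℂ → ℝ) (V W : Cn n × ℂ) : ℝ :=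
  ∫ p : Cn n × ℂ, (Ω.coord e p.1 V.1 W.1 * χ p + u p.2.re (e.symm p.1) * ddc χ p V W)

/-- `C^{1,1}`-subgeodesics `(u_t)`, `0 ≤ t ≤ 1`: the function `U(x, τ) = u_{Re τ}(x)` is
continuous up to the boundary, `π^* Ω + dd^c U` is a positive current on `X × D`, and its
coefficients are bounded up to the boundary, that is, it is bounded from above by a constant times
the metric `π^* Ω + (i/2) dτ ∧ dτ̄`. (With the annulus in place of the strip one has
`t = log |τ|`; the two descriptions correspond under the exponential.) -/
structure KahlerForm.IsSubgeodesic (Ω : KahlerForm n X) (u : ℝ → X → ℝ) : Prop where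
  continuous : ContinuousOn (fun p : ℝ × X => u p.1 p.2) (Icc 0 1 ×ˢ univ)
  positive : ∀ e ∈ atlas (Cn n) X, ∀ χ : Cn n × ℂ → ℝ,
    IsTestFunction (e.target ×ˢ strip) χ → (∀ p, 0 ≤ χ p) →
      ∀ V : Cn n × ℂ, 0 ≤ Ω.stripPair u e χ V (Complex.I • V)
  bounded : ∃ K : ℝ, ∀ e ∈ atlas (Cn n) X, ∀ χ : Cn n × ℂ → ℝ,
    IsTestFunction (e.target ×ˢ strip) χ → (∀ p, 0 ≤ χ p) →
      ∀ V : Cn n × ℂ, Ω.stripPair u e χ V (Complex.I • V) ≤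
        K * ∫ p : Cn n × ℂ, (Ω.coord e p.1 V.1 (Complex.I • V.1) + ‖V.2‖ ^ 2) * χ p

/-! ### Volume forms -/

variable (n X) in
theorem exists_chartCenters [CompactSpace X] :
    ∃ S : Finset X, ∀ x : X, ∃ c ∈ S, x ∈ (chartAt (Cn n) c).source := by
  obtain ⟨S, hS⟩ := isCompact_univ.elim_finite_subcover
    (fun c : X => (chartAt (Cn n) c).source) (fun c => (chartAt (Cn n) c).open_source)
    (fun x _ => mem_iUnion.2 ⟨x, mem_chart_source (Cn n) x⟩)
  refine ⟨S, fun x => ?_⟩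
  simpa using hS (mem_univ x)

variable (n X) in
/-- Centers of finitely many preferred charts that cover `X`. -/
def chartCenters [CompactSpace X] : Finset X := (exists_chartCenters n X).choose

open Classical in
variable (n X) in
/-- The number of the charts of the finite cover whose domain contains `x`. -/
def chartMultiplicity [CompactSpace X] (x : X) : ℕ :=
  ((chartCenters n X).filter (fun c => x ∈ (chartAt (Cn n) c).source)).card

/-- The measure on `X` whose density with respect to Lebesgue measure in the chart `e` is `ρ e`.
The pieces coming from the charts of a finite cover are added up, each weighted with the inverse of
the number of charts that contain the point. -/
def glueMeasure [CompactSpace X] [MeasurableSpace X]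
    (ρ : OpenPartialHomeomorph X (Cn n) → Cn n → ℝ) : Measure X :=
  ∑ c ∈ chartCenters n X,
    ((volume.restrict (chartAt (Cn n) c).target).withDensity (fun z =>
      ENNReal.ofReal (ρ (chartAt (Cn n) c) z) /
        (chartMultiplicity n X ((chartAt (Cn n) c).symm z) : ENNReal))).map
      (chartAt (Cn n) c).symm

/-- The Hermitian matrix `H` of a real `(1,1)`-form `θ` with constant coefficients:
`v̄ᵀ H w = θ(v, i w) + i θ(v, w)`, so that `v̄ᵀ H v = θ(v, i v)`. -/
def hermitianMatrix (θ : Cn n → Cn n → ℝ) : Matrix (Fin n) (Fin n) ℂ :=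
  Matrix.of fun j k =>
    (θ (Pi.single j 1) (Complex.I • Pi.single k 1) : ℂ)
      + Complex.I * (θ (Pi.single j 1) (Pi.single k 1) : ℂ)

/-- The measure `Ω_u^n` (top exterior power), for a smooth function `u`: if
`θ = (i/2) ∑ H_{jk} dz_j ∧ dz̄_k`, then `θ^n = n! det H dλ`. -/
def KahlerForm.topPower [CompactSpace X] [MeasurableSpace X] (Ω : KahlerForm n X) (u : X → ℝ) :
    Measure X :=
  glueMeasure fun e z => (n.factorial : ℝ) * (hermitianMatrix (Ω.potForm u e z)).det.re

variable (n) in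
/-- Smooth, strictly positive volume forms, as measures: in every chart the measure has a smooth
and strictly positive density with respect to Lebesgue measure. -/
def IsSmoothVolume [MeasurableSpace X] (μ : Measure X) : Prop :=
  ∀ e ∈ atlas (Cn n) X, ∃ ρ : Cn n → ℝ, ContDiffOn ℝ ∞ ρ e.target ∧ (∀ z ∈ e.target, 0 < ρ z) ∧
    (μ.restrict e.source).map e =
      (volume.restrict e.target).withDensity (fun z => ENNReal.ofReal (ρ z))

/-! ### The Mabuchi distance -/

/-- Smooth curves `(φ_t)`, `0 ≤ t ≤ 1`, of Kähler potentials. -/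
def KahlerForm.IsSmoothCurve (Ω : KahlerForm n X) (φ : ℝ → X → ℝ) : Prop :=
  ContMDiff (𝓘(ℝ).prod 𝓘(ℝ, Cn n)) 𝓘(ℝ) ∞ (fun p : ℝ × X => φ p.1 p.2) ∧
  ∀ t ∈ Icc (0 : ℝ) 1, Ω.IsPotential (φ t)

/-- The length, for the Mabuchi metric, of the curve `(Ω_{φ_t})` in the space of Kähler metrics
(potentials modulo constants): the square of the speed is `∫ (φ̇_t - b_t)² Ω_{φ_t}^n`, where `b_t`
is the average of `φ̇_t` with respect to `Ω_{φ_t}^n`. -/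
def KahlerForm.mabuchiLength [CompactSpace X] [MeasurableSpace X] (Ω : KahlerForm n X)
    (φ : ℝ → X → ℝ) : ℝ :=
  ∫ t in (0 : ℝ)..1, Real.sqrt (∫ x, (deriv (fun s => φ s x) t
    - ⨍ y, deriv (fun s => φ s y) t ∂(Ω.topPower (φ t))) ^ 2 ∂(Ω.topPower (φ t)))

/-- The Mabuchi distance `d(Ω_u, Ω_v)` between the Kähler metrics with potentials `u, v ∈ ℋ`: the
infimum of the lengths of the smooth curves of Kähler metrics, in the class of `Ω`, joining them
(a Kähler metric determines its potential up to a constant). -/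
def KahlerForm.mabuchiDist [CompactSpace X] [MeasurableSpace X] (Ω : KahlerForm n X)
    (u v : X → ℝ) : ℝ :=
  sInf {L : ℝ | ∃ φ : ℝ → X → ℝ, Ω.IsSmoothCurve φ ∧
    (∃ c : ℝ, ∀ x, φ 0 x = u x + c) ∧ (∃ c : ℝ, ∀ x, φ 1 x = v x + c) ∧ L = Ω.mabuchiLength φ}

/-- `d` is the Mabuchi distance between `Ω_u` and `Ω_v`, for continuous `Ω`-plurisubharmonic
functions `u, v`: the distance on `ℋ`, extended by continuity with respect to uniform convergence
of potentials. -/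
def KahlerForm.HasMabuchiDist [CompactSpace X] [MeasurableSpace X] (Ω : KahlerForm n X)
    (u v : X → ℝ) (d : ℝ) : Prop :=
  ∃ a b : ℕ → X → ℝ, (∀ j, Ω.IsPotential (a j)) ∧ (∀ j, Ω.IsPotential (b j)) ∧
    TendstoUniformly a u atTop ∧ TendstoUniformly b v atTop ∧
    Tendsto (fun j => Ω.mabuchiDist (a j) (b j)) atTop (𝓝 d)

/-- On `ℋ` the extended distance is the Mabuchi distance itself. -/
theorem KahlerForm.hasMabuchiDist_mabuchiDist [CompactSpace X] [MeasurableSpace X]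
    (Ω : KahlerForm n X) {u v : X → ℝ} (hu : Ω.IsPotential u) (hv : Ω.IsPotential v) :
    Ω.HasMabuchiDist u v (Ω.mabuchiDist u v) :=
  ⟨fun _ => u, fun _ => v, fun _ => hu, fun _ => hv,
    fun _ h => Eventually.of_forall fun _ _ => refl_mem_uniformity h,
    fun _ h => Eventually.of_forall fun _ _ => refl_mem_uniformity h, tendsto_const_nhds⟩

end Manifold

end

/-!
# Strict convexity of linear functionals along subgeodesics of Kähler potentials

Positivity of `π^*Ω + dd^c U` on the product of `X` with the strip says, for smooth
`U(x, τ) = u_{re τ}(x)`, that a quadratic polynomial in the direction of `τ` is nonnegative. Its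
discriminant gives, for `Ω_t ≤ C Ω`,

  `|d u̇_t|² ≤ 4 π C ü_t`,

where the gradient is measured with `Ω`. The Poincaré inequality for `μ` on the compact connected
manifold `X` (`IsSmoothVolume.poincareOn_univ`, from the inequality on balls and connectedness) bounds
the `μ`-variance of `u̇_t` by `4 π K C ∫ ü_t dμ`. Since `Ω_t^n ≤ C^n Ω^n ≤ C^n A⁻¹ μ`, this bounds the
square of the Mabuchi speed of the curve, and the integral over `t` of the acceleration is
`f'(1) - f'(0)`. So the square of the distance is at most `4 π K C^{n+1} A⁻¹ (f'(1) - f'(0))`. If `f` is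
affine, the variance of the velocity vanishes and `u_t - u_s` is constant on `X`.

A subgeodesic is only continuous with bounded `dd^c U`, and `Ω_t` is only nonnegative, so the argument
is applied to regularizations on `[σ, 1 - σ]` (`KahlerForm.IsRegularization`): smooth curves of Kähler
potentials for which all the inequalities hold with a small loss. Mollification in charts passes the
bounds for the current on to the Levi form (`KahlerForm.IsSubgeodesic.exists_local_regularization`).
The mollifications are glued by a partition of unity
(`KahlerForm.IsSubgeodesic.exists_smooth_approx`), where the errors contain derivatives of differences
of two mollifications. These differences are uniformly small with bounded Levi form, so the
interpolation inequality `abs_fderiv_le_of_levi_bounded` makes their first derivatives small too.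
Scaling by a factor slightly below one makes the potentials strictly positive
(`KahlerForm.IsSubgeodesic.exists_potential_approx`). The same regularizations show that
`t ↦ u_t(x)` is convex with bounded second derivative
(`KahlerForm.IsSubgeodesic.convexOn_curve`), whence convexity and differentiability of `f`.

The Mabuchi distance of two potentials close to `u_0` and `u_1` is estimated by the length of a curve
that passes over to the regularization in a time `σ`, follows it, and passes over to the end point in a
time `σ` (`KahlerForm.IsSubgeodesic.exists_mabuchiDist_le`). The transitions have bounded speed with
respect to the measures `Ω_φ^n`, because these have the same total mass for all potentials `φ`
(`KahlerForm.IsPotential.topPower_univ`). This is Stokes' theorem, proved in charts: the derivative of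
the determinant in the direction of `dd^c w` is a divergence, as the cofactor matrix of a closed form
is divergence free (`sum_dbar_adjugate_eq_zero`), and the general case follows by adding small pieces
of the potential that are supported in charts.
-/

noncomputable section

set_option linter.unusedSectionVars false

/-! ### The complex Hessian and its Levi form -/

section Calculus

variable {V W : Type*} [NormedAddCommGroup V] [NormedSpace ℂ V]
  [NormedAddCommGroup W] [NormedSpace ℂ W]

theorem ddc_eq (f : V → ℝ) (p v w : V) :
    ddc f p v w = (fderiv ℝ (fderiv ℝ f) p (Complex.I • v) w
      - fderiv ℝ (fderiv ℝ f) p v (Complex.I • w)) / (4 * Real.pi) := by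
  simp [ddc, iteratedFDeriv_two_apply]

theorem Complex.I_smul_I_smul (v : V) : Complex.I • Complex.I • v = -v := by
  rw [smul_smul, Complex.I_mul_I, neg_one_smul]

/-- The Levi form of `f`: `dd^c f` on the complex line spanned by `v`. -/
def levi (f : V → ℝ) (p v : V) : ℝ := ddc f p v (Complex.I • v)

theorem levi_eq (f : V → ℝ) (p v : V) :
    levi f p v = (fderiv ℝ (fderiv ℝ f) p v v
      + fderiv ℝ (fderiv ℝ f) p (Complex.I • v) (Complex.I • v)) / (4 * Real.pi) := by
  rw [levi, ddc_eq, Complex.I_smul_I_smul, map_neg]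
  ring

theorem Filter.EventuallyEq.ddc_eq {f g : V → ℝ} {p : V} (h : f =ᶠ[𝓝 p] g) (v w : V) :
    ddc f p v w = ddc g p v w := by
  rw [_root_.ddc_eq, _root_.ddc_eq, (h.fderiv (𝕜 := ℝ)).fderiv_eq]

theorem Filter.EventuallyEq.levi_eq {f g : V → ℝ} {p : V} (h : f =ᶠ[𝓝 p] g) (v : V) :
    levi f p v = levi g p v := h.ddc_eq v _

theorem ContDiffAt.differentiableAt_fderiv {𝕜 E F : Type*} [NontriviallyNormedField 𝕜]
    [NormedAddCommGroup E] [NormedSpace 𝕜 E] [NormedAddCommGroup F] [NormedSpace 𝕜 F]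
    {f : E → F} {p : E} (hf : ContDiffAt 𝕜 2 f p) : DifferentiableAt 𝕜 (fderiv 𝕜 f) p :=
  (hf.fderiv_right (m := 1) (by norm_num)).differentiableAt (by norm_num)

theorem ContDiffAt.eventually_differentiableAt {𝕜 E F : Type*} [NontriviallyNormedField 𝕜]
    [NormedAddCommGroup E] [NormedSpace 𝕜 E] [NormedAddCommGroup F] [NormedSpace 𝕜 F]
    {f : E → F} {p : E} (hf : ContDiffAt 𝕜 2 f p) : ∀ᶠ q in 𝓝 p, DifferentiableAt 𝕜 f q :=
  (hf.eventually (by norm_num)).mono fun _ h => h.differentiableAt (by norm_num)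

theorem fderiv_fderiv_add {f g : V → ℝ} {p : V} (hf : ContDiffAt ℝ 2 f p)
    (hg : ContDiffAt ℝ 2 g p) : fderiv ℝ (fderiv ℝ (fun q => f q + g q)) p
      = fderiv ℝ (fderiv ℝ f) p + fderiv ℝ (fderiv ℝ g) p := by
  have h : fderiv ℝ (fun q => f q + g q) =ᶠ[𝓝 p] fun q => fderiv ℝ f q + fderiv ℝ g q := by
    filter_upwards [hf.eventually_differentiableAt, hg.eventually_differentiableAt] with q h1 h2
    exact fderiv_fun_add h1 h2
  rw [h.fderiv_eq]
  exact fderiv_fun_add hf.differentiableAt_fderiv hg.differentiableAt_fderiv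

theorem fderiv_fderiv_mul {f g : V → ℝ} {p : V} (hf : ContDiffAt ℝ 2 f p)
    (hg : ContDiffAt ℝ 2 g p) (v w : V) : fderiv ℝ (fderiv ℝ (fun q => f q * g q)) p v w
      = f p * fderiv ℝ (fderiv ℝ g) p v w + fderiv ℝ f p v * fderiv ℝ g p w
        + fderiv ℝ f p w * fderiv ℝ g p v + g p * fderiv ℝ (fderiv ℝ f) p v w := by
  have h : fderiv ℝ (fun q => f q * g q) =ᶠ[𝓝 p]
      fun q => f q • fderiv ℝ g q + g q • fderiv ℝ f q := by
    filter_upwards [hf.eventually_differentiableAt, hg.eventually_differentiableAt] with q h1 h2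
    exact fderiv_fun_mul h1 h2
  have hf1 := hf.differentiableAt (by norm_num)
  have hg1 := hg.differentiableAt (by norm_num)
  have h' : HasFDerivAt (fun q => f q • fderiv ℝ g q + g q • fderiv ℝ f q) _ p :=
    (hf1.hasFDerivAt.smul hg.differentiableAt_fderiv.hasFDerivAt).add
      (hg1.hasFDerivAt.smul hf.differentiableAt_fderiv.hasFDerivAt)
  rw [h.fderiv_eq, h'.fderiv]
  simp
  ring

theorem levi_add {f g : V → ℝ} {p : V} (hf : ContDiffAt ℝ 2 f p) (hg : ContDiffAt ℝ 2 g p)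
    (v : V) : levi (fun q => f q + g q) p v = levi f p v + levi g p v := by
  simp only [levi_eq, fderiv_fderiv_add hf hg, add_apply]
  ring

theorem levi_mul {f g : V → ℝ} {p : V} (hf : ContDiffAt ℝ 2 f p) (hg : ContDiffAt ℝ 2 g p)
    (v : V) : levi (fun q => f q * g q) p v = f p * levi g p v + g p * levi f p v
      + (fderiv ℝ f p v * fderiv ℝ g p v
        + fderiv ℝ f p (Complex.I • v) * fderiv ℝ g p (Complex.I • v)) / (2 * Real.pi) := by
  simp only [levi_eq, fderiv_fderiv_mul hf hg]
  field_simp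
  ring

theorem levi_const (c : ℝ) (p v : V) : levi (fun _ => c) p v = 0 := by
  have h : fderiv ℝ (fun _ : V => c) = fun _ => 0 := by ext; simp
  simp [levi_eq, h]

theorem levi_const_mul (c : ℝ) {f : V → ℝ} {p : V} (hf : ContDiffAt ℝ 2 f p) (v : V) :
    levi (fun q => c * f q) p v = c * levi f p v := by
  rw [levi_mul contDiffAt_const hf, levi_const]
  simp

theorem levi_sum {ι : Type*} (s : Finset ι) {f : ι → V → ℝ} {p : V}
    (hf : ∀ i ∈ s, ContDiffAt ℝ 2 (f i) p) (v : V) :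
    levi (fun q => ∑ i ∈ s, f i q) p v = ∑ i ∈ s, levi (f i) p v := by
  classical
  induction s using Finset.induction_on with
  | empty => simpa using levi_const 0 p v
  | insert a s ha ih =>
    simp only [Finset.sum_insert ha]
    rw [levi_add (hf a (by simp)) (ContDiffAt.sum fun i hi => hf i (by simp [hi])),
      ih fun i hi => hf i (by simp [hi])]

theorem levi_sub {f g : V → ℝ} {p : V} (hf : ContDiffAt ℝ 2 f p) (hg : ContDiffAt ℝ 2 g p)
    (v : V) : levi (fun q => f q - g q) p v = levi f p v - levi g p v := by
  have := levi_add hf (contDiffAt_const.mul hg (x := p) (f := fun _ => (-1 : ℝ))) v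
  rw [levi_const_mul _ hg] at this
  simp only [sub_eq_add_neg]
  convert this using 1
  · congr 1; ext q; ring
  · ring

/-- `dd^c` commutes with holomorphic maps. -/
theorem ddc_comp {f : W → ℝ} {T : V → W} {p : V} (hf : ContDiffAt ℝ 2 f (T p))
    (hT : ContDiffAt ℂ 2 T p) (v w : V) :
    ddc (fun q => f (T q)) p v w = ddc f (T p) (fderiv ℂ T p v) (fderiv ℂ T p w) := by
  have hT1 := hT.eventually_differentiableAt
  have hTr : DifferentiableAt ℝ T p := hT1.self_of_nhds.restrictScalars ℝ
  have hfd : fderiv ℝ T =ᶠ[𝓝 p] fun q => (fderiv ℂ T q).restrictScalars ℝ :=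
    hT1.mono fun q hq => hq.fderiv_restrictScalars ℝ
  have h2 : HasFDerivAt (fun q => (fderiv ℂ T q).restrictScalars ℝ)
      ((ContinuousLinearMap.restrictScalarsL ℂ V W ℝ ℝ).comp
        ((fderiv ℂ (fderiv ℂ T) p).restrictScalars ℝ)) p :=
    (ContinuousLinearMap.restrictScalarsL ℂ V W ℝ ℝ).hasFDerivAt.comp p
      (hT.differentiableAt_fderiv.hasFDerivAt.restrictScalars ℝ)
  have h3 : fderiv ℝ (fun q => f (T q)) =ᶠ[𝓝 p]
      fun q => (fderiv ℝ f (T q)).comp ((fderiv ℂ T q).restrictScalars ℝ) := by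
    filter_upwards [hT1, hTr.continuousAt.eventually hf.eventually_differentiableAt, hfd]
      with q h1 h2 h3
    rw [← h3]
    exact fderiv_comp q h2 (h1.restrictScalars ℝ)
  have h4 : HasFDerivAt (fun q => fderiv ℝ f (T q))
      ((fderiv ℝ (fderiv ℝ f) (T p)).comp ((fderiv ℂ T p).restrictScalars ℝ)) p := by
    have := hf.differentiableAt_fderiv.hasFDerivAt.comp p hTr.hasFDerivAt
    rwa [hfd.self_of_nhds] at this
  have key : ∀ a b : V, fderiv ℝ (fderiv ℝ (fun q => f (T q))) p a b
      = fderiv ℝ (fderiv ℝ f) (T p) (fderiv ℂ T p a) (fderiv ℂ T p b)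
        + fderiv ℝ f (T p) (fderiv ℂ (fderiv ℂ T) p a b) := by
    intro a b
    rw [h3.fderiv_eq, (h4.clm_comp h2).fderiv]
    simp [add_comm]
  simp only [ddc_eq, key, map_smul, smul_apply]
  ring

theorem levi_comp {f : W → ℝ} {T : V → W} {p : V} (hf : ContDiffAt ℝ 2 f (T p))
    (hT : ContDiffAt ℂ 2 T p) (v : V) :
    levi (fun q => f (T q)) p v = levi f (T p) (fderiv ℂ T p v) := by
  rw [levi, ddc_comp hf hT, map_smul, levi]

end Calculus

/-! ### Charts and the Kähler metric in charts -/

section Charts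

variable {n : ℕ} {X : Type*} [TopologicalSpace X] [ChartedSpace (Cn n) X]

/-- A complex manifold is a real manifold. -/
theorem isManifold_real [IsManifold 𝓘(ℂ, Cn n) ∞ X] : IsManifold 𝓘(ℝ, Cn n) ∞ X := by
  refine isManifold_of_contDiffOn _ _ _ fun e e' he he' => ?_
  have h := (contDiffGroupoid ∞ 𝓘(ℂ, Cn n)).compatible he he'
  rw [contDiffGroupoid, mem_groupoid_of_pregroupoid] at h
  replace h := h.1
  simp only [contDiffPregroupoid] at h
  simpa using h.restrict_scalars ℝ

theorem contDiffAt_transition [IsManifold 𝓘(ℂ, Cn n) ∞ X] {e e' : OpenPartialHomeomorph X (Cn n)}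
    (he : e ∈ atlas (Cn n) X) (he' : e' ∈ atlas (Cn n) X) {z : Cn n} (hz : z ∈ e.target)
    (hz' : e.symm z ∈ e'.source) : ContDiffAt ℂ ∞ (fun y => e' (e.symm y)) z := by
  have h := (contDiffGroupoid ∞ 𝓘(ℂ, Cn n)).compatible he he'
  rw [contDiffGroupoid, mem_groupoid_of_pregroupoid] at h
  replace h := h.1
  have h' : ContDiffOn ℂ ∞ (fun y => e' (e.symm y)) (e.symm.trans e').source := by
    simp only [contDiffPregroupoid] at h
    simpa [Function.comp_def] using h
  exact h'.contDiffAt ((e.symm.trans e').open_source.mem_nhds (by simp [hz, hz']))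

/-- The coordinate expression of a field of forms transforms by pull-back. -/
theorem chartForm_transition [IsManifold 𝓘(ℂ, Cn n) ∞ X]
    (θ : ∀ x : X, TangentSpace 𝓘(ℂ, Cn n) x →ₗ[ℝ] TangentSpace 𝓘(ℂ, Cn n) x →ₗ[ℝ] ℝ)
    {e e' : OpenPartialHomeomorph X (Cn n)} (he : e ∈ atlas (Cn n) X)
    (he' : e' ∈ atlas (Cn n) X) {z : Cn n} (hz : z ∈ e.target) (hz' : e.symm z ∈ e'.source)
    (v w : Cn n) : chartForm θ e z v w = chartForm θ e' (e' (e.symm z))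
      (fderiv ℂ (fun y => e' (e.symm y)) z v) (fderiv ℂ (fun y => e' (e.symm y)) z w) := by
  have : IsManifold 𝓘(ℂ, Cn n) 1 X := IsManifold.of_le (n := ∞) (by exact_mod_cast le_top)
  have h1 : MDifferentiableAt 𝓘(ℂ, Cn n) 𝓘(ℂ, Cn n) e'.symm (e' (e.symm z)) :=
    mdifferentiableAt_atlas_symm he' (e'.map_source hz')
  have h2 : DifferentiableAt ℂ (fun y => e' (e.symm y)) z :=
    (contDiffAt_transition he he' hz hz').differentiableAt (by simp)
  have h3 : e.symm =ᶠ[𝓝 z] e'.symm ∘ fun y => e' (e.symm y) := by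
    have : ∀ᶠ y in 𝓝 z, e.symm y ∈ e'.source :=
      (e.symm.continuousAt hz).eventually (e'.open_source.mem_nhds hz')
    filter_upwards [this] with y hy
    simp [e'.left_inv hy]
  have h4 : mfderiv 𝓘(ℂ, Cn n) 𝓘(ℂ, Cn n) e.symm z
      = (mfderiv 𝓘(ℂ, Cn n) 𝓘(ℂ, Cn n) e'.symm (e' (e.symm z))).comp
        (fderiv ℂ (fun y => e' (e.symm y)) z) := by
    rw [h3.mfderiv_eq, mfderiv_comp z h1 h2.mdifferentiableAt, mfderiv_eq_fderiv]
    rfl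
  unfold chartForm
  have h5 : e'.symm (e' (e.symm z)) = e.symm z := e'.left_inv hz'
  rw [h4]
  generalize mfderiv 𝓘(ℂ, Cn n) 𝓘(ℂ, Cn n) e'.symm (e' (e.symm z)) = L
  revert L
  rw [h5]
  intro L
  rfl

namespace KahlerForm

variable (Ω : KahlerForm n X) {e e' : OpenPartialHomeomorph X (Cn n)}

theorem coord_transition [IsManifold 𝓘(ℂ, Cn n) ∞ X] (he : e ∈ atlas (Cn n) X)
    (he' : e' ∈ atlas (Cn n) X) {z : Cn n} (hz : z ∈ e.target) (hz' : e.symm z ∈ e'.source)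
    (v w : Cn n) : Ω.coord e z v w = Ω.coord e' (e' (e.symm z))
      (fderiv ℂ (fun y => e' (e.symm y)) z v) (fderiv ℂ (fun y => e' (e.symm y)) z w) :=
  chartForm_transition _ he he' hz hz' v w

/-- The Kähler form at a point, as a bilinear form on the model space. -/
def formAt (x : X) : Cn n →ₗ[ℝ] Cn n →ₗ[ℝ] ℝ := Ω.form x

/-- The derivative of the inverse of a chart, as a map between model spaces. -/
def symmDeriv (e : OpenPartialHomeomorph X (Cn n)) (z : Cn n) : Cn n →L[ℂ] Cn n :=
  mfderiv 𝓘(ℂ, Cn n) 𝓘(ℂ, Cn n) e.symm z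

theorem coord_eq_formAt (z v w : Cn n) :
    Ω.coord e z v w = Ω.formAt (e.symm z) (symmDeriv e z v) (symmDeriv e z w) := rfl

theorem symmDeriv_real_smul (c : ℝ) (z v : Cn n) :
    symmDeriv e z (c • v) = c • symmDeriv e z v :=
  ((symmDeriv e z).restrictScalars ℝ).map_smul c v

/-- The Kähler form in a chart, as a continuous bilinear map. -/
def coordL (e : OpenPartialHomeomorph X (Cn n)) (z : Cn n) : Cn n →L[ℝ] Cn n →L[ℝ] ℝ :=
  LinearMap.toContinuousLinearMap <|
    LinearMap.toContinuousLinearMap.toLinearMap.comp <|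
      LinearMap.mk₂ ℝ (Ω.coord e z)
        (fun v v' w => by simp only [coord_eq_formAt, map_add, LinearMap.add_apply])
        (fun c v w => by
          simp only [coord_eq_formAt, symmDeriv_real_smul, map_smul, LinearMap.smul_apply])
        (fun v w w' => by simp only [coord_eq_formAt, map_add])
        (fun c v w => by simp only [coord_eq_formAt, symmDeriv_real_smul, map_smul])

@[simp] theorem coordL_apply (z v w : Cn n) : Ω.coordL e z v w = Ω.coord e z v w := rfl

theorem coord_I_smul (z v w : Cn n) :
    Ω.coord e z (Complex.I • v) (Complex.I • w) = Ω.coord e z v w := by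
  rw [coord_eq_formAt, (symmDeriv e z).map_smul, (symmDeriv e z).map_smul]
  exact Ω.type_one_one _ _ _

theorem coord_self (z v : Cn n) : Ω.coord e z v v = 0 := Ω.alternating _ _

/-- The squared length of the tangent vector `v` for the Kähler metric, in a chart. -/
def normSq (e : OpenPartialHomeomorph X (Cn n)) (z v : Cn n) : ℝ := Ω.coord e z v (Complex.I • v)

theorem normSq_I_smul (z v : Cn n) : Ω.normSq e z (Complex.I • v) = Ω.normSq e z v :=
  Ω.coord_I_smul _ _ _

theorem normSq_smul (c : ℝ) (z v : Cn n) : Ω.normSq e z (c • v) = c ^ 2 * Ω.normSq e z v := by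
  simp only [normSq, coord_eq_formAt, symmDeriv_real_smul, map_smul, LinearMap.smul_apply,
    smul_eq_mul]
  rw [smul_comm, map_smul, smul_eq_mul]
  ring

theorem normSq_zero (z : Cn n) : Ω.normSq e z 0 = 0 := by
  simpa using Ω.normSq_smul (e := e) 0 z 0

theorem normSq_transition [IsManifold 𝓘(ℂ, Cn n) ∞ X] (he : e ∈ atlas (Cn n) X)
    (he' : e' ∈ atlas (Cn n) X) {z : Cn n} (hz : z ∈ e.target) (hz' : e.symm z ∈ e'.source)
    (v : Cn n) : Ω.normSq e z v = Ω.normSq e' (e' (e.symm z))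
      (fderiv ℂ (fun y => e' (e.symm y)) z v) := by
  rw [normSq, Ω.coord_transition he he' hz hz', map_smul, normSq]

theorem normSq_pos [IsManifold 𝓘(ℂ, Cn n) ∞ X] (he : e ∈ atlas (Cn n) X) {z : Cn n}
    (hz : z ∈ e.target) {v : Cn n} (hv : v ≠ 0) : 0 < Ω.normSq e z v := by
  have : IsManifold 𝓘(ℂ, Cn n) 1 X := IsManifold.of_le (n := ∞) (by exact_mod_cast le_top)
  have hinj := (mdifferentiable_of_mem_atlas (I := 𝓘(ℂ, Cn n)) he).symm.mfderiv_injective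
    (x := z) hz
  have h := Ω.positive (e.symm z) (mfderiv 𝓘(ℂ, Cn n) 𝓘(ℂ, Cn n) e.symm z v) (by
    intro h0
    exact hv (hinj (h0.trans (map_zero _).symm)))
  rw [normSq, coord_eq_formAt, map_smul]
  exact h

theorem normSq_nonneg [IsManifold 𝓘(ℂ, Cn n) ∞ X] (he : e ∈ atlas (Cn n) X) {z : Cn n}
    (hz : z ∈ e.target) (v : Cn n) : 0 ≤ Ω.normSq e z v := by
  by_cases hv : v = 0
  · rw [hv, normSq_zero]
  · exact (Ω.normSq_pos he hz hv).le

theorem contDiffOn_coordL (he : e ∈ atlas (Cn n) X) : ContDiffOn ℝ ∞ (Ω.coordL e) e.target := by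
  rw [contDiffOn_clm_apply]
  intro v
  rw [contDiffOn_clm_apply]
  intro w
  exact Ω.smooth e he v w

theorem continuousOn_coordL (he : e ∈ atlas (Cn n) X) : ContinuousOn (Ω.coordL e) e.target :=
  (Ω.contDiffOn_coordL he).continuousOn

theorem continuousOn_normSq (he : e ∈ atlas (Cn n) X) :
    ContinuousOn (fun p : Cn n × Cn n => Ω.normSq e p.1 p.2) (e.target ×ˢ univ) := by
  have h := (Ω.continuousOn_coordL he).comp continuousOn_fst
    (fun p (hp : p ∈ e.target ×ˢ (univ : Set (Cn n))) => hp.1)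
  exact (h.clm_apply continuousOn_snd).clm_apply (continuous_snd.const_smul Complex.I).continuousOn

/-- On compact sets the Kähler metric is comparable with the norm of `ℂⁿ`. -/
theorem exists_normSq_bounds [IsManifold 𝓘(ℂ, Cn n) ∞ X] (he : e ∈ atlas (Cn n) X)
    {K : Set (Cn n)} (hK : IsCompact K) (hKe : K ⊆ e.target) :
    ∃ c : ℝ, 0 < c ∧ ∀ z ∈ K, ∀ v, c * ‖v‖ ^ 2 ≤ Ω.normSq e z v ∧
      c * Ω.normSq e z v ≤ ‖v‖ ^ 2 := by
  have hS : IsCompact (K ×ˢ Metric.sphere (0 : Cn n) 1) := hK.prod (isCompact_sphere _ _)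
  have hc : ContinuousOn (fun p : Cn n × Cn n => Ω.normSq e p.1 p.2)
      (K ×ˢ Metric.sphere (0 : Cn n) 1) :=
    (Ω.continuousOn_normSq he).mono (prod_mono hKe (subset_univ _))
  obtain ⟨M, hM⟩ := (hS.bddAbove_image hc)
  obtain ⟨m, hm0, hm⟩ : ∃ m : ℝ, 0 < m ∧ ∀ p ∈ K ×ˢ Metric.sphere (0 : Cn n) 1,
      m ≤ Ω.normSq e p.1 p.2 := by
    rcases (K ×ˢ Metric.sphere (0 : Cn n) 1).eq_empty_or_nonempty with h | h
    · exact ⟨1, one_pos, by simp [h]⟩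
    · obtain ⟨p, hp, hmin⟩ := hS.exists_isMinOn h hc
      refine ⟨_, Ω.normSq_pos he (hKe hp.1) (v := p.2) ?_, fun q hq => hmin hq⟩
      exact ne_zero_of_mem_unit_sphere ⟨p.2, hp.2⟩
  have hM1 : 0 < max M 1 := lt_max_of_lt_right one_pos
  refine ⟨min m (max M 1)⁻¹, lt_min hm0 (inv_pos.2 hM1), fun z hz v => ?_⟩
  by_cases hv : v = 0
  · simp [hv, normSq_zero]
  have hv' : 0 < ‖v‖ := norm_pos_iff.2 hv
  have hmem : (z, ‖v‖⁻¹ • v) ∈ K ×ˢ Metric.sphere (0 : Cn n) 1 :=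
    ⟨hz, by simp [norm_smul, hv'.ne']⟩
  have hvv : Ω.normSq e z v = ‖v‖ ^ 2 * Ω.normSq e z (‖v‖⁻¹ • v) := by
    rw [normSq_smul]; field_simp
  have h1 := hm _ hmem
  have h2 : Ω.normSq e z (‖v‖⁻¹ • v) ≤ max M 1 :=
    (hM (mem_image_of_mem _ hmem)).trans (le_max_left _ _)
  have h3 : 0 ≤ Ω.normSq e z (‖v‖⁻¹ • v) := hm0.le.trans h1
  rw [hvv]
  constructor
  · rw [mul_comm]
    exact mul_le_mul_of_nonneg_left ((min_le_left _ _).trans h1) (by positivity)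
  · calc min m (max M 1)⁻¹ * (‖v‖ ^ 2 * Ω.normSq e z (‖v‖⁻¹ • v))
        ≤ (max M 1)⁻¹ * (‖v‖ ^ 2 * max M 1) := by
          gcongr
          exact min_le_right _ _
      _ = ‖v‖ ^ 2 := by field_simp

/-- Uniform continuity of the Kähler metric on compact sets, relative to the metric itself. -/
theorem exists_abs_normSq_sub_le [IsManifold 𝓘(ℂ, Cn n) ∞ X] (he : e ∈ atlas (Cn n) X)
    {K : Set (Cn n)} (hK : IsCompact K) (hKe : K ⊆ e.target) {ε : ℝ} (hε : 0 < ε) :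
    ∃ r : ℝ, 0 < r ∧ ∀ z ∈ K, ∀ y, dist y z ≤ r → y ∈ e.target ∧
      ∀ v, |Ω.normSq e y v - Ω.normSq e z v| ≤ ε * Ω.normSq e z v := by
  obtain ⟨c, hc0, hc⟩ := Ω.exists_normSq_bounds he hK hKe
  obtain ⟨L, hL, hKL, hLe⟩ := exists_compact_between hK e.open_target hKe
  obtain ⟨r₁, hr₁, hr₁L⟩ := hK.exists_cthickening_subset_open isOpen_interior hKL
  have huc : UniformContinuousOn (Ω.coordL e) L :=
    IsCompact.uniformContinuousOn_of_continuous hL ((Ω.continuousOn_coordL he).mono hLe)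
  obtain ⟨r₂, hr₂, huc⟩ := (Metric.uniformContinuousOn_iff_le (f := Ω.coordL e) (s := L)).1
    huc (ε * c) (by positivity)
  refine ⟨min r₁ r₂, lt_min hr₁ hr₂, fun z hz y hy => ?_⟩
  have hyL : y ∈ L := interior_subset (hr₁L (Metric.mem_cthickening_of_dist_le y z _ _ hz
    (hy.trans (min_le_left _ _))))
  have hzL : z ∈ L := interior_subset (hKL hz)
  refine ⟨hLe hyL, fun v => ?_⟩
  have h1 : ‖Ω.coordL e y - Ω.coordL e z‖ ≤ ε * c :=
    (dist_eq_norm (Ω.coordL e y) (Ω.coordL e z)).symm.le.trans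
      (huc y hyL z hzL (hy.trans (min_le_right _ _)))
  have h2 : Ω.normSq e y v - Ω.normSq e z v = (Ω.coordL e y - Ω.coordL e z) v (Complex.I • v) := by
    simp [normSq]
  calc |Ω.normSq e y v - Ω.normSq e z v| ≤ ‖Ω.coordL e y - Ω.coordL e z‖ * ‖v‖ * ‖Complex.I • v‖ := by
        rw [h2, ← Real.norm_eq_abs]
        exact ContinuousLinearMap.le_opNorm₂ _ _ _
    _ ≤ (ε * c) * ‖v‖ * ‖v‖ := by
        rw [norm_smul, Complex.norm_I, one_mul]
        gcongr
    _ = ε * (c * ‖v‖ ^ 2) := by ring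
    _ ≤ ε * Ω.normSq e z v := by
        gcongr
        exact (hc z hz v).1

end KahlerForm

end Charts

/-! ### An interpolation inequality for gradients -/

section Interpolation

/-- The necessary second-order condition at a local minimum. -/
theorem IsLocalMin.deriv_deriv_nonneg {f : ℝ → ℝ} {a : ℝ} (h : IsLocalMin f a)
    (hf : ContinuousAt f a) : 0 ≤ deriv (deriv f) a := by
  by_contra! hneg
  have hmax := isLocalMax_of_deriv_deriv_neg hneg h.deriv_eq_zero hf
  have hc : f =ᶠ[𝓝 a] fun _ => f a := by
    filter_upwards [h, hmax] with x h1 h2 using le_antisymm h2 h1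
  have : deriv (deriv f) a = 0 := by
    have h1 : deriv f =ᶠ[𝓝 a] deriv fun _ => f a := hc.deriv
    rw [h1.deriv_eq]
    simp
  linarith

theorem hasDerivAt_line {V : Type*} [NormedAddCommGroup V] [NormedSpace ℝ V] (p v : V) (t : ℝ) :
    HasDerivAt (fun t : ℝ => p + t • v) v t := by
  simpa using ((hasDerivAt_id t).smul_const v).const_add p

theorem deriv_deriv_line {V : Type*} [NormedAddCommGroup V] [NormedSpace ℝ V] {f : V → ℝ}
    {p v : V} {t : ℝ} (hf : ContDiffAt ℝ 2 f (p + t • v)) :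
    deriv (deriv fun s : ℝ => f (p + s • v)) t = fderiv ℝ (fderiv ℝ f) (p + t • v) v v := by
  have hl := hasDerivAt_line p v
  have h : deriv (fun s : ℝ => f (p + s • v)) =ᶠ[𝓝 t] fun s => fderiv ℝ f (p + s • v) v := by
    filter_upwards [(hl t).continuousAt.eventually hf.eventually_differentiableAt] with s hs
    exact (hs.hasFDerivAt.comp_hasDerivAt s (hl s)).deriv
  rw [h.deriv_eq]
  have h1 : HasDerivAt (fun s : ℝ => fderiv ℝ f (p + s • v))
      (fderiv ℝ (fderiv ℝ f) (p + t • v) v) t :=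
    hf.differentiableAt_fderiv.hasFDerivAt.comp_hasDerivAt t (hl t)
  have h2 := h1.clm_apply (hasDerivAt_const t v)
  simpa using h2.deriv

/-- The weak minimum principle on a rectangle: a function with negative Laplacian attains its
minimum on the boundary. -/
theorem nonneg_of_laplacian_neg {h : ℝ × ℝ → ℝ} {a b c d : ℝ}
    (hh : ∀ p ∈ Icc a b ×ˢ Icc c d, ContDiffAt ℝ 2 h p)
    (hlap : ∀ p ∈ Icc a b ×ˢ Icc c d, fderiv ℝ (fderiv ℝ h) p (1, 0) (1, 0)
      + fderiv ℝ (fderiv ℝ h) p (0, 1) (0, 1) < 0)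
    (hbd : ∀ p ∈ Icc a b ×ˢ Icc c d, p.1 = a ∨ p.1 = b ∨ p.2 = c ∨ p.2 = d → 0 ≤ h p) :
    ∀ p ∈ Icc a b ×ˢ Icc c d, 0 ≤ h p := by
  intro p hp
  obtain ⟨q, hq, hmin⟩ := (isCompact_Icc.prod isCompact_Icc).exists_isMinOn ⟨p, hp⟩
    (fun x hx => (hh x hx).continuousAt.continuousWithinAt)
  refine le_trans ?_ (hmin hp)
  by_cases hb : q.1 = a ∨ q.1 = b ∨ q.2 = c ∨ q.2 = d
  · exact hbd q hq hb
  exfalso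
  push Not at hb
  obtain ⟨⟨h1, h2⟩, h3, h4⟩ := hq
  have hmem : Icc a b ×ˢ Icc c d ∈ 𝓝 q := by
    rw [← Prod.mk.eta (p := q)]
    exact prod_mem_nhds (Icc_mem_nhds (h1.lt_of_ne' hb.1) (h2.lt_of_ne hb.2.1))
      (Icc_mem_nhds (h3.lt_of_ne' hb.2.2.1) (h4.lt_of_ne hb.2.2.2))
  have hloc : IsLocalMin h q := hmin.isLocalMin hmem
  have hC := hh q (mem_of_mem_nhds hmem)
  have key : ∀ v : ℝ × ℝ, 0 ≤ fderiv ℝ (fderiv ℝ h) q v v := by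
    intro v
    have hq0 : q + (0 : ℝ) • v = q := by simp
    have h5 := deriv_deriv_line (f := h) (p := q) (v := v) (t := 0) (by rwa [hq0])
    rw [hq0] at h5
    rw [← h5]
    have hl := (hasDerivAt_line q v 0).continuousAt
    have hl' : Tendsto (fun t : ℝ => q + t • v) (𝓝 0) (𝓝 q) := by
      have := hl.tendsto
      rwa [hq0] at this
    refine IsLocalMin.deriv_deriv_nonneg ?_ ?_
    · have := hl'.eventually hloc
      filter_upwards [this] with t ht
      simpa [hq0] using ht
    · refine ContinuousAt.comp (g := h) ?_ hl
      rw [hq0]; exact hC.continuousAt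
  have := hlap q (mem_of_mem_nhds hmem)
  linarith [key (1, 0), key (0, 1)]

/-- Interior gradient estimate in the plane, by comparison with a quadratic barrier on a half
square. -/
theorem abs_fderiv_le_of_laplacian_bounded {g : ℝ × ℝ → ℝ} {d η K : ℝ} (hd : 0 < d) (hη : 0 ≤ η)
    (hK : 0 ≤ K) (hg : ∀ p ∈ Icc (-d) d ×ˢ Icc (-d) d, ContDiffAt ℝ 2 g p)
    (hgη : ∀ p ∈ Icc (-d) d ×ˢ Icc (-d) d, |g p| ≤ η)
    (hlap : ∀ p ∈ Icc (-d) d ×ˢ Icc (-d) d, |fderiv ℝ (fderiv ℝ g) p (1, 0) (1, 0)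
      + fderiv ℝ (fderiv ℝ g) p (0, 1) (0, 1)| ≤ K) :
    fderiv ℝ g 0 (1, 0) ≤ 2 * η / d + K * d / 2 := by
  -- the odd part of `g` in the first variable
  set ι : ℝ × ℝ → ℝ × ℝ := fun p => (-p.1, p.2) with hι
  have hsub : Icc 0 d ×ˢ Icc (-d) d ⊆ Icc (-d) d ×ˢ Icc (-d) d :=
    prod_mono (Icc_subset_Icc (by linarith) le_rfl) le_rfl
  have hιm : ∀ p ∈ Icc 0 d ×ˢ Icc (-d) d, ι p ∈ Icc (-d) d ×ˢ Icc (-d) d := by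
    rintro p ⟨⟨h1, h2⟩, h3⟩
    exact ⟨⟨by simp [hι]; linarith, by simp [hι]; linarith⟩, h3⟩
  have hιC : ∀ p, ContDiffAt ℝ 2 ι p := fun p => by
    apply ContDiff.contDiffAt
    fun_prop
  -- The barrier `b` below has Laplacian `-K' < -K`. On the axis `x = 0`, where the odd part vanishes,
  -- it is nonnegative, and on the other three sides of the half square it is at least `η`.
  have key : ∀ K' > K, ∀ x ∈ Icc 0 d,
      g (x, 0) - g (-x, 0) ≤ 2 * (η / d ^ 2 * (x * (2 * d - x)) + K' / 2 * (x * (d - x))) := by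
    intro K' hK' x hx
    set b : ℝ × ℝ → ℝ := fun p =>
      η / d ^ 2 * (p.2 * p.2 + p.1 * (2 * d - p.1)) + K' / 2 * (p.1 * (d - p.1)) with hb
    have hbC : ∀ p, ContDiffAt ℝ 2 b p := fun p => by
      apply ContDiff.contDiffAt
      rw [hb]
      fun_prop
    have hb2 : ∀ p, fderiv ℝ (fderiv ℝ b) p (1, 0) (1, 0)
        + fderiv ℝ (fderiv ℝ b) p (0, 1) (0, 1) = -K' := by
      intro p
      have e1 := deriv_deriv_line (p := p) (v := (1, 0)) (t := 0) (f := b) (hbC _)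
      have e2 := deriv_deriv_line (p := p) (v := (0, 1)) (t := 0) (f := b) (hbC _)
      simp only [zero_smul, add_zero] at e1 e2
      rw [← e1, ← e2]
      have f1 : deriv (fun s : ℝ => b (p + s • (1, 0))) = fun s =>
          η / d ^ 2 * (2 * d - 2 * (p.1 + s)) + K' / 2 * (d - 2 * (p.1 + s)) := by
        ext s
        have hs : HasDerivAt (fun s : ℝ => p.1 + s) 1 s := (hasDerivAt_id s).const_add _
        have := (((hs.mul (hs.const_sub (2 * d))).const_add (p.2 * p.2)).const_mul (η / d ^ 2)).add
          ((hs.mul (hs.const_sub d)).const_mul (K' / 2))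
        refine HasDerivAt.deriv ?_
        convert this using 1
        · ext s; simp [hb]
        · ring
      have f2 : deriv (fun s : ℝ => b (p + s • (0, 1))) = fun s =>
          η / d ^ 2 * (2 * (p.2 + s)) := by
        ext s
        have hs : HasDerivAt (fun s : ℝ => p.2 + s) 1 s := (hasDerivAt_id s).const_add _
        have := (((hs.mul hs).add_const (p.1 * (2 * d - p.1))).const_mul (η / d ^ 2)).add_const
          (K' / 2 * (p.1 * (d - p.1)))
        refine HasDerivAt.deriv ?_
        convert this using 1
        · ext s; simp [hb]
        · ring
      rw [f1, f2]
      have hs : HasDerivAt (fun s : ℝ => p.1 + s) 1 0 := (hasDerivAt_id _).const_add _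
      have hs' : HasDerivAt (fun s : ℝ => p.2 + s) 1 0 := (hasDerivAt_id _).const_add _
      have g1 : HasDerivAt (fun s => η / d ^ 2 * (2 * d - 2 * (p.1 + s))
          + K' / 2 * (d - 2 * (p.1 + s))) _ 0 :=
        (((hs.const_mul 2).const_sub (2 * d)).const_mul (η / d ^ 2)).add
          (((hs.const_mul 2).const_sub d).const_mul (K' / 2))
      rw [g1.deriv, ((hs'.const_mul 2).const_mul (η / d ^ 2)).deriv]
      ring
    have hmin := nonneg_of_laplacian_neg (a := 0) (b := d) (c := -d) (d := d)
      (h := fun p => b p - (1 / 2 * g p - 1 / 2 * g (ι p))) ?_ ?_ ?_ (x, 0)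
      ⟨hx, ⟨by linarith, hd.le⟩⟩
    · simp only [hb, hι] at hmin
      norm_num at hmin
      linarith
    · intro p hp
      exact (hbC p).sub ((contDiffAt_const.mul (hg p (hsub hp))).sub
        (contDiffAt_const.mul ((hg _ (hιm p hp)).comp p (hιC p))))
    · intro p hp
      have hgp := hg p (hsub hp)
      have hgι := hg _ (hιm p hp)
      have hgc : ContDiffAt ℝ 2 (fun p => g (ι p)) p := hgι.comp p (hιC p)
      have l1 := hlap p (hsub hp)
      have l2 := hlap _ (hιm p hp)
      have hhC : ContDiffAt ℝ 2 (fun p => b p - (1 / 2 * g p - 1 / 2 * g (ι p))) p :=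
        (hbC p).sub ((contDiffAt_const.mul hgp).sub (contDiffAt_const.mul hgc))
      have hlin : fderiv ℝ (fderiv ℝ fun p => b p - (1 / 2 * g p - 1 / 2 * g (ι p))) p
          = fderiv ℝ (fderiv ℝ b) p - (1 / 2 : ℝ) • fderiv ℝ (fderiv ℝ g) p
            + (1 / 2 : ℝ) • fderiv ℝ (fderiv ℝ fun p => g (ι p)) p := by
        have h1 : fderiv ℝ (fun p => b p - (1 / 2 * g p - 1 / 2 * g (ι p))) =ᶠ[𝓝 p] fun p =>
            fderiv ℝ b p - ((1 / 2 : ℝ) • fderiv ℝ g p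
              - (1 / 2 : ℝ) • fderiv ℝ (fun p => g (ι p)) p) := by
          filter_upwards [(hbC p).eventually_differentiableAt, hgp.eventually_differentiableAt,
            hgc.eventually_differentiableAt] with q q1 q2 q3
          exact (q1.hasFDerivAt.sub ((q2.hasFDerivAt.const_mul _).sub
            (q3.hasFDerivAt.const_mul _))).fderiv
        have h2 : HasFDerivAt (fun p => fderiv ℝ b p - ((1 / 2 : ℝ) • fderiv ℝ g p
              - (1 / 2 : ℝ) • fderiv ℝ (fun p => g (ι p)) p)) _ p :=
          (hbC p).differentiableAt_fderiv.hasFDerivAt.sub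
          ((hgp.differentiableAt_fderiv.hasFDerivAt.const_smul (1 / 2 : ℝ)).sub
            (hgc.differentiableAt_fderiv.hasFDerivAt.const_smul (1 / 2 : ℝ)))
        rw [h1.fderiv_eq, h2.fderiv]
        abel
      have hι1 : fderiv ℝ (fderiv ℝ fun p => g (ι p)) p (1, 0) (1, 0)
          = fderiv ℝ (fderiv ℝ g) (ι p) (1, 0) (1, 0) := by
        have e1 := deriv_deriv_line (p := p) (v := (1, 0)) (t := 0) (f := fun p => g (ι p))
          (by simpa using hgc)
        have e2 := deriv_deriv_line (p := ι p) (v := (-1, 0)) (t := 0) (f := g)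
          (by simpa using hgι)
        simp only [zero_smul, add_zero] at e1 e2
        rw [← e1]
        have : ((-1 : ℝ), (0 : ℝ)) = -(1, 0) := by simp
        rw [this, map_neg, map_neg, neg_apply, neg_neg] at e2
        rw [← e2]
        congr 2
        ext s
        simp [hι, add_comm]
      have hι2 : fderiv ℝ (fderiv ℝ fun p => g (ι p)) p (0, 1) (0, 1)
          = fderiv ℝ (fderiv ℝ g) (ι p) (0, 1) (0, 1) := by
        have e1 := deriv_deriv_line (p := p) (v := (0, 1)) (t := 0) (f := fun p => g (ι p))
          (by simpa using hgc)
        have e2 := deriv_deriv_line (p := ι p) (v := (0, 1)) (t := 0) (f := g)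
          (by simpa using hgι)
        simp only [zero_smul, add_zero] at e1 e2
        rw [← e1, ← e2]
        congr 2
        ext s
        simp [hι]
      rw [hlin]
      simp only [add_apply, sub_apply, smul_apply, smul_eq_mul, hι1, hι2]
      have := hb2 p
      rw [abs_le] at l1 l2
      linarith
    · rintro p ⟨⟨p1, p2⟩, p3, p4⟩ hp
      have m1 := abs_le.1 (hgη p (hsub ⟨⟨p1, p2⟩, p3, p4⟩))
      have m2 := abs_le.1 (hgη _ (hιm p ⟨⟨p1, p2⟩, p3, p4⟩))
      have hK'0 : 0 ≤ K' / 2 * (p.1 * (d - p.1)) := by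
        have : 0 ≤ d - p.1 := by linarith
        have : 0 ≤ K' := by linarith
        positivity
      rcases hp with hp | hp
      · have : ι p = p := by ext <;> simp [hι, hp]
        rw [this]
        simp only [hb, hp]
        have : 0 ≤ η / d ^ 2 * (p.2 * p.2) := mul_nonneg (by positivity) (mul_self_nonneg _)
        linarith
      · have hq : d ^ 2 ≤ p.2 * p.2 + p.1 * (2 * d - p.1) := by
          rcases hp with hp | hp | hp
          · rw [hp]; nlinarith [mul_self_nonneg p.2]
          · rw [hp]; nlinarith [mul_nonneg p1 (by linarith : 0 ≤ 2 * d - p.1)]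
          · rw [hp]; nlinarith [mul_nonneg p1 (by linarith : 0 ≤ 2 * d - p.1)]
        have : η ≤ η / d ^ 2 * (p.2 * p.2 + p.1 * (2 * d - p.1)) := by
          calc η = η / d ^ 2 * d ^ 2 := by field_simp
            _ ≤ _ := by gcongr
        simp only [hb]
        linarith
  have hg0 := hg 0 ⟨⟨by simpa using hd.le, hd.le⟩, by simpa using hd.le, hd.le⟩
  have hdiff : HasFDerivAt g (fderiv ℝ g 0) 0 := (hg0.differentiableAt (by norm_num)).hasFDerivAt
  -- divide by `2 x` and let `x` tend to zero
  have hder : HasDerivAt (fun x : ℝ => g (x, 0) - g (-x, 0)) (2 * fderiv ℝ g 0 (1, 0)) 0 := by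
    have l1 : HasDerivAt (fun x : ℝ => (x, (0 : ℝ))) (1, 0) 0 :=
      (hasDerivAt_id _).prodMk (hasDerivAt_const _ _)
    have l2 : HasDerivAt (fun x : ℝ => (-x, (0 : ℝ))) (-1, 0) 0 :=
      (hasDerivAt_id _).neg.prodMk (hasDerivAt_const _ _)
    have m1 := HasFDerivAt.comp_hasDerivAt (f := fun x : ℝ => (x, (0 : ℝ))) (l := g) 0 hdiff l1
    have m2 := HasFDerivAt.comp_hasDerivAt (f := fun x : ℝ => (-x, (0 : ℝ))) (l := g)
      (l' := fderiv ℝ g 0) 0 (by rw [neg_zero]; exact hdiff) l2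
    have : ((-1 : ℝ), (0 : ℝ)) = -(1, 0) := by simp
    rw [this, map_neg] at m2
    exact HasDerivAt.congr_deriv (m1.sub m2) (by ring)
  have hstep : ∀ K' > K, fderiv ℝ g 0 (1, 0) ≤ 2 * η / d + K' * d / 2 := by
    intro K' hK'
    have hder2 : HasDerivAt (fun x : ℝ => 2 * (η / d ^ 2 * (x * (2 * d - x))
        + K' / 2 * (x * (d - x)))) (2 * (2 * η / d + K' * d / 2)) 0 := by
      have h0 := hasDerivAt_id (0 : ℝ)
      have := (((h0.mul (h0.const_sub (2 * d))).const_mul (η / d ^ 2)).add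
        ((h0.mul (h0.const_sub d)).const_mul (K' / 2))).const_mul 2
      refine HasDerivAt.congr_deriv this ?_
      simp
      field_simp
    have h3 := (hder2.sub hder).hasDerivWithinAt (s := Ioi 0)
    have h4 := (hasDerivWithinAt_iff_tendsto_slope' (by simp)).1 h3
    have h5 := ge_of_tendsto h4 (b := 0) (by
      filter_upwards [Ioo_mem_nhdsGT hd] with x hx
      have := key K' hK' x ⟨hx.1.le, hx.2.le⟩
      rw [slope_def_field]
      simp
      exact div_nonneg (by linarith) hx.1.le)
    linarith
  refine le_of_forall_pos_le_add fun ε hε => ?_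
  have := hstep (K + 2 * ε / d) (by have : 0 < 2 * ε / d := by positivity
                                    linarith)
  calc _ ≤ _ := this
    _ = _ := by field_simp; ring

/-- Interpolation: a function which is small, with bounded Levi form along a complex disc, has
small derivative at the centre. -/
theorem abs_fderiv_le_of_levi_bounded {V : Type*} [NormedAddCommGroup V] [NormedSpace ℂ V]
    {w : V → ℝ} {p v : V} {d η K : ℝ} (hd : 0 < d) (hη : 0 ≤ η) (hK : 0 ≤ K)
    (hw : ∀ ζ : ℂ, |ζ.re| ≤ d → |ζ.im| ≤ d → ContDiffAt ℝ 2 w (p + ζ • v))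
    (hwη : ∀ ζ : ℂ, |ζ.re| ≤ d → |ζ.im| ≤ d → |w (p + ζ • v)| ≤ η)
    (hlevi : ∀ ζ : ℂ, |ζ.re| ≤ d → |ζ.im| ≤ d → |levi w (p + ζ • v) v| ≤ K) :
    |fderiv ℝ w p v| ≤ 2 * η / d + 2 * Real.pi * K * d := by
  -- Restrict `w` to the complex line through `p` in the direction of `v'`: up to the factor `4 π`
  -- the Laplacian of the restriction is the Levi form. The bound for the absolute value follows by
  -- taking `v' = v` and `v' = -v`.
  have main : ∀ v' : V, v' = v ∨ v' = -v →
      fderiv ℝ w p v' ≤ 2 * η / d + 2 * Real.pi * K * d := by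
    intro v' hv'
    set ℓ : ℝ × ℝ →L[ℝ] V := ((ContinuousLinearMap.fst ℝ ℝ ℝ).smulRight v'
      + (ContinuousLinearMap.snd ℝ ℝ ℝ).smulRight (Complex.I • v')) with hℓ
    have hℓa : ∀ q : ℝ × ℝ, ∃ ζ : ℂ, |ζ.re| = |q.1| ∧ |ζ.im| = |q.2| ∧ ℓ q = ζ • v := by
      intro q
      rcases hv' with h | h
      · refine ⟨⟨q.1, q.2⟩, rfl, rfl, ?_⟩
        rw [Complex.mk_eq_add_mul_I, add_smul, mul_smul]
        simp [hℓ, h]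
      · refine ⟨⟨-q.1, -q.2⟩, abs_neg _, abs_neg _, ?_⟩
        rw [Complex.mk_eq_add_mul_I, add_smul, mul_smul]
        simp [hℓ, h]
    have hlv : ∀ q : V, levi w q v' = levi w q v := by
      intro q
      rcases hv' with h | h
      · rw [h]
      · rw [h]; simp [levi_eq]
    have hmem : ∀ q ∈ Icc (-d) d ×ˢ Icc (-d) d, ∃ ζ : ℂ, |ζ.re| ≤ d ∧ |ζ.im| ≤ d ∧
        ℓ q = ζ • v := by
      intro q hq
      obtain ⟨ζ, h1, h2, h3⟩ := hℓa q
      exact ⟨ζ, h1 ▸ abs_le.2 hq.1, h2 ▸ abs_le.2 hq.2, h3⟩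
    have hCD : ∀ q ∈ Icc (-d) d ×ˢ Icc (-d) d, ContDiffAt ℝ 2 w (p + ℓ q) := by
      intro q hq
      obtain ⟨ζ, h1, h2, h3⟩ := hmem q hq
      rw [h3]
      exact hw ζ h1 h2
    have hℓC : ∀ q, ContDiffAt ℝ 2 (fun q => p + ℓ q) q := fun q => by
      apply ContDiff.contDiffAt
      fun_prop
    have hℓ1 : ℓ (1, 0) = v' := by simp [hℓ]
    have hℓ2 : ℓ (0, 1) = Complex.I • v' := by simp [hℓ]
    have hgC : ∀ q ∈ Icc (-d) d ×ˢ Icc (-d) d, ContDiffAt ℝ 2 (fun q => w (p + ℓ q)) q :=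
      fun q hq => (hCD q hq).comp q (hℓC q)
    have hsec : ∀ q ∈ Icc (-d) d ×ˢ Icc (-d) d, ∀ a : ℝ × ℝ,
        fderiv ℝ (fderiv ℝ fun q => w (p + ℓ q)) q a a
          = fderiv ℝ (fderiv ℝ w) (p + ℓ q) (ℓ a) (ℓ a) := by
      intro q hq a
      have e1 := deriv_deriv_line (p := q) (v := a) (t := 0) (f := fun q => w (p + ℓ q))
        (by simpa using hgC q hq)
      have e2 := deriv_deriv_line (p := p + ℓ q) (v := ℓ a) (t := 0) (f := w)
        (by simpa using hCD q hq)
      simp only [zero_smul, add_zero] at e1 e2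
      rw [← e1, ← e2]
      simp only [map_add, map_smul, add_assoc]
    have h := abs_fderiv_le_of_laplacian_bounded (g := fun q => w (p + ℓ q)) (d := d) (η := η)
      (K := 4 * Real.pi * K) hd hη (by positivity) hgC ?_ ?_
    · have h0 : HasFDerivAt (fun q => w (p + ℓ q)) ((fderiv ℝ w p).comp ℓ) 0 := by
        have h1 : ContDiffAt ℝ 2 w (p + ℓ 0) :=
          hCD 0 ⟨⟨by simpa using hd.le, hd.le⟩, by simpa using hd.le, hd.le⟩
        have h2 := (h1.differentiableAt (by norm_num)).hasFDerivAt
        have h3 := h2.comp (0 : ℝ × ℝ) (ℓ.hasFDerivAt.const_add p)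
        rw [map_zero, add_zero] at h3
        exact h3
      rw [h0.fderiv, ContinuousLinearMap.comp_apply, hℓ1] at h
      calc _ ≤ _ := h
        _ = _ := by ring
    · intro q hq
      obtain ⟨ζ, h1, h2, h3⟩ := hmem q hq
      simp only [h3]
      exact hwη ζ h1 h2
    · intro q hq
      rw [hsec q hq, hsec q hq, hℓ1, hℓ2]
      obtain ⟨ζ, h1, h2, h3⟩ := hmem q hq
      have h4 := hlevi ζ h1 h2
      rw [← h3, ← hlv, levi_eq, abs_div, abs_of_pos (by positivity : 0 < 4 * Real.pi),
        div_le_iff₀ (by positivity)] at h4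
      linarith
  refine abs_le.2 ⟨?_, main v (Or.inl rfl)⟩
  have := main (-v) (Or.inr rfl)
  rw [map_neg] at this
  linarith

end Interpolation

/-! ### Mollification -/

section Mollify

theorem fderiv_fderiv_apply {E : Type*} [NormedAddCommGroup E] [NormedSpace ℝ E]
    {f : E → ℝ} {p : E} (hf : ContDiffAt ℝ 2 f p) (v w : E) :
    fderiv ℝ (fun q => fderiv ℝ f q w) p v = fderiv ℝ (fderiv ℝ f) p v w := by
  rw [fderiv_clm_apply hf.differentiableAt_fderiv (differentiableAt_const w)]
  simp

theorem continuous_mul_of_tsupport_subset {Y : Type*} [TopologicalSpace Y] {f χ : Y → ℝ}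
    {U : Set Y} (hU : IsOpen U) (hf : ContinuousOn f U) (hχ : Continuous χ)
    (hs : tsupport χ ⊆ U) : Continuous fun q => f q * χ q := by
  refine continuous_of_tsupport fun x hx => ?_
  have hx' : x ∈ tsupport χ := tsupport_mul_subset_right hx
  exact (hf.continuousAt (hU.mem_nhds (hs hx'))).mul hχ.continuousAt

variable {V : Type*} [NormedAddCommGroup V] [NormedSpace ℂ V] [MeasureSpace V]

/-- The convolution of `g` with the kernel `φ`. -/
def mollify (φ g : V → ℝ) (p : V) : ℝ := ∫ t, g t * φ (p - t)

theorem mollify_eq_convolution (φ g : V → ℝ) :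
    mollify φ g = convolution g φ (ContinuousLinearMap.mul ℝ ℝ) volume := rfl

theorem tsupport_comp_sub_subset {φ : V → ℝ} {r : ℝ} (hφr : Function.support φ ⊆ Metric.ball 0 r)
    (p : V) : tsupport (fun q => φ (p - q)) ⊆ Metric.closedBall p r := by
  refine closure_minimal (fun q hq => ?_) Metric.isClosed_closedBall
  have := hφr (show p - q ∈ Function.support φ from hq)
  rw [mem_ball_zero_iff, ← dist_eq_norm, dist_comm] at this
  exact this.le

theorem levi_comp_sub {φ : V → ℝ} (hφ : ContDiff ℝ ∞ φ) (p q v : V) :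
    levi (fun q => φ (p - q)) q v = levi φ (p - q) v := by
  have h1 : fderiv ℝ (fun q => φ (p - q)) = fun q => -fderiv ℝ φ (p - q) := by
    ext1 q
    have h0 : DifferentiableAt ℝ φ (p - q) := hφ.contDiffAt.differentiableAt (by simp)
    have := h0.hasFDerivAt.comp q ((hasFDerivAt_id q).const_sub p)
    refine (HasFDerivAt.congr_fderiv this ?_).fderiv
    ext v; simp
  have hφ2 : ContDiff ℝ 2 φ := hφ.of_le ENat.LEInfty.out
  have h2 : fderiv ℝ (fun q => -fderiv ℝ φ (p - q)) q = fderiv ℝ (fderiv ℝ φ) (p - q) := by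
    have h0 := (hφ2.contDiffAt (x := p - q)).differentiableAt_fderiv
    have := (h0.hasFDerivAt.comp q ((hasFDerivAt_id q).const_sub p)).neg
    refine (HasFDerivAt.congr_fderiv this ?_).fderiv
    ext v; simp
  rw [levi_eq, levi_eq, h1, h2]

variable [BorelSpace V] [(volume : Measure V).IsAddHaarMeasure] [FiniteDimensional ℝ V]

theorem exists_mollifier {r : ℝ} (hr : 0 < r) : ∃ φ : V → ℝ, ContDiff ℝ ∞ φ ∧ (∀ q, 0 ≤ φ q) ∧
    Function.support φ ⊆ Metric.ball 0 r ∧ ∫ q, φ q = 1 := by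
  set φ : ContDiffBump (0 : V) := ⟨r / 2, r, half_pos hr, half_lt_self hr⟩
  exact ⟨φ.normed volume, φ.contDiff_normed, φ.nonneg_normed, φ.support_normed_eq.subset,
    φ.integral_normed⟩

theorem hasCompactSupport_of_support_subset_ball {φ : V → ℝ} {r : ℝ}
    (hφr : Function.support φ ⊆ Metric.ball 0 r) : HasCompactSupport φ := by
  have : ProperSpace V := FiniteDimensional.proper_rclike ℝ V
  exact HasCompactSupport.intro (isCompact_closedBall (0 : V) r) fun x hx => by
    by_contra h
    exact hx (Metric.ball_subset_closedBall (hφr h))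

theorem contDiff_mollify {φ g : V → ℝ} (hφ : ContDiff ℝ ∞ φ) (hφc : HasCompactSupport φ)
    (hg : Continuous g) : ContDiff ℝ ∞ (mollify φ g) :=
  hφc.contDiff_convolution_right (ContinuousLinearMap.mul ℝ ℝ) hg.locallyIntegrable hφ

theorem fderiv_mollify {φ g : V → ℝ} (hφ : ContDiff ℝ ∞ φ) (hφc : HasCompactSupport φ)
    (hg : Continuous g) (p v : V) :
    fderiv ℝ (mollify φ g) p v = mollify (fun q => fderiv ℝ φ q v) g p := by
  rw [mollify_eq_convolution, (hφc.hasFDerivAt_convolution_right _ hg.locallyIntegrable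
    (hφ.of_le (by exact_mod_cast le_top)) p).fderiv]
  rw [convolution_precompR_apply _ hg.locallyIntegrable (hφc.fderiv ℝ)
    (hφ.continuous_fderiv (by simp))]
  rfl

theorem integrable_mul_comp_sub {φ g : V → ℝ} (hφ : Continuous φ) (hφc : HasCompactSupport φ)
    (hg : Continuous g) (p : V) : Integrable fun t => g t * φ (p - t) := by
  refine Continuous.integrable_of_hasCompactSupport (by fun_prop) ?_
  exact HasCompactSupport.mul_left (hφc.comp_homeomorph (Homeomorph.subLeft p))

theorem levi_mollify {φ g : V → ℝ} (hφ : ContDiff ℝ ∞ φ) (hφc : HasCompactSupport φ)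
    (hg : Continuous g) (p v : V) :
    levi (mollify φ g) p v = ∫ q, g q * levi (fun q => φ (p - q)) q v := by
  have h1 : ∀ v : V, ContDiff ℝ ∞ fun q => fderiv ℝ φ q v := fun v =>
    (hφ.fderiv_right (m := ∞) (by simp)).clm_apply contDiff_const
  have h1c : ∀ v : V, HasCompactSupport fun q => fderiv ℝ φ q v := fun v => hφc.fderiv_apply ℝ v
  have h2 : ∀ v : V, Continuous fun q => fderiv ℝ (fun q => fderiv ℝ φ q v) q v := fun v =>
    ((h1 v).continuous_fderiv (by simp)).clm_apply continuous_const
  have h2c : ∀ v : V, HasCompactSupport fun q => fderiv ℝ (fun q => fderiv ℝ φ q v) q v :=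
    fun v => (h1c v).fderiv_apply ℝ v
  have hφ2 : ContDiff ℝ 2 φ := hφ.of_le ENat.LEInfty.out
  have key : ∀ v : V, fderiv ℝ (fderiv ℝ (mollify φ g)) p v v
      = ∫ q, g q * fderiv ℝ (fderiv ℝ φ) (p - q) v v := by
    intro v
    rw [← fderiv_fderiv_apply (((contDiff_mollify hφ hφc hg).of_le
      ENat.LEInfty.out).contDiffAt)]
    have : (fun q => fderiv ℝ (mollify φ g) q v) = mollify (fun q => fderiv ℝ φ q v) g :=
      funext fun q => fderiv_mollify hφ hφc hg q v
    rw [this, fderiv_mollify (h1 v) (h1c v) hg, mollify]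
    congr 1; ext q
    rw [fderiv_fderiv_apply hφ2.contDiffAt]
  have hint : ∀ v : V, Integrable fun q => g q * fderiv ℝ (fderiv ℝ φ) (p - q) v v := by
    intro v
    have := integrable_mul_comp_sub (h2 v) (h2c v) hg p
    simpa only [fderiv_fderiv_apply hφ2.contDiffAt] using this
  rw [levi_eq, key, key, ← integral_add (hint _) (hint _), ← integral_div]
  congr 1; ext q
  rw [levi_comp_sub hφ, levi_eq]
  ring

theorem integral_comp_sub_eq_one {φ : V → ℝ} (hφ1 : ∫ q, φ q = 1) (p : V) :
    ∫ q, φ (p - q) = 1 := by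
  rw [integral_sub_left_eq_self (f := φ), hφ1]

theorem abs_integral_mul_sub_le {χ h : V → ℝ} {a δ : ℝ} (hχ0 : ∀ q, 0 ≤ χ q)
    (hχ1 : ∫ q, χ q = 1) (hint : Integrable fun q => h q * χ q)
    (hδ : ∀ q, χ q ≠ 0 → |h q - a| ≤ δ) : |(∫ q, h q * χ q) - a| ≤ δ := by
  have hχi : Integrable χ := integrable_of_integral_eq_one hχ1
  have h1 : (∫ q, h q * χ q) - a = ∫ q, (h q - a) * χ q := by
    simp only [sub_mul]
    rw [integral_sub hint (hχi.const_mul a), integral_const_mul, hχ1, mul_one]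
  rw [h1]
  calc |∫ q, (h q - a) * χ q| ≤ ∫ q, δ * χ q := by
        rw [← Real.norm_eq_abs]
        refine norm_integral_le_of_norm_le (hχi.const_mul δ) (Eventually.of_forall fun q => ?_)
        rw [norm_mul, Real.norm_eq_abs, Real.norm_of_nonneg (hχ0 q)]
        by_cases hq : χ q = 0
        · simp [hq]
        · exact mul_le_mul_of_nonneg_right (hδ q hq) (hχ0 q)
    _ = δ := by rw [integral_const_mul, hχ1, mul_one]

end Mollify

/-! ### Mollifying a subgeodesic in a chart -/

section LocalRegularization

instance volume_isAddHaarMeasure_prod (n : ℕ) :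
    (volume : Measure (Cn n × ℂ)).IsAddHaarMeasure :=
  Measure.prod.instIsAddHaarMeasure _ _

variable {n : ℕ} {X : Type*} [TopologicalSpace X] [ChartedSpace (Cn n) X]
  [IsManifold 𝓘(ℂ, Cn n) ∞ X] [T2Space X]

/-- The upper bound `Ω + dd^c u_t ≤ C Ω` on the slices of a family, in the sense of currents
on the product with the strip. -/
def KahlerForm.SliceLE (Ω : KahlerForm n X) (u : ℝ → X → ℝ) (C : ℝ) : Prop :=
  ∀ e ∈ atlas (Cn n) X, ∀ χ : Cn n × ℂ → ℝ,
    IsTestFunction (e.target ×ˢ strip) χ → (∀ p, 0 ≤ χ p) →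
      ∀ v : Cn n, Ω.stripPair u e χ (v, 0) (Complex.I • (v, 0)) ≤
        C * ∫ p : Cn n × ℂ, Ω.normSq e p.1 v * χ p

/-- Mollification of a subgeodesic in a chart: the bounds for the current pass to the Levi form
of the regularization, with an arbitrarily small loss. -/
theorem KahlerForm.IsSubgeodesic.exists_local_regularization {Ω : KahlerForm n X}
    {u : ℝ → X → ℝ} (hu : Ω.IsSubgeodesic u) {C : ℝ} (hC : Ω.SliceLE u C) :
    ∃ K₁ : ℝ, 0 ≤ K₁ ∧ ∀ e ∈ atlas (Cn n) X, ∀ K : Set (Cn n), IsCompact K → K ⊆ e.target →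
      ∀ σ : ℝ, 0 < σ → ∀ ε : ℝ, 0 < ε → ∃ G : Cn n × ℂ → ℝ, ContDiff ℝ ∞ G ∧
        (∀ z τ (s : ℝ), G (z, τ + s * Complex.I) = G (z, τ)) ∧
        ∀ z ∈ K, ∀ τ : ℂ, σ ≤ τ.re → τ.re ≤ 1 - σ →
          |G (z, τ) - u τ.re (e.symm z)| ≤ ε ∧ ∀ V : Cn n × ℂ,
            -(1 + ε) * Ω.normSq e z V.1 ≤ levi G (z, τ) V ∧
            levi G (z, τ) V ≤ K₁ * (Ω.normSq e z V.1 + ‖V.2‖ ^ 2) ∧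
            levi G (z, τ) (V.1, 0) ≤ (C - 1 + ε) * Ω.normSq e z V.1 := by
  obtain ⟨K₀, hK₀⟩ := hu.bounded
  refine ⟨2 * max K₀ 0, by positivity, fun e he K hK hKe σ hσ ε hε => ?_⟩
  -- The oscillation `ε'` of the metric on the support of the kernel enters the lower bound with the
  -- factor `1` and the upper bound for the slices with the factor `|C - 1|`.
  set ε' : ℝ := min (ε / (|C - 1| + 1)) (min ε 1) with hε'
  have hε'0 : 0 < ε' := lt_min (by positivity) (lt_min hε one_pos)
  have hε'1 : ε' ≤ 1 := (min_le_right _ _).trans (min_le_right _ _)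
  have hε'ε : ε' ≤ ε := (min_le_right _ _).trans (min_le_left _ _)
  have hε'C : |C - 1| * ε' ≤ ε := by
    have h1 : ε' ≤ ε / (|C - 1| + 1) := min_le_left _ _
    rw [le_div_iff₀ (by positivity)] at h1
    nlinarith
  obtain ⟨L, hL, hKL, hLe⟩ := exists_compact_between hK e.open_target hKe
  obtain ⟨M, hM, hLM, hMe⟩ := exists_compact_between hL e.open_target hLe
  obtain ⟨r₁, hr₁, hr₁L⟩ := hK.exists_cthickening_subset_open isOpen_interior hKL
  obtain ⟨r₂, hr₂, hN⟩ := Ω.exists_abs_normSq_sub_le he hK hKe hε'0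
  -- the function to be mollified: the cutoff `ψ` and the projection of the time to `[0, 1]` make it
  -- continuous everywhere; only values where neither has an effect are used below
  obtain ⟨ψ, hψ1, hψ0, -, -⟩ := exists_continuous_one_zero_of_isCompact hL
    (isOpen_interior (s := M)).isClosed_compl (disjoint_compl_right_iff_subset.2 hLM)
  set U : ℝ → Cn n → ℝ := fun t z => u (projIcc (0 : ℝ) 1 zero_le_one t) (e.symm z) with hU
  set g : Cn n × ℂ → ℝ := fun p => ψ p.1 * U p.2.re p.1 with hg
  have hUc : ContinuousOn (fun p : ℝ × Cn n => U p.1 p.2) (univ ×ˢ e.target) := by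
    have h1 : ContinuousOn (fun p : ℝ × Cn n => ((projIcc (0 : ℝ) 1 zero_le_one p.1 : ℝ),
        e.symm p.2)) (univ ×ˢ e.target) :=
      (continuous_subtype_val.comp (continuous_projIcc.comp continuous_fst)).continuousOn.prodMk
        (e.symm.continuousOn.comp continuousOn_snd fun p hp => hp.2)
    exact hu.continuous.comp h1 fun p _ => ⟨Subtype.mem _, mem_univ _⟩
  have hgc : Continuous g := by
    refine continuous_iff_continuousAt.2 fun p => ?_
    by_cases hp : p.1 ∈ e.target
    · have h1 : ContinuousAt (fun p : ℝ × Cn n => U p.1 p.2) (p.2.re, p.1) :=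
        hUc.continuousAt ((isOpen_univ.prod e.open_target).mem_nhds ⟨mem_univ _, hp⟩)
      have h2 : ContinuousAt (fun p : Cn n × ℂ => (p.2.re, p.1)) p := by fun_prop
      exact (ψ.continuous.comp continuous_fst).continuousAt.mul
        (ContinuousAt.comp (g := fun p : ℝ × Cn n => U p.1 p.2)
          (f := fun p : Cn n × ℂ => (p.2.re, p.1)) h1 h2)
    · have h1 : ∀ᶠ q : Cn n × ℂ in 𝓝 p, q.1 ∈ Mᶜ :=
        continuousAt_fst.eventually (hM.isClosed.isOpen_compl.mem_nhds fun h => hp (hMe h))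
      have h2 : (fun _ => (0 : ℝ)) =ᶠ[𝓝 p] g := by
        filter_upwards [h1] with q hq
        have : ψ q.1 = 0 := hψ0 fun h => hq (interior_subset h)
        simp [hg, this]
      exact continuousAt_const.congr h2
  have hunif : UniformContinuousOn (fun p : ℝ × Cn n => U p.1 p.2) (Icc 0 1 ×ˢ L) :=
    (isCompact_Icc.prod hL).uniformContinuousOn_of_continuous
      (hUc.mono (prod_mono (subset_univ _) hLe))
  obtain ⟨r₃, hr₃, hunif⟩ := Metric.uniformContinuousOn_iff_le.1 hunif ε hε
  set r : ℝ := min (min r₁ r₂) (min r₃ (σ / 2)) with hr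
  have hr0 : 0 < r := lt_min (lt_min hr₁ hr₂) (lt_min hr₃ (half_pos hσ))
  have hrσ : r < σ := ((min_le_right _ _).trans (min_le_right _ _)).trans_lt (half_lt_self hσ)
  obtain ⟨φ, hφ, hφ0, hφr, hφ1⟩ := exists_mollifier (V := Cn n × ℂ) hr0
  have hφc := hasCompactSupport_of_support_subset_ball hφr
  refine ⟨mollify φ g, contDiff_mollify hφ hφc hgc, fun z τ s => ?_, fun z hz τ hτ1 hτ2 => ?_⟩
  -- `g` depends on `τ` through `re τ` only.
  · rw [mollify_eq_convolution, convolution_eq_swap, convolution_eq_swap]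
    congr 1; ext t
    simp [hg]
  -- the kernel centred at the given point is a test function
  set p : Cn n × ℂ := (z, τ) with hp
  have hball : ∀ q ∈ Metric.closedBall p r, q.1 ∈ L ∧ 0 < q.2.re ∧ q.2.re < 1 ∧
      dist q.1 z ≤ r ∧ |q.2.re - τ.re| ≤ r := by
    intro q hq
    have hq' : dist q p ≤ r := hq
    have h1 : dist q.1 z ≤ r := (le_max_left _ _).trans hq'
    have h2 : |q.2.re - τ.re| ≤ r := by
      have h3 : dist q.2 τ ≤ r := (le_max_right _ _).trans hq'
      rw [dist_eq_norm] at h3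
      exact (Complex.abs_re_le_norm (q.2 - τ)).trans h3
    have h4 := abs_le.1 h2
    refine ⟨interior_subset (hr₁L (Metric.mem_cthickening_of_dist_le _ _ _ _ hz
      (h1.trans ((min_le_left _ _).trans (min_le_left _ _))))), ?_, ?_, h1, h2⟩ <;> linarith
  set χ : Cn n × ℂ → ℝ := fun q => φ (p - q) with hχ
  have hχs : tsupport χ ⊆ Metric.closedBall p r := tsupport_comp_sub_subset hφr p
  have hχC : ContDiff ℝ ∞ χ := hφ.comp (contDiff_const.sub contDiff_id)
  have hχt : IsTestFunction (e.target ×ˢ strip) χ := by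
    refine ⟨hχC, hφc.comp_homeomorph (Homeomorph.subLeft p), fun q hq => ?_⟩
    obtain ⟨h1, h2, h3, -, -⟩ := hball q (hχs hq)
    exact ⟨hLe h1, h2, h3⟩
  have hχ0 : ∀ q, 0 ≤ χ q := fun q => hφ0 _
  have hχ1 : ∫ q, χ q = 1 := integral_comp_sub_eq_one hφ1 p
  have hχcs : HasCompactSupport χ := hχt.2.1
  have hgU : ∀ q ∈ Metric.closedBall p r, g q = u q.2.re (e.symm q.1) := by
    intro q hq
    obtain ⟨h1, h2, h3, -, -⟩ := hball q hq
    have : ψ q.1 = 1 := hψ1 h1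
    simp only [hg, this, one_mul, hU]
    rw [projIcc_of_mem zero_le_one ⟨h2.le, h3.le⟩]
  have hχi : Integrable χ := integrable_of_integral_eq_one hχ1
  have hNi : ∀ v : Cn n, Integrable fun q : Cn n × ℂ => Ω.normSq e q.1 v * χ q := by
    intro v
    refine Continuous.integrable_of_hasCompactSupport ?_ hχcs.mul_left
    refine continuous_mul_of_tsupport_subset (U := e.target ×ˢ strip) ?_ ?_ hχC.continuous hχt.2.2
    · exact e.open_target.prod ((isOpen_lt continuous_const Complex.continuous_re).inter
        (isOpen_lt Complex.continuous_re continuous_const))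
    · exact (Ω.continuousOn_normSq he).comp (f := fun q : Cn n × ℂ => (q.1, v))
        (by fun_prop) fun q hq => ⟨hq.1, mem_univ _⟩
  -- The metric varies by at most `ε'` on the support of the kernel.
  have hNm : ∀ v : Cn n, |(∫ q : Cn n × ℂ, Ω.normSq e q.1 v * χ q) - Ω.normSq e z v|
      ≤ ε' * Ω.normSq e z v := fun v => by
    refine abs_integral_mul_sub_le hχ0 hχ1 (hNi v) fun q hq => ?_
    have hq' := hball q (hχs (subset_tsupport _ hq))
    exact (hN z hz q.1 (hq'.2.2.2.1.trans ((min_le_left _ _).trans (min_le_right _ _)))).2 v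
  -- Testing the current against the kernel gives the Levi form of the mollification.
  have hpair : ∀ V : Cn n × ℂ, Ω.stripPair u e χ V (Complex.I • V)
      = (∫ q : Cn n × ℂ, Ω.normSq e q.1 V.1 * χ q) + levi (mollify φ g) p V := by
    intro V
    have hli : Integrable fun q => g q * levi χ q V := by
      have h1 : Continuous fun q => levi χ q V := by
        have h2 : Continuous (fderiv ℝ (fderiv ℝ χ)) :=
          (hχC.fderiv_right (m := ∞) (by simp)).continuous_fderiv (by simp)
        simp only [levi_eq]
        exact (((h2.clm_apply continuous_const).clm_apply continuous_const).add
          ((h2.clm_apply continuous_const).clm_apply continuous_const)).div_const _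
      have h3 : HasCompactSupport fun q => levi χ q V := by
        refine HasCompactSupport.intro hχcs fun q hq => ?_
        have : χ =ᶠ[𝓝 q] fun _ => 0 := notMem_tsupport_iff_eventuallyEq.1 hq
        rw [this.levi_eq, levi_const]
      exact (hgc.mul h1).integrable_of_hasCompactSupport h3.mul_left
    rw [levi_mollify hφ hφc hgc, ← integral_add (hNi _) hli, KahlerForm.stripPair]
    congr 1; ext q
    have h1 : Ω.coord e q.1 V.1 (Complex.I • V).1 = Ω.normSq e q.1 V.1 := rfl
    have h2 : ddc χ q V (Complex.I • V) = levi χ q V := rfl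
    rw [h1, h2]
    by_cases hq : q ∈ tsupport χ
    · rw [hgU q (hχs hq)]
    · have : χ =ᶠ[𝓝 q] fun _ => 0 := notMem_tsupport_iff_eventuallyEq.1 hq
      rw [this.levi_eq, levi_const]
      simp
  have hNz := fun v => Ω.normSq_nonneg he (hKe hz) v
  refine ⟨?_, fun V => ⟨?_, ?_, ?_⟩⟩
  · have h1 := abs_integral_mul_sub_le (h := g) (a := u τ.re (e.symm z)) (δ := ε) hχ0 hχ1
      (integrable_mul_comp_sub hφ.continuous hφc hgc p) fun q hq => ?_
    · exact h1
    · have hqb := hχs (subset_tsupport _ hq)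
      obtain ⟨q1, q2, q3, q4, q5⟩ := hball q hqb
      rw [hgU q hqb]
      have h2 := hunif (q.2.re, q.1) ⟨⟨q2.le, q3.le⟩, q1⟩ (τ.re, z)
        ⟨⟨by linarith, by linarith⟩, interior_subset (hKL hz)⟩ (by
          rw [Prod.dist_eq, Real.dist_eq]
          exact (max_le q5 q4).trans ((min_le_right _ _).trans (min_le_left _ _)))
      simp only [hU, projIcc_of_mem zero_le_one (⟨q2.le, q3.le⟩ : q.2.re ∈ Icc (0 : ℝ) 1),
        projIcc_of_mem zero_le_one (⟨by linarith, by linarith⟩ : τ.re ∈ Icc (0 : ℝ) 1)] at h2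
      exact h2
  · have h1 := hu.positive e he χ hχt hχ0 V
    rw [hpair] at h1
    have h2 := (abs_le.1 (hNm V.1)).2
    nlinarith [hNz V.1]
  · have h1 := hK₀ e he χ hχt hχ0 V
    rw [hpair] at h1
    have h2 := abs_le.1 (hNm V.1)
    have h3 : ∫ q : Cn n × ℂ, (Ω.coord e q.1 V.1 (Complex.I • V.1) + ‖V.2‖ ^ 2) * χ q
        = (∫ q : Cn n × ℂ, Ω.normSq e q.1 V.1 * χ q) + ‖V.2‖ ^ 2 := by
      simp only [add_mul]
      change ∫ q : Cn n × ℂ, (Ω.normSq e q.1 V.1 * χ q + ‖V.2‖ ^ 2 * χ q) = _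
      rw [integral_add (hNi V.1) (hχi.const_mul _), integral_const_mul, hχ1, mul_one]
    rw [h3] at h1
    have h4 : 0 ≤ ∫ q : Cn n × ℂ, Ω.normSq e q.1 V.1 * χ q := by nlinarith [hNz V.1]
    have h5 : (∫ q : Cn n × ℂ, Ω.normSq e q.1 V.1 * χ q) ≤ 2 * Ω.normSq e z V.1 := by
      nlinarith [hNz V.1]
    calc levi (mollify φ g) p V
        ≤ max K₀ 0 * ((∫ q : Cn n × ℂ, Ω.normSq e q.1 V.1 * χ q) + ‖V.2‖ ^ 2) := by
          have : K₀ * ((∫ q : Cn n × ℂ, Ω.normSq e q.1 V.1 * χ q) + ‖V.2‖ ^ 2)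
            ≤ max K₀ 0 * ((∫ q : Cn n × ℂ, Ω.normSq e q.1 V.1 * χ q) + ‖V.2‖ ^ 2) := by
            gcongr
            exact le_max_left _ _
          linarith
      _ ≤ max K₀ 0 * (2 * (Ω.normSq e z V.1 + ‖V.2‖ ^ 2)) := by
          gcongr
          nlinarith [sq_nonneg ‖V.2‖]
      _ = _ := by ring
  · have h1 := hC e he χ hχt hχ0 V.1
    rw [hpair] at h1
    have h2 := hNm V.1
    simp only at h1
    set N := Ω.normSq e z V.1
    set Nm := ∫ q : Cn n × ℂ, Ω.normSq e q.1 V.1 * χ q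
    have h3 : (C - 1) * (Nm - N) ≤ |C - 1| * (ε' * N) :=
      (le_abs_self _).trans ((abs_mul _ _).trans_le (by gcongr))
    have h4 : |C - 1| * (ε' * N) ≤ ε * N := by
      rw [← mul_assoc]
      exact mul_le_mul_of_nonneg_right hε'C (hNz V.1)
    linarith

end LocalRegularization

/-! ### Chart expressions on the product with the strip -/

section ChartExpressions

variable {n : ℕ} {X : Type*} [TopologicalSpace X] [ChartedSpace (Cn n) X]

/-- The expression of a function `P` on `X × ℂ` in the product of a chart with `ℂ`. -/
def chartExpr (P : X → ℂ → ℝ) (e : OpenPartialHomeomorph X (Cn n)) : Cn n × ℂ → ℝ :=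
  fun p => P (e.symm p.1) p.2

variable [IsManifold 𝓘(ℂ, Cn n) ∞ X] {e e' : OpenPartialHomeomorph X (Cn n)}

/-- The derivative of a change of charts, times the identity. -/
def transitionDeriv (e e' : OpenPartialHomeomorph X (Cn n)) (z : Cn n) (V : Cn n × ℂ) : Cn n × ℂ :=
  (fderiv ℂ (fun y => e' (e.symm y)) z V.1, V.2)

theorem chartExpr_transition (P : X → ℂ → ℝ) {z : Cn n} (hz : z ∈ e.target)
    (hz' : e.symm z ∈ e'.source) (τ : ℂ) :
    chartExpr P e =ᶠ[𝓝 (z, τ)] fun p => chartExpr P e' (e' (e.symm p.1), p.2) := by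
  have h : ∀ᶠ p : Cn n × ℂ in 𝓝 (z, τ), e.symm p.1 ∈ e'.source :=
    (ContinuousAt.comp (g := e.symm) (f := Prod.fst) (x := (z, τ)) (e.symm.continuousAt hz)
      continuousAt_fst).eventually
      (e'.open_source.mem_nhds hz')
  filter_upwards [h] with p hp
  simp [chartExpr, e'.left_inv hp]

theorem contDiffAt_prod_transition (he : e ∈ atlas (Cn n) X) (he' : e' ∈ atlas (Cn n) X)
    {z : Cn n} (hz : z ∈ e.target) (hz' : e.symm z ∈ e'.source) (τ : ℂ) :
    ContDiffAt ℂ ∞ (fun p : Cn n × ℂ => (e' (e.symm p.1), p.2)) (z, τ) :=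
  (ContDiffAt.comp (g := fun y => e' (e.symm y)) (f := Prod.fst) (z, τ)
    (contDiffAt_transition he he' hz hz') contDiffAt_fst).prodMk contDiffAt_snd

theorem fderiv_prod_transition (he : e ∈ atlas (Cn n) X) (he' : e' ∈ atlas (Cn n) X)
    {z : Cn n} (hz : z ∈ e.target) (hz' : e.symm z ∈ e'.source) (τ : ℂ) (V : Cn n × ℂ) :
    fderiv ℂ (fun p : Cn n × ℂ => (e' (e.symm p.1), p.2)) (z, τ) V = transitionDeriv e e' z V := by
  have h1 : HasFDerivAt (fun y => e' (e.symm y)) _ z :=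
    ((contDiffAt_transition he he' hz hz').differentiableAt (by simp)).hasFDerivAt
  have h2 := (HasFDerivAt.comp (𝕜 := ℂ) (g := fun y => e' (e.symm y)) (f := Prod.fst) (z, τ) h1
    hasFDerivAt_fst).prodMk (hasFDerivAt_snd (𝕜 := ℂ) (E := Cn n) (F := ℂ) (p := (z, τ)))
  have h3 : fderiv ℂ (fun p : Cn n × ℂ => (e' (e.symm p.1), p.2)) (z, τ) = _ := h2.fderiv
  rw [h3]
  rfl

theorem ContDiffAt.chartExpr_transition {P : X → ℂ → ℝ} (he : e ∈ atlas (Cn n) X)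
    (he' : e' ∈ atlas (Cn n) X) {z : Cn n} (hz : z ∈ e.target) (hz' : e.symm z ∈ e'.source)
    {τ : ℂ} (h : ContDiffAt ℝ ∞ (chartExpr P e') (e' (e.symm z), τ)) :
    ContDiffAt ℝ ∞ (chartExpr P e) (z, τ) :=
  (ContDiffAt.comp (f := fun p : Cn n × ℂ => (e' (e.symm p.1), p.2)) (z, τ) h
    ((contDiffAt_prod_transition he he' hz hz' τ).restrict_scalars ℝ)).congr_of_eventuallyEq
      (_root_.chartExpr_transition P hz hz' τ)

theorem levi_chartExpr {P : X → ℂ → ℝ} (he : e ∈ atlas (Cn n) X)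
    (he' : e' ∈ atlas (Cn n) X) {z : Cn n} (hz : z ∈ e.target) (hz' : e.symm z ∈ e'.source)
    {τ : ℂ} (h : ContDiffAt ℝ 2 (chartExpr P e') (e' (e.symm z), τ)) (V : Cn n × ℂ) :
    levi (chartExpr P e) (z, τ) V
      = levi (chartExpr P e') (e' (e.symm z), τ) (transitionDeriv e e' z V) := by
  rw [(chartExpr_transition P hz hz' τ).levi_eq,
    levi_comp (T := fun p : Cn n × ℂ => (e' (e.symm p.1), p.2)) h
      ((contDiffAt_prod_transition he he' hz hz' τ).of_le ENat.LEInfty.out),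
    fderiv_prod_transition he he' hz hz']

theorem fderiv_chartExpr {P : X → ℂ → ℝ} (he : e ∈ atlas (Cn n) X)
    (he' : e' ∈ atlas (Cn n) X) {z : Cn n} (hz : z ∈ e.target) (hz' : e.symm z ∈ e'.source)
    {τ : ℂ} (h : DifferentiableAt ℝ (chartExpr P e') (e' (e.symm z), τ)) (V : Cn n × ℂ) :
    fderiv ℝ (chartExpr P e) (z, τ) V
      = fderiv ℝ (chartExpr P e') (e' (e.symm z), τ) (transitionDeriv e e' z V) := by
  have h1 : DifferentiableAt ℂ (fun p : Cn n × ℂ => (e' (e.symm p.1), p.2)) (z, τ) :=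
    (contDiffAt_prod_transition he he' hz hz' τ).differentiableAt (by simp)
  have h2 := HasFDerivAt.comp (f := fun p : Cn n × ℂ => (e' (e.symm p.1), p.2)) (z, τ)
    h.hasFDerivAt (h1.hasFDerivAt.restrictScalars ℝ)
  have h3 : fderiv ℝ (fun p : Cn n × ℂ => chartExpr P e' (e' (e.symm p.1), p.2)) (z, τ) = _ :=
    h2.fderiv
  rw [(chartExpr_transition P hz hz' τ).fderiv_eq, h3, ← fderiv_prod_transition he he' hz hz' τ V]
  rfl

/-- The squared length of a tangent vector of `X × ℂ` for the product metric, in a chart. -/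
def KahlerForm.prodNormSq (Ω : KahlerForm n X) (e : OpenPartialHomeomorph X (Cn n)) (z : Cn n)
    (V : Cn n × ℂ) : ℝ :=
  Ω.normSq e z V.1 + ‖V.2‖ ^ 2

theorem KahlerForm.prodNormSq_nonneg (Ω : KahlerForm n X) (he : e ∈ atlas (Cn n) X) {z : Cn n}
    (hz : z ∈ e.target) (V : Cn n × ℂ) : 0 ≤ Ω.prodNormSq e z V :=
  add_nonneg (Ω.normSq_nonneg he hz _) (sq_nonneg _)

theorem KahlerForm.normSq_le_prodNormSq (Ω : KahlerForm n X) (z : Cn n) (V : Cn n × ℂ) :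
    Ω.normSq e z V.1 ≤ Ω.prodNormSq e z V :=
  le_add_of_nonneg_right (sq_nonneg _)

theorem KahlerForm.prodNormSq_transition (Ω : KahlerForm n X) (he : e ∈ atlas (Cn n) X)
    (he' : e' ∈ atlas (Cn n) X) {z : Cn n} (hz : z ∈ e.target) (hz' : e.symm z ∈ e'.source)
    (V : Cn n × ℂ) : Ω.prodNormSq e z V
      = Ω.prodNormSq e' (e' (e.symm z)) (transitionDeriv e e' z V) := by
  rw [prodNormSq, Ω.normSq_transition he he' hz hz', prodNormSq, transitionDeriv]

theorem KahlerForm.prodNormSq_I_smul (Ω : KahlerForm n X) (z : Cn n) (V : Cn n × ℂ) :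
    Ω.prodNormSq e z (Complex.I • V) = Ω.prodNormSq e z V := by
  simp [prodNormSq, normSq_I_smul]

end ChartExpressions

/-! ### Smooth functions in charts and partitions of unity -/

section Smooth

variable {n : ℕ} {X : Type*} [TopologicalSpace X] [ChartedSpace (Cn n) X]
  [IsManifold 𝓘(ℂ, Cn n) ∞ X] {e : OpenPartialHomeomorph X (Cn n)}

theorem ContMDiff.contDiffAt_chart {f : X → ℝ} (hf : ContMDiff 𝓘(ℝ, Cn n) 𝓘(ℝ) ∞ f)
    (he : e ∈ atlas (Cn n) X) {z : Cn n} (hz : z ∈ e.target) :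
    ContDiffAt ℝ ∞ (fun y => f (e.symm y)) z := by
  have := isManifold_real (n := n) (X := X)
  have h1 := (contMDiffOn_symm_of_mem_maximalAtlas (I := 𝓘(ℝ, Cn n)) (n := ∞)
    (IsManifold.subset_maximalAtlas he)).contMDiffAt (e.open_target.mem_nhds hz)
  exact (hf.contMDiffAt.comp z h1).contDiffAt

theorem contMDiffAt_chart (he : e ∈ atlas (Cn n) X) {x : X} (hx : x ∈ e.source) :
    ContMDiffAt 𝓘(ℝ, Cn n) 𝓘(ℝ, Cn n) ∞ e x := by
  have := isManifold_real (n := n) (X := X)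
  exact contMDiffAt_of_mem_maximalAtlas (IsManifold.subset_maximalAtlas he) hx

theorem contMDiff_curve_of_contDiffAt_chart {Φ : ℝ → X → ℝ}
    (h : ∀ x, ∃ e ∈ atlas (Cn n) X, x ∈ e.source ∧ ∀ t : ℝ,
      ContDiffAt ℝ ∞ (fun p : ℝ × Cn n => Φ p.1 (e.symm p.2)) (t, e x)) :
    ContMDiff (𝓘(ℝ).prod 𝓘(ℝ, Cn n)) 𝓘(ℝ) ∞ (fun p : ℝ × X => Φ p.1 p.2) := by
  rintro ⟨t, x⟩
  obtain ⟨e, he, hx, h⟩ := h x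
  have h0 : ContMDiffAt (𝓘(ℝ).prod 𝓘(ℝ, Cn n)) 𝓘(ℝ, ℝ × Cn n) ∞
      (fun p : ℝ × X => (p.1, e p.2)) (t, x) :=
    contMDiffAt_fst.prodMk_space
      (ContMDiffAt.comp (g := e) (f := Prod.snd) (t, x) (contMDiffAt_chart he hx) contMDiffAt_snd)
  have h1 := ContMDiffAt.comp (f := fun p : ℝ × X => (p.1, e p.2)) (t, x) (h t).contMDiffAt h0
  refine h1.congr_of_eventuallyEq ?_
  have h2 : ∀ᶠ p : ℝ × X in 𝓝 (t, x), p.2 ∈ e.source :=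
    continuousAt_snd.eventually (e.open_source.mem_nhds hx)
  filter_upwards [h2] with p hp
  simp [e.left_inv hp]

/-- The chart expression of a smooth curve of functions. -/
theorem ContMDiff.contDiffAt_curve_chart {Φ : ℝ → X → ℝ}
    (hΦ : ContMDiff (𝓘(ℝ).prod 𝓘(ℝ, Cn n)) 𝓘(ℝ) ∞ (fun p : ℝ × X => Φ p.1 p.2))
    (he : e ∈ atlas (Cn n) X) {z : Cn n} (hz : z ∈ e.target) (t : ℝ) :
    ContDiffAt ℝ ∞ (fun p : ℝ × Cn n => Φ p.1 (e.symm p.2)) (t, z) := by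
  have := isManifold_real (n := n) (X := X)
  have h1 := (contMDiffOn_symm_of_mem_maximalAtlas (I := 𝓘(ℝ, Cn n)) (n := ∞)
    (IsManifold.subset_maximalAtlas he)).contMDiffAt (e.open_target.mem_nhds hz)
  have h2 : ContMDiffAt 𝓘(ℝ, ℝ × Cn n) (𝓘(ℝ).prod 𝓘(ℝ, Cn n)) ∞
      (fun p : ℝ × Cn n => (p.1, e.symm p.2)) (t, z) :=
    (contDiffAt_fst.contMDiffAt).prodMk
      (ContMDiffAt.comp (g := e.symm) (f := Prod.snd) (t, z) h1 contDiffAt_snd.contMDiffAt)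
  exact (ContMDiffAt.comp (f := fun p : ℝ × Cn n => (p.1, e.symm p.2)) (t, z)
    hΦ.contMDiffAt h2).contDiffAt

variable [CompactSpace X] [T2Space X]

variable (n X) in
/-- A finite smooth partition of unity subordinate to coordinate charts. -/
theorem exists_chart_partition : ∃ (S : Finset X) (ρ : X → X → ℝ),
    (∀ c, ContMDiff 𝓘(ℝ, Cn n) 𝓘(ℝ) ∞ (ρ c)) ∧ (∀ c x, 0 ≤ ρ c x) ∧ (∀ x, ∑ c ∈ S, ρ c x = 1) ∧
      ∀ c, tsupport (ρ c) ⊆ (chartAt (Cn n) c).source := by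
  have := isManifold_real (n := n) (X := X)
  obtain ⟨f, hf⟩ := SmoothPartitionOfUnity.exists_isSubordinate (I := 𝓘(ℝ, Cn n))
    (s := (univ : Set X)) isClosed_univ (fun c : X => (chartAt (Cn n) c).source)
    (fun c => (chartAt (Cn n) c).open_source)
    (fun x _ => mem_iUnion.2 ⟨x, mem_chart_source (Cn n) x⟩)
  have hfin : {c | (Function.support (f c)).Nonempty}.Finite :=
    f.locallyFinite.finite_nonempty_of_compact
  refine ⟨hfin.toFinset, fun c => f c, fun c => (f c).contMDiff, fun c x => f.nonneg c x,
    fun x => ?_, hf⟩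
  rw [← f.sum_eq_one (mem_univ x), finsum_eq_sum_of_support_subset]
  intro c hc
  simp only [Finite.coe_toFinset]
  exact ⟨x, hc⟩

end Smooth

/-! ### Derivative bounds and comparison of local regularizations -/

section Bounds

variable {n : ℕ} {X : Type*} [TopologicalSpace X] [ChartedSpace (Cn n) X]
  [IsManifold 𝓘(ℂ, Cn n) ∞ X] [CompactSpace X] [T2Space X]

theorem contDiffAt_two_of_infty {E : Type*} [NormedAddCommGroup E] [NormedSpace ℝ E] {f : E → ℝ}
    {p : E} (h : ContDiffAt ℝ ∞ f p) : ContDiffAt ℝ 2 f p := h.of_le ENat.LEInfty.out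

theorem isCompact_image_chart {e : OpenPartialHomeomorph X (Cn n)} {S : Set X} (hS : IsClosed S)
    (hSe : S ⊆ e.source) : IsCompact (e '' S) ∧ e '' S ⊆ e.target :=
  ⟨hS.isCompact.image_of_continuousOn (e.continuousOn.mono hSe),
    image_subset_iff.2 fun _ hx => e.map_source (hSe hx)⟩

theorem abs_levi_le {V : Type*} [NormedAddCommGroup V] [NormedSpace ℂ V] (f : V → ℝ) (p v : V) :
    |levi f p v| ≤ ‖fderiv ℝ (fderiv ℝ f) p‖ * ‖v‖ ^ 2 := by
  have h1 := (fderiv ℝ (fderiv ℝ f) p).le_opNorm₂ v v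
  have h2 := (fderiv ℝ (fderiv ℝ f) p).le_opNorm₂ (Complex.I • v) (Complex.I • v)
  rw [norm_smul, Complex.norm_I, one_mul] at h2
  rw [levi_eq, abs_div, abs_of_pos (by positivity : 0 < 4 * Real.pi), div_le_iff₀ (by positivity)]
  rw [Real.norm_eq_abs] at h1 h2
  have h3 : 0 ≤ ‖fderiv ℝ (fderiv ℝ f) p‖ * ‖v‖ ^ 2 := by positivity
  have h4 := Real.pi_gt_three
  calc _ ≤ _ := abs_add_le _ _
    _ ≤ 2 * (‖fderiv ℝ (fderiv ℝ f) p‖ * ‖v‖ ^ 2) := by nlinarith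
    _ ≤ _ := by nlinarith

/-- Uniform bounds, relative to the Kähler metric, for the first two derivatives of a smooth
function supported in a chart. -/
theorem KahlerForm.exists_derivative_bounds (Ω : KahlerForm n X) {f : X → ℝ}
    (hf : ContMDiff 𝓘(ℝ, Cn n) 𝓘(ℝ) ∞ f) {e₀ : OpenPartialHomeomorph X (Cn n)}
    (he₀ : e₀ ∈ atlas (Cn n) X) (hs : tsupport f ⊆ e₀.source) :
    ∃ M : ℝ, 0 ≤ M ∧ ∀ e ∈ atlas (Cn n) X, ∀ z ∈ e.target, ∀ v : Cn n,
      |fderiv ℝ (fun y => f (e.symm y)) z v| ≤ M * √(Ω.normSq e z v) ∧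
      |levi (fun y => f (e.symm y)) z v| ≤ M * Ω.normSq e z v := by
  obtain ⟨hK, hKe⟩ := isCompact_image_chart (isClosed_tsupport f) hs
  set g : Cn n → ℝ := fun y => f (e₀.symm y) with hg
  have hgC : ∀ y ∈ e₀ '' tsupport f, ContDiffAt ℝ ∞ g y := fun y hy =>
    hf.contDiffAt_chart he₀ (hKe hy)
  obtain ⟨A, hA⟩ := hK.bddAbove_image (f := fun y => ‖fderiv ℝ g y‖) fun y hy =>
    ((hgC y hy).continuousAt_fderiv (by simp)).norm.continuousWithinAt
  obtain ⟨B, hB⟩ := hK.bddAbove_image (f := fun y => ‖fderiv ℝ (fderiv ℝ g) y‖) fun y hy =>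
    (((hgC y hy).fderiv_right (m := ∞) (by simp)).continuousAt_fderiv
      (by simp)).norm.continuousWithinAt
  obtain ⟨c, hc0, hc⟩ := Ω.exists_normSq_bounds he₀ hK hKe
  have hA' : ∀ y ∈ e₀ '' tsupport f, ‖fderiv ℝ g y‖ ≤ max A 0 := fun y hy =>
    (hA (mem_image_of_mem _ hy)).trans (le_max_left _ _)
  have hB' : ∀ y ∈ e₀ '' tsupport f, ‖fderiv ℝ (fderiv ℝ g) y‖ ≤ max B 0 := fun y hy =>
    (hB (mem_image_of_mem _ hy)).trans (le_max_left _ _)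
  refine ⟨max A 0 * √(c⁻¹) + max B 0 * c⁻¹, by positivity, fun e he z hz v => ?_⟩
  have hN := Ω.normSq_nonneg he hz v
  by_cases hzs : e.symm z ∈ tsupport f
  · have hz' := hs hzs
    set z' := e₀ (e.symm z) with hz'def
    have hmem : z' ∈ e₀ '' tsupport f := mem_image_of_mem _ hzs
    set v' := fderiv ℂ (fun y => e₀ (e.symm y)) z v with hv'
    have hT := contDiffAt_transition he he₀ hz hz'
    have heq : (fun y => f (e.symm y)) =ᶠ[𝓝 z] fun y => g (e₀ (e.symm y)) := by
      filter_upwards [(e.symm.continuousAt hz).eventually (e₀.open_source.mem_nhds hz')] with y hy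
      simp [hg, e₀.left_inv hy]
    have h1 : fderiv ℝ (fun y => f (e.symm y)) z v = fderiv ℝ g z' v' := by
      have h2 := HasFDerivAt.comp (f := fun y => e₀ (e.symm y)) z
        ((hgC z' hmem).differentiableAt (by simp)).hasFDerivAt
        ((hT.differentiableAt (by simp)).hasFDerivAt.restrictScalars ℝ)
      have h3 : fderiv ℝ (fun y => g (e₀ (e.symm y))) z = _ := h2.fderiv
      rw [heq.fderiv_eq, h3]
      rfl
    have h2 : levi (fun y => f (e.symm y)) z v = levi g z' v' := by
      rw [heq.levi_eq, levi_comp (T := fun y => e₀ (e.symm y))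
        (contDiffAt_two_of_infty (hgC z' hmem)) (hT.of_le ENat.LEInfty.out)]
    have h3 : ‖v'‖ ^ 2 ≤ c⁻¹ * Ω.normSq e z v := by
      rw [Ω.normSq_transition he he₀ hz hz', inv_mul_eq_div, le_div_iff₀ hc0, mul_comm]
      exact (hc z' hmem v').1
    have h4 : ‖v'‖ ≤ √(c⁻¹) * √(Ω.normSq e z v) := by
      rw [← Real.sqrt_mul (by positivity)]
      exact Real.le_sqrt_of_sq_le h3
    rw [h1, h2]
    constructor
    · calc |fderiv ℝ g z' v'| ≤ ‖fderiv ℝ g z'‖ * ‖v'‖ := (fderiv ℝ g z').le_opNorm v'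
        _ ≤ max A 0 * (√(c⁻¹) * √(Ω.normSq e z v)) := by
          gcongr
          exact hA' z' hmem
        _ = (max A 0 * √(c⁻¹)) * √(Ω.normSq e z v) := by ring
        _ ≤ _ := by
          gcongr
          exact le_add_of_nonneg_right (by positivity)
    · calc |levi g z' v'| ≤ _ := abs_levi_le g z' v'
        _ ≤ max B 0 * (c⁻¹ * Ω.normSq e z v) := by
          gcongr
          exact hB' z' hmem
        _ = (max B 0 * c⁻¹) * Ω.normSq e z v := by ring
        _ ≤ _ := by
          gcongr
          exact le_add_of_nonneg_left (by positivity)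
  · have hev : (fun y => f (e.symm y)) =ᶠ[𝓝 z] fun _ => 0 := by
      filter_upwards [(e.symm.continuousAt hz).eventually
        ((isClosed_tsupport f).isOpen_compl.mem_nhds hzs)] with y hy
      exact image_eq_zero_of_notMem_tsupport hy
    rw [hev.fderiv_eq, hev.levi_eq, levi_const]
    simp only [fderiv_fun_const, Pi.zero_apply, zero_apply, abs_zero]
    constructor <;> positivity

/-- Chart-free form of the local regularization. -/
theorem KahlerForm.IsSubgeodesic.exists_regularization_near {Ω : KahlerForm n X}
    {u : ℝ → X → ℝ} (hu : Ω.IsSubgeodesic u) {C : ℝ} (hC : Ω.SliceLE u C) :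
    ∃ K₁ : ℝ, 0 ≤ K₁ ∧ ∀ e₀ ∈ atlas (Cn n) X, ∀ S : Set X, IsClosed S → S ⊆ e₀.source →
      ∀ σ : ℝ, 0 < σ → ∀ ε : ℝ, 0 < ε → ∃ P : X → ℂ → ℝ,
        (∀ x τ (s : ℝ), P x (τ + s * Complex.I) = P x τ) ∧
        (∀ e ∈ atlas (Cn n) X, ∀ z ∈ e.target, e.symm z ∈ e₀.source → ∀ τ,
          ContDiffAt ℝ ∞ (chartExpr P e) (z, τ)) ∧
        (∀ x ∈ S, ∀ τ : ℂ, σ ≤ τ.re → τ.re ≤ 1 - σ → |P x τ - u τ.re x| ≤ ε) ∧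
        ∀ e ∈ atlas (Cn n) X, ∀ z ∈ e.target, e.symm z ∈ S →
          ∀ τ : ℂ, σ ≤ τ.re → τ.re ≤ 1 - σ → ∀ V : Cn n × ℂ,
            -(1 + ε) * Ω.normSq e z V.1 ≤ levi (chartExpr P e) (z, τ) V ∧
            levi (chartExpr P e) (z, τ) V ≤ K₁ * Ω.prodNormSq e z V ∧
            levi (chartExpr P e) (z, τ) (V.1, 0) ≤ (C - 1 + ε) * Ω.normSq e z V.1 := by
  obtain ⟨K₁, hK₁, h⟩ := hu.exists_local_regularization hC
  refine ⟨K₁, hK₁, fun e₀ he₀ S hS hSe σ hσ ε hε => ?_⟩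
  obtain ⟨hK, hKe⟩ := isCompact_image_chart hS hSe
  obtain ⟨G, hG, hGi, hGb⟩ := h e₀ he₀ _ hK hKe σ hσ ε hε
  set P : X → ℂ → ℝ := fun x τ => G (e₀ x, τ) with hP
  have hPG : ∀ z ∈ e₀.target, ∀ τ, chartExpr P e₀ =ᶠ[𝓝 (z, τ)] G := by
    intro z hz τ
    have : ∀ᶠ p : Cn n × ℂ in 𝓝 (z, τ), p.1 ∈ e₀.target :=
      continuousAt_fst.eventually (e₀.open_target.mem_nhds hz)
    filter_upwards [this] with p hp
    simp [chartExpr, hP, e₀.right_inv hp]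
  have hPC : ∀ z ∈ e₀.target, ∀ τ, ContDiffAt ℝ ∞ (chartExpr P e₀) (z, τ) := fun z hz τ =>
    hG.contDiffAt.congr_of_eventuallyEq (hPG z hz τ)
  refine ⟨P, fun x τ s => hGi _ _ _, fun e he z hz hz' τ =>
    ContDiffAt.chartExpr_transition he he₀ hz hz' (hPC _ (e₀.map_source hz') τ),
    fun x hx τ h1 h2 => ?_, fun e he z hz hzS τ h1 h2 V => ?_⟩
  · have := (hGb (e₀ x) (mem_image_of_mem _ hx) τ h1 h2).1
    rwa [e₀.left_inv (hSe hx)] at this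
  · have hz' := hSe hzS
    have hz'' := e₀.map_source hz'
    have hl : ∀ V, levi (chartExpr P e) (z, τ) V
        = levi G (e₀ (e.symm z), τ) (transitionDeriv e e₀ z V) := fun V => by
      rw [levi_chartExpr he he₀ hz hz' (contDiffAt_two_of_infty (hPC _ hz'' τ)),
        (hPG _ hz'' τ).levi_eq]
    have h3 := (hGb _ (mem_image_of_mem _ hzS) τ h1 h2).2 (transitionDeriv e e₀ z V)
    rw [hl, hl, Ω.prodNormSq_transition he he₀ hz hz', Ω.normSq_transition he he₀ hz hz']
    exact h3

/-- Two local regularizations have almost the same derivative on the overlap of their domains, as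
soon as they are close enough to the same function. -/
theorem KahlerForm.exists_overlap_bound (Ω : KahlerForm n X) {e₁ e₂ : OpenPartialHomeomorph X (Cn n)}
    (he₁ : e₁ ∈ atlas (Cn n) X) {T₁ T₂ S₁ S₂ : Set X}
    (hT₁ : IsClosed T₁) (hT₂ : IsClosed T₂) (hTS₁ : T₁ ⊆ interior S₁) (hTS₂ : T₂ ⊆ interior S₂)
    (hS₁ : S₁ ⊆ e₁.source) (hS₂ : S₂ ⊆ e₂.source) {σ K δ : ℝ} (hσ : 0 < σ) (hK : 0 ≤ K)
    (hδ : 0 < δ) : ∃ η : ℝ, 0 < η ∧ ∀ (u : ℝ → X → ℝ) (P₁ P₂ : X → ℂ → ℝ),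
      (∀ e ∈ atlas (Cn n) X, ∀ z ∈ e.target, e.symm z ∈ e₁.source → ∀ τ,
          ContDiffAt ℝ ∞ (chartExpr P₁ e) (z, τ)) →
      (∀ e ∈ atlas (Cn n) X, ∀ z ∈ e.target, e.symm z ∈ e₂.source → ∀ τ,
          ContDiffAt ℝ ∞ (chartExpr P₂ e) (z, τ)) →
      (∀ x ∈ S₁, ∀ τ : ℂ, σ ≤ τ.re → τ.re ≤ 1 - σ → |P₁ x τ - u τ.re x| ≤ η) →
      (∀ x ∈ S₂, ∀ τ : ℂ, σ ≤ τ.re → τ.re ≤ 1 - σ → |P₂ x τ - u τ.re x| ≤ η) →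
      (∀ e ∈ atlas (Cn n) X, ∀ z ∈ e.target, e.symm z ∈ S₁ → ∀ τ : ℂ, σ ≤ τ.re → τ.re ≤ 1 - σ →
        ∀ V : Cn n × ℂ, |levi (chartExpr P₁ e) (z, τ) V| ≤ K * Ω.prodNormSq e z V) →
      (∀ e ∈ atlas (Cn n) X, ∀ z ∈ e.target, e.symm z ∈ S₂ → ∀ τ : ℂ, σ ≤ τ.re → τ.re ≤ 1 - σ →
        ∀ V : Cn n × ℂ, |levi (chartExpr P₂ e) (z, τ) V| ≤ K * Ω.prodNormSq e z V) →
      ∀ e ∈ atlas (Cn n) X, ∀ z ∈ e.target, e.symm z ∈ T₁ → e.symm z ∈ T₂ →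
        ∀ τ : ℂ, 2 * σ ≤ τ.re → τ.re ≤ 1 - 2 * σ → ∀ V : Cn n × ℂ,
          |fderiv ℝ (chartExpr (fun x τ => P₁ x τ - P₂ x τ) e) (z, τ) V|
            ≤ δ * √(Ω.prodNormSq e z V) := by
  have hTS : T₁ ⊆ S₁ := hTS₁.trans interior_subset
  obtain ⟨hY, hYe⟩ := isCompact_image_chart (e := e₁) (hT₁.inter hT₂)
    ((inter_subset_left.trans hTS).trans hS₁)
  set O : Set (Cn n) := e₁.target ∩ e₁.symm ⁻¹' (interior S₁ ∩ interior S₂) with hO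
  have hOo : IsOpen O := e₁.isOpen_inter_preimage_symm (isOpen_interior.inter isOpen_interior)
  have hYO : e₁ '' (T₁ ∩ T₂) ⊆ O := by
    rintro _ ⟨x, hx, rfl⟩
    have hxs := hS₁ (hTS hx.1)
    refine ⟨e₁.map_source hxs, ?_⟩
    simp only [mem_preimage, e₁.left_inv hxs]
    exact ⟨hTS₁ hx.1, hTS₂ hx.2⟩
  obtain ⟨d₀, hd₀, hd₀O⟩ := hY.exists_cthickening_subset_open hOo hYO
  have hZ : IsCompact (Metric.cthickening d₀ (e₁ '' (T₁ ∩ T₂))) := hY.cthickening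
  obtain ⟨c, hc0, hc⟩ := Ω.exists_normSq_bounds he₁ hZ (hd₀O.trans inter_subset_left)
  -- on vectors of norm at most one the Levi forms are bounded by `B`
  set B : ℝ := 2 * (K * (c⁻¹ + 1)) with hB
  have hB0 : 0 ≤ B := by positivity
  set A : ℝ := √(c⁻¹ + 1) with hA
  have hA0 : 0 < A := Real.sqrt_pos.2 (by positivity)
  have hπ := Real.pi_pos
  -- Discs of size `d` stay in the domain of the bounds. The interpolation inequality on them gives
  -- `2 * (2 * η) / d + 2 π B d`; the last bound in `d` and the choice `η = δ / A * d / 8` make both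
  -- terms at most `δ / A / 2`.
  set d : ℝ := min (min (d₀ / 2) (σ / 2)) (δ / (A * (4 * Real.pi * (B + 1)))) with hd
  have hd0 : 0 < d := by positivity
  have hdB : 2 * Real.pi * B * d ≤ δ / A / 2 := by
    have h1 : d ≤ δ / (A * (4 * Real.pi * (B + 1))) := min_le_right _ _
    rw [le_div_iff₀ (by positivity)] at h1
    rw [div_div, le_div_iff₀ (by positivity)]
    have : 0 ≤ d * (A * (4 * Real.pi)) := by positivity
    nlinarith
  refine ⟨δ / A * d / 8, by positivity, fun u P₁ P₂ hP₁ hP₂ hPu₁ hPu₂ hL₁ hL₂ => ?_⟩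
  set w : X → ℂ → ℝ := fun x τ => P₁ x τ - P₂ x τ with hw
  have hsub : chartExpr w e₁ = fun p => chartExpr P₁ e₁ p - chartExpr P₂ e₁ p := rfl
  have hO1 : ∀ z ∈ O, z ∈ e₁.target ∧ e₁.symm z ∈ S₁ ∧ e₁.symm z ∈ S₂ := fun z hz =>
    ⟨hz.1, interior_subset hz.2.1, interior_subset hz.2.2⟩
  have hwC : ∀ z ∈ O, ∀ τ, ContDiffAt ℝ ∞ (chartExpr w e₁) (z, τ) := fun z hz τ => by
    obtain ⟨h1, h2, h3⟩ := hO1 z hz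
    exact (hP₁ e₁ he₁ z h1 (hS₁ h2) τ).sub (hP₂ e₁ he₁ z h1 (hS₂ h3) τ)
  have key : ∀ z ∈ e₁ '' (T₁ ∩ T₂), ∀ τ : ℂ, 2 * σ ≤ τ.re → τ.re ≤ 1 - 2 * σ →
      ∀ V : Cn n × ℂ, ‖V‖ ≤ 1 → |fderiv ℝ (chartExpr w e₁) (z, τ) V| ≤ δ / A := by
    intro z hz τ hτ1 hτ2 V hV
    have hV1 : ‖V.1‖ ≤ 1 := (norm_fst_le V).trans hV
    have hV2 : ‖V.2‖ ≤ 1 := (norm_snd_le V).trans hV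
    have hζ : ∀ ζ : ℂ, |ζ.re| ≤ d → |ζ.im| ≤ d →
        z + ζ • V.1 ∈ Metric.cthickening d₀ (e₁ '' (T₁ ∩ T₂)) ∧
        σ ≤ (τ + ζ • V.2).re ∧ (τ + ζ • V.2).re ≤ 1 - σ := by
      intro ζ h1 h2
      have h3 : ‖ζ‖ ≤ 2 * d := by
        have := Complex.norm_le_abs_re_add_abs_im ζ
        linarith
      have h4 : ‖ζ‖ ≤ d₀ := h3.trans (by
        have : d ≤ d₀ / 2 := (min_le_left _ _).trans (min_le_left _ _)
        linarith)
      have h5 : ‖ζ‖ ≤ σ := h3.trans (by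
        have : d ≤ σ / 2 := (min_le_left _ _).trans (min_le_right _ _)
        linarith)
      refine ⟨Metric.mem_cthickening_of_dist_le _ z _ _ hz ?_, ?_⟩
      · rw [dist_eq_norm, add_sub_cancel_left, norm_smul]
        calc ‖ζ‖ * ‖V.1‖ ≤ d₀ * 1 := by gcongr
          _ = d₀ := mul_one _
      · have h6 : |(ζ • V.2).re| ≤ σ := by
          refine (Complex.abs_re_le_norm _).trans ?_
          rw [norm_smul]
          calc ‖ζ‖ * ‖V.2‖ ≤ σ * 1 := by gcongr
            _ = σ := mul_one _
        have h7 := abs_le.1 h6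
        rw [Complex.add_re]
        constructor <;> linarith
    have h1 := abs_fderiv_le_of_levi_bounded (w := chartExpr w e₁) (p := (z, τ)) (v := V)
      (d := d) (η := 2 * (δ / A * d / 8)) (K := B) hd0 (by positivity) hB0 ?_ ?_ ?_
    · have h2 : 2 * (2 * (δ / A * d / 8)) / d = δ / A / 2 := by field_simp; ring
      linarith
    · intro ζ h1 h2
      exact contDiffAt_two_of_infty (hwC _ (hd₀O (hζ ζ h1 h2).1) _)
    · intro ζ h1 h2
      obtain ⟨h3, h4, h5⟩ := hζ ζ h1 h2
      obtain ⟨h6, h7, h8⟩ := hO1 _ (hd₀O h3)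
      have a1 := abs_le.1 (hPu₁ _ h7 _ h4 h5)
      have a2 := abs_le.1 (hPu₂ _ h8 _ h4 h5)
      change |P₁ (e₁.symm (z + ζ • V.1)) (τ + ζ • V.2)
        - P₂ (e₁.symm (z + ζ • V.1)) (τ + ζ • V.2)| ≤ _
      rw [abs_le]
      constructor <;> linarith
    · intro ζ h1 h2
      obtain ⟨h3, h4, h5⟩ := hζ ζ h1 h2
      obtain ⟨h6, h7, h8⟩ := hO1 _ (hd₀O h3)
      have a1 := abs_le.1 (hL₁ e₁ he₁ _ h6 h7 _ h4 h5 V)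
      have a2 := abs_le.1 (hL₂ e₁ he₁ _ h6 h8 _ h4 h5 V)
      have a3 : Ω.prodNormSq e₁ (z + ζ • V.1) V ≤ c⁻¹ + 1 := by
        have b1 := (hc _ h3 V.1).2
        have b2 : Ω.normSq e₁ (z + ζ • V.1) V.1 ≤ c⁻¹ := by
          rw [← one_div, le_div_iff₀ hc0, mul_comm]
          exact b1.trans (pow_le_one₀ (norm_nonneg _) hV1)
        exact add_le_add b2 (pow_le_one₀ (norm_nonneg _) hV2)
      have a4 : K * Ω.prodNormSq e₁ (z + ζ • V.1) V ≤ K * (c⁻¹ + 1) := by gcongr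
      have a5 : levi (chartExpr w e₁) ((z, τ) + ζ • V) V
          = levi (chartExpr P₁ e₁) (z + ζ • V.1, τ + ζ • V.2) V
            - levi (chartExpr P₂ e₁) (z + ζ • V.1, τ + ζ • V.2) V := by
        rw [hsub]
        exact levi_sub (contDiffAt_two_of_infty (hP₁ e₁ he₁ _ h6 (hS₁ h7) _))
          (contDiffAt_two_of_infty (hP₂ e₁ he₁ _ h6 (hS₂ h8) _)) V
      rw [a5, abs_le, hB]
      constructor <;> linarith
  intro e he z hz hzT₁ hzT₂ τ hτ1 hτ2 V
  have hz' : e.symm z ∈ e₁.source := hS₁ (hTS hzT₁)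
  set y := e₁ (e.symm z) with hy
  have hyY : y ∈ e₁ '' (T₁ ∩ T₂) := mem_image_of_mem _ ⟨hzT₁, hzT₂⟩
  set W := transitionDeriv e e₁ z V with hW
  rw [Ω.prodNormSq_transition he he₁ hz hz', fderiv_chartExpr he he₁ hz hz'
    ((hwC y (hYO hyY) τ).differentiableAt (by simp))]
  have hWA : ‖W‖ ≤ A * √(Ω.prodNormSq e₁ y W) := by
    rw [hA, ← Real.sqrt_mul (by positivity)]
    refine Real.le_sqrt_of_sq_le ?_
    have b1 := (hc y (Metric.self_subset_cthickening _ hyY) W.1).1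
    have b2 : ‖W.1‖ ^ 2 ≤ c⁻¹ * Ω.normSq e₁ y W.1 := by
      rw [inv_mul_eq_div, le_div_iff₀ hc0, mul_comm]
      exact b1
    have b3 := Ω.normSq_nonneg he₁ (hYe hyY) W.1
    have b4 : 0 ≤ c⁻¹ := by positivity
    rw [KahlerForm.prodNormSq, Prod.norm_def]
    rcases max_cases ‖W.1‖ ‖W.2‖ with ⟨h, -⟩ | ⟨h, -⟩ <;> rw [h] <;>
      nlinarith [sq_nonneg ‖W.2‖, mul_nonneg b4 (sq_nonneg ‖W.2‖)]
  -- From vectors of norm at most one to all vectors, by homogeneity.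
  have hlin : |fderiv ℝ (chartExpr w e₁) (y, τ) W| ≤ δ / A * ‖W‖ := by
    by_cases hW0 : W = 0
    · simp [hW0]
    have hWp : 0 < ‖W‖ := norm_pos_iff.2 hW0
    have h1 := key y hyY τ hτ1 hτ2 (‖W‖⁻¹ • W) (by simp [norm_smul, hWp.ne'])
    rw [map_smul, smul_eq_mul, abs_mul, abs_of_pos (by positivity : 0 < ‖W‖⁻¹),
      inv_mul_eq_div, div_le_iff₀ hWp] at h1
    exact h1
  calc _ ≤ δ / A * ‖W‖ := hlin
    _ ≤ δ / A * (A * √(Ω.prodNormSq e₁ y W)) := by gcongr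
    _ = δ * √(Ω.prodNormSq e₁ y W) := by field_simp

end Bounds

/-! ### Gluing local regularizations -/

section Gluing

variable {n : ℕ} {X : Type*} [TopologicalSpace X] [ChartedSpace (Cn n) X]
  [IsManifold 𝓘(ℂ, Cn n) ∞ X] [CompactSpace X] [T2Space X]

theorem Finset.exists_pos_le {ι : Type*} (s : Finset ι) {f : ι → ℝ} (hf : ∀ i ∈ s, 0 < f i) :
    ∃ m : ℝ, 0 < m ∧ ∀ i ∈ s, m ≤ f i := by
  classical
  induction s using Finset.induction_on with
  | empty => exact ⟨1, one_pos, by simp⟩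
  | insert a s ha ih =>
    obtain ⟨m, hm, h⟩ := ih fun i hi => hf i (by simp [hi])
    refine ⟨min m (f a), lt_min hm (hf a (by simp)), fun i hi => ?_⟩
    rcases Finset.mem_insert.1 hi with rfl | hi
    · exact min_le_right _ _
    · exact (min_le_left _ _).trans (h i hi)

theorem contDiffAt_comp_fst {f : Cn n → ℝ} {z : Cn n} (hf : ContDiffAt ℝ ∞ f z) (τ : ℂ) :
    ContDiffAt ℝ ∞ (fun p : Cn n × ℂ => f p.1) (z, τ) :=
  ContDiffAt.comp (f := Prod.fst) (z, τ) hf contDiffAt_fst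

theorem fderiv_comp_fst {f : Cn n → ℝ} {z : Cn n} (hf : ContDiffAt ℝ ∞ f z) (τ : ℂ)
    (V : Cn n × ℂ) : fderiv ℝ (fun p : Cn n × ℂ => f p.1) (z, τ) V = fderiv ℝ f z V.1 := by
  have h := HasFDerivAt.comp (f := Prod.fst) (g := f) (z, τ)
    (hf.differentiableAt (by simp)).hasFDerivAt hasFDerivAt_fst
  have h' : fderiv ℝ (fun p : Cn n × ℂ => f p.1) (z, τ) = _ := h.fderiv
  rw [h']
  rfl

theorem levi_comp_fst {f : Cn n → ℝ} {z : Cn n} (hf : ContDiffAt ℝ ∞ f z) (τ : ℂ)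
    (V : Cn n × ℂ) : levi (fun p : Cn n × ℂ => f p.1) (z, τ) V = levi f z V.1 := by
  rw [levi_comp (T := (Prod.fst : Cn n × ℂ → Cn n)) (contDiffAt_two_of_infty hf) contDiffAt_fst]
  congr 1
  have : fderiv ℂ (Prod.fst : Cn n × ℂ → Cn n) (z, τ) = _ :=
    (hasFDerivAt_fst (𝕜 := ℂ) (E := Cn n) (F := ℂ) (p := (z, τ))).fderiv
  rw [this]
  rfl

/-- Regularization of subgeodesics: local mollifications are glued by a partition of unity. The
gluing errors are products of derivatives of the partition functions with differences of local
mollifications or of their first derivatives, and these differences are small. -/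
theorem KahlerForm.IsSubgeodesic.exists_smooth_approx {Ω : KahlerForm n X}
    {u : ℝ → X → ℝ} (hu : Ω.IsSubgeodesic u) {C : ℝ} (hC : Ω.SliceLE u C) :
    ∃ K₂ : ℝ, 0 ≤ K₂ ∧ ∀ σ : ℝ, 0 < σ → ∀ ε : ℝ, 0 < ε → ε ≤ 1 → ∃ Φ : ℝ → X → ℝ,
      (∀ e ∈ atlas (Cn n) X, ∀ z ∈ e.target, ∀ τ : ℂ,
          ContDiffAt ℝ ∞ (chartExpr (fun x τ => Φ τ.re x) e) (z, τ)) ∧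
      (∀ x t, σ ≤ t → t ≤ 1 - σ → |Φ t x - u t x| ≤ ε) ∧
      ∀ e ∈ atlas (Cn n) X, ∀ z ∈ e.target, ∀ τ : ℂ, σ ≤ τ.re → τ.re ≤ 1 - σ →
        ∀ V : Cn n × ℂ,
          -(Ω.normSq e z V.1 + ε * Ω.prodNormSq e z V)
              ≤ levi (chartExpr (fun x τ => Φ τ.re x) e) (z, τ) V ∧
          levi (chartExpr (fun x τ => Φ τ.re x) e) (z, τ) V ≤ K₂ * Ω.prodNormSq e z V ∧
          levi (chartExpr (fun x τ => Φ τ.re x) e) (z, τ) (V.1, 0)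
            ≤ (C - 1 + ε) * Ω.normSq e z V.1 := by
  classical
  obtain ⟨K₁, hK₁, hreg⟩ := hu.exists_regularization_near hC
  refine ⟨K₁ + 1, by positivity, fun σ hσ ε hε hε1 => ?_⟩
  obtain ⟨S, ρ, hρC, hρ0, hρ1, hρs⟩ := exists_chart_partition n X
  have hat : ∀ c : X, chartAt (Cn n) c ∈ atlas (Cn n) X := fun c => chart_mem_atlas _ c
  choose S' hS'c hS'1 hS'2 using fun c => exists_compact_between (isClosed_tsupport (ρ c)).isCompact
    (chartAt (Cn n) c).open_source (hρs c)
  choose M hM0 hM using fun c => Ω.exists_derivative_bounds (hρC c) (hat c) (hρs c)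
  set Mt : ℝ := ∑ c ∈ S, M c with hMt
  have hMt0 : 0 ≤ Mt := Finset.sum_nonneg fun c _ => hM0 c
  have hσ2 : 0 < σ / 2 := half_pos hσ
  -- The gluing errors sum up to at most `4 * δ * Mt ≤ ε / 2`.
  set δ : ℝ := ε / (8 * (Mt + 1)) with hδ
  have hδ0 : 0 < δ := by positivity
  set K := max K₁ 2 with hK
  have hK0 : 0 ≤ K := hK₁.trans (le_max_left _ _)
  choose η hη0 hη using fun c c' : X => Ω.exists_overlap_bound (hat c)
    (isClosed_tsupport (ρ c)) (isClosed_tsupport (ρ c')) (hS'1 c) (hS'1 c') (hS'2 c) (hS'2 c')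
    hσ2 hK0 hδ0
  obtain ⟨m, hm0, hm⟩ := Finset.exists_pos_le (S ×ˢ S) (f := fun q => η q.1 q.2)
    fun q _ => hη0 q.1 q.2
  set ε₁ : ℝ := min m (min (ε / 2) δ) with hε₁
  have hε₁0 : 0 < ε₁ := lt_min hm0 (lt_min (half_pos hε) hδ0)
  have hε₁m : ε₁ ≤ m := min_le_left _ _
  have hε₁ε : ε₁ ≤ ε / 2 := (min_le_right _ _).trans (min_le_left _ _)
  have hε₁δ : ε₁ ≤ δ := (min_le_right _ _).trans (min_le_right _ _)
  choose P hPi hPC hPu hPb using fun c => hreg _ (hat c) (S' c) (hS'c c).isClosed (hS'2 c) _ hσ2 _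
    hε₁0
  -- absolute bounds for the Levi forms of the local regularizations
  have hPabs : ∀ c, ∀ e ∈ atlas (Cn n) X, ∀ z ∈ e.target, e.symm z ∈ S' c → ∀ τ : ℂ,
      σ / 2 ≤ τ.re → τ.re ≤ 1 - σ / 2 → ∀ V : Cn n × ℂ,
        |levi (chartExpr (P c) e) (z, τ) V| ≤ K * Ω.prodNormSq e z V := by
    intro c e he z hz hzS τ h1 h2 V
    obtain ⟨b1, b2, -⟩ := hPb c e he z hz hzS τ h1 h2 V
    have b3 := Ω.prodNormSq_nonneg he hz V
    have b4 := Ω.normSq_le_prodNormSq (e := e) z V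
    have b5 := Ω.normSq_nonneg he hz V.1
    rw [abs_le]
    constructor
    · have : (2 : ℝ) ≤ K := le_max_right _ _
      nlinarith
    · refine b2.trans ?_
      gcongr
      exact le_max_left _ _
  set Φ : ℝ → X → ℝ := fun t x => ∑ c ∈ S, ρ c x * P c x t with hΦ
  -- The local regularizations are invariant under imaginary translations, hence are functions of
  -- `x` and `re τ`.
  have hPre : ∀ c x (τ : ℂ), P c x τ.re = P c x τ := by
    intro c x τ
    have := hPi c x (τ.re : ℂ) τ.im
    rw [Complex.re_add_im] at this
    exact this.symm
  -- near a point, the approximation is a perturbation of one local regularization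
  have hlocal : ∀ e ∈ atlas (Cn n) X, ∀ z ∈ e.target, ∀ τ : ℂ, ∃ I ⊆ S, ∃ l ∈ I,
      (∀ c ∈ I, e.symm z ∈ tsupport (ρ c)) ∧ (∑ c ∈ I, ρ c (e.symm z) = 1) ∧
      chartExpr (fun x τ => Φ τ.re x) e =ᶠ[𝓝 (z, τ)] fun p => chartExpr (P l) e p
        + ∑ c ∈ I, ρ c (e.symm p.1) * chartExpr (fun x τ => P c x τ - P l x τ) e p := by
    intro e he z hz τ
    set I := S.filter fun c => e.symm z ∈ tsupport (ρ c) with hI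
    have hIS : I ⊆ S := Finset.filter_subset _ _
    have hev : ∀ᶠ p : Cn n × ℂ in 𝓝 (z, τ), ∀ c ∈ S \ I, ρ c (e.symm p.1) = 0 := by
      rw [eventually_all_finset]
      intro c hc
      simp only [hI, Finset.mem_sdiff, Finset.mem_filter, not_and] at hc
      have h1 : (tsupport (ρ c))ᶜ ∈ 𝓝 (e.symm z) :=
        (isClosed_tsupport _).isOpen_compl.mem_nhds (hc.2 hc.1)
      have h2 : ContinuousAt (fun p : Cn n × ℂ => e.symm p.1) (z, τ) :=
        ContinuousAt.comp (g := e.symm) (f := Prod.fst) (x := (z, τ)) (e.symm.continuousAt hz)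
          continuousAt_fst
      filter_upwards [h2.eventually h1] with p hp
      exact image_eq_zero_of_notMem_tsupport hp
    have hsum : ∀ p : Cn n × ℂ, (∀ c ∈ S \ I, ρ c (e.symm p.1) = 0) →
        ∑ c ∈ I, ρ c (e.symm p.1) = 1 := fun p hp => by
      rw [← hρ1 (e.symm p.1), ← Finset.sum_subset hIS]
      exact fun c h1 h2 => hp c (Finset.mem_sdiff.2 ⟨h1, h2⟩)
    have h1 := hsum (z, τ) hev.self_of_nhds
    obtain ⟨l, hl⟩ : I.Nonempty := by
      by_contra h
      rw [Finset.not_nonempty_iff_eq_empty] at h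
      rw [h] at h1
      simp at h1
    refine ⟨I, hIS, l, hl, fun c hc => (Finset.mem_filter.1 hc).2, h1, ?_⟩
    filter_upwards [hev] with p hp
    have h2 : Φ p.2.re (e.symm p.1) = ∑ c ∈ I, ρ c (e.symm p.1) * P c (e.symm p.1) p.2 := by
      simp only [hΦ, hPre]
      rw [← Finset.sum_subset hIS]
      intro c h1 h2
      rw [hp c (Finset.mem_sdiff.2 ⟨h1, h2⟩), zero_mul]
    simp only [chartExpr, mul_sub, Finset.sum_sub_distrib, ← Finset.sum_mul, hsum p hp, h2]
    ring
  have hts : ∀ c, tsupport (ρ c) ⊆ S' c := fun c => (hS'1 c).trans interior_subset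
  refine ⟨Φ, fun e he z hz τ => ?_, fun x t h1 h2 => ?_, fun e he z hz τ hτ1 hτ2 => ?_⟩
  · obtain ⟨I, hIS, l, hl, hI, -, hev⟩ := hlocal e he z hz τ
    refine ContDiffAt.congr_of_eventuallyEq ?_ hev
    have hPCI : ∀ c ∈ I, ContDiffAt ℝ ∞ (chartExpr (P c) e) (z, τ) := fun c hc =>
      hPC c e he z hz (hρs c (hI c hc)) τ
    exact (hPCI l hl).add (ContDiffAt.sum fun c hc =>
      (contDiffAt_comp_fst ((hρC c).contDiffAt_chart he hz) τ).mul
        ((hPCI c hc).sub (hPCI l hl)))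
  · have h3 : Φ t x - u t x = ∑ c ∈ S, ρ c x * (P c x t - u t x) := by
      simp only [hΦ, mul_sub, Finset.sum_sub_distrib, ← Finset.sum_mul, hρ1 x, one_mul]
    rw [h3]
    calc |∑ c ∈ S, ρ c x * (P c x t - u t x)| ≤ ∑ c ∈ S, |ρ c x * (P c x t - u t x)| :=
          Finset.abs_sum_le_sum_abs _ _
      _ ≤ ∑ c ∈ S, ρ c x * ε₁ := by
          refine Finset.sum_le_sum fun c _ => ?_
          rw [abs_mul, abs_of_nonneg (hρ0 c x)]
          by_cases hx : ρ c x = 0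
          · simp [hx]
          · refine mul_le_mul_of_nonneg_left ?_ (hρ0 c x)
            have := hPu c x (hts c (subset_tsupport _ hx)) (t : ℂ) (by simp; linarith)
              (by simp; linarith)
            simpa using this
      _ = ε₁ := by rw [← Finset.sum_mul, hρ1, one_mul]
      _ ≤ ε := by linarith
  obtain ⟨I, hIS, l, hl, hI, hI1, hev⟩ := hlocal e he z hz τ
  have hPCI : ∀ c ∈ I, ContDiffAt ℝ ∞ (chartExpr (P c) e) (z, τ) := fun c hc =>
    hPC c e he z hz (hρs c (hI c hc)) τ
  set F : X → Cn n × ℂ → ℝ := fun c => chartExpr (fun x τ => P c x τ - P l x τ) e with hF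
  have hFC : ∀ c ∈ I, ContDiffAt ℝ ∞ (F c) (z, τ) := fun c hc => (hPCI c hc).sub (hPCI l hl)
  set r : X → Cn n → ℝ := fun c y => ρ c (e.symm y) with hr
  have hrC : ∀ c, ContDiffAt ℝ ∞ (r c) z := fun c => (hρC c).contDiffAt_chart he hz
  -- the error term contributed by one chart
  set E : X → Cn n × ℂ → ℝ := fun c V => F c (z, τ) * levi (r c) z V.1
    + (fderiv ℝ (r c) z V.1 * fderiv ℝ (F c) (z, τ) V
      + fderiv ℝ (r c) z (Complex.I • V.1) * fderiv ℝ (F c) (z, τ) (Complex.I • V))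
        / (2 * Real.pi) with hE
  -- The Levi form is a convex combination of those of the local regularizations plus the errors.
  have hlevi : ∀ V, levi (chartExpr (fun x τ => Φ τ.re x) e) (z, τ) V
      = ∑ c ∈ I, ρ c (e.symm z) * levi (chartExpr (P c) e) (z, τ) V + ∑ c ∈ I, E c V := by
    intro V
    have a1 : ∀ c ∈ I, ContDiffAt ℝ 2 (fun p : Cn n × ℂ => r c p.1 * F c p) (z, τ) := fun c hc =>
      contDiffAt_two_of_infty ((contDiffAt_comp_fst (hrC c) τ).mul (hFC c hc))
    have a2 : ∀ c ∈ I, levi (fun p : Cn n × ℂ => r c p.1 * F c p) (z, τ) V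
        = ρ c (e.symm z) * levi (chartExpr (P c) e) (z, τ) V
          - ρ c (e.symm z) * levi (chartExpr (P l) e) (z, τ) V + E c V := by
      intro c hc
      rw [levi_mul (contDiffAt_two_of_infty (contDiffAt_comp_fst (hrC c) τ))
        (contDiffAt_two_of_infty (hFC c hc)), levi_comp_fst (hrC c), fderiv_comp_fst (hrC c),
        fderiv_comp_fst (hrC c)]
      have a3 : levi (F c) (z, τ) V = levi (chartExpr (P c) e) (z, τ) V
          - levi (chartExpr (P l) e) (z, τ) V :=
        levi_sub (contDiffAt_two_of_infty (hPCI c hc)) (contDiffAt_two_of_infty (hPCI l hl)) V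
      rw [a3]
      simp only [hE, hr, Prod.smul_fst]
      ring
    rw [hev.levi_eq]
    have a4 := levi_add (f := chartExpr (P l) e)
      (g := fun p => ∑ c ∈ I, r c p.1 * F c p) (p := (z, τ)) (contDiffAt_two_of_infty (hPCI l hl))
      (ContDiffAt.sum a1) V
    refine a4.trans ?_
    rw [levi_sum I a1, Finset.sum_congr rfl a2, Finset.sum_add_distrib, Finset.sum_sub_distrib,
      ← Finset.sum_mul, hI1]
    ring
  have hEb : ∀ V, |∑ c ∈ I, E c V| ≤ ε / 2 * Ω.prodNormSq e z V := by
    intro V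
    have hN' := Ω.prodNormSq_nonneg he hz V
    have hNN' := Ω.normSq_le_prodNormSq (e := e) z V
    have b : ∀ c ∈ I, |E c V| ≤ M c * (4 * δ) * Ω.prodNormSq e z V := by
      intro c hc
      have b1 : |F c (z, τ)| ≤ 2 * δ := by
        have c1 := abs_le.1 (hPu c _ (hts c (hI c hc)) τ (by linarith) (by linarith))
        have c2 := abs_le.1 (hPu l _ (hts l (hI l hl)) τ (by linarith) (by linarith))
        change |P c (e.symm z) τ - P l (e.symm z) τ| ≤ _
        rw [abs_le]
        constructor <;> linarith
      have b2 : ∀ W, |fderiv ℝ (F c) (z, τ) W| ≤ δ * √(Ω.prodNormSq e z W) := fun W => by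
        have hmη : ε₁ ≤ η c l :=
          hε₁m.trans (hm (c, l) (Finset.mem_product.2 ⟨hIS hc, hIS hl⟩))
        exact hη c l u (P c) (P l) (hPC c) (hPC l)
          (fun x hx τ h1 h2 => (hPu c x hx τ h1 h2).trans hmη)
          (fun x hx τ h1 h2 => (hPu l x hx τ h1 h2).trans hmη) (hPabs c) (hPabs l) e he z hz
          (hI c hc) (hI l hl) τ (by linarith) (by linarith) W
      have b3 : ∀ v, |fderiv ℝ (r c) z v| ≤ M c * √(Ω.normSq e z v) := fun v =>
        (hM c e he z hz v).1
      have b4 := (hM c e he z hz V.1).2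
      have hs : √(Ω.normSq e z V.1) ≤ √(Ω.prodNormSq e z V) := Real.sqrt_le_sqrt hNN'
      have b5 : |fderiv ℝ (r c) z V.1 * fderiv ℝ (F c) (z, τ) V|
          ≤ M c * δ * Ω.prodNormSq e z V := by
        rw [abs_mul]
        calc _ ≤ (M c * √(Ω.prodNormSq e z V)) * (δ * √(Ω.prodNormSq e z V)) :=
              mul_le_mul ((b3 _).trans (mul_le_mul_of_nonneg_left hs (hM0 c))) (b2 V)
                (abs_nonneg _) (mul_nonneg (hM0 c) (Real.sqrt_nonneg _))
          _ = M c * δ * (√(Ω.prodNormSq e z V) * √(Ω.prodNormSq e z V)) := by ring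
          _ = _ := by rw [Real.mul_self_sqrt hN']
      have b6 : |fderiv ℝ (r c) z (Complex.I • V.1) * fderiv ℝ (F c) (z, τ) (Complex.I • V)|
          ≤ M c * δ * Ω.prodNormSq e z V := by
        rw [abs_mul]
        have c1 := b3 (Complex.I • V.1)
        have c2 := b2 (Complex.I • V)
        rw [Ω.normSq_I_smul] at c1
        rw [Ω.prodNormSq_I_smul] at c2
        calc _ ≤ (M c * √(Ω.prodNormSq e z V)) * (δ * √(Ω.prodNormSq e z V)) :=
              mul_le_mul (c1.trans (mul_le_mul_of_nonneg_left hs (hM0 c))) c2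
                (abs_nonneg _) (mul_nonneg (hM0 c) (Real.sqrt_nonneg _))
          _ = M c * δ * (√(Ω.prodNormSq e z V) * √(Ω.prodNormSq e z V)) := by ring
          _ = _ := by rw [Real.mul_self_sqrt hN']
      have b7 : |F c (z, τ) * levi (r c) z V.1| ≤ 2 * δ * (M c * Ω.prodNormSq e z V) := by
        rw [abs_mul]
        exact mul_le_mul b1 (b4.trans (mul_le_mul_of_nonneg_left hNN' (hM0 c))) (abs_nonneg _)
          (by positivity)
      have b8 : |(fderiv ℝ (r c) z V.1 * fderiv ℝ (F c) (z, τ) V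
          + fderiv ℝ (r c) z (Complex.I • V.1) * fderiv ℝ (F c) (z, τ) (Complex.I • V))
            / (2 * Real.pi)| ≤ 2 * (M c * δ * Ω.prodNormSq e z V) := by
        rw [abs_div, abs_of_pos (by positivity : 0 < 2 * Real.pi), div_le_iff₀ (by positivity)]
        have c0 : 0 ≤ M c * δ * Ω.prodNormSq e z V :=
          mul_nonneg (mul_nonneg (hM0 c) hδ0.le) hN'
        have c1 := Real.pi_gt_three
        calc _ ≤ _ := abs_add_le _ _
          _ ≤ 2 * (M c * δ * Ω.prodNormSq e z V) := by linarith
          _ ≤ _ := by nlinarith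
      calc |E c V| ≤ _ := abs_add_le _ _
        _ ≤ 2 * δ * (M c * Ω.prodNormSq e z V) + 2 * (M c * δ * Ω.prodNormSq e z V) :=
          add_le_add b7 b8
        _ = _ := by ring
    calc |∑ c ∈ I, E c V| ≤ ∑ c ∈ I, |E c V| := Finset.abs_sum_le_sum_abs _ _
      _ ≤ ∑ c ∈ I, M c * (4 * δ) * Ω.prodNormSq e z V := Finset.sum_le_sum b
      _ = (∑ c ∈ I, M c) * (4 * δ) * Ω.prodNormSq e z V := by simp only [Finset.sum_mul]
      _ ≤ Mt * (4 * δ) * Ω.prodNormSq e z V := by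
        gcongr
        exact Finset.sum_le_sum_of_subset_of_nonneg hIS fun c _ _ => hM0 c
      _ ≤ _ := by
        gcongr
        rw [hδ, mul_div_assoc', mul_div_assoc', div_le_div_iff₀ (by positivity) (by positivity)]
        nlinarith
  have hρz : ∀ c, 0 ≤ ρ c (e.symm z) := fun c => hρ0 c _
  intro V
  have hb := fun c (hc : c ∈ I) => hPb c e he z hz (hts c (hI c hc)) τ (by linarith) (by linarith) V
  have hN := Ω.normSq_nonneg he hz V.1
  have hNN' := Ω.normSq_le_prodNormSq (e := e) z V
  have hEV := abs_le.1 (hEb V)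
  have hEV0 := abs_le.1 (hEb (V.1, 0))
  have hV0 : Ω.prodNormSq e z (V.1, 0) = Ω.normSq e z V.1 := by
    simp [KahlerForm.prodNormSq]
  rw [hV0] at hEV0
  refine ⟨?_, ?_, ?_⟩
  · rw [hlevi]
    have h1 : -(1 + ε₁) * Ω.normSq e z V.1
        ≤ ∑ c ∈ I, ρ c (e.symm z) * levi (chartExpr (P c) e) (z, τ) V := by
      calc _ = ∑ c ∈ I, ρ c (e.symm z) * (-(1 + ε₁) * Ω.normSq e z V.1) := by
            rw [← Finset.sum_mul, hI1, one_mul]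
        _ ≤ _ := Finset.sum_le_sum fun c hc => mul_le_mul_of_nonneg_left (hb c hc).1 (hρz c)
    nlinarith
  · rw [hlevi]
    have h1 : ∑ c ∈ I, ρ c (e.symm z) * levi (chartExpr (P c) e) (z, τ) V
        ≤ K₁ * Ω.prodNormSq e z V := by
      calc _ ≤ ∑ c ∈ I, ρ c (e.symm z) * (K₁ * Ω.prodNormSq e z V) :=
            Finset.sum_le_sum fun c hc => mul_le_mul_of_nonneg_left (hb c hc).2.1 (hρz c)
        _ = _ := by rw [← Finset.sum_mul, hI1, one_mul]
    nlinarith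
  · rw [hlevi]
    have h1 : ∑ c ∈ I, ρ c (e.symm z) * levi (chartExpr (P c) e) (z, τ) (V.1, 0)
        ≤ (C - 1 + ε₁) * Ω.normSq e z V.1 := by
      calc _ ≤ ∑ c ∈ I, ρ c (e.symm z) * ((C - 1 + ε₁) * Ω.normSq e z V.1) :=
            Finset.sum_le_sum fun c hc => mul_le_mul_of_nonneg_left (hb c hc).2.2 (hρz c)
        _ = _ := by rw [← Finset.sum_mul, hI1, one_mul]
    nlinarith

end Gluing

/-! ### Regularization by curves of Kähler potentials -/

section Curves

theorem fderiv_fderiv_comp_affine {E F : Type*} [NormedAddCommGroup E] [NormedSpace ℝ E]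
    [NormedAddCommGroup F] [NormedSpace ℝ F] {f : F → ℝ} (ℓ : E →L[ℝ] F) (c : F) {q : E}
    (hf : ContDiffAt ℝ 2 f (ℓ q + c)) (v w : E) :
    fderiv ℝ (fderiv ℝ fun q => f (ℓ q + c)) q v w = fderiv ℝ (fderiv ℝ f) (ℓ q + c) (ℓ v) (ℓ w) := by
  have hT : ∀ q, HasFDerivAt (fun q => ℓ q + c) ℓ q := fun q => ℓ.hasFDerivAt.add_const c
  have h1 : fderiv ℝ (fun q => f (ℓ q + c)) =ᶠ[𝓝 q] fun q => (fderiv ℝ f (ℓ q + c)).comp ℓ := by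
    filter_upwards [(hT q).continuousAt.eventually hf.eventually_differentiableAt] with y hy
    exact (hy.hasFDerivAt.comp y (hT y)).fderiv
  have h2 : HasFDerivAt (fun q => fderiv ℝ f (ℓ q + c))
      ((fderiv ℝ (fderiv ℝ f) (ℓ q + c)).comp ℓ) q :=
    hf.differentiableAt_fderiv.hasFDerivAt.comp q (hT q)
  rw [h1.fderiv_eq, (h2.clm_comp (hasFDerivAt_const ℓ q)).fderiv]
  simp

variable {n : ℕ} {X : Type*} [TopologicalSpace X] [ChartedSpace (Cn n) X]

/-- The chart expression of a curve of functions. -/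
def curveExpr (Φ : ℝ → X → ℝ) (e : OpenPartialHomeomorph X (Cn n)) : ℝ × Cn n → ℝ :=
  fun p => Φ p.1 (e.symm p.2)

variable {Φ : ℝ → X → ℝ} {e : OpenPartialHomeomorph X (Cn n)}

theorem deriv_deriv_curve {z : Cn n} {t : ℝ} (h : ContDiffAt ℝ 2 (curveExpr Φ e) (t, z)) :
    deriv (deriv fun s => Φ s (e.symm z)) t
      = fderiv ℝ (fderiv ℝ (curveExpr Φ e)) (t, z) (1, 0) (1, 0) := by
  have h1 := deriv_deriv_line (f := curveExpr Φ e) (p := (0, z)) (v := (1, 0)) (t := t)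
    (by simpa using h)
  simpa [curveExpr] using h1

theorem hasDerivAt_curve {z : Cn n} {t : ℝ} (h : DifferentiableAt ℝ (curveExpr Φ e) (t, z)) :
    HasDerivAt (fun s => Φ s (e.symm z)) (fderiv ℝ (curveExpr Φ e) (t, z) (1, 0)) t := by
  have h1 : HasDerivAt (fun s : ℝ => (s, z)) ((1 : ℝ), (0 : Cn n)) t :=
    (hasDerivAt_id t).prodMk (hasDerivAt_const t z)
  exact HasFDerivAt.comp_hasDerivAt (l := curveExpr Φ e) (f := fun s : ℝ => (s, z)) t
    h.hasFDerivAt h1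

theorem fderiv_deriv_curve {z : Cn n} {t : ℝ} (h : ContDiffAt ℝ 2 (curveExpr Φ e) (t, z))
    (v : Cn n) : fderiv ℝ (fun y => deriv (fun s => Φ s (e.symm y)) t) z v
      = fderiv ℝ (fderiv ℝ (curveExpr Φ e)) (t, z) (0, v) (1, 0) := by
  have hι : ∀ y, HasFDerivAt (fun y : Cn n => (t, y)) (ContinuousLinearMap.inr ℝ ℝ (Cn n)) y :=
    fun y => (hasFDerivAt_const t y).prodMk (hasFDerivAt_id y)
  have h1 : (fun y => deriv (fun s => Φ s (e.symm y)) t) =ᶠ[𝓝 z]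
      fun y => fderiv ℝ (curveExpr Φ e) (t, y) (1, 0) := by
    filter_upwards [(hι z).continuousAt.eventually h.eventually_differentiableAt] with y hy
    exact (hasDerivAt_curve hy).deriv
  have h2 : HasFDerivAt (fun y => fderiv ℝ (curveExpr Φ e) (t, y))
      ((fderiv ℝ (fderiv ℝ (curveExpr Φ e)) (t, z)).comp (ContinuousLinearMap.inr ℝ ℝ (Cn n))) z :=
    HasFDerivAt.comp (f := fun y : Cn n => (t, y)) z h.differentiableAt_fderiv.hasFDerivAt (hι z)
  rw [h1.fderiv_eq, (h2.clm_apply (hasFDerivAt_const ((1 : ℝ), (0 : Cn n)) z)).fderiv]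
  simp

theorem levi_slice {z : Cn n} {t : ℝ} (h : ContDiffAt ℝ 2 (curveExpr Φ e) (t, z)) (v : Cn n) :
    levi (fun y => Φ t (e.symm y)) z v
      = (fderiv ℝ (fderiv ℝ (curveExpr Φ e)) (t, z) (0, v) (0, v)
        + fderiv ℝ (fderiv ℝ (curveExpr Φ e)) (t, z) (0, Complex.I • v) (0, Complex.I • v))
          / (4 * Real.pi) := by
  have h1 := fderiv_fderiv_comp_affine (f := curveExpr Φ e) (ContinuousLinearMap.inr ℝ ℝ (Cn n))
    (t, 0) (q := z) (by simpa using h)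
  have h2 : (fun q => curveExpr Φ e ((ContinuousLinearMap.inr ℝ ℝ (Cn n)) q + (t, 0)))
      = fun y => Φ t (e.symm y) := by
    ext y; simp [curveExpr]
  rw [h2] at h1
  rw [levi_eq, h1, h1]
  simp

theorem contDiffAt_curveExpr_of_chartExpr {z : Cn n} {t : ℝ}
    (h : ContDiffAt ℝ ∞ (chartExpr (fun x τ => Φ τ.re x) e) (z, (t : ℂ))) :
    ContDiffAt ℝ ∞ (curveExpr Φ e) (t, z) := by
  have h1 : ContDiffAt ℝ ∞ (fun p : ℝ × Cn n => (p.2, (p.1 : ℂ))) (t, z) :=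
    contDiffAt_snd.prodMk (Complex.ofRealCLM.contDiff.contDiffAt.comp _ contDiffAt_fst)
  exact ContDiffAt.comp (f := fun p : ℝ × Cn n => (p.2, (p.1 : ℂ))) (t, z) h h1

/-- The Levi form on `X × ℂ` of a function of `x` and `Re τ`. -/
theorem levi_chartExpr_curve {z : Cn n} {t : ℝ} (h : ContDiffAt ℝ 2 (curveExpr Φ e) (t, z))
    (v : Cn n) (a : ℝ) : levi (chartExpr (fun x τ => Φ τ.re x) e) (z, (t : ℂ)) (v, (a : ℂ))
      = levi (fun y => Φ t (e.symm y)) z v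
        + a / (2 * Real.pi) * fderiv ℝ (fun y => deriv (fun s => Φ s (e.symm y)) t) z v
        + a ^ 2 / (4 * Real.pi) * deriv (deriv fun s => Φ s (e.symm z)) t := by
  set ℓ : Cn n × ℂ →L[ℝ] ℝ × Cn n :=
    (Complex.reCLM.comp (ContinuousLinearMap.snd ℝ (Cn n) ℂ)).prod
      (ContinuousLinearMap.fst ℝ (Cn n) ℂ) with hℓ
  have hℓa : ∀ p, ℓ p = (p.2.re, p.1) := fun p => rfl
  have h1 := fderiv_fderiv_comp_affine (f := curveExpr Φ e) ℓ 0 (q := (z, (t : ℂ)))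
    (by simpa [hℓa] using h)
  have h2 : (fun q => curveExpr Φ e (ℓ q + 0)) = chartExpr (fun x τ => Φ τ.re x) e := by
    ext p; simp [curveExpr, chartExpr, hℓa]
  rw [h2] at h1
  have h3 : ℓ (z, (t : ℂ)) + 0 = (t, z) := by simp [hℓa]
  rw [h3] at h1
  have hsymm : IsSymmSndFDerivAt ℝ (curveExpr Φ e) (t, z) := h.isSymmSndFDerivAt (by simp)
  -- Multiplication by `I` turns `(v, a)` into `(I v, I a)`, whose time component has real part zero.
  have h4 : levi (chartExpr (fun x τ => Φ τ.re x) e) (z, (t : ℂ)) (v, (a : ℂ))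
      = (fderiv ℝ (fderiv ℝ (curveExpr Φ e)) (t, z) (a, v) (a, v)
        + fderiv ℝ (fderiv ℝ (curveExpr Φ e)) (t, z) (0, Complex.I • v) (0, Complex.I • v))
          / (4 * Real.pi) := by
    rw [levi_eq]
    have h5 := h1 (v, (a : ℂ)) (v, (a : ℂ))
    have h6 := h1 (Complex.I • (v, (a : ℂ))) (Complex.I • (v, (a : ℂ)))
    simp only [hℓa, Complex.ofReal_re] at h5
    simp only [hℓa, Prod.smul_fst, Prod.smul_snd, smul_eq_mul, Complex.mul_re, Complex.I_re,
      Complex.I_im, Complex.ofReal_im, zero_mul, mul_zero, sub_zero] at h6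
    exact congrArg₂ (fun x y => (x + y) / (4 * Real.pi)) h5 h6
  have h7 : ((a, v) : ℝ × Cn n) = a • ((1 : ℝ), (0 : Cn n)) + (0, v) := by simp
  rw [h4, levi_slice h, deriv_deriv_curve h, fderiv_deriv_curve h, h7]
  simp only [map_add, map_smul, add_apply, smul_apply, smul_eq_mul]
  rw [hsymm.eq (1, 0) (0, v)]
  field_simp
  ring

variable [IsManifold 𝓘(ℂ, Cn n) ∞ X] [CompactSpace X] [T2Space X]

theorem KahlerForm.potForm_I_smul (Ω : KahlerForm n X) (φ : X → ℝ) (z v : Cn n) :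
    Ω.potForm φ e z v (Complex.I • v) = Ω.normSq e z v + levi (fun y => φ (e.symm y)) z v := rfl

/-- Regularization of subgeodesics by curves of Kähler potentials, with the differential
inequality that controls the gradient of the velocity by the acceleration. -/
theorem KahlerForm.IsSubgeodesic.exists_potential_approx {Ω : KahlerForm n X}
    {u : ℝ → X → ℝ} (hu : Ω.IsSubgeodesic u) {C : ℝ} (hC0 : 0 ≤ C) (hC : Ω.SliceLE u C) :
    ∃ K : ℝ, 0 ≤ K ∧ ∀ σ : ℝ, 0 < σ → ∀ ε : ℝ, 0 < ε → ∃ Φ : ℝ → X → ℝ,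
      ContMDiff (𝓘(ℝ).prod 𝓘(ℝ, Cn n)) 𝓘(ℝ) ∞ (fun p : ℝ × X => Φ p.1 p.2) ∧
      (∀ x t, σ ≤ t → t ≤ 1 - σ → |Φ t x - u t x| ≤ ε) ∧
      (∀ t, σ ≤ t → t ≤ 1 - σ → Ω.IsPotential (Φ t)) ∧
      (∀ x t, σ ≤ t → t ≤ 1 - σ → -ε ≤ deriv (deriv fun s => Φ s x) t ∧
        deriv (deriv fun s => Φ s x) t ≤ K) ∧
      ∀ e ∈ atlas (Cn n) X, ∀ z ∈ e.target, ∀ t, σ ≤ t → t ≤ 1 - σ → ∀ v : Cn n,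
        Ω.potForm (Φ t) e z v (Complex.I • v) ≤ (C + ε) * Ω.normSq e z v ∧
        fderiv ℝ (fun y => deriv (fun s => Φ s (e.symm y)) t) z v ^ 2
          ≤ 4 * Real.pi * (C + ε) * (deriv (deriv fun s => Φ s (e.symm z)) t + ε)
            * Ω.normSq e z v := by
  obtain ⟨K₂, hK₂, H⟩ := hu.exists_smooth_approx hC
  obtain ⟨B, hB⟩ := (isCompact_Icc.prod isCompact_univ).bddAbove_image hu.continuous.norm
  have hB' : ∀ x, ∀ t ∈ Icc (0 : ℝ) 1, |u t x| ≤ max B 0 := fun x t ht =>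
    (hB (mem_image_of_mem (fun p : ℝ × X => ‖u p.1 p.2‖) (mk_mem_prod ht (mem_univ x)))).trans
      (le_max_left _ _)
  have hπ := Real.pi_gt_three
  refine ⟨4 * Real.pi * K₂, by positivity, fun σ hσ ε hε => ?_⟩
  -- The three bounds for `κ` keep the loss in the acceleration, which is multiplied by `4 π`, and
  -- the change of the potentials by the scaling below `ε`, and `1 - κ` positive.
  set κ : ℝ := min (1 / 2) (min (ε / (4 * Real.pi)) (ε / (2 + max B 0))) with hκ
  have hB0 : 0 ≤ max B 0 := le_max_right _ _
  have hκ0 : 0 < κ := by positivity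
  have hκ1 : κ ≤ 1 / 2 := min_le_left _ _
  have hκ2 : 4 * Real.pi * κ ≤ ε := by
    have h1 : κ ≤ ε / (4 * Real.pi) := (min_le_right _ _).trans (min_le_left _ _)
    rw [le_div_iff₀ (by positivity)] at h1
    linarith
  have hκ3 : κ * (2 + max B 0) ≤ ε := by
    have h1 : κ ≤ ε / (2 + max B 0) := (min_le_right _ _).trans (min_le_right _ _)
    rwa [le_div_iff₀ (by positivity)] at h1
  have hκε : 2 * κ ≤ ε := by nlinarith
  obtain ⟨Φ₀, hΦ₀, hΦu, hΦb⟩ := H σ hσ κ hκ0 (by linarith)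
  -- scaling by `1 - κ` makes the regularization strictly positive
  set Φ : ℝ → X → ℝ := fun t x => (1 - κ) * Φ₀ t x with hΦ
  have hch : ∀ e : OpenPartialHomeomorph X (Cn n), chartExpr (fun x τ => Φ τ.re x) e
      = fun p => (1 - κ) * chartExpr (fun x τ => Φ₀ τ.re x) e p := fun e => rfl
  have hΦC : ∀ e ∈ atlas (Cn n) X, ∀ z ∈ e.target, ∀ τ : ℂ,
      ContDiffAt ℝ ∞ (chartExpr (fun x τ => Φ τ.re x) e) (z, τ) := fun e he z hz τ => by
    rw [hch]
    exact contDiffAt_const.mul (hΦ₀ e he z hz τ)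
  have hcu : ∀ e ∈ atlas (Cn n) X, ∀ z ∈ e.target, ∀ t : ℝ,
      ContDiffAt ℝ ∞ (curveExpr Φ e) (t, z) := fun e he z hz t =>
    contDiffAt_curveExpr_of_chartExpr (hΦC e he z hz t)
  have hcu2 : ∀ e ∈ atlas (Cn n) X, ∀ z ∈ e.target, ∀ t : ℝ,
      ContDiffAt ℝ 2 (curveExpr Φ e) (t, z) := fun e he z hz t =>
    contDiffAt_two_of_infty (hcu e he z hz t)
  have hsm : ContMDiff (𝓘(ℝ).prod 𝓘(ℝ, Cn n)) 𝓘(ℝ) ∞ (fun p : ℝ × X => Φ p.1 p.2) :=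
    contMDiff_curve_of_contDiffAt_chart fun x => ⟨chartAt (Cn n) x, chart_mem_atlas _ x,
      mem_chart_source _ x, fun t => hcu _ (chart_mem_atlas _ x) _ (mem_chart_target _ x) t⟩
  have hsl : ∀ t, ContMDiff 𝓘(ℝ, Cn n) 𝓘(ℝ) ∞ (Φ t) := fun t =>
    hsm.comp (contMDiff_const.prodMk contMDiff_id)
  have hlv : ∀ e ∈ atlas (Cn n) X, ∀ z ∈ e.target, ∀ t : ℝ, ∀ V,
      levi (chartExpr (fun x τ => Φ τ.re x) e) (z, (t : ℂ)) V
        = (1 - κ) * levi (chartExpr (fun x τ => Φ₀ τ.re x) e) (z, (t : ℂ)) V :=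
    fun e he z hz t V => by
      rw [hch, levi_const_mul _ (contDiffAt_two_of_infty (hΦ₀ e he z hz t))]
  have hκ' : 0 ≤ 1 - κ := by linarith
  -- the bounds for the Levi form on `X × ℂ`
  have hlow : ∀ e ∈ atlas (Cn n) X, ∀ z ∈ e.target, ∀ t, σ ≤ t → t ≤ 1 - σ → ∀ (v : Cn n) (a : ℝ),
      κ ^ 2 * Ω.normSq e z v - κ * a ^ 2 ≤ Ω.normSq e z v
        + levi (chartExpr (fun x τ => Φ τ.re x) e) (z, (t : ℂ)) (v, (a : ℂ)) := by
    intro e he z hz t h1 h2 v a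
    rw [hlv e he z hz]
    have h3 := (hΦb e he z hz (t : ℂ) (by simpa using h1) (by simpa using h2) (v, (a : ℂ))).1
    have h4 : Ω.prodNormSq e z (v, (a : ℂ)) = Ω.normSq e z v + a ^ 2 := by
      simp [KahlerForm.prodNormSq]
    rw [h4] at h3
    simp only at h3
    have h5 := mul_le_mul_of_nonneg_left h3 hκ'
    have h6 := sq_nonneg a
    have : 0 ≤ κ * κ * a ^ 2 := by positivity
    nlinarith
  have hzero : ∀ e ∈ atlas (Cn n) X, ∀ z ∈ e.target, ∀ (t : ℝ) (v : Cn n),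
      levi (chartExpr (fun x τ => Φ τ.re x) e) (z, (t : ℂ)) (v, 0)
        = levi (fun y => Φ t (e.symm y)) z v := by
    intro e he z hz t v
    have := levi_chartExpr_curve (hcu2 e he z hz t) v 0
    simpa using this
  have hpos : ∀ e ∈ atlas (Cn n) X, ∀ z ∈ e.target, ∀ t, σ ≤ t → t ≤ 1 - σ → ∀ v : Cn n,
      κ ^ 2 * Ω.normSq e z v ≤ Ω.potForm (Φ t) e z v (Complex.I • v) := by
    intro e he z hz t h1 h2 v
    have h3 := hlow e he z hz t h1 h2 v 0
    rw [Complex.ofReal_zero, hzero e he z hz] at h3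
    rw [Ω.potForm_I_smul]
    linarith
  refine ⟨Φ, hsm, fun x t h1 h2 => ?_, fun t h1 h2 => ⟨hsl t, fun e he z hz v hv => ?_⟩,
    fun x t h1 h2 => ?_, fun e he z hz t h1 h2 v => ?_⟩
  · have h3 := hΦu x t h1 h2
    have h4 := hB' x t ⟨by linarith, by linarith⟩
    have h5 : Φ t x - u t x = (1 - κ) * (Φ₀ t x - u t x) - κ * u t x := by
      simp only [hΦ]; ring
    rw [h5]
    calc _ ≤ |(1 - κ) * (Φ₀ t x - u t x)| + |κ * u t x| := abs_sub _ _
      _ ≤ 1 * κ + κ * max B 0 := by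
        rw [abs_mul, abs_mul, abs_of_nonneg hκ', abs_of_pos hκ0]
        gcongr
        linarith
      _ ≤ ε := by linarith
  · have h3 := Ω.normSq_pos he hz hv
    have h4 := hpos e he z hz t h1 h2 v
    have : 0 < κ ^ 2 * Ω.normSq e z v := by positivity
    linarith
  · set e := chartAt (Cn n) x with he
    have hea : e ∈ atlas (Cn n) X := chart_mem_atlas _ x
    have hx : x ∈ e.source := mem_chart_source _ x
    have hz := e.map_source hx
    have h3 := levi_chartExpr_curve (hcu2 e hea _ hz t) 0 1
    have h4 : levi (fun y => Φ t (e.symm y)) (e x) 0 = 0 := by simp [levi_eq]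
    rw [e.left_inv hx, h4, map_zero] at h3
    have h5 := hlow e hea _ hz t h1 h2 0 1
    have h6 := (hΦb e hea _ hz (t : ℂ) (by simpa using h1) (by simpa using h2) (0, 1)).2.1
    rw [h3, Ω.normSq_zero] at h5
    have h7 := hlv e hea _ hz t (0, 1)
    have h8 : Ω.prodNormSq e (e x) ((0 : Cn n), (1 : ℂ)) = 1 := by
      simp [KahlerForm.prodNormSq, Ω.normSq_zero]
    rw [h8, mul_one] at h6
    rw [Complex.ofReal_one, h7] at h3
    have hd : deriv (deriv fun s => Φ s x) t = 4 * Real.pi * ((1 - κ)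
        * levi (chartExpr (fun x τ => Φ₀ τ.re x) e) (e x, (t : ℂ)) (0, 1)) := by
      rw [h3]; field_simp; ring
    constructor
    · have : -κ ≤ 1 / (4 * Real.pi) * deriv (deriv fun s => Φ s x) t := by linarith
      rw [one_div, inv_mul_eq_div, le_div_iff₀ (by positivity)] at this
      linarith
    · rw [hd]
      gcongr
      calc _ ≤ (1 - κ) * K₂ := by gcongr
        _ ≤ 1 * K₂ := by gcongr; linarith
        _ = K₂ := one_mul _
  have hN := Ω.normSq_nonneg he hz v
  have hup : Ω.potForm (Φ t) e z v (Complex.I • v) ≤ (C + ε) * Ω.normSq e z v := by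
    have h3 := (hΦb e he z hz (t : ℂ) (by simpa using h1) (by simpa using h2) (v, 0)).2.2
    have h4 := hlv e he z hz t (v, 0)
    rw [hzero e he z hz] at h4
    rw [Ω.potForm_I_smul, h4]
    simp only at h3
    have h5 := mul_le_mul_of_nonneg_left h3 hκ'
    have h6 : 0 ≤ κ * (C + κ) * Ω.normSq e z v := by positivity
    have h7 : (2 * κ) * Ω.normSq e z v ≤ ε * Ω.normSq e z v := by gcongr
    nlinarith
  refine ⟨hup, ?_⟩
  set D := fderiv ℝ (fun y => deriv (fun s => Φ s (e.symm y)) t) z v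
  set S := deriv (deriv fun s => Φ s (e.symm z)) t
  -- Positivity of the form on `X × D` in the directions `(v, a)`: a quadratic polynomial in `a` is
  -- nonnegative, and its discriminant gives the gradient estimate.
  have hquad : ∀ a : ℝ, 0 ≤ (S / (4 * Real.pi) + κ) * (a * a) + D / (2 * Real.pi) * a
      + Ω.potForm (Φ t) e z v (Complex.I • v) := by
    intro a
    have h3 := hlow e he z hz t h1 h2 v a
    rw [levi_chartExpr_curve (hcu2 e he z hz t) v a] at h3
    rw [Ω.potForm_I_smul]
    have : 0 ≤ κ ^ 2 * Ω.normSq e z v := by positivity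
    have h4 : a ^ 2 / (4 * Real.pi) * S = S / (4 * Real.pi) * (a * a) := by ring
    have h5 : a / (2 * Real.pi) * D = D / (2 * Real.pi) * a := by ring
    rw [h4, h5] at h3
    nlinarith
  have hdisc := discrim_le_zero hquad
  rw [discrim] at hdisc
  have h3 : D ^ 2 ≤ 4 * Real.pi * (S + 4 * Real.pi * κ)
      * Ω.potForm (Φ t) e z v (Complex.I • v) := by
    have h4 : (D / (2 * Real.pi)) ^ 2 = D ^ 2 / (4 * Real.pi ^ 2) := by ring
    have h5 : 4 * (S / (4 * Real.pi) + κ) * Ω.potForm (Φ t) e z v (Complex.I • v)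
        = (4 * Real.pi * (S + 4 * Real.pi * κ) * Ω.potForm (Φ t) e z v (Complex.I • v))
          / (4 * Real.pi ^ 2) := by field_simp
    rw [h4, h5, sub_nonpos, div_le_div_iff_of_pos_right (by positivity)] at hdisc
    exact hdisc
  have hS : 0 ≤ S + 4 * Real.pi * κ := by
    -- the quadratic polynomial is nonnegative, hence so is its leading coefficient
    by_contra! hneg
    have h8 := hlow e he z hz t h1 h2 0 1
    rw [levi_chartExpr_curve (hcu2 e he z hz t) 0 1, Ω.normSq_zero, map_zero] at h8
    have h9 : levi (fun y => Φ t (e.symm y)) z 0 = 0 := by simp [levi_eq]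
    rw [h9] at h8
    have h10 : -κ ≤ 1 / (4 * Real.pi) * S := by
      have : (1 : ℝ) ^ 2 / (4 * Real.pi) * S = 1 / (4 * Real.pi) * S := by ring
      linarith
    rw [one_div, inv_mul_eq_div, le_div_iff₀ (by positivity)] at h10
    linarith
  calc D ^ 2 ≤ _ := h3
    _ ≤ 4 * Real.pi * (S + ε) * ((C + ε) * Ω.normSq e z v) := by
      have h6 := hpos e he z hz t h1 h2 v
      have h7 : 0 ≤ κ ^ 2 * Ω.normSq e z v := by positivity
      have h8 : 0 ≤ S + ε := by linarith
      exact mul_le_mul (by gcongr) hup (h7.trans h6) (by positivity)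
    _ = _ := by ring

end Curves

/-! ### The Poincaré inequality on a ball -/

section PoincareBall

variable {E : Type*} [NormedAddCommGroup E] [NormedSpace ℝ E]

theorem sq_integral_le_integral_sq {φ : ℝ → ℝ} (hφ : ContinuousOn φ (Icc 0 1)) :
    (∫ s in Ioc (0 : ℝ) 1, φ s) ^ 2 ≤ ∫ s in Ioc (0 : ℝ) 1, φ s ^ 2 := by
  have : IsProbabilityMeasure (volume.restrict (Ioc (0 : ℝ) 1)) := ⟨by simp⟩
  have hi : ∀ ψ : ℝ → ℝ, ContinuousOn ψ (Icc 0 1) → IntegrableOn ψ (Ioc 0 1) := fun ψ h =>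
    (h.integrableOn_Icc).mono_set Ioc_subset_Icc_self
  exact ConvexOn.map_integral_le (g := fun x : ℝ => x ^ 2) (s := univ) (even_two.convexOn_pow)
    (by fun_prop) isClosed_univ (by simp) (hi _ hφ) (hi _ (hφ.pow 2))

/-- The squared difference of two values of a function is bounded by the integral, along the
segment, of a bound for the squared norm of the derivative. -/
theorem ofReal_sq_sub_le_lintegral_segment {g Γ : E → ℝ} {B : Set E} (hBo : IsOpen B)
    (hB : Convex ℝ B) {R : ℝ} (hg : ContDiffOn ℝ 1 g B)
    (hΓ : ∀ z ∈ B, ∀ v, fderiv ℝ g z v ^ 2 ≤ Γ z * ‖v‖ ^ 2) {y z : E} (hy : y ∈ B) (hz : z ∈ B)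
    (hyz : ‖y - z‖ ≤ R) :
    ENNReal.ofReal ((g y - g z) ^ 2) ≤ ENNReal.ofReal (R ^ 2) *
      ∫⁻ s in Ioc (0 : ℝ) 1, B.indicator (fun w => ENNReal.ofReal (Γ w)) (z + s • (y - z)) := by
  have hmem : ∀ s ∈ Icc (0 : ℝ) 1, z + s • (y - z) ∈ B := fun s hs => hB.add_smul_sub_mem hz hy hs
  set φ' : ℝ → ℝ := fun s => fderiv ℝ g (z + s • (y - z)) (y - z) with hφ'
  have hd : ∀ s ∈ Icc (0 : ℝ) 1, HasDerivAt (fun s => g (z + s • (y - z))) (φ' s) s := by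
    intro s hs
    have h1 : HasDerivAt (fun s : ℝ => z + s • (y - z)) (y - z) s := by
      simpa using ((hasDerivAt_id s).smul_const (y - z)).const_add z
    exact HasFDerivAt.comp_hasDerivAt (l := g) s
      (((hg.differentiableOn (by simp)) _ (hmem s hs)).differentiableAt
        (hBo.mem_nhds (hmem s hs))).hasFDerivAt h1
  have hφc : ContinuousOn φ' (Icc 0 1) := by
    have h1 : ContinuousOn (fderiv ℝ g) B := hg.continuousOn_fderiv_of_isOpen hBo le_rfl
    exact (h1.comp (by fun_prop) hmem).clm_apply continuousOn_const
  have hF : ∫ s in Ioc (0 : ℝ) 1, φ' s = g y - g z := by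
    rw [← intervalIntegral.integral_of_le zero_le_one,
      intervalIntegral.integral_eq_sub_of_hasDerivAt (f := fun s => g (z + s • (y - z)))]
    · simp
    · rwa [uIcc_of_le zero_le_one]
    · exact ContinuousOn.intervalIntegrable (by rwa [uIcc_of_le zero_le_one])
  have hi : IntegrableOn (fun s => φ' s ^ 2) (Ioc 0 1) :=
    ((hφc.pow 2).integrableOn_Icc).mono_set Ioc_subset_Icc_self
  rw [← hF]
  calc _ ≤ ENNReal.ofReal (∫ s in Ioc (0 : ℝ) 1, φ' s ^ 2) :=
        ENNReal.ofReal_le_ofReal (sq_integral_le_integral_sq hφc)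
    _ = ∫⁻ s in Ioc (0 : ℝ) 1, ENNReal.ofReal (φ' s ^ 2) :=
        ofReal_integral_eq_lintegral_ofReal hi (Eventually.of_forall fun s => sq_nonneg _)
    _ ≤ ∫⁻ s in Ioc (0 : ℝ) 1, ENNReal.ofReal (R ^ 2) *
          B.indicator (fun w => ENNReal.ofReal (Γ w)) (z + s • (y - z)) := by
        refine setLIntegral_mono_ae' measurableSet_Ioc (Eventually.of_forall fun s hs => ?_)
        have hs' := hmem s (Ioc_subset_Icc_self hs)
        rw [indicator_of_mem hs', ← ENNReal.ofReal_mul (sq_nonneg _)]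
        by_cases h0 : y - z = 0
        · simp [hφ', h0]
        apply ENNReal.ofReal_le_ofReal
        have h1 := hΓ _ hs' (y - z)
        have h2 : 0 ≤ Γ (z + s • (y - z)) := by
          have h3 : 0 < ‖y - z‖ ^ 2 := by positivity
          by_contra! h4
          have := mul_neg_of_neg_of_pos h4 h3
          nlinarith [sq_nonneg (fderiv ℝ g (z + s • (y - z)) (y - z))]
        calc _ ≤ _ := h1
          _ ≤ Γ (z + s • (y - z)) * R ^ 2 := by gcongr
          _ = _ := mul_comm _ _
    _ = _ := lintegral_const_mul' _ _ (by simp)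

variable [FiniteDimensional ℝ E] [MeasurableSpace E] [BorelSpace E] (ν : Measure E)
  [ν.IsAddHaarMeasure]

theorem lintegral_comp_add_smul_le {F : E → ENNReal} (hF : Measurable F) {a : ℝ} (ha : 1 / 2 ≤ a)
    (w : E) : ∫⁻ y, F (w + a • y) ∂ν ≤ 2 ^ Module.finrank ℝ E * ∫⁻ y, F y ∂ν := by
  have ha0 : a ≠ 0 := by linarith
  have h1 : ∫⁻ y, F (w + a • y) ∂ν
      = ∫⁻ y, F (w + y) ∂(Measure.map (fun y => a • y) ν) :=
    (lintegral_map (f := fun y => F (w + y)) (by fun_prop) (by fun_prop)).symm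
  rw [h1, Measure.map_addHaar_smul ν ha0, lintegral_smul_measure, lintegral_add_left_eq_self,
    smul_eq_mul]
  gcongr
  rw [abs_inv, abs_pow, ← inv_pow, ENNReal.ofReal_pow (by positivity)]
  gcongr
  rw [abs_of_pos (by linarith)]
  calc ENNReal.ofReal a⁻¹ ≤ ENNReal.ofReal 2 := by
        apply ENNReal.ofReal_le_ofReal
        rw [inv_le_comm₀ (by linarith) (by norm_num)]
        linarith
    _ = 2 := by simp

/-- Averaging a nonnegative function over the points that divide the segments joining the points of
`B` in a given ratio: one of the two end points moves the dividing point at speed `≥ 1 / 2`. -/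
theorem lintegral_lintegral_segment_le {F : E → ENNReal} (hF : Measurable F) (B : Set E) (s : ℝ) :
    ∫⁻ z in B, ∫⁻ y in B, F (z + s • (y - z)) ∂ν ∂ν
      ≤ 2 ^ Module.finrank ℝ E * ν B * ∫⁻ y, F y ∂ν := by
  have hm : Measurable fun p : E × E => F (p.1 + s • (p.2 - p.1)) := hF.comp (by fun_prop)
  have key : ∀ (b : ℝ), 1 / 2 ≤ b → ∀ w : E → E, ∫⁻ z in B, ∫⁻ y in B, F (w z + b • y) ∂ν ∂ν
      ≤ 2 ^ Module.finrank ℝ E * ν B * ∫⁻ y, F y ∂ν := fun b hb w =>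
    calc _ ≤ ∫⁻ z in B, 2 ^ Module.finrank ℝ E * ∫⁻ y, F y ∂ν ∂ν :=
          lintegral_mono fun z => (setLIntegral_le_lintegral _ _).trans
            (lintegral_comp_add_smul_le ν hF hb _)
      _ = _ := by rw [lintegral_const, Measure.restrict_apply_univ]; ring
  rcases le_total (1 / 2) s with hs | hs
  · have h1 := key s hs fun z => z - s • z
    refine le_of_eq_of_le ?_ h1
    congr! 5 with z y
    rw [smul_sub]; abel
  · rw [lintegral_lintegral_swap (by exact hm.aemeasurable)]
    have h1 := key (1 - s) (by linarith) fun y => s • y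
    refine le_of_eq_of_le ?_ h1
    congr! 5 with z y
    rw [smul_sub, sub_smul, one_smul]; abel

/-- The Poincaré inequality on a ball. -/
theorem exists_lintegral_ball_sq_sub_le {g Γ : E → ℝ} {z₀ : E} {r : ℝ} (hr : 0 < r)
    (hg : ContDiffOn ℝ 1 g (Metric.ball z₀ r)) (hΓc : ContinuousOn Γ (Metric.ball z₀ r))
    (hΓ : ∀ z ∈ Metric.ball z₀ r, ∀ v, fderiv ℝ g z v ^ 2 ≤ Γ z * ‖v‖ ^ 2) :
    ∃ c : ℝ, ∫⁻ y in Metric.ball z₀ r, ENNReal.ofReal ((g y - c) ^ 2) ∂ν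
      ≤ ENNReal.ofReal ((2 * r) ^ 2) * 2 ^ Module.finrank ℝ E
        * ∫⁻ y in Metric.ball z₀ r, ENNReal.ofReal (Γ y) ∂ν := by
  classical
  set B := Metric.ball z₀ r with hBdef
  have hBm : MeasurableSet B := measurableSet_ball
  set F : E → ENNReal := B.indicator fun w => ENNReal.ofReal (Γ w) with hF
  have hFm : Measurable F := by
    have h1 := ContinuousOn.measurable_piecewise (f := fun w => ENNReal.ofReal (Γ w))
      (g := fun _ : E => (0 : ENNReal)) (s := B)
      (ENNReal.continuous_ofReal.comp_continuousOn hΓc) continuousOn_const hBm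
    rw [hF, ← piecewise_eq_indicator]
    exact h1
  have hgm : AEMeasurable (fun p : E × E => ENNReal.ofReal ((g p.2 - g p.1) ^ 2))
      ((ν.restrict B).prod (ν.restrict B)) := by
    rw [Measure.prod_restrict]
    refine ContinuousOn.aemeasurable ?_ (hBm.prod hBm)
    refine ENNReal.continuous_ofReal.comp_continuousOn ?_
    exact ((hg.continuousOn.comp continuousOn_snd fun p hp => hp.2).sub
      (hg.continuousOn.comp continuousOn_fst fun p hp => hp.1)).pow 2
  -- The double integral is estimated along the segments that join the two points.
  have hdouble : ∫⁻ z in B, ∫⁻ y in B, ENNReal.ofReal ((g y - g z) ^ 2) ∂ν ∂ν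
      ≤ ENNReal.ofReal ((2 * r) ^ 2) * (2 ^ Module.finrank ℝ E * ν B * ∫⁻ y, F y ∂ν) := by
    calc _ ≤ ∫⁻ z in B, ∫⁻ y in B, ENNReal.ofReal ((2 * r) ^ 2) *
          (∫⁻ s in Ioc (0 : ℝ) 1, F (z + s • (y - z))) ∂ν ∂ν := by
          refine setLIntegral_mono_ae' hBm (Eventually.of_forall fun z hz => ?_)
          refine setLIntegral_mono_ae' hBm (Eventually.of_forall fun y hy => ?_)
          refine ofReal_sq_sub_le_lintegral_segment Metric.isOpen_ball (convex_ball _ _) hg hΓ hy hz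
            ?_
          rw [← dist_eq_norm]
          have h1 := Metric.mem_ball.1 hy
          have h2 := Metric.mem_ball.1 hz
          have h3 := dist_triangle_right y z z₀
          linarith
      _ = ENNReal.ofReal ((2 * r) ^ 2) * ∫⁻ s in Ioc (0 : ℝ) 1, ∫⁻ z in B, ∫⁻ y in B,
            F (z + s • (y - z)) ∂ν ∂ν := by
          have h1 : ∀ z, ∫⁻ y in B, (∫⁻ s in Ioc (0 : ℝ) 1, F (z + s • (y - z))) ∂ν
              = ∫⁻ s in Ioc (0 : ℝ) 1, ∫⁻ y in B, F (z + s • (y - z)) ∂ν := fun z =>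
            lintegral_lintegral_swap (by
              exact (hFm.comp (f := fun p : E × ℝ => z + p.2 • (p.1 - z)) (by fun_prop)).aemeasurable)
          simp_rw [lintegral_const_mul' _ _ ENNReal.ofReal_ne_top, h1]
          rw [lintegral_lintegral_swap]
          have h2 : Measurable fun p : (E × ℝ) × E => F (p.1.1 + p.1.2 • (p.2 - p.1.1)) :=
            hFm.comp (by fun_prop)
          exact (h2.lintegral_prod_right' (ν := ν.restrict B)).aemeasurable
      _ ≤ ENNReal.ofReal ((2 * r) ^ 2) * ∫⁻ s in Ioc (0 : ℝ) 1,
            2 ^ Module.finrank ℝ E * ν B * ∫⁻ y, F y ∂ν := by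
          gcongr with s
          exact lintegral_lintegral_segment_le ν hFm B s
      _ = _ := by simp
  have hB0 : ν B ≠ 0 := (Metric.measure_ball_pos ν z₀ hr).ne'
  have hBt : ν B ≠ ⊤ := measure_ball_lt_top.ne
  -- Some value `g z` is at most as far from `g` as the values are on average.
  obtain ⟨z, -, hz⟩ := exists_le_setLAverage hB0 hBt (hgm.lintegral_prod_right')
  refine ⟨g z, hz.trans ?_⟩
  rw [setLAverage_eq]
  refine ENNReal.div_le_of_le_mul (hdouble.trans (le_of_eq ?_))
  rw [hF, lintegral_indicator hBm]
  ring

end PoincareBall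

/-! ### Smooth volume forms -/

section SmoothVolume

variable {n : ℕ} {X : Type*} [TopologicalSpace X] [ChartedSpace (Cn n) X] [MeasurableSpace X]
  [BorelSpace X] {μ : Measure X}

/-- Integration in a chart with respect to a smooth volume form. -/
theorem IsSmoothVolume.exists_density (hμ : IsSmoothVolume n μ)
    {e : OpenPartialHomeomorph X (Cn n)} (he : e ∈ atlas (Cn n) X) :
    ∃ ρ : Cn n → ℝ, ContinuousOn ρ e.target ∧ (∀ z ∈ e.target, 0 < ρ z) ∧
      ∀ f : X → ENNReal, Measurable f → ∀ B ⊆ e.target, IsOpen B →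
        ∫⁻ x in e.source ∩ e ⁻¹' B, f x ∂μ = ∫⁻ z in B, ENNReal.ofReal (ρ z) * f (e.symm z) := by
  obtain ⟨ρ, hρ, hρ0, hmap⟩ := hμ e he
  refine ⟨ρ, hρ.continuousOn, hρ0, fun f hf B hB hBo => ?_⟩
  have hes : MeasurableSet e.source := e.open_source.measurableSet
  have het : MeasurableSet e.target := e.open_target.measurableSet
  have hU : MeasurableSet (e.source ∩ e ⁻¹' B) := (e.isOpen_inter_preimage hBo).measurableSet
  have hem : AEMeasurable e (μ.restrict e.source) := e.continuousOn.aemeasurable hes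
  have hsm : AEMeasurable e.symm (volume.restrict e.target) :=
    e.continuousOn_symm.aemeasurable het
  have hρm : AEMeasurable (fun z => ENNReal.ofReal (ρ z)) (volume.restrict e.target) :=
    (hρ.continuousOn.aemeasurable het).ennreal_ofReal
  set g : X → ENNReal := (e.source ∩ e ⁻¹' B).indicator f with hg
  have hgm : Measurable g := hf.indicator hU
  have hgs : AEMeasurable (fun z => g (e.symm z)) (volume.restrict e.target) :=
    hgm.comp_aemeasurable hsm
  calc ∫⁻ x in e.source ∩ e ⁻¹' B, f x ∂μ = ∫⁻ x in e.source, g x ∂μ := by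
        rw [hg, lintegral_indicator hU, Measure.restrict_restrict hU,
          inter_eq_left.2 inter_subset_left]
    _ = ∫⁻ x in e.source, g (e.symm (e x)) ∂μ :=
        setLIntegral_congr_fun hes fun x hx => by simp only [e.left_inv hx]
    _ = ∫⁻ z, g (e.symm z) ∂((μ.restrict e.source).map e) := by
        rw [lintegral_map' _ hem]
        rw [hmap]
        exact hgs.mono_ac (withDensity_absolutelyContinuous _ _)
    _ = ∫⁻ z in e.target, ENNReal.ofReal (ρ z) * g (e.symm z) := by
        rw [hmap, lintegral_withDensity_eq_lintegral_mul₀ hρm hgs]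
        rfl
    _ = ∫⁻ z in e.target, B.indicator (fun z => ENNReal.ofReal (ρ z) * f (e.symm z)) z := by
        refine setLIntegral_congr_fun het fun z hz => ?_
        by_cases hzB : z ∈ B
        · have : e.symm z ∈ e.source ∩ e ⁻¹' B :=
            ⟨e.map_target hz, by rwa [mem_preimage, e.right_inv hz]⟩
          simp only [hg, indicator_of_mem this, indicator_of_mem hzB]
        · have : e.symm z ∉ e.source ∩ e ⁻¹' B := fun h => hzB (by
            have := h.2; rwa [mem_preimage, e.right_inv hz] at this)
          simp only [hg, indicator_of_notMem this, indicator_of_notMem hzB, mul_zero]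
    _ = _ := by
        rw [lintegral_indicator hBo.measurableSet, Measure.restrict_restrict hBo.measurableSet,
          inter_eq_left.2 hB]

/-- A coordinate ball on which the density of the volume form and the Kähler metric are comparable
to the Euclidean ones. -/
theorem IsSmoothVolume.exists_ball [IsManifold 𝓘(ℂ, Cn n) ∞ X] (hμ : IsSmoothVolume n μ)
    (Ω : KahlerForm n X) (x : X) :
    ∃ r > 0, ∃ c > 0, Metric.ball (chartAt (Cn n) x x) r ⊆ (chartAt (Cn n) x).target ∧
      (∀ z ∈ Metric.ball (chartAt (Cn n) x x) r, ∀ v,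
        Ω.normSq (chartAt (Cn n) x) z v ≤ c * ‖v‖ ^ 2) ∧
      ∀ f : X → ENNReal, Measurable f → ∀ B ⊆ Metric.ball (chartAt (Cn n) x x) r, IsOpen B →
        (∫⁻ y in (chartAt (Cn n) x).source ∩ chartAt (Cn n) x ⁻¹' B, f y ∂μ
          ≤ ENNReal.ofReal c * ∫⁻ z in B, f ((chartAt (Cn n) x).symm z)) ∧
        (∫⁻ z in B, f ((chartAt (Cn n) x).symm z)
          ≤ ENNReal.ofReal c
            * ∫⁻ y in (chartAt (Cn n) x).source ∩ chartAt (Cn n) x ⁻¹' B, f y ∂μ) := by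
  set e := chartAt (Cn n) x with hedef
  have he : e ∈ atlas (Cn n) X := chart_mem_atlas _ x
  have hxt : e x ∈ e.target := mem_chart_target _ x
  obtain ⟨ρ, hρc, hρ0, hρ⟩ := hμ.exists_density he
  obtain ⟨r, hr, hrt⟩ := Metric.nhds_basis_closedBall.mem_iff.1 (e.open_target.mem_nhds hxt)
  have hK : IsCompact (Metric.closedBall (e x) r) := isCompact_closedBall _ _
  obtain ⟨b, hb, hb1⟩ := Ω.exists_normSq_bounds he hK hrt
  obtain ⟨M, hM⟩ := hK.bddAbove_image (hρc.mono hrt)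
  obtain ⟨M', hM'⟩ := hK.bddAbove_image
    (ContinuousOn.inv₀ (hρc.mono hrt) fun z hz => (hρ0 z (hrt hz)).ne')
  have hsub : Metric.ball (e x) r ⊆ Metric.closedBall (e x) r := Metric.ball_subset_closedBall
  refine ⟨r, hr, max b⁻¹ (max M M'), lt_max_of_lt_left (by positivity), hsub.trans hrt, ?_, ?_⟩
  · intro z hz v
    have h1 := (hb1 z (hsub hz) v).2
    rw [mul_comm, ← le_div_iff₀ hb, div_eq_inv_mul] at h1
    exact h1.trans (by gcongr; exact le_max_left _ _)
  · intro f hf B hB hBo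
    have hBt : B ⊆ e.target := hB.trans (hsub.trans hrt)
    rw [hρ f hf B hBt hBo, ← lintegral_const_mul' _ _ (by simp),
      ← lintegral_const_mul' _ _ (by simp)]
    constructor
    · refine setLIntegral_mono_ae' hBo.measurableSet (Eventually.of_forall fun z hz => ?_)
      gcongr
      exact (hM (mem_image_of_mem ρ (hsub (hB hz)))).trans
        ((le_max_left _ _).trans (le_max_right _ _))
    · refine setLIntegral_mono_ae' hBo.measurableSet (Eventually.of_forall fun z hz => ?_)
      have h0 := hρ0 z (hBt hz)
      rw [← mul_assoc, ← ENNReal.ofReal_mul (le_max_of_le_left (by positivity))]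
      conv_lhs => rw [← one_mul (f _)]
      gcongr
      rw [ENNReal.one_le_ofReal]
      have h1 : (ρ z)⁻¹ ≤ max b⁻¹ (max M M') :=
        (hM' (mem_image_of_mem (fun z => (ρ z)⁻¹) (hsub (hB hz)))).trans
          ((le_max_right _ _).trans (le_max_right _ _))
      calc (1 : ℝ) = (ρ z)⁻¹ * ρ z := (inv_mul_cancel₀ h0.ne').symm
        _ ≤ _ := by gcongr

theorem IsSmoothVolume.isLocallyFiniteMeasure [IsManifold 𝓘(ℂ, Cn n) ∞ X]
    (hμ : IsSmoothVolume n μ) (Ω : KahlerForm n X) : IsLocallyFiniteMeasure μ := by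
  refine ⟨fun x => ?_⟩
  obtain ⟨r, hr, c, hc, hB, -, h⟩ := hμ.exists_ball Ω x
  set e := chartAt (Cn n) x
  refine ⟨e.source ∩ e ⁻¹' Metric.ball (e x) r,
    (e.isOpen_inter_preimage Metric.isOpen_ball).mem_nhds
      ⟨mem_chart_source _ x, Metric.mem_ball_self hr⟩, ?_⟩
  have h1 := (h (fun _ => 1) measurable_const _ Subset.rfl Metric.isOpen_ball).1
  simp only [lintegral_const, one_mul, Measure.restrict_apply_univ] at h1
  exact h1.trans_lt (ENNReal.mul_lt_top (by simp) measure_ball_lt_top)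

theorem IsSmoothVolume.isOpenPosMeasure [IsManifold 𝓘(ℂ, Cn n) ∞ X]
    (hμ : IsSmoothVolume n μ) (Ω : KahlerForm n X) : μ.IsOpenPosMeasure := by
  refine ⟨fun U hU ⟨x, hx⟩ h0 => ?_⟩
  obtain ⟨r, hr, c, hc, hB, -, h⟩ := hμ.exists_ball Ω x
  set e := chartAt (Cn n) x
  set B := Metric.ball (e x) r ∩ (e.target ∩ e.symm ⁻¹' U) with hBdef
  have hBo : IsOpen B := Metric.isOpen_ball.inter (e.symm.isOpen_inter_preimage hU)
  have h1 := (h (fun _ => 1) measurable_const B inter_subset_left hBo).2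
  simp only [lintegral_const, one_mul, Measure.restrict_apply_univ] at h1
  have h2 : μ (e.source ∩ e ⁻¹' B) = 0 := measure_mono_null (fun y hy => by
    have := hy.2.2.2
    rwa [mem_preimage, e.left_inv hy.1] at this) h0
  rw [h2, mul_zero] at h1
  have hxs : x ∈ e.source := mem_chart_source _ x
  refine (hBo.measure_pos volume ⟨e x, Metric.mem_ball_self hr, e.map_source hxs, ?_⟩).ne'
    (le_antisymm h1 zero_le)
  rwa [mem_preimage, e.left_inv hxs]

end SmoothVolume

/-! ### The Poincaré inequality on a compact Kähler manifold -/

section PoincareManifold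

variable {n : ℕ} {X : Type*} [TopologicalSpace X] [ChartedSpace (Cn n) X]
  [IsManifold 𝓘(ℂ, Cn n) ∞ X] [MeasurableSpace X]

/-- The Poincaré inequality on `U`: functions whose squared gradient with respect to `Ω` is bounded
by `G` have variance at most `K ∫_X G dμ` on `U`. -/
def KahlerForm.PoincareOn (Ω : KahlerForm n X) (μ : Measure X) (U : Set X) : Prop :=
  ∃ K : ℝ, 0 ≤ K ∧ ∀ h G : X → ℝ, ContMDiff 𝓘(ℝ, Cn n) 𝓘(ℝ) ∞ h → Continuous G → (∀ x, 0 ≤ G x) →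
    (∀ e ∈ atlas (Cn n) X, ∀ z ∈ e.target, ∀ v : Cn n,
      fderiv ℝ (fun y => h (e.symm y)) z v ^ 2 ≤ G (e.symm z) * Ω.normSq e z v) →
    ∃ c : ℝ, ∫ x in U, (h x - c) ^ 2 ∂μ ≤ K * ∫ x, G x ∂μ

variable [BorelSpace X] {μ : Measure X} {Ω : KahlerForm n X}

theorem KahlerForm.PoincareOn.mono [CompactSpace X] [IsFiniteMeasure μ] {U V : Set X}
    (hV : Ω.PoincareOn μ V) (h : U ⊆ V) : Ω.PoincareOn μ U := by
  obtain ⟨K, hK, H⟩ := hV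
  refine ⟨K, hK, fun h' G hh hG hG0 hd => ?_⟩
  obtain ⟨c, hc⟩ := H h' G hh hG hG0 hd
  refine ⟨c, le_trans (setIntegral_mono_set ?_ (Eventually.of_forall fun x => sq_nonneg _)
    h.eventuallyLE) hc⟩
  exact (Continuous.integrable_of_hasCompactSupport
    ((hh.continuous.sub continuous_const).pow 2) (HasCompactSupport.of_compactSpace _)).integrableOn

/-- The Poincaré inequality holds on coordinate balls, where `μ` and the metric are comparable to
Lebesgue measure and the Euclidean metric. -/
theorem IsSmoothVolume.exists_poincareOn_nhds [CompactSpace X] (hμ : IsSmoothVolume n μ)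
    (Ω : KahlerForm n X) (x : X) : ∃ U : Set X, IsOpen U ∧ x ∈ U ∧ Ω.PoincareOn μ U := by
  have := hμ.isLocallyFiniteMeasure Ω
  have : IsFiniteMeasure μ := CompactSpace.isFiniteMeasure
  obtain ⟨r, hr, c, hc, hB, hN, h⟩ := hμ.exists_ball Ω x
  set e := chartAt (Cn n) x with hedef
  have he : e ∈ atlas (Cn n) X := chart_mem_atlas _ x
  set B := Metric.ball (e x) r with hBdef
  set D : ENNReal := ENNReal.ofReal c * (ENNReal.ofReal ((2 * r) ^ 2)
    * 2 ^ Module.finrank ℝ (Cn n) * (ENNReal.ofReal c * ENNReal.ofReal c)) with hD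
  have hDt : D ≠ ⊤ := by
    rw [hD]
    finiteness
  have hU : IsOpen (e.source ∩ e ⁻¹' B) := e.isOpen_inter_preimage Metric.isOpen_ball
  refine ⟨e.source ∩ e ⁻¹' B, hU, ⟨mem_chart_source _ x, Metric.mem_ball_self hr⟩, D.toReal,
    by positivity, fun φ G hφ hG hG0 hd => ?_⟩
  have hGs : ∀ z ∈ B, ContinuousAt (fun z => G (e.symm z)) z := fun z hz =>
    hG.continuousAt.comp (e.continuousAt_symm (hB hz))
  obtain ⟨a, ha⟩ := exists_lintegral_ball_sq_sub_le (volume : Measure (Cn n))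
    (g := fun z => φ (e.symm z)) (Γ := fun z => c * G (e.symm z)) (z₀ := e x) hr
    (fun z hz => ((hφ.contDiffAt_chart he (hB hz)).of_le (by exact_mod_cast le_top)).contDiffWithinAt)
    (fun z hz => ((hGs z hz).const_mul c).continuousWithinAt)
    (fun z hz v => (hd e he z (hB hz) v).trans (by
      have h1 := mul_le_mul_of_nonneg_left (hN z hz v) (hG0 (e.symm z))
      linarith))
  refine ⟨a, ?_⟩
  have hsc : Continuous fun y => (φ y - a) ^ 2 := (hφ.continuous.sub continuous_const).pow 2
  have hGi : Integrable G μ :=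
    Continuous.integrable_of_hasCompactSupport hG (HasCompactSupport.of_compactSpace _)
  have hsi : IntegrableOn (fun y => (φ y - a) ^ 2) (e.source ∩ e ⁻¹' B) μ :=
    (Continuous.integrable_of_hasCompactSupport hsc (HasCompactSupport.of_compactSpace _)).integrableOn
  have h1 := (h (fun y => ENNReal.ofReal ((φ y - a) ^ 2)) hsc.measurable.ennreal_ofReal B
    Subset.rfl Metric.isOpen_ball).1
  have h2 := (h (fun y => ENNReal.ofReal (G y)) hG.measurable.ennreal_ofReal B
    Subset.rfl Metric.isOpen_ball).2
  have h3 : ∫⁻ y in B, ENNReal.ofReal (c * G (e.symm y))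
      = ENNReal.ofReal c * ∫⁻ y in B, ENNReal.ofReal (G (e.symm y)) := by
    rw [← lintegral_const_mul' _ _ (by simp)]
    simp_rw [ENNReal.ofReal_mul hc.le]
  have h4 : ∫⁻ y in e.source ∩ e ⁻¹' B, ENNReal.ofReal ((φ y - a) ^ 2) ∂μ
      ≤ D * ∫⁻ y, ENNReal.ofReal (G y) ∂μ := by
    calc _ ≤ _ := h1
      _ ≤ ENNReal.ofReal c * (ENNReal.ofReal ((2 * r) ^ 2) * 2 ^ Module.finrank ℝ (Cn n) *
          (ENNReal.ofReal c * (ENNReal.ofReal c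
            * ∫⁻ y in e.source ∩ e ⁻¹' B, ENNReal.ofReal (G y) ∂μ))) := by
          gcongr
          rw [h3] at ha
          exact ha.trans (by gcongr)
      _ ≤ ENNReal.ofReal c * (ENNReal.ofReal ((2 * r) ^ 2) * 2 ^ Module.finrank ℝ (Cn n) *
          (ENNReal.ofReal c * (ENNReal.ofReal c * ∫⁻ y, ENNReal.ofReal (G y) ∂μ))) := by
          gcongr
          exact Measure.restrict_le_self
      _ = _ := by rw [hD]; ring
  rw [← ofReal_integral_eq_lintegral_ofReal hsi (Eventually.of_forall fun _ => sq_nonneg _),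
    ← ofReal_integral_eq_lintegral_ofReal hGi (Eventually.of_forall hG0),
    ← ENNReal.ofReal_toReal hDt, ← ENNReal.ofReal_mul (by positivity),
    ENNReal.ofReal_le_ofReal_iff (mul_nonneg (by positivity) (integral_nonneg hG0))] at h4
  exact h4

/-- The Poincaré inequality passes to unions of overlapping open sets: the mean values on the two
sets are compared on the intersection, which has positive measure. -/
theorem KahlerForm.PoincareOn.union [CompactSpace X] [IsFiniteMeasure μ] [μ.IsOpenPosMeasure]
    {U V : Set X} (hUo : IsOpen U) (hVo : IsOpen V) (hU : Ω.PoincareOn μ U)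
    (hV : Ω.PoincareOn μ V) (hUV : (U ∩ V).Nonempty) : Ω.PoincareOn μ (U ∪ V) := by
  obtain ⟨K, hK, HU⟩ := hU
  obtain ⟨L, hL, HV⟩ := hV
  set m := μ.real (U ∩ V) with hm
  have hm0 : 0 < m := ENNReal.toReal_pos ((hUo.inter hVo).measure_pos μ hUV).ne'
    (measure_ne_top _ _)
  refine ⟨K + 2 * L + 2 * μ.real V * (2 * (K + L) / m), by positivity,
    fun φ G hφ hG hG0 hd => ?_⟩
  obtain ⟨a, ha⟩ := HU φ G hφ hG hG0 hd
  obtain ⟨b, hb⟩ := HV φ G hφ hG hG0 hd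
  have hI : 0 ≤ ∫ x, G x ∂μ := integral_nonneg hG0
  have hsi : ∀ c : ℝ, Integrable (fun x => (φ x - c) ^ 2) μ := fun c =>
    Continuous.integrable_of_hasCompactSupport ((hφ.continuous.sub continuous_const).pow 2)
      (HasCompactSupport.of_compactSpace _)
  have hnn : ∀ c : ℝ, ∀ W : Set X, 0 ≤ᵐ[μ.restrict W] fun x => (φ x - c) ^ 2 := fun c W =>
    Eventually.of_forall fun x => sq_nonneg _
  have hab : (b - a) ^ 2 * m ≤ 2 * (K + L) * ∫ x, G x ∂μ := by
    have h1 : ∫ x in U ∩ V, (b - a) ^ 2 ∂μ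
        ≤ ∫ x in U ∩ V, (2 * (φ x - a) ^ 2 + 2 * (φ x - b) ^ 2) ∂μ := by
      refine integral_mono (integrable_const _)
        (((hsi a).integrableOn.const_mul 2).add ((hsi b).integrableOn.const_mul 2)) fun x => ?_
      nlinarith [sq_nonneg ((φ x - a) + (φ x - b))]
    rw [integral_add ((hsi a).integrableOn.const_mul 2) ((hsi b).integrableOn.const_mul 2),
      integral_const_mul, integral_const_mul, setIntegral_const, smul_eq_mul] at h1
    have h2 : ∫ x in U ∩ V, (φ x - a) ^ 2 ∂μ ≤ ∫ x in U, (φ x - a) ^ 2 ∂μ :=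
      setIntegral_mono_set (hsi a).integrableOn (hnn a U) inter_subset_left.eventuallyLE
    have h3 : ∫ x in U ∩ V, (φ x - b) ^ 2 ∂μ ≤ ∫ x in V, (φ x - b) ^ 2 ∂μ :=
      setIntegral_mono_set (hsi b).integrableOn (hnn b V) inter_subset_right.eventuallyLE
    rw [← hm] at h1
    nlinarith
  refine ⟨a, ?_⟩
  have hVa : ∫ x in V, (φ x - a) ^ 2 ∂μ
      ≤ 2 * ∫ x in V, (φ x - b) ^ 2 ∂μ + 2 * (b - a) ^ 2 * μ.real V := by
    have h1 : ∫ x in V, (φ x - a) ^ 2 ∂μ ≤ ∫ x in V, (2 * (φ x - b) ^ 2 + 2 * (b - a) ^ 2) ∂μ := by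
      refine integral_mono (hsi a).integrableOn
        (((hsi b).integrableOn.const_mul 2).add (integrable_const _)) fun x => ?_
      nlinarith [sq_nonneg ((φ x - b) - (b - a))]
    rw [integral_add ((hsi b).integrableOn.const_mul 2) (integrable_const _),
      integral_const_mul, setIntegral_const, smul_eq_mul] at h1
    linarith
  have hunion : ∫ x in U ∪ V, (φ x - a) ^ 2 ∂μ
      ≤ ∫ x in U, (φ x - a) ^ 2 ∂μ + ∫ x in V, (φ x - a) ^ 2 ∂μ := by
    have h1 := integral_mono_measure (μ := μ.restrict (U ∪ V)) (ν := μ.restrict U + μ.restrict V)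
      (f := fun x => (φ x - a) ^ 2) (Measure.restrict_union_le U V)
      (Eventually.of_forall fun x => sq_nonneg _)
      ((hsi a).restrict.add_measure (hsi a).restrict)
    rwa [integral_add_measure (hsi a).integrableOn (hsi a).integrableOn] at h1
  have hab' : (b - a) ^ 2 ≤ 2 * (K + L) / m * ∫ x, G x ∂μ := by
    rw [div_mul_eq_mul_div, le_div_iff₀ hm0]
    exact hab
  have h5 := mul_le_mul_of_nonneg_left hab' (by positivity : 0 ≤ 2 * μ.real V)
  calc _ ≤ _ := hunion
    _ ≤ K * ∫ x, G x ∂μ + (2 * (L * ∫ x, G x ∂μ)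
        + 2 * μ.real V * (2 * (K + L) / m * ∫ x, G x ∂μ)) := by linarith
    _ = _ := by ring

/-- The Poincaré inequality on a compact connected Kähler manifold with a smooth volume form. -/
theorem IsSmoothVolume.poincareOn_univ [CompactSpace X] [ConnectedSpace X]
    (hμ : IsSmoothVolume n μ) (Ω : KahlerForm n X) : Ω.PoincareOn μ univ := by
  have := hμ.isLocallyFiniteMeasure Ω
  have : IsFiniteMeasure μ := CompactSpace.isFiniteMeasure
  have := hμ.isOpenPosMeasure Ω
  obtain ⟨x₀⟩ : Nonempty X := inferInstance
  have hloc := hμ.exists_poincareOn_nhds Ω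
  -- the set of points that share with `x₀` an open set where the inequality holds
  have hS : {x | ∃ U : Set X, IsOpen U ∧ x₀ ∈ U ∧ x ∈ U ∧ Ω.PoincareOn μ U} = univ := by
    refine IsClopen.eq_univ ⟨⟨?_⟩, ?_⟩ ?_
    · rw [isOpen_iff_mem_nhds]
      intro x hx
      obtain ⟨V, hVo, hxV, hV⟩ := hloc x
      filter_upwards [hVo.mem_nhds hxV] with y hy
      rintro ⟨U, hUo, h0U, hyU, hU⟩
      exact hx ⟨U ∪ V, hUo.union hVo, Or.inl h0U, Or.inr hxV, hU.union hUo hVo hV ⟨y, hyU, hy⟩⟩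
    · rw [isOpen_iff_mem_nhds]
      rintro x ⟨U, hUo, h0U, hxU, hU⟩
      filter_upwards [hUo.mem_nhds hxU] with y hy using ⟨U, hUo, h0U, hy, hU⟩
    · obtain ⟨V, hVo, hxV, hV⟩ := hloc x₀
      exact ⟨x₀, V, hVo, hxV, hxV, hV⟩
  -- Finitely many of these open sets cover `X`, and they all contain `x₀`.
  obtain ⟨U, -, -, hU, hPU⟩ := isCompact_univ.induction_on
    (p := fun s : Set X => ∃ U : Set X, IsOpen U ∧ x₀ ∈ U ∧ s ⊆ U ∧ Ω.PoincareOn μ U)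
    (by
      obtain ⟨V, hVo, hxV, hV⟩ := hloc x₀
      exact ⟨V, hVo, hxV, empty_subset _, hV⟩)
    (fun s t hst ⟨U, h1, h2, h3, h4⟩ => ⟨U, h1, h2, hst.trans h3, h4⟩)
    (fun s t ⟨U, h1, h2, h3, h4⟩ ⟨V, k1, k2, k3, k4⟩ =>
      ⟨U ∪ V, h1.union k1, Or.inl h2, union_subset_union h3 k3, h4.union h1 k1 k4 ⟨x₀, h2, k2⟩⟩)
    (fun x _ => by
      obtain ⟨U, h1, h2, h3, h4⟩ : x ∈ {x | ∃ U : Set X, IsOpen U ∧ x₀ ∈ U ∧ x ∈ U ∧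
        Ω.PoincareOn μ U} := hS ▸ mem_univ x
      exact ⟨U, mem_nhdsWithin_of_mem_nhds (h1.mem_nhds h3), U, h1, h2, Subset.rfl, h4⟩)
  exact hPU.mono hU

end PoincareManifold

/-! ### Real forms of type (1, 1) and Hermitian matrices -/

section HermitianForms

open Matrix
open scoped ComplexOrder

/-- The determinant is monotone on positive definite Hermitian matrices. -/
theorem Matrix.PosDef.det_re_le_of_le {m : Type*} [Fintype m] [DecidableEq m] {P Q : Matrix m m ℂ}
    (hP : P.PosDef) (hQ : Q.PosDef)
    (h : ∀ x, (star x ⬝ᵥ P *ᵥ x).re ≤ (star x ⬝ᵥ Q *ᵥ x).re) : P.det.re ≤ Q.det.re := by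
  obtain ⟨B, hB⟩ : ∃ B : Matrix m m ℂ, Q = Bᴴ * B := by
    open scoped MatrixOrder in
    exact CStarAlgebra.nonneg_iff_eq_star_mul_self.mp hQ.posSemidef.nonneg
  have hdet : IsUnit B.det := by
    have h1 : Q.det ≠ 0 := hQ.det_pos.ne'
    rw [hB, det_mul] at h1
    exact (right_ne_zero_of_mul h1).isUnit
  set M := (B⁻¹)ᴴ * P * B⁻¹ with hM
  have hMp : M.PosSemidef := hP.posSemidef.conjTranspose_mul_mul_same _
  have hquad : ∀ x y : m → ℂ, star x ⬝ᵥ (Bᴴ * B) *ᵥ y = star (B *ᵥ x) ⬝ᵥ (B *ᵥ y) := by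
    intro x y
    rw [← mulVec_mulVec, star_mulVec, dotProduct_mulVec]
  have hle : ∀ i, hMp.1.eigenvalues i ≤ 1 := by
    intro i
    set x := (hMp.1.eigenvectorBasis i).ofLp with hx
    have h1 : star x ⬝ᵥ M *ᵥ x = star (B⁻¹ *ᵥ x) ⬝ᵥ P *ᵥ (B⁻¹ *ᵥ x) := by
      rw [hM, Matrix.mul_assoc, ← mulVec_mulVec, star_mulVec, dotProduct_mulVec, ← mulVec_mulVec]
    have h2 := h (B⁻¹ *ᵥ x)
    have h0 : B *ᵥ B⁻¹ *ᵥ x = x := by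
      rw [mulVec_mulVec, mul_nonsing_inv _ hdet, one_mulVec]
    rw [hB, hquad, h0, ← h1] at h2
    have h3 : star x ⬝ᵥ x = 1 := by
      have h4 : ‖hMp.1.eigenvectorBasis i‖ = 1 := hMp.1.eigenvectorBasis.norm_eq_one i
      have h5 := EuclideanSpace.inner_eq_star_dotProduct (hMp.1.eigenvectorBasis i)
        (hMp.1.eigenvectorBasis i)
      rw [inner_self_eq_norm_sq_to_K, h4, dotProduct_comm] at h5
      simpa using h5.symm
    rw [h3] at h2
    rw [hMp.1.eigenvalues_eq]
    simpa using h2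
  have hMdet : M.det.re ≤ 1 ∧ M.det.im = 0 := by
    rw [hMp.1.det_eq_prod_eigenvalues, ← RCLike.ofReal_prod]
    refine ⟨?_, Complex.ofReal_im _⟩
    change (((∏ i, hMp.1.eigenvalues i : ℝ) : ℂ)).re ≤ 1
    rw [Complex.ofReal_re]
    exact Finset.prod_le_one (fun i _ => hMp.eigenvalues_nonneg i) fun i _ => hle i
  have hPM : P = Bᴴ * M * B := by
    have h1 : Bᴴ * (B⁻¹)ᴴ = 1 := by rw [← conjTranspose_mul, nonsing_inv_mul _ hdet,
      conjTranspose_one]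
    calc P = 1 * P * 1 := by simp
      _ = (Bᴴ * (B⁻¹)ᴴ) * P * (B⁻¹ * B) := by rw [h1, nonsing_inv_mul _ hdet]
      _ = _ := by rw [hM]; simp only [Matrix.mul_assoc]
  have h1 : P.det = (Complex.normSq B.det : ℂ) * M.det := by
    rw [hPM, det_mul, det_mul, det_conjTranspose, Complex.normSq_eq_conj_mul_self]
    simp only [starRingEnd_apply]
    ring
  have h2 : Q.det = (Complex.normSq B.det : ℂ) := by
    rw [hB, det_mul, det_conjTranspose, Complex.normSq_eq_conj_mul_self]
    rfl
  rw [h1, h2, Complex.re_ofReal_mul, Complex.ofReal_re]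
  exact mul_le_of_le_one_right (Complex.normSq_nonneg _) hMdet.1

variable {n : ℕ}

/-- Real alternating forms of type `(1, 1)` with constant coefficients. -/
structure IsOneOneForm (θ : Cn n →L[ℝ] Cn n →L[ℝ] ℝ) : Prop where
  self : ∀ v, θ v v = 0
  I_smul : ∀ v w, θ (Complex.I • v) (Complex.I • w) = θ v w

namespace IsOneOneForm

variable {θ : Cn n →L[ℝ] Cn n →L[ℝ] ℝ}

theorem swap (hθ : IsOneOneForm θ) (v w : Cn n) : θ v w = -θ w v := by
  have h := hθ.self (v + w)
  simp only [map_add, _root_.add_apply, hθ.self] at h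
  linarith

theorem I_left (hθ : IsOneOneForm θ) (v w : Cn n) : θ (Complex.I • v) w = -θ v (Complex.I • w) := by
  rw [← hθ.I_smul (Complex.I • v) w, Complex.I_smul_I_smul]
  simp

theorem add {θ' : Cn n →L[ℝ] Cn n →L[ℝ] ℝ} (hθ : IsOneOneForm θ) (hθ' : IsOneOneForm θ') :
    IsOneOneForm (θ + θ') :=
  ⟨fun v => by simp [hθ.self, hθ'.self], fun v w => by simp [hθ.I_smul, hθ'.I_smul]⟩

theorem smul (hθ : IsOneOneForm θ) (c : ℝ) : IsOneOneForm (c • θ) :=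
  ⟨fun v => by simp [hθ.self], fun v w => by simp [hθ.I_smul]⟩

end IsOneOneForm

/-- The sesquilinear form whose imaginary part is `θ`. -/
def sesqForm (θ : Cn n →L[ℝ] Cn n →L[ℝ] ℝ) (v w : Cn n) : ℂ :=
  (θ v (Complex.I • w) : ℂ) + Complex.I * (θ v w : ℂ)

variable {θ : Cn n →L[ℝ] Cn n →L[ℝ] ℝ}

theorem Complex.smul_eq_re_add_im {V : Type*} [AddCommGroup V] [Module ℂ V] (c : ℂ) (v : V) :
    c • v = c.re • v + c.im • (Complex.I • v) := by
  conv_lhs => rw [← Complex.re_add_im c, add_smul, mul_smul]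
  rfl

theorem sesqForm_smul_right (θ : Cn n →L[ℝ] Cn n →L[ℝ] ℝ) (c : ℂ) (v w : Cn n) :
    sesqForm θ v (c • w) = c * sesqForm θ v w := by
  have h1 : Complex.I • (c • w) = c.re • (Complex.I • w) + (-c.im) • w := by
    rw [smul_comm, Complex.smul_eq_re_add_im c, Complex.I_smul_I_smul, smul_neg, neg_smul]
  rw [sesqForm, h1, Complex.smul_eq_re_add_im c w, sesqForm]
  simp only [map_add, map_smul, smul_eq_mul]
  apply Complex.ext <;> simp <;> ring

theorem sesqForm_add_right (θ : Cn n →L[ℝ] Cn n →L[ℝ] ℝ) (v w w' : Cn n) :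
    sesqForm θ v (w + w') = sesqForm θ v w + sesqForm θ v w' := by
  simp only [sesqForm, smul_add, map_add]
  push_cast
  ring

theorem sesqForm_conj (hθ : IsOneOneForm θ) (v w : Cn n) :
    sesqForm θ w v = star (sesqForm θ v w) := by
  rw [sesqForm, sesqForm, hθ.swap w (Complex.I • v), hθ.I_left, hθ.swap w v]
  apply Complex.ext <;> simp

theorem sesqForm_smul_left (hθ : IsOneOneForm θ) (c : ℂ) (v w : Cn n) :
    sesqForm θ (c • v) w = star c * sesqForm θ v w := by
  rw [sesqForm_conj hθ, sesqForm_smul_right, star_mul, ← sesqForm_conj hθ, mul_comm]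

theorem sesqForm_sum_right {ι : Type*} (s : Finset ι) (θ : Cn n →L[ℝ] Cn n →L[ℝ] ℝ) (v : Cn n)
    (w : ι → Cn n) : sesqForm θ v (∑ i ∈ s, w i) = ∑ i ∈ s, sesqForm θ v (w i) := by
  classical
  induction s using Finset.induction_on with
  | empty => simp [sesqForm]
  | insert i s hi ih => rw [Finset.sum_insert hi, Finset.sum_insert hi, sesqForm_add_right, ih]

theorem sesqForm_sum_left {ι : Type*} (s : Finset ι) (hθ : IsOneOneForm θ) (v : ι → Cn n)
    (w : Cn n) : sesqForm θ (∑ i ∈ s, v i) w = ∑ i ∈ s, sesqForm θ (v i) w := by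
  rw [sesqForm_conj hθ, sesqForm_sum_right, star_sum]
  simp_rw [← sesqForm_conj hθ]

theorem sesqForm_eq (hθ : IsOneOneForm θ) (v w : Cn n) :
    sesqForm θ v w = star v ⬝ᵥ hermitianMatrix (fun v w => θ v w) *ᵥ w := by
  have h1 : ∀ v : Cn n, v = ∑ i, v i • (Pi.single i 1 : Cn n) := fun v => by
    conv_lhs => rw [← Finset.univ_sum_single v]
    refine Finset.sum_congr rfl fun i _ => ?_
    rw [← Pi.single_smul, smul_eq_mul, mul_one]
  conv_lhs => rw [h1 v, h1 w]
  rw [sesqForm_sum_left _ hθ]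
  simp_rw [sesqForm_sum_right, sesqForm_smul_left hθ, sesqForm_smul_right]
  simp only [dotProduct, mulVec, Pi.star_apply, Finset.mul_sum]
  refine Finset.sum_congr rfl fun i _ => Finset.sum_congr rfl fun j _ => ?_
  simp only [hermitianMatrix, of_apply, sesqForm]
  ring

theorem hermitianMatrix_isHermitian (hθ : IsOneOneForm θ) :
    (hermitianMatrix fun v w => θ v w).IsHermitian := by
  ext j k
  exact (sesqForm_conj hθ (Pi.single k 1) (Pi.single j 1)).symm

theorem re_quadratic_hermitianMatrix (hθ : IsOneOneForm θ) (v : Cn n) :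
    (star v ⬝ᵥ hermitianMatrix (fun v w => θ v w) *ᵥ v).re = θ v (Complex.I • v) := by
  rw [← sesqForm_eq hθ]
  simp [sesqForm]

theorem hermitianMatrix_posDef (hθ : IsOneOneForm θ)
    (hpos : ∀ v, v ≠ 0 → 0 < θ v (Complex.I • v)) :
    (hermitianMatrix fun v w => θ v w).PosDef := by
  refine PosDef.of_dotProduct_mulVec_pos (hermitianMatrix_isHermitian hθ) fun v hv => ?_
  rw [← sesqForm_eq hθ, sesqForm, hθ.self]
  simpa using hpos v hv

theorem det_hermitianMatrix_pos (hθ : IsOneOneForm θ)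
    (hpos : ∀ v, v ≠ 0 → 0 < θ v (Complex.I • v)) :
    0 < (hermitianMatrix fun v w => θ v w).det.re :=
  (Complex.pos_iff.1 (hermitianMatrix_posDef hθ hpos).det_pos).1

/-- The hermitian matrix as a real linear function of the form. -/
theorem hermitianMatrix_add_smul (θ θ' : Cn n →L[ℝ] Cn n →L[ℝ] ℝ) (c : ℝ) :
    hermitianMatrix (fun v w => (θ + c • θ') v w)
      = hermitianMatrix (fun v w => θ v w) + (c : ℂ) • hermitianMatrix (fun v w => θ' v w) := by
  ext j k
  simp only [hermitianMatrix, of_apply, _root_.add_apply, _root_.smul_apply, Matrix.add_apply, Matrix.smul_apply,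
    smul_eq_mul]
  push_cast
  ring

theorem det_hermitianMatrix_le {θ' : Cn n →L[ℝ] Cn n →L[ℝ] ℝ} (hθ : IsOneOneForm θ)
    (hθ' : IsOneOneForm θ') (hpos : ∀ v, v ≠ 0 → 0 < θ v (Complex.I • v))
    (hpos' : ∀ v, v ≠ 0 → 0 < θ' v (Complex.I • v)) {C : ℝ} (hC : 0 < C)
    (h : ∀ v, θ v (Complex.I • v) ≤ C * θ' v (Complex.I • v)) :
    (hermitianMatrix fun v w => θ v w).det.re
      ≤ C ^ n * (hermitianMatrix fun v w => θ' v w).det.re := by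
  have hCθ : hermitianMatrix (fun v w => (C • θ') v w)
      = (C : ℂ) • hermitianMatrix (fun v w => θ' v w) := by
    ext j k
    simp only [hermitianMatrix, of_apply, _root_.smul_apply, Matrix.smul_apply, smul_eq_mul]
    push_cast
    ring
  have h1 : (hermitianMatrix fun v w => θ v w).det.re
      ≤ (hermitianMatrix fun v w => (C • θ') v w).det.re := by
    refine (hermitianMatrix_posDef hθ hpos).det_re_le_of_le (hermitianMatrix_posDef (hθ'.smul C)
      fun v hv => ?_) fun v => ?_
    · simpa using mul_pos hC (hpos' v hv)
    · rw [re_quadratic_hermitianMatrix hθ, re_quadratic_hermitianMatrix (hθ'.smul C)]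
      simpa using h v
  refine h1.trans (le_of_eq ?_)
  rw [hCθ, det_smul, Fintype.card_fin, ← Complex.ofReal_pow, Complex.re_ofReal_mul]

/-- Change of coordinates in the determinant of a form. -/
theorem det_hermitianMatrix_comp (hθ : IsOneOneForm θ) (T : Cn n →L[ℂ] Cn n) :
    (hermitianMatrix fun v w => θ (T v) (T w)).det.re
      = |(T.restrictScalars ℝ).det| * (hermitianMatrix fun v w => θ v w).det.re := by
  set M := LinearMap.toMatrix' (T : Cn n →ₗ[ℂ] Cn n) with hM
  have hTM : ∀ v, T v = M *ᵥ v := fun v => by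
    rw [hM, LinearMap.toMatrix'_mulVec]; rfl
  have h1 : (hermitianMatrix fun v w => θ (T v) (T w))
      = Mᴴ * hermitianMatrix (fun v w => θ v w) * M := by
    ext j k
    have h2 : (hermitianMatrix fun v w => θ (T v) (T w)) j k
        = sesqForm θ (T (Pi.single j 1)) (T (Pi.single k 1)) := by
      simp only [hermitianMatrix, of_apply, sesqForm, map_smul]
    rw [h2, sesqForm_eq hθ, hTM, hTM, star_mulVec, ← dotProduct_mulVec, mulVec_mulVec,
      mulVec_mulVec, Matrix.mul_assoc]
    simp [dotProduct, mulVec, Pi.single_apply]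
  have h3 : (T.restrictScalars ℝ).det = Complex.normSq M.det := by
    have h4 : (T.restrictScalars ℝ).det
        = LinearMap.det ((T : Cn n →ₗ[ℂ] Cn n).restrictScalars ℝ) := rfl
    rw [h4, LinearMap.det_restrictScalars, Algebra.norm_complex_apply, hM, LinearMap.det_toMatrix']
  have h5 : (Mᴴ * hermitianMatrix (fun v w => θ v w) * M).det
      = (Complex.normSq M.det : ℂ) * (hermitianMatrix fun v w => θ v w).det := by
    rw [det_mul, det_mul, det_conjTranspose, Complex.normSq_eq_conj_mul_self]
    simp only [starRingEnd_apply]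
    ring
  rw [h1, h5, Complex.re_ofReal_mul, h3, abs_of_nonneg (Complex.normSq_nonneg _)]

end HermitianForms

/-! ### The forms of Kähler potentials and their densities -/

section PotentialForms

open scoped ComplexOrder

variable {n : ℕ}

/-- Multiplication by `i`, as a real linear map. -/
def mulI (n : ℕ) : Cn n →L[ℝ] Cn n := (Complex.I • ContinuousLinearMap.id ℂ (Cn n)).restrictScalars ℝ

@[simp] theorem mulI_apply (v : Cn n) : mulI n v = Complex.I • v := rfl

/-- The form `dd^c f` at a point, as a continuous bilinear map. -/
def ddcL (f : Cn n → ℝ) (p : Cn n) : Cn n →L[ℝ] Cn n →L[ℝ] ℝ :=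
  (4 * Real.pi)⁻¹ • ((fderiv ℝ (fderiv ℝ f) p).bilinearComp (mulI n) (ContinuousLinearMap.id ℝ _)
    - (fderiv ℝ (fderiv ℝ f) p).bilinearComp (ContinuousLinearMap.id ℝ _) (mulI n))

@[simp] theorem ddcL_apply (f : Cn n → ℝ) (p v w : Cn n) : ddcL f p v w = ddc f p v w := by
  rw [ddc_eq, ddcL]
  simp only [smul_apply, sub_apply, ContinuousLinearMap.bilinearComp_apply, smul_eq_mul,
    mulI_apply, ContinuousLinearMap.id_apply]
  ring

theorem isOneOneForm_ddcL {f : Cn n → ℝ} {p : Cn n} (hf : ContDiffAt ℝ 2 f p) :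
    IsOneOneForm (ddcL f p) := by
  have hs : IsSymmSndFDerivAt ℝ f p := hf.isSymmSndFDerivAt (by simp)
  constructor
  · intro v
    rw [ddcL_apply, ddc_eq, hs.eq, sub_self, zero_div]
  · intro v w
    rw [ddcL_apply, ddcL_apply, ddc_eq, ddc_eq, Complex.I_smul_I_smul, Complex.I_smul_I_smul]
    simp only [map_neg, neg_apply]
    ring

variable {X : Type*} [TopologicalSpace X] [ChartedSpace (Cn n) X]

namespace KahlerForm

variable (Ω : KahlerForm n X) {e e' : OpenPartialHomeomorph X (Cn n)}

/-- The form `Ω + dd^c φ` in a chart, as a continuous bilinear map. -/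
def potL (φ : X → ℝ) (e : OpenPartialHomeomorph X (Cn n)) (z : Cn n) : Cn n →L[ℝ] Cn n →L[ℝ] ℝ :=
  Ω.coordL e z + ddcL (fun y => φ (e.symm y)) z

@[simp] theorem potL_apply (φ : X → ℝ) (z v w : Cn n) : Ω.potL φ e z v w = Ω.potForm φ e z v w := by
  simp [potL, potForm]

theorem isOneOneForm_coordL (z : Cn n) : IsOneOneForm (Ω.coordL e z) :=
  ⟨fun v => Ω.coord_self z v, fun v w => Ω.coord_I_smul z v w⟩

theorem isOneOneForm_potL {φ : X → ℝ} {z : Cn n}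
    (hφ : ContDiffAt ℝ 2 (fun y => φ (e.symm y)) z) : IsOneOneForm (Ω.potL φ e z) :=
  (Ω.isOneOneForm_coordL z).add (isOneOneForm_ddcL hφ)

variable [IsManifold 𝓘(ℂ, Cn n) ∞ X] {φ : X → ℝ}

theorem potForm_transition (hφ : ContMDiff 𝓘(ℝ, Cn n) 𝓘(ℝ) ∞ φ) (he : e ∈ atlas (Cn n) X)
    (he' : e' ∈ atlas (Cn n) X) {z : Cn n} (hz : z ∈ e.target) (hz' : e.symm z ∈ e'.source)
    (v w : Cn n) : Ω.potForm φ e z v w = Ω.potForm φ e' (e' (e.symm z))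
      (fderiv ℂ (fun y => e' (e.symm y)) z v) (fderiv ℂ (fun y => e' (e.symm y)) z w) := by
  have hT : ContDiffAt ℂ 2 (fun y => e' (e.symm y)) z :=
    (contDiffAt_transition he he' hz hz').of_le ENat.LEInfty.out
  have hev : (fun y => φ (e.symm y)) =ᶠ[𝓝 z] fun y => φ (e'.symm (e' (e.symm y))) := by
    filter_upwards [(e.continuousAt_symm hz).eventually (e'.open_source.mem_nhds hz')] with y hy
    rw [e'.left_inv hy]
  rw [potForm, potForm, hev.ddc_eq, Ω.coord_transition he he' hz hz',
    ddc_comp (f := fun y => φ (e'.symm y)) (T := fun y => e' (e.symm y)) _ hT]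
  exact (hφ.contDiffAt_chart he' (e'.map_source hz')).of_le ENat.LEInfty.out

/-- The density of `Ω_φ^n` in a chart. -/
def density (φ : X → ℝ) (e : OpenPartialHomeomorph X (Cn n)) (z : Cn n) : ℝ :=
  (n.factorial : ℝ) * (hermitianMatrix (Ω.potForm φ e z)).det.re

theorem hermitianMatrix_potForm (φ : X → ℝ) (e : OpenPartialHomeomorph X (Cn n)) (z : Cn n) :
    hermitianMatrix (Ω.potForm φ e z) = hermitianMatrix fun v w => Ω.potL φ e z v w := by
  simp only [potL_apply]

theorem density_transition (hφ : ContMDiff 𝓘(ℝ, Cn n) 𝓘(ℝ) ∞ φ) (he : e ∈ atlas (Cn n) X)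
    (he' : e' ∈ atlas (Cn n) X) {z : Cn n} (hz : z ∈ e.target) (hz' : e.symm z ∈ e'.source) :
    Ω.density φ e z = |(fderiv ℝ (fun y => e' (e.symm y)) z).det|
      * Ω.density φ e' (e' (e.symm z)) := by
  have hT := contDiffAt_transition he he' hz hz'
  have h1 := det_hermitianMatrix_comp (Ω.isOneOneForm_potL (φ := φ) (e := e')
    (z := e' (e.symm z)) ((hφ.contDiffAt_chart he' (e'.map_source hz')).of_le ENat.LEInfty.out))
    (fderiv ℂ (fun y => e' (e.symm y)) z)
  simp only [potL_apply, ← Ω.potForm_transition hφ he he' hz hz'] at h1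
  rw [← (hT.differentiableAt (by simp)).fderiv_restrictScalars ℝ] at h1
  rw [density, density]
  change (n.factorial : ℝ) * (hermitianMatrix fun v w => Ω.potForm φ e z v w).det.re = _
  rw [h1]
  ring

theorem contDiffOn_potL (hφ : ContMDiff 𝓘(ℝ, Cn n) 𝓘(ℝ) ∞ φ) (he : e ∈ atlas (Cn n) X)
    (v w : Cn n) : ContDiffOn ℝ ∞ (fun z => Ω.potForm φ e z v w) e.target := by
  refine (Ω.smooth e he v w).add fun z hz => ?_
  have h1 := hφ.contDiffAt_chart he hz
  have h2 : ContDiffAt ℝ ∞ (fderiv ℝ (fderiv ℝ fun y => φ (e.symm y))) z :=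
    (h1.fderiv_right (m := ∞) (by simp)).fderiv_right (m := ∞) (by simp)
  have h3 : ∀ v w, ContDiffAt ℝ ∞ (fun z => fderiv ℝ (fderiv ℝ fun y => φ (e.symm y)) z v w) z :=
    fun v w => (h2.clm_apply contDiffAt_const).clm_apply contDiffAt_const
  simp only [ddc_eq]
  exact (((h3 _ _).sub (h3 _ _)).div_const _).contDiffWithinAt

theorem contDiffOn_hermitianMatrix_potForm (hφ : ContMDiff 𝓘(ℝ, Cn n) 𝓘(ℝ) ∞ φ)
    (he : e ∈ atlas (Cn n) X) (j k : Fin n) :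
    ContDiffOn ℝ ∞ (fun z => hermitianMatrix (Ω.potForm φ e z) j k) e.target := by
  simp only [hermitianMatrix, Matrix.of_apply]
  exact (Complex.ofRealCLM.contDiff.comp_contDiffOn (Ω.contDiffOn_potL hφ he _ _)).add
    (contDiffOn_const.mul (Complex.ofRealCLM.contDiff.comp_contDiffOn (Ω.contDiffOn_potL hφ he _ _)))

theorem continuousOn_det_hermitianMatrix (hφ : ContMDiff 𝓘(ℝ, Cn n) 𝓘(ℝ) ∞ φ)
    (he : e ∈ atlas (Cn n) X) :
    ContinuousOn (fun z => (hermitianMatrix (Ω.potForm φ e z)).det) e.target := by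
  simp only [Matrix.det_apply]
  exact continuousOn_finsetSum _ fun σ _ => (continuousOn_finsetProd _ fun i _ =>
    (Ω.contDiffOn_hermitianMatrix_potForm hφ he _ _).continuousOn).const_smul _

theorem continuousOn_density (hφ : ContMDiff 𝓘(ℝ, Cn n) 𝓘(ℝ) ∞ φ) (he : e ∈ atlas (Cn n) X) :
    ContinuousOn (Ω.density φ e) e.target :=
  continuousOn_const.mul
    (Complex.continuous_re.comp_continuousOn (Ω.continuousOn_det_hermitianMatrix hφ he))

theorem IsPotential.contDiffAt_chart {Ω : KahlerForm n X} (hφ : Ω.IsPotential φ)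
    (he : e ∈ atlas (Cn n) X) {z : Cn n} (hz : z ∈ e.target) :
    ContDiffAt ℝ ∞ (fun y => φ (e.symm y)) z := hφ.1.contDiffAt_chart he hz

theorem IsPotential.isOneOneForm {Ω : KahlerForm n X} (hφ : Ω.IsPotential φ)
    (he : e ∈ atlas (Cn n) X) {z : Cn n} (hz : z ∈ e.target) : IsOneOneForm (Ω.potL φ e z) :=
  Ω.isOneOneForm_potL ((hφ.contDiffAt_chart he hz).of_le ENat.LEInfty.out)

theorem IsPotential.density_pos {Ω : KahlerForm n X} (hφ : Ω.IsPotential φ)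
    (he : e ∈ atlas (Cn n) X) {z : Cn n} (hz : z ∈ e.target) : 0 < Ω.density φ e z := by
  rw [density, hermitianMatrix_potForm]
  exact mul_pos (by positivity) (det_hermitianMatrix_pos (hφ.isOneOneForm he hz) fun v hv => by
    simpa using hφ.2 e he z hz v hv)

theorem IsPotential.density_le {Ω : KahlerForm n X} (hφ : Ω.IsPotential φ) {ψ : X → ℝ}
    (hψ : Ω.IsPotential ψ) {C : ℝ} (hC : 0 < C) (he : e ∈ atlas (Cn n) X) {z : Cn n}
    (hz : z ∈ e.target) (h : ∀ v, Ω.potForm φ e z v (Complex.I • v)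
      ≤ C * Ω.potForm ψ e z v (Complex.I • v)) : Ω.density φ e z ≤ C ^ n * Ω.density ψ e z := by
  rw [density, density, hermitianMatrix_potForm, hermitianMatrix_potForm]
  have h1 := det_hermitianMatrix_le (hφ.isOneOneForm he hz) (hψ.isOneOneForm he hz)
    (fun v hv => by simpa using hφ.2 e he z hz v hv)
    (fun v hv => by simpa using hψ.2 e he z hz v hv) hC (fun v => by simpa using h v)
  calc _ ≤ (n.factorial : ℝ) * (C ^ n * (hermitianMatrix fun v w => Ω.potL ψ e z v w).det.re) := by
        gcongr
    _ = _ := by ring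

end KahlerForm

end PotentialForms

/-! ### The measures given by top powers -/

section GluedMeasures

variable {n : ℕ} {X : Type*} [TopologicalSpace X] [ChartedSpace (Cn n) X] [CompactSpace X]
  [MeasurableSpace X] [BorelSpace X]

theorem chartMultiplicity_eq_sum (x : X) : (chartMultiplicity n X x : ENNReal)
    = ∑ c ∈ chartCenters n X, (chartAt (Cn n) c).source.indicator (fun _ => 1) x := by
  classical
  simp only [indicator_apply, chartMultiplicity]
  rw [Finset.sum_boole]

theorem measurable_chartMultiplicity :
    Measurable fun x : X => (chartMultiplicity n X x : ENNReal) := by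
  simp only [chartMultiplicity_eq_sum]
  exact Finset.measurable_sum _ fun c _ =>
    measurable_const.indicator (chartAt (Cn n) c).open_source.measurableSet

theorem chartMultiplicity_ne_zero (x : X) : (chartMultiplicity n X x : ENNReal) ≠ 0 := by
  obtain ⟨c, hc, hx⟩ := (exists_chartCenters n X).choose_spec x
  rw [chartMultiplicity_eq_sum]
  refine (Finset.sum_pos_iff.2 ⟨c, hc, ?_⟩).ne'
  simp [indicator_of_mem hx]

theorem lintegral_glueMeasure {ρ : OpenPartialHomeomorph X (Cn n) → Cn n → ℝ}
    (hρ : ∀ e ∈ atlas (Cn n) X, ContinuousOn (ρ e) e.target) {g : X → ENNReal}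
    (hg : Measurable g) : ∫⁻ x, g x ∂(glueMeasure ρ) = ∑ c ∈ chartCenters n X,
      ∫⁻ z in (chartAt (Cn n) c).target, ENNReal.ofReal (ρ (chartAt (Cn n) c) z) /
        (chartMultiplicity n X ((chartAt (Cn n) c).symm z) : ENNReal)
          * g ((chartAt (Cn n) c).symm z) := by
  rw [glueMeasure, lintegral_finsetSum_measure]
  refine Finset.sum_congr rfl fun c _ => ?_
  set e := chartAt (Cn n) c
  have he : e ∈ atlas (Cn n) X := chart_mem_atlas _ c
  have het : MeasurableSet e.target := e.open_target.measurableSet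
  have hsm : AEMeasurable e.symm (volume.restrict e.target) :=
    e.continuousOn_symm.aemeasurable het
  have hd : AEMeasurable (fun z => ENNReal.ofReal (ρ e z) /
      (chartMultiplicity n X (e.symm z) : ENNReal)) (volume.restrict e.target) :=
    (((hρ e he).aemeasurable het).ennreal_ofReal).div
      (measurable_chartMultiplicity.comp_aemeasurable hsm)
  rw [lintegral_map' hg.aemeasurable (hsm.mono_ac (withDensity_absolutelyContinuous _ _))]
  exact lintegral_withDensity_eq_lintegral_mul₀ hd (hg.comp_aemeasurable hsm)

/-- A family of densities that transforms like a volume form is glued to a measure with these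
densities in all charts. -/
theorem lintegral_glueMeasure_source [IsManifold 𝓘(ℂ, Cn n) ∞ X]
    {ρ : OpenPartialHomeomorph X (Cn n) → Cn n → ℝ}
    (hρ : ∀ e ∈ atlas (Cn n) X, ContinuousOn (ρ e) e.target)
    (htr : ∀ e ∈ atlas (Cn n) X, ∀ e' ∈ atlas (Cn n) X, ∀ z ∈ e.target, e.symm z ∈ e'.source →
      ρ e z = |(fderiv ℝ (fun y => e' (e.symm y)) z).det| * ρ e' (e' (e.symm z)))
    {e : OpenPartialHomeomorph X (Cn n)} (he : e ∈ atlas (Cn n) X) {f : X → ENNReal}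
    (hf : Measurable f) : ∫⁻ x in e.source, f x ∂(glueMeasure ρ)
      = ∫⁻ z in e.target, ENNReal.ofReal (ρ e z) * f (e.symm z) := by
  have hes : MeasurableSet e.source := e.open_source.measurableSet
  have het : MeasurableSet e.target := e.open_target.measurableSet
  have hsm : AEMeasurable e.symm (volume.restrict e.target) :=
    e.continuousOn_symm.aemeasurable het
  rw [← lintegral_indicator hes, lintegral_glueMeasure hρ (hf.indicator hes)]
  -- change of variables in the piece of the chart with center `c`
  have key : ∀ c ∈ chartCenters n X, ∫⁻ z in (chartAt (Cn n) c).target,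
      ENNReal.ofReal (ρ (chartAt (Cn n) c) z) /
        (chartMultiplicity n X ((chartAt (Cn n) c).symm z) : ENNReal)
          * e.source.indicator f ((chartAt (Cn n) c).symm z)
      = ∫⁻ z in e.target, (chartAt (Cn n) c).source.indicator (fun _ => 1) (e.symm z) /
        (chartMultiplicity n X (e.symm z) : ENNReal) * (ENNReal.ofReal (ρ e z) * f (e.symm z)) := by
    intro c _
    set e' := chartAt (Cn n) c
    have he' : e' ∈ atlas (Cn n) X := chart_mem_atlas _ c
    set s : Set (Cn n) := e.target ∩ e.symm ⁻¹' e'.source with hs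
    set s' : Set (Cn n) := e'.target ∩ e'.symm ⁻¹' e.source with hs'
    have hso : IsOpen s := e.symm.isOpen_inter_preimage e'.open_source
    have hso' : IsOpen s' := e'.symm.isOpen_inter_preimage e.open_source
    set T : Cn n → Cn n := fun y => e' (e.symm y) with hT
    have himage : T '' s = s' := by
      ext w
      constructor
      · rintro ⟨z, ⟨hz, hz'⟩, rfl⟩
        refine ⟨e'.map_source hz', ?_⟩
        rw [mem_preimage, hT]
        simp only [e'.left_inv hz', e.map_target hz]
      · rintro ⟨hw, hw'⟩
        refine ⟨e (e'.symm w), ⟨e.map_source hw', ?_⟩, ?_⟩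
        · rw [mem_preimage, e.left_inv hw']; exact e'.map_target hw
        · simp only [hT, e.left_inv hw', e'.right_inv hw]
    have hinj : InjOn T s := by
      rintro z ⟨hz, hz'⟩ w ⟨hw, hw'⟩ h
      exact e.symm.injOn hz hw (e'.injOn hz' hw' h)
    have hder : ∀ z ∈ s, HasFDerivWithinAt T (fderiv ℝ T z) s z := fun z hz =>
      (((contDiffAt_transition he he' hz.1 hz.2).differentiableAt
        (by simp)).restrictScalars ℝ).hasFDerivAt.hasFDerivWithinAt
    calc _ = ∫⁻ z in e'.target, s'.indicator (fun z => ENNReal.ofReal (ρ e' z) /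
          (chartMultiplicity n X (e'.symm z) : ENNReal) * f (e'.symm z)) z := by
          refine setLIntegral_congr_fun e'.open_target.measurableSet fun z hz => ?_
          by_cases h : e'.symm z ∈ e.source
          · rw [indicator_of_mem h, indicator_of_mem (show z ∈ s' from ⟨hz, h⟩)]
          · rw [indicator_of_notMem h, indicator_of_notMem (show z ∉ s' from fun h' => h h'.2),
              mul_zero]
      _ = ∫⁻ z in T '' s, ENNReal.ofReal (ρ e' z) /
          (chartMultiplicity n X (e'.symm z) : ENNReal) * f (e'.symm z) := by
          rw [lintegral_indicator hso'.measurableSet, Measure.restrict_restrict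
            hso'.measurableSet, inter_eq_left.2 inter_subset_left, himage]
      _ = ∫⁻ z in s, ENNReal.ofReal |(fderiv ℝ T z).det| * (ENNReal.ofReal (ρ e' (T z)) /
          (chartMultiplicity n X (e'.symm (T z)) : ENNReal) * f (e'.symm (T z))) :=
          lintegral_image_eq_lintegral_abs_det_fderiv_mul volume hso.measurableSet hder hinj _
      _ = ∫⁻ z in s, (chartMultiplicity n X (e.symm z) : ENNReal)⁻¹
            * (ENNReal.ofReal (ρ e z) * f (e.symm z)) := by
          refine setLIntegral_congr_fun hso.measurableSet fun z hz => ?_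
          have h1 : e'.symm (T z) = e.symm z := e'.left_inv hz.2
          simp only [h1]
          rw [htr e he e' he' z hz.1 hz.2, ENNReal.ofReal_mul (abs_nonneg _), ENNReal.div_eq_inv_mul]
          ring
      _ = ∫⁻ z in e.target, s.indicator (fun z => (chartMultiplicity n X (e.symm z) : ENNReal)⁻¹
            * (ENNReal.ofReal (ρ e z) * f (e.symm z))) z := by
          rw [lintegral_indicator hso.measurableSet, Measure.restrict_restrict
            hso.measurableSet, inter_eq_left.2 inter_subset_left]
      _ = _ := by
          refine setLIntegral_congr_fun het fun z hz => ?_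
          by_cases h : e.symm z ∈ e'.source
          · rw [indicator_of_mem (show z ∈ s from ⟨hz, h⟩)]
            simp only [indicator_of_mem h, one_div]
          · rw [indicator_of_notMem (show z ∉ s from fun h' => h h'.2)]
            simp only [indicator_of_notMem h, ENNReal.zero_div, zero_mul]
  rw [Finset.sum_congr rfl key, ← lintegral_finsetSum']
  · refine setLIntegral_congr_fun het fun z hz => ?_
    rw [← Finset.sum_mul]
    simp_rw [ENNReal.div_eq_inv_mul]
    rw [← Finset.mul_sum, ← chartMultiplicity_eq_sum,
      ENNReal.inv_mul_cancel (chartMultiplicity_ne_zero _) (by simp), one_mul]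
  · intro c _
    refine AEMeasurable.mul (AEMeasurable.div ?_ ?_) (AEMeasurable.mul ?_ ?_)
    · exact (measurable_const.indicator
        (chartAt (Cn n) c).open_source.measurableSet).comp_aemeasurable hsm
    · exact measurable_chartMultiplicity.comp_aemeasurable hsm
    · exact ((hρ e he).aemeasurable het).ennreal_ofReal
    · exact hf.comp_aemeasurable hsm

namespace KahlerForm

variable {Ω : KahlerForm n X} {φ ψ : X → ℝ}

theorem topPower_eq (Ω : KahlerForm n X) (φ : X → ℝ) :
    Ω.topPower φ = glueMeasure (Ω.density φ) := rfl

theorem lintegral_topPower_source [IsManifold 𝓘(ℂ, Cn n) ∞ X]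
    (hφ : ContMDiff 𝓘(ℝ, Cn n) 𝓘(ℝ) ∞ φ) {e : OpenPartialHomeomorph X (Cn n)}
    (he : e ∈ atlas (Cn n) X) {f : X → ENNReal} (hf : Measurable f) :
    ∫⁻ x in e.source, f x ∂(Ω.topPower φ)
      = ∫⁻ z in e.target, ENNReal.ofReal (Ω.density φ e z) * f (e.symm z) :=
  lintegral_glueMeasure_source (fun _ he => Ω.continuousOn_density hφ he)
    (fun _ he _ he' _ hz hz' => Ω.density_transition hφ he he' hz hz') he hf

/-- Comparison of densities gives comparison of the measures. -/
theorem topPower_le [IsManifold 𝓘(ℂ, Cn n) ∞ X] (hφ : ContMDiff 𝓘(ℝ, Cn n) 𝓘(ℝ) ∞ φ)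
    (hψ : ContMDiff 𝓘(ℝ, Cn n) 𝓘(ℝ) ∞ ψ) {D : ℝ} (hD : 0 ≤ D)
    (h : ∀ e ∈ atlas (Cn n) X, ∀ z ∈ e.target, Ω.density φ e z ≤ D * Ω.density ψ e z) :
    Ω.topPower φ ≤ ENNReal.ofReal D • Ω.topPower ψ := by
  refine Measure.le_iff.2 fun s hs => ?_
  rw [Measure.smul_apply, ← lintegral_indicator_one hs, ← lintegral_indicator_one hs, topPower_eq,
    topPower_eq, lintegral_glueMeasure (fun _ he => Ω.continuousOn_density hφ he)
      (measurable_one.indicator hs), lintegral_glueMeasure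
      (fun _ he => Ω.continuousOn_density hψ he) (measurable_one.indicator hs), smul_eq_mul,
    Finset.mul_sum]
  refine Finset.sum_le_sum fun c _ => ?_
  rw [← lintegral_const_mul' _ _ ENNReal.ofReal_ne_top]
  refine setLIntegral_mono_ae' (chartAt (Cn n) c).open_target.measurableSet
    (Eventually.of_forall fun z hz => ?_)
  rw [← mul_assoc, ← mul_div_assoc, ← ENNReal.ofReal_mul hD]
  gcongr
  exact h _ (chart_mem_atlas _ c) z hz

/-- The measures `Ω_φ^n` agree outside a closed set if the potentials do. -/
theorem topPower_compl_eq [IsManifold 𝓘(ℂ, Cn n) ∞ X] (hφ : ContMDiff 𝓘(ℝ, Cn n) 𝓘(ℝ) ∞ φ)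
    (hψ : ContMDiff 𝓘(ℝ, Cn n) 𝓘(ℝ) ∞ ψ) {K : Set X} (hK : IsClosed K)
    (h : ∀ x ∉ K, φ x = ψ x) : Ω.topPower φ Kᶜ = Ω.topPower ψ Kᶜ := by
  have hs : MeasurableSet Kᶜ := hK.measurableSet.compl
  rw [← lintegral_indicator_one hs, ← lintegral_indicator_one hs, topPower_eq,
    topPower_eq, lintegral_glueMeasure (fun _ he => Ω.continuousOn_density hφ he)
      (measurable_one.indicator hs), lintegral_glueMeasure
      (fun _ he => Ω.continuousOn_density hψ he) (measurable_one.indicator hs)]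
  refine Finset.sum_congr rfl fun c _ => ?_
  set e := chartAt (Cn n) c
  refine setLIntegral_congr_fun e.open_target.measurableSet fun z hz => ?_
  by_cases hzK : e.symm z ∈ K
  · simp [hzK]
  · have hev : (fun y => φ (e.symm y)) =ᶠ[𝓝 z] fun y => ψ (e.symm y) := by
      filter_upwards [(e.continuousAt_symm hz).eventually (hK.isOpen_compl.mem_nhds hzK)] with y hy
      exact h _ hy
    have h1 : Ω.density φ e z = Ω.density ψ e z := by
      have : Ω.potForm φ e z = Ω.potForm ψ e z := by
        ext v w
        rw [potForm, potForm, hev.ddc_eq]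
      rw [density, density, this]
    simp only [h1]

theorem isFiniteMeasure_topPower [IsManifold 𝓘(ℂ, Cn n) ∞ X] (Ω : KahlerForm n X)
    (hφ : ContMDiff 𝓘(ℝ, Cn n) 𝓘(ℝ) ∞ φ) : IsFiniteMeasure (Ω.topPower φ) := by
  have : IsLocallyFiniteMeasure (Ω.topPower φ) := by
    refine ⟨fun x => ?_⟩
    set e := chartAt (Cn n) x
    have he : e ∈ atlas (Cn n) X := chart_mem_atlas _ x
    have hxt : e x ∈ e.target := mem_chart_target _ x
    obtain ⟨r, hr, hrt⟩ := Metric.nhds_basis_closedBall.mem_iff.1 (e.open_target.mem_nhds hxt)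
    have hK : IsCompact (Metric.closedBall (e x) r) := isCompact_closedBall _ _
    obtain ⟨M, hM⟩ := hK.bddAbove_image ((Ω.continuousOn_density hφ he).mono hrt)
    set U := e.source ∩ e ⁻¹' Metric.ball (e x) r with hU
    have hUo : IsOpen U := e.isOpen_inter_preimage Metric.isOpen_ball
    refine ⟨U, hUo.mem_nhds ⟨mem_chart_source _ x, Metric.mem_ball_self hr⟩, ?_⟩
    have h1 := lintegral_topPower_source (Ω := Ω) hφ he
      (measurable_one.indicator hUo.measurableSet : Measurable (U.indicator (1 : X → ENNReal)))
    rw [lintegral_indicator_one hUo.measurableSet, Measure.restrict_apply hUo.measurableSet,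
      inter_eq_left.2 inter_subset_left] at h1
    rw [h1]
    calc _ ≤ ∫⁻ z in e.target, (Metric.ball (e x) r).indicator
          (fun _ => ENNReal.ofReal M) z := by
          refine setLIntegral_mono_ae' e.open_target.measurableSet
            (Eventually.of_forall fun z hz => ?_)
          by_cases hzB : z ∈ Metric.ball (e x) r
          · rw [indicator_of_mem hzB]
            calc _ ≤ ENNReal.ofReal M * 1 := by
                  gcongr
                  · exact hM (mem_image_of_mem _ (Metric.ball_subset_closedBall hzB))
                  · exact indicator_le_self' (fun _ _ => zero_le) _
              _ = _ := mul_one _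
          · have : e.symm z ∉ U := fun h => hzB (by
              have := h.2; rwa [mem_preimage, e.right_inv hz] at this)
            simp [this]
      _ ≤ ∫⁻ z, (Metric.ball (e x) r).indicator (fun _ => ENNReal.ofReal M) z :=
          setLIntegral_le_lintegral _ _
      _ < ⊤ := by
          rw [lintegral_indicator measurableSet_ball, lintegral_const, Measure.restrict_apply_univ]
          exact ENNReal.mul_lt_top (by simp) measure_ball_lt_top
  exact CompactSpace.isFiniteMeasure

end KahlerForm

end GluedMeasures

/-! ### Derivatives of determinants -/

section Jacobi

open Matrix

variable {m : Type*} [Fintype m] [DecidableEq m]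

theorem Matrix.adjugate_eq_det_smul_inv {H : Matrix m m ℂ} (hH : IsUnit H.det) :
    H.adjugate = H.det • H⁻¹ := by
  rw [inv_def, smul_smul, Ring.mul_inverse_cancel _ hH, one_smul]

theorem Matrix.hasDerivAt_det_add_smul {H : Matrix m m ℂ} (hH : IsUnit H.det) (E : Matrix m m ℂ) :
    HasDerivAt (fun s : ℝ => (H + (s : ℂ) • E).det) (H.adjugate * E).trace 0 := by
  have h1 : ∀ s : ℝ, (H + (s : ℂ) • E).det = H.det * (1 + (H⁻¹ * E).trace * s
      + (det (1 + (Polynomial.X : Polynomial ℂ) • (H⁻¹ * E).map Polynomial.C)).divX.divX.eval (s : ℂ)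
        * (s : ℂ) ^ 2) := fun s => by
    rw [← det_one_add_smul, ← det_mul, mul_add, Matrix.mul_one, mul_smul_comm,
      mul_nonsing_inv_cancel_left _ _ hH]
  set P := (det (1 + (Polynomial.X : Polynomial ℂ) • (H⁻¹ * E).map Polynomial.C)).divX.divX
  have hs : HasDerivAt (fun s : ℝ => (s : ℂ)) 1 0 := Complex.ofRealCLM.hasDerivAt
  have hP : HasDerivAt (fun s : ℝ => P.eval (s : ℂ)) (P.derivative.eval ((0 : ℝ) : ℂ) * 1) 0 :=
    HasDerivAt.comp (h₂ := fun s : ℂ => P.eval s) (0 : ℝ) (P.hasDerivAt _) hs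
  have h2 := ((((hs.const_mul (H⁻¹ * E).trace).const_add 1).add (hP.mul (hs.pow 2)))).const_mul H.det
  simp only [h1]
  refine h2.congr_deriv ?_
  have h3 : (H.adjugate * E).trace = H.det * (H⁻¹ * E).trace := by
    rw [adjugate_eq_det_smul_inv hH, smul_mul, trace_smul, smul_eq_mul]
  rw [h3]
  simp

theorem Matrix.hasDerivAt_det_line {H E : Matrix m m ℂ} {s : ℝ}
    (hH : IsUnit (H + (s : ℂ) • E).det) :
    HasDerivAt (fun s : ℝ => (H + (s : ℂ) • E).det) ((H + (s : ℂ) • E).adjugate * E).trace s := by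
  have h1 := hasDerivAt_det_add_smul hH E
  have h2 : HasDerivAt (fun r : ℝ => r - s) 1 s := (hasDerivAt_id s).sub_const s
  rw [← sub_self s] at h1
  have h3 := HasDerivAt.scomp (g₁ := fun r : ℝ => (H + (s : ℂ) • E + (r : ℂ) • E).det)
    (h := fun r => r - s) s h1 h2
  simp only [one_smul] at h3
  refine h3.congr_of_eventuallyEq (Eventually.of_forall fun r => ?_)
  simp only [Function.comp_apply]
  push_cast
  rw [add_assoc, ← add_smul, add_sub_cancel]

variable {E : Type*} [NormedAddCommGroup E] [NormedSpace ℝ E] {H : E → Matrix m m ℂ} {z : E}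

theorem ContDiffAt.matrix_det {k : WithTop ℕ∞} (hH : ∀ i j, ContDiffAt ℝ k (fun z => H z i j) z) :
    ContDiffAt ℝ k (fun z => (H z).det) z := by
  simp only [det_apply]
  exact ContDiffAt.sum fun σ _ => (contDiffAt_prod fun i _ => hH _ _).const_smul _

theorem ContinuousOn.matrix_det' {Y : Type*} [TopologicalSpace Y] {H : Y → Matrix m m ℂ} {s : Set Y}
    (hH : ∀ i j, ContinuousOn (fun z => H z i j) s) : ContinuousOn (fun z => (H z).det) s := by
  simp only [det_apply]
  exact continuousOn_finsetSum _ fun σ _ => (continuousOn_finsetProd _ fun i _ =>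
    hH _ _).const_smul _

theorem ContDiffAt.matrix_adjugate {k : WithTop ℕ∞}
    (hH : ∀ i j, ContDiffAt ℝ k (fun z => H z i j) z) (i j : m) :
    ContDiffAt ℝ k (fun z => (H z).adjugate i j) z := by
  simp only [adjugate_apply]
  refine ContDiffAt.matrix_det fun a b => ?_
  simp only [updateRow_apply]
  split_ifs
  · exact contDiffAt_const
  · exact hH _ _

theorem ContinuousOn.matrix_adjugate' {Y : Type*} [TopologicalSpace Y] {H : Y → Matrix m m ℂ}
    {s : Set Y} (hH : ∀ i j, ContinuousOn (fun z => H z i j) s) (i j : m) :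
    ContinuousOn (fun z => (H z).adjugate i j) s := by
  simp only [adjugate_apply]
  refine ContinuousOn.matrix_det' fun a b => ?_
  simp only [updateRow_apply]
  split_ifs
  · exact continuousOn_const
  · exact hH _ _

/-- Jacobi's formula for the derivative of a determinant. -/
theorem fderiv_matrix_det (hH : ∀ i j, DifferentiableAt ℝ (fun z => H z i j) z)
    (hu : IsUnit (H z).det) (v : E) : fderiv ℝ (fun z => (H z).det) z v
      = ((H z).adjugate * Matrix.of fun i j => fderiv ℝ (fun z => H z i j) z v).trace := by
  set D : (m → m → ℂ) → ℂ := fun M => (Matrix.of M).det with hD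
  have hDd : Differentiable ℝ D := fun M =>
    (ContDiffAt.matrix_det (k := 1) (H := fun M : m → m → ℂ => Matrix.of M) fun i j =>
      (contDiff_apply_apply ℝ ℂ i j).contDiffAt).differentiableAt (by simp)
  set M : E → m → m → ℂ := fun z i j => H z i j with hM
  have hM' : HasFDerivAt M
      (ContinuousLinearMap.pi fun i => ContinuousLinearMap.pi fun j => fderiv ℝ (fun z => H z i j) z) z :=
    hasFDerivAt_pi.2 fun i => hasFDerivAt_pi.2 fun j => (hH i j).hasFDerivAt
  have h1 : HasFDerivAt (fun z => (H z).det) ((fderiv ℝ D (M z)).comp _) z :=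
    HasFDerivAt.comp (g := D) z (hDd (M z)).hasFDerivAt hM'
  rw [h1.fderiv, ContinuousLinearMap.comp_apply]
  set V : m → m → ℂ := fun i j => fderiv ℝ (fun z => H z i j) z v
  change fderiv ℝ D (M z) V = _
  have hlin : HasDerivAt (fun s : ℝ => M z + s • V) V 0 := by
    simpa using ((hasDerivAt_id (0 : ℝ)).smul_const V).const_add (M z)
  have h2 : HasDerivAt (fun s : ℝ => D (M z + s • V)) (fderiv ℝ D (M z) V) 0 := by
    have h3 : HasFDerivAt D (fderiv ℝ D (M z)) (M z + (0 : ℝ) • V) := by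
      rw [zero_smul, add_zero]; exact (hDd (M z)).hasFDerivAt
    exact h3.comp_hasDerivAt 0 hlin
  have h4 := hasDerivAt_det_add_smul hu (Matrix.of V)
  exact h2.unique h4

end Jacobi

/-! ### Divergence of the cofactor matrix -/

section Piola

open Matrix

variable {n : ℕ}

/-- The operator `2 ∂/∂z̄_j`. -/
def dbar (j : Fin n) (F : Cn n → ℂ) (z : Cn n) : ℂ :=
  fderiv ℝ F z (Pi.single j 1) + Complex.I * fderiv ℝ F z (Complex.I • Pi.single j 1)

variable {F G : Cn n → ℂ} {z : Cn n}

theorem dbar_mul (j : Fin n) (hF : DifferentiableAt ℝ F z) (hG : DifferentiableAt ℝ G z) :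
    dbar j (fun z => F z * G z) z = dbar j F z * G z + F z * dbar j G z := by
  have h := (hF.hasFDerivAt.mul hG.hasFDerivAt).fderiv
  simp only [dbar]
  rw [show fderiv ℝ (fun z => F z * G z) z = _ from h]
  simp only [_root_.add_apply, _root_.smul_apply, smul_eq_mul]
  ring

theorem dbar_sum {ι : Type*} (j : Fin n) (s : Finset ι) {F : ι → Cn n → ℂ}
    (hF : ∀ i ∈ s, DifferentiableAt ℝ (F i) z) :
    dbar j (fun z => ∑ i ∈ s, F i z) z = ∑ i ∈ s, dbar j (F i) z := by
  have h := (HasFDerivAt.fun_sum fun i hi => (hF i hi).hasFDerivAt).fderiv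
  simp only [dbar]
  rw [h]
  simp only [_root_.sum_apply]
  rw [Finset.mul_sum, Finset.sum_add_distrib]

theorem dbar_const (j : Fin n) (c : ℂ) : dbar j (fun _ => c) z = 0 := by
  simp [dbar]

theorem Filter.EventuallyEq.dbar_eq (j : Fin n) (h : F =ᶠ[𝓝 z] G) : dbar j F z = dbar j G z := by
  simp only [dbar, h.fderiv_eq]

theorem integral_dbar_eq_zero (j : Fin n) (hF : ContDiff ℝ 1 F) (hFc : HasCompactSupport F) :
    ∫ z, dbar j F z = 0 := by
  have hcont : ∀ v, Continuous fun z => fderiv ℝ F z v := fun v =>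
    (hF.continuous_fderiv (by simp)).clm_apply continuous_const
  have hsupp : ∀ v, HasCompactSupport fun z => fderiv ℝ F z v := fun v =>
    (hFc.fderiv ℝ).comp_left (g := fun L : Cn n →L[ℝ] ℂ => L v) rfl
  have hint : ∀ v, Integrable fun z => fderiv ℝ F z v := fun v =>
    (hcont v).integrable_of_hasCompactSupport (hsupp v)
  have h0 : ∀ v, ∫ z, fderiv ℝ F z v = 0 := fun v => by
    have h := integral_bilinear_fderiv_right_eq_neg_left_of_integrable (μ := volume)
      (f := fun _ : Cn n => (1 : ℝ)) (g := F) (v := v) (B := ContinuousLinearMap.lsmul ℝ ℝ)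
      (by simp) (by simpa using hint v)
      (by simpa using hF.continuous.integrable_of_hasCompactSupport hFc)
      (fun _ _ => differentiableAt_const _) (fun z _ => hF.differentiable (by simp) z)
    simpa using h
  simp only [dbar]
  rw [integral_add (hint _) ((hint _).const_mul _), integral_const_mul, h0, h0]
  simp

/-- The rows of the cofactor matrix of a `∂̄`-closed matrix are divergence free. -/
theorem sum_dbar_adjugate_eq_zero {H : Cn n → Matrix (Fin n) (Fin n) ℂ}
    (hH : ∀ i j, DifferentiableAt ℝ (fun z => H z i j) z)
    (hA : ∀ i j, DifferentiableAt ℝ (fun z => (H z).adjugate i j) z) (hu : IsUnit (H z).det)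
    (hd : DifferentiableAt ℝ (fun z => (H z).det) z)
    (hclosed : ∀ l j k, dbar l (fun z => H z j k) z = dbar j (fun z => H z l k) z) (k : Fin n) :
    ∑ l, dbar l (fun z => (H z).adjugate k l) z = 0 := by
  set P := (H z)⁻¹ with hP
  set d := (H z).det with hd'
  have hadj : (H z).adjugate = d • P := adjugate_eq_det_smul_inv hu
  set Ed : Fin n → Matrix (Fin n) (Fin n) ℂ := fun l => Matrix.of fun i j => dbar l (fun z => H z i j) z
    with hEd
  set Ad : Fin n → Matrix (Fin n) (Fin n) ℂ := fun l =>
    Matrix.of fun i j => dbar l (fun z => (H z).adjugate i j) z with hAd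
  have hdet : ∀ l, dbar l (fun z => (H z).det) z = d * (P * Ed l).trace := by
    intro l
    rw [dbar, fderiv_matrix_det hH hu, fderiv_matrix_det hH hu, hadj, smul_mul, smul_mul, trace_smul,
      trace_smul]
    simp only [hEd, dbar, trace, diag_apply, mul_apply, of_apply, smul_eq_mul, mul_add,
      Finset.sum_add_distrib, Finset.mul_sum]
    congr 1
    refine Finset.sum_congr rfl fun i _ => Finset.sum_congr rfl fun j _ => ?_
    ring
  -- differentiate `H * adj H = det H`
  have hAeq : ∀ l, Ad l = d • ((P * Ed l).trace • P - P * Ed l * P) := by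
    intro l
    have h1 : Ed l * (H z).adjugate + H z * Ad l = (d * (P * Ed l).trace) • (1 : Matrix _ _ ℂ) := by
      ext i j
      have h2 : (fun y => ∑ a, H y i a * (H y).adjugate a j)
          = fun y => (H y).det * (1 : Matrix (Fin n) (Fin n) ℂ) i j := by
        ext y
        rw [← mul_apply, mul_adjugate, Matrix.smul_apply, smul_eq_mul]
      have h3 := dbar_sum l Finset.univ (z := z) (F := fun a y => H y i a * (H y).adjugate a j)
        fun a _ => (hH i a).mul (hA a j)
      rw [h2, dbar_mul l hd (differentiableAt_const _), dbar_const, hdet, mul_zero, add_zero] at h3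
      simp only [dbar_mul l (hH i _) (hA _ j), Finset.sum_add_distrib] at h3
      simp only [Matrix.add_apply, mul_apply, hEd, hAd, of_apply, Matrix.smul_apply, smul_eq_mul]
      exact h3.symm
    have h4 : Ad l = P * (H z * Ad l) := by rw [hP, nonsing_inv_mul_cancel_left _ _ hu]
    rw [h4, eq_sub_of_add_eq' h1, mul_sub, hadj]
    simp only [mul_smul_comm, Matrix.mul_one, mul_smul, smul_sub, Matrix.mul_assoc]
  have hEsymm : ∀ l i j, Ed l i j = Ed i l j := fun l i j => hclosed l i j
  have h5 : ∀ l, dbar l (fun z => (H z).adjugate k l) z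
      = d * ((∑ i, ∑ j, P i j * Ed l j i * P k l) - ∑ i, ∑ j, P k j * Ed l j i * P i l) := by
    intro l
    have h6 : dbar l (fun z => (H z).adjugate k l) z = Ad l k l := rfl
    rw [h6, hAeq]
    simp only [Matrix.smul_apply, Matrix.sub_apply, smul_eq_mul, trace, diag_apply, mul_apply,
      Finset.sum_mul]
  simp_rw [h5]
  rw [← Finset.mul_sum, Finset.sum_sub_distrib]
  -- By closedness both sums agree up to a permutation of the summation indices.
  have h7 : ∑ l, ∑ i, ∑ j, P i j * Ed l j i * P k l = ∑ l, ∑ i, ∑ j, P k j * Ed l j i * P i l := by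
    calc _ = ∑ l, ∑ i, ∑ j, P i j * Ed j l i * P k l := by simp_rw [hEsymm _ _ _]
      _ = ∑ l, ∑ j, ∑ i, P i j * Ed j l i * P k l := by
        refine Finset.sum_congr rfl fun l _ => Finset.sum_comm
      _ = ∑ j, ∑ l, ∑ i, P i j * Ed j l i * P k l := Finset.sum_comm
      _ = ∑ j, ∑ i, ∑ l, P i j * Ed j l i * P k l := by
        refine Finset.sum_congr rfl fun l _ => Finset.sum_comm
      _ = _ := by
        refine Finset.sum_congr rfl fun l _ => Finset.sum_congr rfl fun i _ =>
          Finset.sum_congr rfl fun j _ => ?_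
        ring
  rw [h7, sub_self, mul_zero]

/-- Closed forms of type `(1, 1)` have `∂̄`-closed Hermitian matrices. -/
theorem dbar_hermitianMatrix_comm {Θ : Cn n → Cn n →L[ℝ] Cn n →L[ℝ] ℝ}
    (h11 : ∀ᶠ y in 𝓝 z, IsOneOneForm (Θ y)) (hd : ∀ v w, DifferentiableAt ℝ (fun y => Θ y v w) z)
    (hc : ∀ a b c, fderiv ℝ (fun y => Θ y b c) z a + fderiv ℝ (fun y => Θ y c a) z b
      + fderiv ℝ (fun y => Θ y a b) z c = 0) (l j k : Fin n) :
    dbar l (fun y => hermitianMatrix (fun v w => Θ y v w) j k) z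
      = dbar j (fun y => hermitianMatrix (fun v w => Θ y v w) l k) z := by
  have hH : ∀ j k v, fderiv ℝ (fun y => hermitianMatrix (fun v w => Θ y v w) j k) z v
      = (fderiv ℝ (fun y => Θ y (Pi.single j 1) (Complex.I • Pi.single k 1)) z v : ℂ)
        + Complex.I * (fderiv ℝ (fun y => Θ y (Pi.single j 1) (Pi.single k 1)) z v : ℂ) := by
    intro j k v
    have h1 : ∀ v w, HasFDerivAt (fun y => ((Θ y v w : ℝ) : ℂ))
        (Complex.ofRealCLM.comp (fderiv ℝ (fun y => Θ y v w) z)) z := fun v w =>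
      Complex.ofRealCLM.hasFDerivAt.comp z (hd v w).hasFDerivAt
    have h2 := ((h1 (Pi.single j 1) (Complex.I • Pi.single k 1)).add
      ((h1 (Pi.single j 1) (Pi.single k 1)).const_mul Complex.I)).fderiv
    simp only [hermitianMatrix, of_apply]
    rw [show fderiv ℝ (fun y => (Θ y (Pi.single j 1) (Complex.I • Pi.single k 1) : ℂ)
      + Complex.I * (Θ y (Pi.single j 1) (Pi.single k 1) : ℂ)) z = _ from h2]
    rfl
  have hsw : ∀ v w a, fderiv ℝ (fun y => Θ y v w) z a = -fderiv ℝ (fun y => Θ y w v) z a := by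
    intro v w a
    have h1 : (fun y => Θ y v w) =ᶠ[𝓝 z] fun y => -Θ y w v := by
      filter_upwards [h11] with y hy using hy.swap v w
    rw [h1.fderiv_eq, show fderiv ℝ (fun y => -Θ y w v) z = _ from fderiv_neg]
    rfl
  have hI : ∀ v w a, fderiv ℝ (fun y => Θ y (Complex.I • v) (Complex.I • w)) z a
      = fderiv ℝ (fun y => Θ y v w) z a := by
    intro v w a
    have h1 : (fun y => Θ y (Complex.I • v) (Complex.I • w)) =ᶠ[𝓝 z] fun y => Θ y v w := by
      filter_upwards [h11] with y hy using hy.I_smul v w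
    rw [h1.fderiv_eq]
  have hIl : ∀ v w a, fderiv ℝ (fun y => Θ y (Complex.I • v) w) z a
      = -fderiv ℝ (fun y => Θ y v (Complex.I • w)) z a := by
    intro v w a
    have h1 : (fun y => Θ y (Complex.I • v) w) =ᶠ[𝓝 z] fun y => -Θ y v (Complex.I • w) := by
      filter_upwards [h11] with y hy using hy.I_left v w
    rw [h1.fderiv_eq, show fderiv ℝ (fun y => -Θ y v (Complex.I • w)) z = _ from fderiv_neg]
    rfl
  simp only [dbar, hH]
  set L : Cn n := Pi.single l 1
  set J : Cn n := Pi.single j 1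
  set K : Cn n := Pi.single k 1
  have c1 := hc L J (Complex.I • K)
  have c2 := hc (Complex.I • L) (Complex.I • J) (Complex.I • K)
  have c3 := hc L J K
  have c4 := hc (Complex.I • L) (Complex.I • J) K
  rw [hI, hI, hI] at c2
  rw [hIl, hI, hsw K, hIl, neg_neg] at c4
  rw [hsw (Complex.I • K)] at c1
  rw [hsw K L] at c2 c3
  apply Complex.ext
  · simp
    linarith
  · simp
    linarith

theorem fderiv_ddc_cyclic {w : Cn n → ℝ} (hw : ContDiff ℝ ∞ w) (z a b c : Cn n) :
    fderiv ℝ (fun y => ddc w y b c) z a + fderiv ℝ (fun y => ddc w y c a) z b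
      + fderiv ℝ (fun y => ddc w y a b) z c = 0 := by
  have hD : ContDiff ℝ ∞ (fderiv ℝ w) := hw.fderiv_right (m := ∞) (by simp)
  have hDD : ContDiff ℝ ∞ (fderiv ℝ (fderiv ℝ w)) := hD.fderiv_right (m := ∞) (by simp)
  set T : Cn n → Cn n → Cn n → ℝ := fun a b c =>
    fderiv ℝ (fun y => fderiv ℝ (fderiv ℝ w) y b c) z a with hT
  have hdiff : ∀ b c, DifferentiableAt ℝ (fun y => fderiv ℝ (fderiv ℝ w) y b c) z := fun b c =>
    (((hDD.clm_apply contDiff_const).clm_apply contDiff_const).differentiable (by simp)) z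
  have h23 : ∀ a b c, T a b c = T a c b := by
    intro a b c
    have : (fun y => fderiv ℝ (fderiv ℝ w) y b c) = fun y => fderiv ℝ (fderiv ℝ w) y c b := by
      ext y
      exact ((hw.contDiffAt (x := y)).isSymmSndFDerivAt
        (by simpa using ENat.LEInfty.out)).eq b c
    simp only [hT, this]
  have h12 : ∀ a b c, T a b c = T b a c := by
    intro a b c
    set g : Cn n → ℝ := fun y => fderiv ℝ w y c with hg
    have hgs : ContDiff ℝ ∞ g := hD.clm_apply contDiff_const
    have h1 : ∀ b, (fun y => fderiv ℝ (fderiv ℝ w) y b c) = fun y => fderiv ℝ g y b := by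
      intro b
      ext y
      have h2 := ((hD.differentiable (by simp) y).hasFDerivAt.clm_apply
        (hasFDerivAt_const c y)).fderiv
      rw [show fderiv ℝ g y = _ from h2]
      simp
    have h3 : ∀ a b, T a b c = fderiv ℝ (fderiv ℝ g) z a b := by
      intro a b
      simp only [hT, h1]
      have h2 := (((hgs.fderiv_right (m := ∞) (by simp)).differentiable
        (by simp) z).hasFDerivAt.clm_apply (hasFDerivAt_const b z)).fderiv
      rw [show fderiv ℝ (fun y => fderiv ℝ g y b) z = _ from h2]
      simp
    rw [h3, h3]
    exact ((hgs.contDiffAt (x := z)).isSymmSndFDerivAt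
        (by simpa using ENat.LEInfty.out)).eq a b
  have hddc : ∀ a b c, fderiv ℝ (fun y => ddc w y b c) z a
      = (T a (Complex.I • b) c - T a b (Complex.I • c)) / (4 * Real.pi) := by
    intro a b c
    have h1 := (((hdiff (Complex.I • b) c).hasFDerivAt.sub
      (hdiff b (Complex.I • c)).hasFDerivAt).mul_const (4 * Real.pi)⁻¹).fderiv
    simp only [ddc_eq, div_eq_mul_inv]
    rw [show fderiv ℝ (fun y => (fderiv ℝ (fderiv ℝ w) y (Complex.I • b) c
      - fderiv ℝ (fderiv ℝ w) y b (Complex.I • c)) * (4 * Real.pi)⁻¹) z = _ from h1]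
    simp only [_root_.smul_apply, _root_.sub_apply, smul_eq_mul, hT]
    ring
  rw [hddc, hddc, hddc]
  have e1 : T b c (Complex.I • a) = T c (Complex.I • a) b := by rw [h12, h23]
  have e2 : T c a (Complex.I • b) = T a (Complex.I • b) c := by rw [h12, h23]
  have e3 : T a b (Complex.I • c) = T b (Complex.I • c) a := by rw [h12, h23]
  rw [e1, e2, e3]
  ring

end Piola

/-! ### Integration by parts in a chart -/

section LocalStokes

open Matrix

variable {n : ℕ}

/-- The functions `(1/2π) ∂w/∂z_k`, whose `∂̄`-derivatives are the coefficients of `dd^c w`. -/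
def dzCoeff (w : Cn n → ℝ) (k : Fin n) (z : Cn n) : ℂ :=
  ((4 * Real.pi)⁻¹ : ℝ) * ((fderiv ℝ w z (Pi.single k 1) : ℂ)
    - Complex.I * (fderiv ℝ w z (Complex.I • Pi.single k 1) : ℂ))

variable {w : Cn n → ℝ}

theorem contDiff_dzCoeff (hw : ContDiff ℝ ∞ w) (k : Fin n) : ContDiff ℝ ∞ (dzCoeff w k) := by
  have hD : ContDiff ℝ ∞ (fderiv ℝ w) := hw.fderiv_right (m := ∞) (by simp)
  have h1 : ∀ v, ContDiff ℝ ∞ fun z => (fderiv ℝ w z v : ℂ) := fun v =>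
    Complex.ofRealCLM.contDiff.comp (hD.clm_apply contDiff_const)
  exact contDiff_const.mul ((h1 _).sub (contDiff_const.mul (h1 _)))

theorem tsupport_dzCoeff_subset (k : Fin n) : tsupport (dzCoeff w k) ⊆ tsupport w := by
  refine closure_minimal (fun z hz => ?_) (isClosed_tsupport w)
  by_contra h
  have h1 : fderiv ℝ w z = 0 := by
    by_contra h2
    exact h (support_fderiv_subset ℝ h2)
  exact hz (by simp [dzCoeff, h1])

theorem dbar_dzCoeff (hw : ContDiff ℝ ∞ w) (j k : Fin n) (z : Cn n) :
    dbar j (dzCoeff w k) z = hermitianMatrix (ddc w z) j k := by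
  have hD : ContDiff ℝ ∞ (fderiv ℝ w) := hw.fderiv_right (m := ∞) (by simp)
  have h1 : ∀ v, HasFDerivAt (fun z => (fderiv ℝ w z v : ℂ))
      (Complex.ofRealCLM.comp ((fderiv ℝ (fderiv ℝ w) z).flip v)) z := fun v => by
    have h2 := (hD.differentiable (by simp) z).hasFDerivAt.clm_apply (hasFDerivAt_const v z)
    have h3 : HasFDerivAt (fun z => fderiv ℝ w z v) ((fderiv ℝ (fderiv ℝ w) z).flip v) z :=
      h2.congr_fderiv (by ext a; simp)
    exact Complex.ofRealCLM.hasFDerivAt.comp z h3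
  have h4 := (((h1 (Pi.single k 1)).sub ((h1 (Complex.I • Pi.single k 1)).const_mul
    Complex.I)).const_mul (((4 * Real.pi)⁻¹ : ℝ) : ℂ)).fderiv
  have h5 : fderiv ℝ (dzCoeff w k) z = _ := h4
  rw [dbar, h5]
  simp only [hermitianMatrix, of_apply, ddc_eq, Complex.I_smul_I_smul, _root_.smul_apply,
    _root_.sub_apply, smul_eq_mul, ContinuousLinearMap.comp_apply, ContinuousLinearMap.flip_apply,
    Complex.ofRealCLM_apply, map_neg]
  push_cast
  have hπ : (Real.pi : ℂ) ≠ 0 := by exact_mod_cast Real.pi_ne_zero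
  field_simp
  linear_combination (-(fderiv ℝ (fderiv ℝ w) z (Complex.I • Pi.single j 1)
    (Complex.I • Pi.single k 1) : ℂ)) * Complex.I_sq

theorem continuous_hermitianMatrix_ddc (hw : ContDiff ℝ ∞ w) (j k : Fin n) :
    ContDiff ℝ ∞ fun z => hermitianMatrix (ddc w z) j k := by
  have hD : ContDiff ℝ ∞ (fderiv ℝ w) := hw.fderiv_right (m := ∞) (by simp)
  have hDD : ContDiff ℝ ∞ (fderiv ℝ (fderiv ℝ w)) := hD.fderiv_right (m := ∞) (by simp)
  have h1 : ∀ a b, ContDiff ℝ ∞ fun z => ((ddc w z a b : ℝ) : ℂ) := fun a b => by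
    simp only [ddc_eq]
    exact Complex.ofRealCLM.contDiff.comp
      ((((hDD.clm_apply contDiff_const).clm_apply contDiff_const).sub
        ((hDD.clm_apply contDiff_const).clm_apply contDiff_const)).div_const _)
  simp only [hermitianMatrix, of_apply]
  exact (h1 _ _).add (contDiff_const.mul (h1 _ _))

theorem hermitianMatrix_ddc_eq_zero {z : Cn n} (hz : z ∉ tsupport w) :
    hermitianMatrix (ddc w z) = 0 := by
  have h1 : w =ᶠ[𝓝 z] fun _ => 0 := by
    filter_upwards [(isClosed_tsupport w).isOpen_compl.mem_nhds hz] with y hy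
    exact image_eq_zero_of_notMem_tsupport hy
  ext j k
  simp [hermitianMatrix, h1.ddc_eq, ddc_eq]

/-- Integration by parts: the linearization of the determinant at a closed form integrates to zero
against `dd^c w`, for `w` with compact support. -/
theorem integral_trace_adjugate_mul_ddc {U : Set (Cn n)} (hU : IsOpen U)
    {Θ : Cn n → Cn n →L[ℝ] Cn n →L[ℝ] ℝ} (h11 : ∀ z ∈ U, IsOneOneForm (Θ z))
    (hs : ∀ v w, ContDiffOn ℝ ∞ (fun z => Θ z v w) U)
    (hc : ∀ z ∈ U, ∀ a b c, fderiv ℝ (fun y => Θ y b c) z a + fderiv ℝ (fun y => Θ y c a) z b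
      + fderiv ℝ (fun y => Θ y a b) z c = 0)
    (hu : ∀ z ∈ U, IsUnit (hermitianMatrix fun v w => Θ z v w).det) (hw : IsTestFunction U w) :
    ∫ z, ((hermitianMatrix fun v w => Θ z v w).adjugate * hermitianMatrix (ddc w z)).trace = 0 := by
  set H : Cn n → Matrix (Fin n) (Fin n) ℂ := fun z => hermitianMatrix fun v w => Θ z v w with hH
  obtain ⟨hws, hwc, hwU⟩ := hw
  have hHs : ∀ i j, ∀ z ∈ U, ContDiffAt ℝ ∞ (fun z => H z i j) z := by
    intro i j z hz
    have h1 : ∀ a b, ContDiffAt ℝ ∞ (fun z => ((Θ z a b : ℝ) : ℂ)) z := fun a b =>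
      Complex.ofRealCLM.contDiff.contDiffAt.comp z ((hs a b).contDiffAt (hU.mem_nhds hz))
    simp only [hH, hermitianMatrix, of_apply]
    exact (h1 _ _).add (contDiffAt_const.mul (h1 _ _))
  have hAs : ∀ i j, ∀ z ∈ U, ContDiffAt ℝ ∞ (fun z => (H z).adjugate i j) z := fun i j z hz =>
    ContDiffAt.matrix_adjugate (fun i j => hHs i j z hz) i j
  set F : Fin n → Cn n → ℂ := fun j z => ∑ k, (H z).adjugate k j * dzCoeff w k z with hF
  have hFU : ∀ j, ∀ z ∈ U, ContDiffAt ℝ ∞ (F j) z := fun j z hz =>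
    ContDiffAt.sum fun k _ => (hAs k j z hz).mul (contDiff_dzCoeff hws k).contDiffAt
  have hF0 : ∀ j, ∀ z ∉ tsupport w, F j z = 0 := fun j z hz => by
    simp only [hF]
    refine Finset.sum_eq_zero fun k _ => ?_
    rw [image_eq_zero_of_notMem_tsupport fun h => hz (tsupport_dzCoeff_subset k h), mul_zero]
  have hF0' : ∀ j, ∀ z ∉ tsupport w, F j =ᶠ[𝓝 z] fun _ => 0 := fun j z hz => by
    filter_upwards [(isClosed_tsupport w).isOpen_compl.mem_nhds hz] with y hy using hF0 j y hy
  have hFs : ∀ j, ContDiff ℝ ∞ (F j) := fun j => contDiff_iff_contDiffAt.2 fun z => by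
    by_cases hz : z ∈ tsupport w
    · exact hFU j z (hwU hz)
    · exact contDiffAt_const.congr_of_eventuallyEq (hF0' j z hz)
  have hFc : ∀ j, HasCompactSupport (F j) := fun j => by
    refine HasCompactSupport.of_support_subset_isCompact hwc fun z hz => ?_
    by_contra h
    exact hz (hF0 j z h)
  -- Since the cofactor matrix is divergence free, the trace is the divergence of `F`.
  have hdiv : ∀ z, ((H z).adjugate * hermitianMatrix (ddc w z)).trace = ∑ j, dbar j (F j) z := by
    intro z
    by_cases hz : z ∈ tsupport w
    · have hzU := hwU hz
      have hAd : ∀ i j, DifferentiableAt ℝ (fun z => (H z).adjugate i j) z := fun i j =>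
        (hAs i j z hzU).differentiableAt (by simp)
      have hgd : ∀ k, DifferentiableAt ℝ (dzCoeff w k) z := fun k =>
        (contDiff_dzCoeff hws k).differentiable (by simp) z
      have hpiola := sum_dbar_adjugate_eq_zero (H := H) (z := z)
        (fun i j => (hHs i j z hzU).differentiableAt (by simp)) hAd (hu z hzU)
        ((ContDiffAt.matrix_det fun i j => hHs i j z hzU).differentiableAt (by simp))
        (dbar_hermitianMatrix_comm (by filter_upwards [hU.mem_nhds hzU] with y hy using h11 y hy)
          (fun v w => ((hs v w).contDiffAt (hU.mem_nhds hzU)).differentiableAt (by simp)) (hc z hzU))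
      have h1 : ∀ j, dbar j (F j) z = ∑ k, (dbar j (fun z => (H z).adjugate k j) z * dzCoeff w k z
          + (H z).adjugate k j * hermitianMatrix (ddc w z) j k) := fun j => by
        rw [hF]
        simp only
        rw [dbar_sum (F := fun k z => (H z).adjugate k j * dzCoeff w k z) j _
          fun k _ => (hAd k j).mul (hgd k)]
        refine Finset.sum_congr rfl fun k _ => ?_
        rw [dbar_mul j (hAd k j) (hgd k), dbar_dzCoeff hws]
      simp_rw [h1, Finset.sum_add_distrib]
      rw [Finset.sum_comm]
      simp_rw [← Finset.sum_mul, hpiola]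
      simp only [zero_mul, Finset.sum_const_zero, zero_add, trace, diag_apply, mul_apply]
      exact Finset.sum_comm
    · rw [hermitianMatrix_ddc_eq_zero hz, Matrix.mul_zero, trace_zero]
      exact (Finset.sum_eq_zero fun j _ => by rw [(hF0' j z hz).dbar_eq, dbar_const]).symm
  rw [integral_congr_ae (Eventually.of_forall hdiv)]
  have hdc : ∀ j, Integrable fun z => dbar j (F j) z := fun j => by
    have h1 : ∀ v, Integrable fun z => fderiv ℝ (F j) z v := fun v =>
      (((hFs j).continuous_fderiv (by simp)).clm_apply continuous_const).integrable_of_hasCompactSupport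
        (((hFc j).fderiv ℝ).comp_left (g := fun L : Cn n →L[ℝ] ℂ => L v) rfl)
    exact (h1 _).add ((h1 _).const_mul _)
  rw [integral_finsetSum _ fun j _ => hdc j]
  exact Finset.sum_eq_zero fun j _ =>
    integral_dbar_eq_zero j ((hFs j).of_le (by exact_mod_cast le_top)) (hFc j)

/-- The integral of the determinant does not change when `dd^c w` is added to a closed form, for `w`
with compact support. -/
theorem integral_det_add_ddc_sub {U : Set (Cn n)} (hU : IsOpen U)
    {Θ : Cn n → Cn n →L[ℝ] Cn n →L[ℝ] ℝ} (h11 : ∀ z ∈ U, IsOneOneForm (Θ z))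
    (hs : ∀ v w, ContDiffOn ℝ ∞ (fun z => Θ z v w) U)
    (hc : ∀ z ∈ U, ∀ a b c, fderiv ℝ (fun y => Θ y b c) z a + fderiv ℝ (fun y => Θ y c a) z b
      + fderiv ℝ (fun y => Θ y a b) z c = 0) (hw : IsTestFunction U w)
    (hu : ∀ τ ∈ Icc (0 : ℝ) 1, ∀ z ∈ U,
      IsUnit ((hermitianMatrix fun v w => Θ z v w) + (τ : ℂ) • hermitianMatrix (ddc w z)).det) :
    ∫ z, (((hermitianMatrix fun v w => Θ z v w) + hermitianMatrix (ddc w z)).det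
      - (hermitianMatrix fun v w => Θ z v w).det) = 0 := by
  set H : Cn n → Matrix (Fin n) (Fin n) ℂ := fun z => hermitianMatrix fun v w => Θ z v w with hH
  set L : Cn n → Matrix (Fin n) (Fin n) ℂ := fun z => hermitianMatrix (ddc w z) with hL
  have hK : IsCompact (tsupport w) := hw.2.1
  have hKU : tsupport w ⊆ U := hw.2.2
  have hHτ : ∀ τ : ℝ, ∀ z, (hermitianMatrix fun v v' => (Θ z + τ • ddcL w z) v v')
      = H z + (τ : ℂ) • L z := fun τ z => by
    rw [hermitianMatrix_add_smul]
    simp only [ddcL_apply, hH, hL]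
  have hddc : ∀ a b, ContDiff ℝ ∞ fun z => ddc w z a b := fun a b => by
    have hD : ContDiff ℝ ∞ (fderiv ℝ w) := hw.1.fderiv_right (m := ∞) (by simp)
    have hDD : ContDiff ℝ ∞ (fderiv ℝ (fderiv ℝ w)) := hD.fderiv_right (m := ∞) (by simp)
    simp only [ddc_eq]
    exact (((hDD.clm_apply contDiff_const).clm_apply contDiff_const).sub
        ((hDD.clm_apply contDiff_const).clm_apply contDiff_const)).div_const _
  have hzero : ∀ τ ∈ Icc (0 : ℝ) 1,
      ∫ z in tsupport w, ((H z + (τ : ℂ) • L z).adjugate * L z).trace = 0 := by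
    intro τ hτ
    have h1 := integral_trace_adjugate_mul_ddc hU (Θ := fun z => Θ z + τ • ddcL w z)
      (fun z hz => (h11 z hz).add ((isOneOneForm_ddcL
        (hw.1.contDiffAt.of_le ENat.LEInfty.out)).smul τ))
      (fun v v' => by
        simp only [_root_.add_apply, _root_.smul_apply, ddcL_apply, smul_eq_mul]
        exact (hs v v').add (contDiff_const.mul (hddc v v')).contDiffOn)
      (fun z hz a b c => by
        have h2 : ∀ a b c, fderiv ℝ (fun y => (Θ y + τ • ddcL w y) b c) z a
            = fderiv ℝ (fun y => Θ y b c) z a + τ * fderiv ℝ (fun y => ddc w y b c) z a := by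
          intro a b c
          have h3 := (((((hs b c).contDiffAt (hU.mem_nhds hz)).differentiableAt
            (by simp)).hasFDerivAt).add
              (((hddc b c).differentiable (by simp) z).hasFDerivAt.const_mul τ)).fderiv
          simp only [_root_.add_apply, _root_.smul_apply, ddcL_apply, smul_eq_mul]
          rw [show fderiv ℝ (fun y => Θ y b c + τ * ddc w y b c) z = _ from h3]
          rfl
        rw [h2, h2, h2]
        have h4 := hc z hz a b c
        have h5 := fderiv_ddc_cyclic hw.1 z a b c
        linear_combination h4 + τ * h5)
      (fun z hz => by rw [hHτ]; exact hu τ hτ z hz) hw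
    simp only [hHτ] at h1
    rw [setIntegral_eq_integral_of_forall_compl_eq_zero]
    · exact h1
    · intro z hz
      simp only [hL, hermitianMatrix_ddc_eq_zero hz, Matrix.mul_zero, trace_zero]
  have hHc : ∀ i j, ContinuousOn (fun p : Cn n × ℝ => (H p.1 + (p.2 : ℂ) • L p.1) i j)
      (tsupport w ×ˢ Icc 0 1) := by
    intro i j
    have h1 : ∀ a b, ContinuousOn (fun p : Cn n × ℝ => ((Θ p.1 a b : ℝ) : ℂ))
        (tsupport w ×ˢ Icc 0 1) := fun a b =>
      Complex.continuous_ofReal.comp_continuousOn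
        ((hs a b).continuousOn.comp continuousOn_fst fun p hp => hKU hp.1)
    have h2 : ContinuousOn (fun p : Cn n × ℝ => H p.1 i j) (tsupport w ×ˢ Icc 0 1) := by
      simp only [hH, hermitianMatrix, of_apply]
      exact (h1 _ _).add (continuousOn_const.mul (h1 _ _))
    have h3 : Continuous fun p : Cn n × ℝ => L p.1 i j :=
      (continuous_hermitianMatrix_ddc hw.1 i j).continuous.comp continuous_fst
    simp only [Matrix.add_apply, Matrix.smul_apply, smul_eq_mul]
    exact h2.add ((Complex.continuous_ofReal.comp continuous_snd).mul h3).continuousOn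
  have hTc : ContinuousOn (fun p : Cn n × ℝ =>
      ((H p.1 + (p.2 : ℂ) • L p.1).adjugate * L p.1).trace) (tsupport w ×ˢ Icc 0 1) := by
    simp only [trace, diag_apply, mul_apply]
    refine continuousOn_finsetSum _ fun i _ => continuousOn_finsetSum _ fun j _ => ?_
    exact (ContinuousOn.matrix_adjugate' hHc i j).mul
      ((continuous_hermitianMatrix_ddc hw.1 j i).continuous.comp continuous_fst).continuousOn
  -- The increment is the integral of the derivative along the segment, by Jacobi's formula.
  have hftc : ∀ z ∈ tsupport w, (H z + L z).det - (H z).det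
      = ∫ τ in Ioc (0 : ℝ) 1, ((H z + (τ : ℂ) • L z).adjugate * L z).trace := by
    intro z hz
    have h1 : ∀ τ ∈ uIcc (0 : ℝ) 1, HasDerivAt (fun τ : ℝ => (H z + (τ : ℂ) • L z).det)
        (((H z + (τ : ℂ) • L z).adjugate * L z).trace) τ := fun τ hτ => by
      rw [uIcc_of_le zero_le_one] at hτ
      exact hasDerivAt_det_line (hu τ hτ z (hKU hz))
    have h2 : ContinuousOn (fun τ : ℝ => ((H z + (τ : ℂ) • L z).adjugate * L z).trace) (Icc 0 1) :=
      hTc.comp (f := fun τ : ℝ => (z, τ)) (by fun_prop) fun τ hτ => ⟨hz, hτ⟩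
    have h3 := intervalIntegral.integral_eq_sub_of_hasDerivAt h1
      (ContinuousOn.intervalIntegrable (by rwa [uIcc_of_le zero_le_one]))
    rw [intervalIntegral.integral_of_le zero_le_one] at h3
    rw [h3]
    simp
  rw [← setIntegral_eq_integral_of_forall_compl_eq_zero (s := tsupport w) (fun z hz => by
      rw [hermitianMatrix_ddc_eq_zero hz, add_zero, sub_self]),
    setIntegral_congr_fun hK.measurableSet hftc, integral_integral_swap]
  · rw [setIntegral_congr_fun measurableSet_Ioc fun τ hτ => hzero τ (Ioc_subset_Icc_self hτ)]
    simp
  · rw [Measure.prod_restrict]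
    exact (hTc.integrableOn_compact (hK.prod isCompact_Icc)).mono_set
      (prod_mono Subset.rfl Ioc_subset_Icc_self)

end LocalStokes

/-! ### The total mass of Kähler metrics -/

section TotalMass

open scoped ComplexOrder

variable {n : ℕ} {X : Type*} [TopologicalSpace X] [ChartedSpace (Cn n) X]
  [IsManifold 𝓘(ℂ, Cn n) ∞ X] [CompactSpace X] [T2Space X]

/-- On a compact manifold a family of quadratic functions on the tangent spaces is bounded by a
multiple of a positive one. Both are given by their expressions in the charts. -/
theorem exists_abs_le_mul_of_pos {P Q : OpenPartialHomeomorph X (Cn n) → Cn n → Cn n → ℝ}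
    (hPc : ∀ e ∈ atlas (Cn n) X, ContinuousOn (fun p : Cn n × Cn n => P e p.1 p.2) (e.target ×ˢ univ))
    (hQc : ∀ e ∈ atlas (Cn n) X, ContinuousOn (fun p : Cn n × Cn n => Q e p.1 p.2) (e.target ×ˢ univ))
    (hPt : ∀ e ∈ atlas (Cn n) X, ∀ e' ∈ atlas (Cn n) X, ∀ z ∈ e.target, e.symm z ∈ e'.source →
      ∀ v, P e z v = P e' (e' (e.symm z)) (fderiv ℂ (fun y => e' (e.symm y)) z v))
    (hQt : ∀ e ∈ atlas (Cn n) X, ∀ e' ∈ atlas (Cn n) X, ∀ z ∈ e.target, e.symm z ∈ e'.source →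
      ∀ v, Q e z v = Q e' (e' (e.symm z)) (fderiv ℂ (fun y => e' (e.symm y)) z v))
    (hPs : ∀ e z (c : ℝ) v, P e z (c • v) = c ^ 2 * P e z v)
    (hQs : ∀ e z (c : ℝ) v, Q e z (c • v) = c ^ 2 * Q e z v)
    (hPpos : ∀ e ∈ atlas (Cn n) X, ∀ z ∈ e.target, ∀ v, v ≠ 0 → 0 < P e z v) :
    ∃ M : ℝ, 0 ≤ M ∧ ∀ e ∈ atlas (Cn n) X, ∀ z ∈ e.target, ∀ v, |Q e z v| ≤ M * P e z v := by
  obtain ⟨S, ρ, hρ, -, hρ1, hρs⟩ := exists_chart_partition n X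
  have hcpt : ∀ c, ∃ M : ℝ, ∀ z ∈ chartAt (Cn n) c '' tsupport (ρ c), ∀ v,
      |Q (chartAt (Cn n) c) z v| ≤ M * P (chartAt (Cn n) c) z v := by
    intro c
    set e := chartAt (Cn n) c
    have he : e ∈ atlas (Cn n) X := chart_mem_atlas _ c
    obtain ⟨hK, hKe⟩ := isCompact_image_chart (isClosed_tsupport (ρ c)) (hρs c)
    have hsub : (e '' tsupport (ρ c)) ×ˢ Metric.sphere (0 : Cn n) 1 ⊆ e.target ×ˢ univ :=
      prod_mono hKe (subset_univ _)
    have hne : ∀ v ∈ Metric.sphere (0 : Cn n) 1, v ≠ 0 := fun v hv h0 => by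
      rw [mem_sphere_zero_iff_norm, h0, norm_zero] at hv
      exact zero_ne_one hv
    obtain ⟨M, hM⟩ := (hK.prod (isCompact_sphere (0 : Cn n) 1)).bddAbove_image
      (((hQc e he).mono hsub).abs.div ((hPc e he).mono hsub)
        fun p hp => (hPpos e he _ (hKe hp.1) _ (hne _ hp.2)).ne')
    refine ⟨M, fun z hz v => ?_⟩
    by_cases hv : v = 0
    · have h1 := hPs e z 0 v
      have h2 := hQs e z 0 v
      rw [zero_smul] at h1 h2
      rw [hv, h1, h2]
      simp
    · have hn : 0 < ‖v‖ := norm_pos_iff.2 hv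
      set s : Cn n := ‖v‖⁻¹ • v with hs
      have hsm : s ∈ Metric.sphere (0 : Cn n) 1 := by
        rw [mem_sphere_zero_iff_norm, hs, norm_smul, norm_inv, norm_norm, inv_mul_cancel₀ hn.ne']
      have hvs : v = ‖v‖ • s := by rw [hs, smul_smul, mul_inv_cancel₀ hn.ne', one_smul]
      have h1 := hM (mem_image_of_mem (fun p : Cn n × Cn n => |Q e p.1 p.2| / P e p.1 p.2)
        (mk_mem_prod hz hsm))
      simp only at h1
      rw [div_le_iff₀ (hPpos e he _ (hKe hz) _ (hne _ hsm))] at h1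
      rw [hvs, hPs, hQs, abs_mul, abs_of_nonneg (sq_nonneg _)]
      calc _ ≤ ‖v‖ ^ 2 * (M * P e z s) := by gcongr
        _ = _ := by ring
  choose M hM using hcpt
  refine ⟨∑ c ∈ S, |M c|, Finset.sum_nonneg fun c _ => abs_nonneg _, fun e he z hz v => ?_⟩
  obtain ⟨c, hc, hcz⟩ : ∃ c ∈ S, ρ c (e.symm z) ≠ 0 := by
    by_contra! h
    have := hρ1 (e.symm z)
    rw [Finset.sum_eq_zero h] at this
    exact zero_ne_one this
  have hmem : e.symm z ∈ tsupport (ρ c) := subset_tsupport _ hcz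
  have he' : chartAt (Cn n) c ∈ atlas (Cn n) X := chart_mem_atlas _ c
  rw [hPt e he _ he' z hz (hρs c hmem), hQt e he _ he' z hz (hρs c hmem)]
  set v' := fderiv ℂ (fun y => chartAt (Cn n) c (e.symm y)) z v
  have h0 : 0 ≤ P (chartAt (Cn n) c) (chartAt (Cn n) c (e.symm z)) v' := by
    by_cases hv : v' = 0
    · have h1 := hPs (chartAt (Cn n) c) (chartAt (Cn n) c (e.symm z)) 0 v'
      rw [zero_smul] at h1
      rw [hv, h1]
      simp
    · exact (hPpos _ he' _ ((chartAt (Cn n) c).map_source (hρs c hmem)) _ hv).le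
  calc _ ≤ M c * P (chartAt (Cn n) c) (chartAt (Cn n) c (e.symm z)) v' :=
        hM c _ (mem_image_of_mem _ hmem) v'
    _ ≤ _ := by
        gcongr
        exact (le_abs_self _).trans
          (Finset.single_le_sum (f := fun c => |M c|) (fun c _ => abs_nonneg _) hc)

namespace KahlerForm

variable {Ω : KahlerForm n X} {φ g : X → ℝ} {e : OpenPartialHomeomorph X (Cn n)}

theorem contDiffAt_two_chart (hφ : ContMDiff 𝓘(ℝ, Cn n) 𝓘(ℝ) ∞ φ) (he : e ∈ atlas (Cn n) X)
    {z : Cn n} (hz : z ∈ e.target) : ContDiffAt ℝ 2 (fun y => φ (e.symm y)) z :=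
  (hφ.contDiffAt_chart he hz).of_le ENat.LEInfty.out

theorem levi_chart_transition (hg : ContMDiff 𝓘(ℝ, Cn n) 𝓘(ℝ) ∞ g) (he : e ∈ atlas (Cn n) X)
    {e' : OpenPartialHomeomorph X (Cn n)} (he' : e' ∈ atlas (Cn n) X) {z : Cn n}
    (hz : z ∈ e.target) (hz' : e.symm z ∈ e'.source) (v : Cn n) :
    levi (fun y => g (e.symm y)) z v = levi (fun y => g (e'.symm y)) (e' (e.symm z))
      (fderiv ℂ (fun y => e' (e.symm y)) z v) := by
  have hT : ContDiffAt ℂ 2 (fun y => e' (e.symm y)) z :=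
    (contDiffAt_transition he he' hz hz').of_le ENat.LEInfty.out
  have hev : (fun y => g (e.symm y)) =ᶠ[𝓝 z] fun y => g (e'.symm (e' (e.symm y))) := by
    filter_upwards [(e.continuousAt_symm hz).eventually (e'.open_source.mem_nhds hz')] with y hy
    rw [e'.left_inv hy]
  rw [hev.levi_eq, levi_comp (f := fun y => g (e'.symm y)) (T := fun y => e' (e.symm y)) _ hT]
  exact contDiffAt_two_chart hg he' (e'.map_source hz')

theorem continuousOn_levi_chart (hg : ContMDiff 𝓘(ℝ, Cn n) 𝓘(ℝ) ∞ g) (he : e ∈ atlas (Cn n) X) :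
    ContinuousOn (fun p : Cn n × Cn n => levi (fun y => g (e.symm y)) p.1 p.2)
      (e.target ×ˢ univ) := by
  simp only [levi_eq]
  have h1 : ContinuousOn (fun p : Cn n × Cn n => fderiv ℝ (fderiv ℝ fun y => g (e.symm y)) p.1)
      (e.target ×ˢ univ) := by
    intro p hp
    have h2 := (((hg.contDiffAt_chart he hp.1).fderiv_right (m := ∞) (by simp)).fderiv_right
      (m := ∞) (by simp)).continuousAt
    exact (h2.comp (f := fun p : Cn n × Cn n => p.1) (x := p)
      continuousAt_fst).continuousWithinAt
  exact (((h1.clm_apply continuousOn_snd).clm_apply continuousOn_snd).add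
    ((h1.clm_apply (continuous_snd.const_smul Complex.I).continuousOn).clm_apply
      (continuous_snd.const_smul Complex.I).continuousOn)).div_const _

theorem levi_real_smul {V : Type*} [NormedAddCommGroup V] [NormedSpace ℂ V] (f : V → ℝ) (p : V)
    (c : ℝ) (v : V) : levi f p (c • v) = c ^ 2 * levi f p v := by
  simp only [levi_eq, smul_comm Complex.I c v, map_smul, smul_apply, smul_eq_mul]
  ring

/-- The Levi form of a smooth function is bounded by a multiple of a Kähler metric. -/
theorem IsPotential.exists_abs_levi_le (hφ : Ω.IsPotential φ)
    (hg : ContMDiff 𝓘(ℝ, Cn n) 𝓘(ℝ) ∞ g) : ∃ M : ℝ, 0 ≤ M ∧ ∀ e ∈ atlas (Cn n) X,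
      ∀ z ∈ e.target, ∀ v, |levi (fun y => g (e.symm y)) z v|
        ≤ M * Ω.potForm φ e z v (Complex.I • v) := by
  refine exists_abs_le_mul_of_pos (P := fun e z v => Ω.potForm φ e z v (Complex.I • v))
    (Q := fun e z v => levi (fun y => g (e.symm y)) z v) (fun e he => ?_)
    (fun e he => continuousOn_levi_chart hg he) (fun e he e' he' z hz hz' v => ?_)
    (fun e he e' he' z hz hz' v => levi_chart_transition hg he he' hz hz' v)
    (fun e z c v => ?_) (fun e z c v => levi_real_smul _ _ _ _) hφ.2
  · exact (Ω.continuousOn_normSq he).add (continuousOn_levi_chart hφ.1 he)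
  · rw [Ω.potForm_transition hφ.1 he he' hz hz', map_smul]
  · rw [potForm_I_smul, potForm_I_smul, normSq_smul, levi_real_smul]
    ring

/-- Kähler metrics on a compact manifold are comparable. -/
theorem IsPotential.exists_normSq_le (hφ : Ω.IsPotential φ) : ∃ M : ℝ, 0 ≤ M ∧
    ∀ e ∈ atlas (Cn n) X, ∀ z ∈ e.target, ∀ v,
      Ω.normSq e z v ≤ M * Ω.potForm φ e z v (Complex.I • v) := by
  obtain ⟨M, hM, h⟩ := exists_abs_le_mul_of_pos
    (P := fun e z v => Ω.potForm φ e z v (Complex.I • v)) (Q := fun e z v => Ω.normSq e z v)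
    (fun e he => (Ω.continuousOn_normSq he).add (continuousOn_levi_chart hφ.1 he))
    (fun e he => Ω.continuousOn_normSq he) (fun e he e' he' z hz hz' v => by
      rw [Ω.potForm_transition hφ.1 he he' hz hz', map_smul])
    (fun e he e' he' z hz hz' v => Ω.normSq_transition he he' hz hz' v)
    (fun e z c v => by
      rw [potForm_I_smul, potForm_I_smul, normSq_smul, levi_real_smul]; ring)
    (fun e z c v => Ω.normSq_smul c z v) hφ.2
  exact ⟨M, hM, fun e he z hz v => (le_abs_self _).trans (h e he z hz v)⟩

theorem ddc_add_chart (hφ : ContMDiff 𝓘(ℝ, Cn n) 𝓘(ℝ) ∞ φ) (hg : ContMDiff 𝓘(ℝ, Cn n) 𝓘(ℝ) ∞ g)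
    (he : e ∈ atlas (Cn n) X) {z : Cn n} (hz : z ∈ e.target) (v w : Cn n) :
    Ω.potForm (fun x => φ x + g x) e z v w
      = Ω.potForm φ e z v w + ddc (fun y => g (e.symm y)) z v w := by
  rw [potForm, potForm, ddc_eq, ddc_eq, ddc_eq,
    fderiv_fderiv_add (contDiffAt_two_chart hφ he hz) (contDiffAt_two_chart hg he hz)]
  simp only [add_apply]
  ring

variable [MeasurableSpace X] [BorelSpace X]

/-- The total mass of `Ω_φ^n` does not change when a function supported in a chart is added to the
potential `φ`. -/
theorem IsPotential.topPower_univ_add (hφ : Ω.IsPotential φ)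
    (hφg : Ω.IsPotential fun x => φ x + g x) (hg : ContMDiff 𝓘(ℝ, Cn n) 𝓘(ℝ) ∞ g)
    (he : e ∈ atlas (Cn n) X) (hs : tsupport g ⊆ e.source) :
    Ω.topPower (fun x => φ x + g x) univ = Ω.topPower φ univ := by
  set K := tsupport g with hKdef
  have hKc : IsClosed K := isClosed_tsupport g
  obtain ⟨hK', hKe⟩ := isCompact_image_chart hKc hs
  set w : Cn n → ℝ := e.target.indicator fun z => g (e.symm z) with hw
  have hwt : ∀ z ∈ e.target, w =ᶠ[𝓝 z] fun z => g (e.symm z) := fun z hz => by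
    filter_upwards [e.open_target.mem_nhds hz] with y hy
    rw [hw, indicator_of_mem hy]
  have hsupp : Function.support w ⊆ e '' K := fun z hz => by
    have hzt : z ∈ e.target := by
      by_contra h
      exact hz (indicator_of_notMem h _)
    refine ⟨e.symm z, subset_tsupport g ?_, e.right_inv hzt⟩
    have h1 : w z = g (e.symm z) := indicator_of_mem hzt _
    rw [Function.mem_support, ← h1]
    exact hz
  have htw : tsupport w ⊆ e '' K := closure_minimal hsupp hK'.isClosed
  have hwtest : IsTestFunction e.target w := by
    refine ⟨contDiff_iff_contDiffAt.2 fun z => ?_, HasCompactSupport.of_support_subset_isCompact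
      hK' hsupp, htw.trans hKe⟩
    by_cases hz : z ∈ e.target
    · exact (hg.contDiffAt_chart he hz).congr_of_eventuallyEq (hwt z hz)
    · have h0 : w =ᶠ[𝓝 z] fun _ => 0 := by
        filter_upwards [(isClosed_tsupport w).isOpen_compl.mem_nhds fun h => hz (hKe (htw h))]
          with y hy
        exact image_eq_zero_of_notMem_tsupport hy
      exact contDiffAt_const.congr_of_eventuallyEq h0
  have hddc : ∀ z ∈ e.target, ∀ v v', Ω.potForm (fun x => φ x + g x) e z v v'
      = Ω.potForm φ e z v v' + ddc w z v v' := fun z hz v v' => by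
    rw [ddc_add_chart hφ.1 hg he hz, (hwt z hz).ddc_eq]
  -- the local computation
  have hτ : ∀ τ ∈ Icc (0 : ℝ) 1, ∀ z ∈ e.target, IsUnit
      ((hermitianMatrix fun v v' => Ω.potL φ e z v v') + (τ : ℂ) • hermitianMatrix (ddc w z)).det := by
    intro τ hτ z hz
    have h1 := hermitianMatrix_add_smul (Ω.potL φ e z) (ddcL w z) τ
    simp only [ddcL_apply] at h1
    rw [show hermitianMatrix (ddc w z) = hermitianMatrix fun v v' => ddc w z v v' from rfl, ← h1]
    refine (hermitianMatrix_posDef ((hφ.isOneOneForm he hz).add ((isOneOneForm_ddcL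
      (hwtest.1.contDiffAt.of_le ENat.LEInfty.out)).smul τ)) fun v hv => ?_).det_pos.ne'.isUnit
    have h2 := hφ.2 e he z hz v hv
    have h3 := hφg.2 e he z hz v hv
    rw [hddc z hz] at h3
    simp only [add_apply, smul_apply, potL_apply, ddcL_apply, smul_eq_mul]
    rcases eq_or_lt_of_le hτ.1 with h0 | h0
    · rw [← h0]; linarith
    · nlinarith [mul_pos h0 h3, mul_nonneg (sub_nonneg.2 hτ.2) h2.le, hτ.2]
  have hint := integral_det_add_ddc_sub e.open_target (Θ := fun z => Ω.potL φ e z)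
    (fun z hz => hφ.isOneOneForm he hz)
    (fun v v' => by simp only [potL_apply]; exact Ω.contDiffOn_potL hφ.1 he v v')
    (fun z hz a b c => by
      -- `Ω` and `dd^c φ` are closed; the latter is computed with a cut-off function
      have hclosed := Ω.closed e he z hz a b c
      obtain ⟨f, hf, hfe⟩ : ∃ f : Cn n → ℝ, ContDiff ℝ ∞ f ∧
          f =ᶠ[𝓝 z] fun y => φ (e.symm y) := by
        obtain ⟨r, hr, hrt⟩ := Metric.nhds_basis_closedBall.mem_iff.1 (e.open_target.mem_nhds hz)
        obtain ⟨χ, hχ⟩ : ∃ χ : ContDiffBump z, χ.rOut = r :=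
          ⟨⟨r / 2, r, by positivity, by linarith⟩, rfl⟩
        refine ⟨fun y => χ y * φ (e.symm y), contDiff_iff_contDiffAt.2 fun y => ?_, ?_⟩
        · by_cases hy : y ∈ e.target
          · exact χ.contDiffAt.mul (hφ.contDiffAt_chart he hy)
          · have h0 : (fun y => χ y * φ (e.symm y)) =ᶠ[𝓝 y] fun _ => 0 := by
              have h1 : y ∉ tsupport χ := fun h => hy (by
                rw [χ.tsupport_eq, hχ] at h; exact hrt h)
              filter_upwards [(isClosed_tsupport χ).isOpen_compl.mem_nhds h1] with y' hy'
              rw [image_eq_zero_of_notMem_tsupport hy', zero_mul]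
            exact contDiffAt_const.congr_of_eventuallyEq h0
        · filter_upwards [χ.eventuallyEq_one] with y hy
          rw [hy, Pi.one_apply, one_mul]
      have hpot : ∀ b c, (fun y => Ω.potL φ e y b c) =ᶠ[𝓝 z]
          fun y => Ω.coord e y b c + ddc f y b c := fun b c => by
        filter_upwards [hfe.eventuallyEq_nhds] with y hy
        rw [potL_apply, potForm, hy.ddc_eq]
      have hD : ContDiff ℝ ∞ (fderiv ℝ f) := hf.fderiv_right (m := ∞) (by simp)
      have hDD : ContDiff ℝ ∞ (fderiv ℝ (fderiv ℝ f)) := hD.fderiv_right (m := ∞) (by simp)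
      have hdd : ∀ b c, DifferentiableAt ℝ (fun y => ddc f y b c) z := fun b c => by
        simp only [ddc_eq]
        exact (((((hDD.clm_apply contDiff_const).clm_apply contDiff_const).sub
          ((hDD.clm_apply contDiff_const).clm_apply contDiff_const)).div_const
            (4 * Real.pi)).differentiable (by simp)) z
      have hcd : ∀ b c, DifferentiableAt ℝ (fun y => Ω.coord e y b c) z := fun b c =>
        ((Ω.smooth e he b c).contDiffAt (e.open_target.mem_nhds hz)).differentiableAt (by simp)
      have h1 : ∀ a b c, fderiv ℝ (fun y => Ω.potL φ e y b c) z a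
          = fderiv ℝ (fun y => Ω.coord e y b c) z a + fderiv ℝ (fun y => ddc f y b c) z a := by
        intro a b c
        rw [(hpot b c).fderiv_eq, fderiv_fun_add (hcd b c) (hdd b c), add_apply]
      have h2 := fderiv_ddc_cyclic hf z a b c
      rw [h1, h1, h1]
      have h3 : fderiv ℝ (fun y => Ω.coord e y b c) z a + fderiv ℝ (fun y => Ω.coord e y c a) z b
        + fderiv ℝ (fun y => Ω.coord e y a b) z c = 0 := hclosed
      linear_combination h3 + h2)
    hwtest hτ
  have hdet : ∀ z ∈ e '' K, (((hermitianMatrix fun v v' => Ω.potL φ e z v v')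
      + hermitianMatrix (ddc w z)).det - (hermitianMatrix fun v v' => Ω.potL φ e z v v').det)
      = (hermitianMatrix (Ω.potForm (fun x => φ x + g x) e z)).det
        - (hermitianMatrix (Ω.potForm φ e z)).det := by
    intro z hz
    have h1 := hermitianMatrix_add_smul (Ω.potL φ e z) (ddcL w z) 1
    simp only [Complex.ofReal_one, one_smul, add_apply, ddcL_apply, potL_apply,
      ← hddc z (hKe hz)] at h1
    simp only [potL_apply]
    congr 2
    exact h1.symm
  have hcφ := (Ω.continuousOn_det_hermitianMatrix hφ.1 he).mono hKe
  have hcφg := (Ω.continuousOn_det_hermitianMatrix hφg.1 he).mono hKe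
  rw [← setIntegral_eq_integral_of_forall_compl_eq_zero (s := e '' K) (fun z hz => by
      rw [hermitianMatrix_ddc_eq_zero fun h => hz (htw h), add_zero, sub_self]),
    setIntegral_congr_fun hK'.measurableSet hdet,
    integral_sub (hcφg.integrableOn_compact hK') (hcφ.integrableOn_compact hK'),
    sub_eq_zero] at hint
  have hdens : ∫ z in e '' K, Ω.density (fun x => φ x + g x) e z = ∫ z in e '' K, Ω.density φ e z := by
    simp only [density]
    rw [integral_const_mul, integral_const_mul]
    have h1 := integral_re (𝕜 := ℂ) (hcφg.integrableOn_compact (μ := volume) hK')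
    have h2 := integral_re (𝕜 := ℂ) (hcφ.integrableOn_compact (μ := volume) hK')
    simp only [RCLike.re_eq_complex_re] at h1 h2
    rw [h1, h2, hint]
  have hKm : MeasurableSet K := hKc.measurableSet
  have hmass : ∀ ψ : X → ℝ, Ω.IsPotential ψ →
      Ω.topPower ψ K = ENNReal.ofReal (∫ z in e '' K, Ω.density ψ e z) := by
    intro ψ hψ
    have h1 := lintegral_topPower_source (Ω := Ω) hψ.1 he
      (measurable_one.indicator hKm : Measurable (K.indicator (1 : X → ENNReal)))
    rw [lintegral_indicator_one hKm, Measure.restrict_apply hKm, inter_eq_left.2 hs] at h1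
    rw [h1, ofReal_integral_eq_lintegral_ofReal
      (((Ω.continuousOn_density hψ.1 he).mono hKe).integrableOn_compact hK')
      ((ae_restrict_iff' hK'.measurableSet).2 (Eventually.of_forall fun z hz =>
        (hψ.density_pos he (hKe hz)).le)), ← lintegral_indicator hK'.measurableSet,
      ← lintegral_indicator e.open_target.measurableSet]
    refine lintegral_congr fun z => ?_
    by_cases hz : z ∈ e.target
    · rw [indicator_of_mem hz]
      by_cases hzK : e.symm z ∈ K
      · have : z ∈ e '' K := ⟨_, hzK, e.right_inv hz⟩
        simp [hzK, this]
      · have : z ∉ e '' K := fun ⟨x, hx, hxz⟩ => hzK (by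
          rw [← hxz, e.left_inv (hs hx)]; exact hx)
        rw [indicator_of_notMem this]
        simp [hzK]
    · rw [indicator_of_notMem hz, indicator_of_notMem fun h => hz (hKe h)]
  rw [← measure_add_measure_compl hKm, ← measure_add_measure_compl hKm (μ := Ω.topPower φ),
    hmass _ hφg, hmass _ hφ, hdens, topPower_compl_eq hφg.1 hφ.1 hKc fun x hx => ?_]
  rw [image_eq_zero_of_notMem_tsupport hx, add_zero]

theorem isPotential_zero (Ω : KahlerForm n X) : Ω.IsPotential 0 := by
  refine ⟨contMDiff_const, fun e he z hz v hv => ?_⟩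
  rw [potForm_I_smul]
  have h1 : levi (fun y => (0 : X → ℝ) (e.symm y)) z v = 0 := levi_const 0 z v
  rw [h1, add_zero]
  exact Ω.normSq_pos he hz hv

/-- The total mass of `Ω_φ^n` is the same for all Kähler potentials. -/
theorem IsPotential.topPower_univ (hφ : Ω.IsPotential φ) :
    Ω.topPower φ univ = Ω.topPower 0 univ := by
  classical
  obtain ⟨S, ρ, hρ, -, hρ1, hρs⟩ := exists_chart_partition n X
  have hg : ∀ c, ContMDiff 𝓘(ℝ, Cn n) 𝓘(ℝ) ∞ fun x => ρ c x * φ x := fun c => (hρ c).mul hφ.1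
  choose M hM0 hM using fun c => (isPotential_zero Ω).exists_abs_levi_le (hg c)
  obtain ⟨m, hm0, hm⟩ := hφ.exists_normSq_le
  set B := ∑ c ∈ S, M c with hB
  have hB0 : 0 ≤ B := Finset.sum_nonneg fun c _ => hM0 c
  obtain ⟨N, hN⟩ := exists_nat_gt (B * (1 + m))
  have hN0 : (0 : ℝ) < N := lt_of_le_of_lt (by positivity) hN
  -- small steps along the segment from `0` to `φ`, each split by the partition of unity
  set ψ : ℕ → Finset X → X → ℝ := fun i T x => i / N * φ x + ∑ c ∈ T, 1 / N * (ρ c x * φ x) with hψ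
  have hψs : ∀ i T, ContMDiff 𝓘(ℝ, Cn n) 𝓘(ℝ) ∞ (ψ i T) := fun i T =>
    (contMDiff_const.mul hφ.1).add (contMDiff_finsetSum fun c _ => contMDiff_const.mul (hg c))
  have hpot : ∀ i, i ≤ N → ∀ T ⊆ S, Ω.IsPotential (ψ i T) := by
    intro i hi T hT
    refine ⟨hψs i T, fun e he z hz v hv => ?_⟩
    have h2 : ∀ f : X → ℝ, ContMDiff 𝓘(ℝ, Cn n) 𝓘(ℝ) ∞ f →
        ContDiffAt ℝ 2 (fun y => f (e.symm y)) z := fun f hf => contDiffAt_two_chart hf he hz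
    have h3 : levi (fun y => ψ i T (e.symm y)) z v = i / N * levi (fun y => φ (e.symm y)) z v
        + ∑ c ∈ T, 1 / N * levi (fun y => ρ c (e.symm y) * φ (e.symm y)) z v := by
      have h4 := levi_add (f := fun y => i / N * φ (e.symm y))
        (g := fun y => ∑ c ∈ T, 1 / N * (ρ c (e.symm y) * φ (e.symm y)))
        (contDiffAt_const.mul (h2 φ hφ.1))
        (ContDiffAt.sum fun c _ => contDiffAt_const.mul (h2 _ (hg c))) v
      rw [levi_const_mul _ (h2 φ hφ.1), levi_sum T (fun c _ =>
        contDiffAt_const.mul (h2 _ (hg c)))] at h4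
      refine h4.trans ?_
      congr 1
      exact Finset.sum_congr rfl fun c _ => levi_const_mul _ (h2 _ (hg c)) v
    have hn := Ω.normSq_pos he hz hv
    have hφv := hφ.2 e he z hz v hv
    have hmv := hm e he z hz v
    rw [potForm_I_smul] at hφv hmv ⊢
    have h0 : ∀ c, |levi (fun y => ρ c (e.symm y) * φ (e.symm y)) z v| ≤ M c * Ω.normSq e z v := by
      intro c
      have h5 := hM c e he z hz v
      rw [potForm_I_smul, show levi (fun y => (0 : X → ℝ) (e.symm y)) z v = 0 from levi_const 0 z v,
        add_zero] at h5
      exact h5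
    have h5 : |∑ c ∈ T, 1 / N * levi (fun y => ρ c (e.symm y) * φ (e.symm y)) z v|
        ≤ B / N * Ω.normSq e z v := by
      calc _ ≤ ∑ c ∈ T, |1 / N * levi (fun y => ρ c (e.symm y) * φ (e.symm y)) z v| :=
            Finset.abs_sum_le_sum_abs _ _
        _ ≤ ∑ c ∈ T, 1 / N * (M c * Ω.normSq e z v) := by
            refine Finset.sum_le_sum fun c _ => ?_
            rw [abs_mul, abs_of_nonneg (by positivity)]
            gcongr
            exact h0 c
        _ ≤ ∑ c ∈ S, 1 / N * (M c * Ω.normSq e z v) :=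
            Finset.sum_le_sum_of_subset_of_nonneg hT fun c _ _ => by
              have := hM0 c
              positivity
        _ = _ := by rw [← Finset.mul_sum, ← Finset.sum_mul]; ring
    have h6 := (abs_le.1 h5).1
    rw [h3]
    set s : ℝ := i / N with hs
    have hs0 : 0 ≤ s := by positivity
    have hs1 : s ≤ 1 := by
      rw [hs, div_le_one hN0]; exact_mod_cast hi
    set a := Ω.normSq e z v
    set b := levi (fun y => φ (e.symm y)) z v
    -- the metric along the segment is at least `a / (1 + m)`
    have h7 : a ≤ (1 + m) * (a + s * b) := by
      have h8 : (1 - s) * a + s * (a + b) = a + s * b := by ring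
      rw [← h8]
      have h9 : 0 ≤ (1 - s) * (m * a) := mul_nonneg (sub_nonneg.2 hs1) (by positivity)
      have h10 : 0 ≤ s * (m * (a + b) - a) := mul_nonneg hs0 (by linarith)
      have h11 : 0 ≤ s * (a + b) := by positivity
      nlinarith
    have h8 : B / N * a * (1 + m) < a := by
      have h9 : B * (1 + m) / N < 1 := by rwa [div_lt_one hN0]
      calc _ = B * (1 + m) / N * a := by ring
        _ < 1 * a := by gcongr
        _ = a := one_mul a
    have h9 : 0 < (1 + m) * (a + (s * b + ∑ c ∈ T, 1 / N
        * levi (fun y => ρ c (e.symm y) * φ (e.symm y)) z v)) := by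
      nlinarith
    exact pos_of_mul_pos_right h9 (by positivity)
  have hstep : ∀ i, i ≤ N → ∀ T ⊆ S, Ω.topPower (ψ i T) univ = Ω.topPower (ψ i ∅) univ := by
    intro i hi T
    induction T using Finset.induction_on with
    | empty => intro _; rfl
    | insert c T hc ih =>
      intro hT
      have hTS : T ⊆ S := (Finset.subset_insert c T).trans hT
      rw [← ih hTS]
      have h1 : ψ i (insert c T) = fun x => ψ i T x + 1 / N * (ρ c x * φ x) := by
        ext x
        simp only [hψ, Finset.sum_insert hc]
        ring
      have h2 := hpot i hi (insert c T) hT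
      rw [h1] at h2 ⊢
      refine (hpot i hi T hTS).topPower_univ_add h2 (contMDiff_const.mul (hg c))
        (chart_mem_atlas (Cn n) c) (subset_trans ?_ (hρs c))
      refine closure_mono fun x hx => ?_
      simp only [Function.mem_support] at hx ⊢
      exact left_ne_zero_of_mul (right_ne_zero_of_mul hx)
  have hall : ∀ i, i ≤ N → Ω.topPower (ψ i ∅) univ = Ω.topPower 0 univ := by
    intro i
    induction i with
    | zero =>
      intro _
      congr 2
      ext x
      simp [hψ]
    | succ i ih =>
      intro hi
      rw [← ih (by omega), ← hstep i (by omega) S Finset.Subset.rfl]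
      congr 2
      ext x
      simp only [hψ, Finset.sum_empty, add_zero]
      rw [← Finset.mul_sum, ← Finset.sum_mul, hρ1]
      push_cast
      ring
  rw [← hall N le_rfl]
  congr 2
  ext x
  simp only [hψ, Finset.sum_empty, add_zero]
  rw [div_self hN0.ne', one_mul]

end KahlerForm

end TotalMass

/-! ### Convex functions on the unit interval -/

section RealConvexity

theorem convexOn_of_approx {f : ℝ → ℝ} {s : Set ℝ} (hs : Convex ℝ s)
    (h : ∀ ε > 0, ∃ g, ConvexOn ℝ s g ∧ ∀ t ∈ s, |g t - f t| ≤ ε) : ConvexOn ℝ s f := by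
  refine ⟨hs, fun x hx y hy a b ha hb hab => le_of_forall_pos_le_add fun ε hε => ?_⟩
  obtain ⟨g, hg, hgf⟩ := h (ε / 2) (by positivity)
  have h1 := hg.2 hx hy ha hb hab
  have h2 := abs_le.1 (hgf _ (hs hx hy ha hb hab))
  have h3 := abs_le.1 (hgf x hx)
  have h4 := abs_le.1 (hgf y hy)
  simp only [smul_eq_mul] at h1 h2 ⊢
  have h5 : a * g x ≤ a * (f x + ε / 2) := by gcongr; linarith
  have h6 : b * g y ≤ b * (f y + ε / 2) := by gcongr; linarith
  have h7 : a * (f x + ε / 2) + b * (f y + ε / 2) = a * f x + b * f y + (a + b) * (ε / 2) := by ring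
  rw [hab] at h7
  linarith

theorem convexOn_Icc_of_forall {f : ℝ → ℝ} (hf : ContinuousOn f (Icc 0 1))
    (h : ∀ σ > 0, ConvexOn ℝ (Icc σ (1 - σ)) f) : ConvexOn ℝ (Icc 0 1) f := by
  refine ⟨convex_Icc _ _, fun x hx y hy a b ha hb hab => ?_⟩
  -- contract the interval to its middle point
  set T : ℝ → ℝ → ℝ := fun s x => (1 - s) * x + s / 2 with hT
  have hTm : ∀ s ∈ Ioo (0 : ℝ) 1, ∀ x ∈ Icc (0 : ℝ) 1, T s x ∈ Icc (s / 2) (1 - s / 2) := by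
    intro s hs x hx
    have h1 : 0 ≤ (1 - s) * x := mul_nonneg (by linarith [hs.2]) hx.1
    have h2 : (1 - s) * x ≤ (1 - s) * 1 := mul_le_mul_of_nonneg_left hx.2 (by linarith [hs.2])
    exact ⟨by simp only [hT]; linarith, by simp only [hT]; linarith⟩
  have hlim : ∀ x ∈ Icc (0 : ℝ) 1, Tendsto (fun s => f (T s x)) (𝓝[>] 0) (𝓝 (f x)) := by
    intro x hx
    have h1 : Tendsto (fun s => T s x) (𝓝[>] 0) (𝓝[Icc 0 1] x) := by
      refine tendsto_nhdsWithin_iff.2 ⟨?_, ?_⟩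
      · have : Continuous fun s => T s x := by simp only [hT]; fun_prop
        have h2 := this.tendsto 0
        simp only [hT] at h2 ⊢
        simpa using h2.mono_left nhdsWithin_le_nhds
      · filter_upwards [Ioo_mem_nhdsGT (zero_lt_one' ℝ)] with s hs
        have := hTm s hs x hx
        exact ⟨by linarith [this.1, hs.1], by linarith [this.2, hs.1]⟩
    exact (hf x hx).tendsto.comp h1
  have hm : a • x + b • y ∈ Icc (0 : ℝ) 1 := convex_Icc _ _ hx hy ha hb hab
  refine le_of_tendsto_of_tendsto (hlim _ hm) (((hlim x hx).const_smul a).add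
    ((hlim y hy).const_smul b)) ?_
  filter_upwards [Ioo_mem_nhdsGT (zero_lt_one' ℝ)] with s hs
  have h1 := (h (s / 2) (by linarith [hs.1])).2 (hTm s hs x hx) (hTm s hs y hy) ha hb hab
  have h2 : T s (a • x + b • y) = a • T s x + b • T s y := by
    simp only [hT, smul_eq_mul]
    have : s / 2 = (a + b) * (s / 2) := by rw [hab, one_mul]
    linear_combination this
  rw [h2]
  exact h1

theorem slope_half_mul_sq (L : ℝ) {x y : ℝ} (hxy : x ≠ y) {f : ℝ → ℝ} :
    slope (fun t => L / 2 * t ^ 2 - f t) x y = L / 2 * (x + y) - slope f x y := by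
  have : y - x ≠ 0 := sub_ne_zero.2 hxy.symm
  rw [slope_def_field, slope_def_field]
  field_simp
  ring

/-- Functions with second derivative between `0` and `L`, in the sense of convexity, are
differentiable. -/
theorem differentiableOn_of_convexOn {f : ℝ → ℝ} {s : Set ℝ} {L : ℝ} (hL : 0 ≤ L)
    (hf : ConvexOn ℝ s f) (hf' : ConvexOn ℝ s fun t => L / 2 * t ^ 2 - f t) :
    DifferentiableOn ℝ f s := by
  intro x hx
  have hlip : LipschitzOnWith (Real.toNNReal (L / 2)) (slope f x) (s \ {x}) := by
    refine LipschitzOnWith.of_le_add_mul _ fun y hy z hz => ?_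
    rw [Real.coe_toNNReal _ (by positivity), Real.dist_eq]
    rcases le_total y z with h | h
    · have h1 := hf.slope_mono hx hy hz h
      have : 0 ≤ L / 2 * |y - z| := by positivity
      linarith
    · have h1 := hf'.slope_mono hx hz hy h
      rw [slope_half_mul_sq L (Ne.symm hz.2), slope_half_mul_sq L (Ne.symm hy.2)] at h1
      rw [abs_of_nonneg (sub_nonneg.2 h)]
      linarith
  obtain ⟨g, hg, hfg⟩ := hlip.extend_real
  have h1 : HasDerivWithinAt f (g x) s x := by
    rw [hasDerivWithinAt_iff_tendsto_slope]
    refine ((hg.continuous.tendsto x).mono_left nhdsWithin_le_nhds).congr' ?_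
    filter_upwards [self_mem_nhdsWithin] with y hy using (hfg hy).symm
  exact h1.differentiableWithinAt

theorem abs_sub_le_of_convexOn {f : ℝ → ℝ} {L B : ℝ} (hL : 0 ≤ L) (hf : ConvexOn ℝ (Icc 0 1) f)
    (hf' : ConvexOn ℝ (Icc 0 1) fun t => L / 2 * t ^ 2 - f t) (hB0 : |f 0| ≤ B) (hB1 : |f 1| ≤ B)
    {x y : ℝ} (hx : x ∈ Icc (0 : ℝ) 1) (hy : y ∈ Icc (0 : ℝ) 1) :
    |f x - f y| ≤ (L + 2 * B) * |x - y| := by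
  have h0m : (0 : ℝ) ∈ Icc (0 : ℝ) 1 := ⟨le_rfl, zero_le_one⟩
  have h1m : (1 : ℝ) ∈ Icc (0 : ℝ) 1 := ⟨zero_le_one, le_rfl⟩
  wlog hxy : x < y generalizing x y
  · rcases eq_or_lt_of_le (not_lt.1 hxy) with h | h
    · simp [h]
    · rw [abs_sub_comm, abs_sub_comm x]
      exact this hy hx h
  have hB0' := abs_le.1 hB0
  have hB1' := abs_le.1 hB1
  have h01 : slope f 0 1 = f 1 - f 0 := by rw [slope_def_field]; simp
  have hup : slope f x y ≤ L + 2 * B := by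
    have h1 : slope f x y ≤ slope f x 1 := hf.slope_mono hx ⟨hy, hxy.ne'⟩
      ⟨h1m, (hxy.trans_le hy.2).ne'⟩ hy.2
    have hx1 : x < 1 := hxy.trans_le hy.2
    have h2 : slope (fun t => L / 2 * t ^ 2 - f t) 1 0 ≤ slope (fun t => L / 2 * t ^ 2 - f t) 1 x :=
      hf'.slope_mono h1m ⟨h0m, zero_ne_one⟩ ⟨hx, hx1.ne⟩ hx.1
    rw [slope_half_mul_sq L one_ne_zero, slope_half_mul_sq L hx1.ne', slope_comm f 1,
      slope_comm f 1, h01] at h2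
    nlinarith [hx.2]
  have hlow : -(L + 2 * B) ≤ slope f x y := by
    have hy0 : 0 < y := hx.1.trans_lt hxy
    have h1 : slope f y 0 ≤ slope f y x := hf.slope_mono hy ⟨h0m, hy0.ne⟩ ⟨hx, hxy.ne⟩ hx.1
    have h2 : slope (fun t => L / 2 * t ^ 2 - f t) 0 y ≤ slope (fun t => L / 2 * t ^ 2 - f t) 0 1 :=
      hf'.slope_mono h0m ⟨hy, hy0.ne'⟩ ⟨h1m, one_ne_zero⟩ hy.2
    rw [slope_half_mul_sq L hy0.ne, slope_half_mul_sq L zero_ne_one, h01] at h2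
    rw [slope_comm f y, slope_comm f y] at h1
    nlinarith [hy.1, hy.2]
  have h3 : f x - f y = -(slope f x y * (y - x)) := by
    rw [slope_def_field, div_mul_cancel₀ _ (sub_pos.2 hxy).ne']; ring
  rw [h3, abs_neg, abs_mul, abs_sub_comm x y]
  gcongr
  exact abs_le.2 ⟨hlow, hup⟩

end RealConvexity

/-! ### Test functions -/

section TestFunctions

variable {V : Type*} [NormedAddCommGroup V] [NormedSpace ℂ V]

theorem continuous_ddc {χ : V → ℝ} (hχ : ContDiff ℝ ∞ χ) (v w : V) :
    Continuous fun p => ddc χ p v w := by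
  have hD : ContDiff ℝ ∞ (fderiv ℝ χ) := hχ.fderiv_right (m := ∞) (by simp)
  have hDD : Continuous (fderiv ℝ (fderiv ℝ χ)) := hD.continuous_fderiv (by simp)
  simp only [ddc_eq]
  exact (((hDD.clm_apply continuous_const).clm_apply continuous_const).sub
    ((hDD.clm_apply continuous_const).clm_apply continuous_const)).div_const _

theorem tsupport_ddc_subset (χ : V → ℝ) (v w : V) :
    tsupport (fun p => ddc χ p v w) ⊆ tsupport χ := by
  refine closure_minimal (fun p hp => ?_) (isClosed_tsupport χ)
  by_contra h
  refine hp ?_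
  have h1 : χ =ᶠ[𝓝 p] fun _ => 0 := by
    filter_upwards [(isClosed_tsupport χ).isOpen_compl.mem_nhds h] with q hq
    exact image_eq_zero_of_notMem_tsupport hq
  simp only [h1.ddc_eq]
  simp [ddc_eq]

end TestFunctions

/-! ### Time derivatives of smooth curves -/

section CurveDerivative

variable {n : ℕ} {X : Type*} [TopologicalSpace X] [ChartedSpace (Cn n) X]
  [IsManifold 𝓘(ℂ, Cn n) ∞ X] {Φ : ℝ → X → ℝ}

theorem contDiffAt_curveExpr (hΦ : ContMDiff (𝓘(ℝ).prod 𝓘(ℝ, Cn n)) 𝓘(ℝ) ∞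
    (fun p : ℝ × X => Φ p.1 p.2)) {e : OpenPartialHomeomorph X (Cn n)} (he : e ∈ atlas (Cn n) X)
    {z : Cn n} (hz : z ∈ e.target) (t : ℝ) : ContDiffAt ℝ ∞ (curveExpr Φ e) (t, z) :=
  hΦ.contDiffAt_curve_chart he hz t

theorem contMDiff_deriv_curve (hΦ : ContMDiff (𝓘(ℝ).prod 𝓘(ℝ, Cn n)) 𝓘(ℝ) ∞
    (fun p : ℝ × X => Φ p.1 p.2)) : ContMDiff (𝓘(ℝ).prod 𝓘(ℝ, Cn n)) 𝓘(ℝ) ∞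
    (fun p : ℝ × X => deriv (fun s => Φ s p.2) p.1) := by
  refine contMDiff_curve_of_contDiffAt_chart (Φ := fun t x => deriv (fun s => Φ s x) t)
    fun x => ⟨chartAt (Cn n) x, chart_mem_atlas _ x, mem_chart_source _ x, fun t => ?_⟩
  set e := chartAt (Cn n) x
  have he : e ∈ atlas (Cn n) X := chart_mem_atlas _ x
  have h1 := contDiffAt_curveExpr hΦ he (mem_chart_target _ x) t
  have h2 : ContDiffAt ℝ ∞ (fun p => fderiv ℝ (curveExpr Φ e) p (1, 0)) (t, e x) :=
    (h1.fderiv_right (m := ∞) (by simp)).clm_apply contDiffAt_const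
  refine h2.congr_of_eventuallyEq ?_
  have h3 : ∀ᶠ p : ℝ × Cn n in 𝓝 (t, e x), p.2 ∈ e.target :=
    continuousAt_snd.eventually (e.open_target.mem_nhds (mem_chart_target _ x))
  filter_upwards [h3] with p hp
  exact (hasDerivAt_curve ((contDiffAt_curveExpr hΦ he hp p.1).differentiableAt (by simp))).deriv

theorem hasDerivAt_of_contMDiff (hΦ : ContMDiff (𝓘(ℝ).prod 𝓘(ℝ, Cn n)) 𝓘(ℝ) ∞
    (fun p : ℝ × X => Φ p.1 p.2)) (x : X) (t : ℝ) :
    HasDerivAt (fun s => Φ s x) (deriv (fun s => Φ s x) t) t := by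
  set e := chartAt (Cn n) x
  have h1 := hasDerivAt_curve (Φ := Φ) ((contDiffAt_curveExpr hΦ (chart_mem_atlas _ x)
    (mem_chart_target _ x) t).differentiableAt (by simp))
  rw [e.left_inv (mem_chart_source _ x)] at h1
  exact h1.differentiableAt.hasDerivAt

end CurveDerivative

/-! ### Convexity and regularity of subgeodesics in time -/

section Subgeodesics

variable {n : ℕ} {X : Type*} [TopologicalSpace X] [ChartedSpace (Cn n) X]
  [IsManifold 𝓘(ℂ, Cn n) ∞ X] [CompactSpace X] [T2Space X] {Ω : KahlerForm n X} {u : ℝ → X → ℝ}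

namespace KahlerForm

theorem IsSubgeodesic.continuous_slice (hu : Ω.IsSubgeodesic u) {t : ℝ} (ht : t ∈ Icc (0 : ℝ) 1) :
    Continuous (u t) := by
  rw [← continuousOn_univ]
  exact hu.continuous.comp (f := fun x : X => (t, x)) (by fun_prop) fun x hx => ⟨ht, hx⟩

theorem IsSubgeodesic.continuousOn_curve (hu : Ω.IsSubgeodesic u) (x : X) :
    ContinuousOn (fun t => u t x) (Icc 0 1) :=
  hu.continuous.comp (f := fun t : ℝ => (t, x)) (by fun_prop) fun t ht => ⟨ht, mem_univ x⟩

theorem IsSubgeodesic.exists_abs_le (hu : Ω.IsSubgeodesic u) :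
    ∃ B : ℝ, ∀ t ∈ Icc (0 : ℝ) 1, ∀ x, |u t x| ≤ B := by
  obtain ⟨B, hB⟩ := (isCompact_Icc.prod isCompact_univ).bddAbove_image hu.continuous.norm
  exact ⟨B, fun t ht x =>
    hB (mem_image_of_mem (fun p : ℝ × X => ‖u p.1 p.2‖) (mk_mem_prod ht (mem_univ x)))⟩

theorem integral_normSq_mul_nonneg {e : OpenPartialHomeomorph X (Cn n)} (he : e ∈ atlas (Cn n) X)
    {χ : Cn n × ℂ → ℝ} (hχ : IsTestFunction (e.target ×ˢ strip) χ) (hχ0 : ∀ p, 0 ≤ χ p) (v : Cn n) :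
    0 ≤ ∫ p : Cn n × ℂ, Ω.normSq e p.1 v * χ p := by
  refine integral_nonneg fun p => ?_
  by_cases hp : p ∈ tsupport χ
  · exact mul_nonneg (Ω.normSq_nonneg he (hχ.2.2 hp).1 v) (hχ0 p)
  · simp [image_eq_zero_of_notMem_tsupport hp]

/-- Taking test vectors in the direction of `X` in the bound for the current on the product. -/
theorem IsSubgeodesic.exists_sliceLE (hu : Ω.IsSubgeodesic u) : ∃ C : ℝ, 0 ≤ C ∧ Ω.SliceLE u C := by
  obtain ⟨K, hK⟩ := hu.bounded
  refine ⟨max K 0, le_max_right _ _, fun e he χ hχ hχ0 v => (hK e he χ hχ hχ0 (v, 0)).trans ?_⟩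
  have h1 : (∫ p : Cn n × ℂ, (Ω.coord e p.1 v (Complex.I • v) + ‖(0 : ℂ)‖ ^ 2) * χ p)
      = ∫ p : Cn n × ℂ, Ω.normSq e p.1 v * χ p := by simp [normSq]
  have h2 := integral_normSq_mul_nonneg (Ω := Ω) he hχ hχ0 v
  rw [← h1] at h2 ⊢
  exact mul_le_mul_of_nonneg_right (le_max_left K 0) h2

/-- Bounds for the currents `Ω + dd^c u_t` on `X` give a bound for the current on `X × D`. -/
theorem IsSubgeodesic.sliceLE (hu : Ω.IsSubgeodesic u) {C : ℝ}
    (hC : ∀ t ∈ Icc (0 : ℝ) 1, Ω.CurrentLE (u t) C) : Ω.SliceLE u C := by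
  intro e he χ hχ hχ0 v
  obtain ⟨hχs, hχc, hχt⟩ := hχ
  have hstrip : IsOpen strip :=
    (isOpen_lt continuous_const Complex.continuous_re).inter
      (isOpen_lt Complex.continuous_re continuous_const)
  have hW : IsOpen (e.target ×ˢ strip) := e.open_target.prod hstrip
  have hslice : ∀ τ, IsTestFunction e.target fun z => χ (z, τ) := by
    intro τ
    have h1 : HasCompactSupport fun z => χ (z, τ) := by
      refine HasCompactSupport.of_support_subset_isCompact (hχc.image continuous_fst)
        fun z hz => ⟨(z, τ), subset_tsupport _ hz, rfl⟩
    refine ⟨hχs.comp (contDiff_id.prodMk contDiff_const), h1, ?_⟩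
    have h2 : tsupport (fun z => χ (z, τ)) ⊆ Prod.fst '' tsupport χ :=
      closure_minimal (fun z hz => ⟨(z, τ), subset_tsupport _ hz, rfl⟩)
        (hχc.image continuous_fst).isClosed
    rintro z hz
    obtain ⟨p, hp, rfl⟩ := h2 hz
    exact (hχt hp).1
  have hddc : ∀ p : Cn n × ℂ, ddc χ p (v, 0) (Complex.I • (v, 0))
      = ddc (fun z => χ (z, p.2)) p.1 v (Complex.I • v) := by
    intro p
    have h1 := fderiv_fderiv_comp_affine (f := χ) (ContinuousLinearMap.inl ℝ (Cn n) ℂ)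
      ((0 : Cn n), p.2) (q := p.1) (hχs.contDiffAt.of_le ENat.LEInfty.out)
    have h2 : (fun q => χ ((ContinuousLinearMap.inl ℝ (Cn n) ℂ) q + (0, p.2)))
        = fun z => χ (z, p.2) := by ext z; simp
    rw [h2] at h1
    rw [ddc_eq, ddc_eq, h1, h1]
    simp
  have hcoordc : Continuous fun p : Cn n × ℂ => Ω.coord e p.1 v (Complex.I • v) * χ p := by
    refine continuous_mul_of_tsupport_subset (U := e.target ×ˢ strip) hW ?_ hχs.continuous hχt
    exact ((Ω.smooth e he v (Complex.I • v)).continuousOn).comp continuousOn_fst fun p hp => hp.1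
  have huc : Continuous fun p : Cn n × ℂ =>
      u p.2.re (e.symm p.1) * ddc χ p (v, 0) (Complex.I • (v, 0)) := by
    refine continuous_mul_of_tsupport_subset (U := e.target ×ˢ strip) hW ?_
      (continuous_ddc hχs _ _) ((tsupport_ddc_subset χ _ _).trans hχt)
    refine hu.continuous.comp (f := fun p : Cn n × ℂ => (p.2.re, e.symm p.1)) ?_ fun p hp =>
      ⟨⟨hp.2.1.le, hp.2.2.le⟩, mem_univ _⟩
    exact (Complex.continuous_re.comp_continuousOn continuousOn_snd).prodMk
      (e.continuousOn_symm.comp continuousOn_fst fun p hp => hp.1)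
  have hi1 : Integrable fun p : Cn n × ℂ => Ω.coord e p.1 v (Complex.I • v) * χ p :=
    hcoordc.integrable_of_hasCompactSupport hχc.mul_left
  have hi2 : Integrable fun p : Cn n × ℂ =>
      u p.2.re (e.symm p.1) * ddc χ p (v, 0) (Complex.I • (v, 0)) :=
    huc.integrable_of_hasCompactSupport
      (HasCompactSupport.mul_left (hχc.mono' ((subset_tsupport _).trans (tsupport_ddc_subset χ _ _))))
  have hsum := hi1.add hi2
  change ∫ p : Cn n × ℂ, (Ω.coord e p.1 v (Complex.I • v) * χ p
    + u p.2.re (e.symm p.1) * ddc χ p (v, 0) (Complex.I • (v, 0))) ≤ _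
  have e1 := integral_prod_symm (μ := (volume : Measure (Cn n))) (ν := (volume : Measure ℂ)) _ hsum
  have e2 := integral_prod_symm (μ := (volume : Measure (Cn n))) (ν := (volume : Measure ℂ)) _ hi1
  rw [← Measure.volume_eq_prod] at e1 e2
  change _ ≤ C * ∫ p : Cn n × ℂ, Ω.coord e p.1 v (Complex.I • v) * χ p
  rw [e2, ← integral_const_mul]
  refine (le_of_eq e1).trans (integral_mono hsum.integral_prod_right
    (hi1.integral_prod_right.const_mul C) fun τ => ?_)
  by_cases hτ : τ ∈ strip
  · have h1 := hC τ.re ⟨hτ.1.le, hτ.2.le⟩ e he (fun z => χ (z, τ)) (hslice τ) (fun z => hχ0 _) v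
    simp only [hddc]
    exact h1
  · have h0 : ∀ z, χ (z, τ) = 0 := fun z => by
      by_contra h
      exact hτ (hχt (subset_tsupport _ h)).2
    have h2 : ∀ x, ddc (fun _ : Cn n => (0 : ℝ)) x v (Complex.I • v) = 0 := fun x => by
      simp [ddc_eq]
    simp [-Prod.smul_mk, hddc, h0, h2]

/-- Subgeodesics are convex in `t`, with bounded second derivative. -/
theorem IsSubgeodesic.convexOn_curve (hu : Ω.IsSubgeodesic u) : ∃ K : ℝ, 0 ≤ K ∧ ∀ x,
    ConvexOn ℝ (Icc 0 1) (fun t => u t x) ∧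
      ConvexOn ℝ (Icc 0 1) (fun t => K / 2 * t ^ 2 - u t x) := by
  obtain ⟨C, hC0, hC⟩ := hu.exists_sliceLE
  obtain ⟨K, hK0, hK⟩ := hu.exists_potential_approx hC0 hC
  have hder : ∀ (c : ℝ) (Φ : ℝ → X → ℝ), ContMDiff (𝓘(ℝ).prod 𝓘(ℝ, Cn n)) 𝓘(ℝ) ∞
      (fun p : ℝ × X => Φ p.1 p.2) → ∀ (a : ℝ) (x : X), ∀ s : Set ℝ, Convex ℝ s →
      (∀ t ∈ s, 0 ≤ a * deriv (deriv fun s => Φ s x) t + c) →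
      ConvexOn ℝ s fun t => a * Φ t x + c / 2 * t ^ 2 := by
    intro c Φ hΦ a x s hs h0
    have h1 : ∀ t, HasDerivAt (fun t => a * Φ t x + c / 2 * t ^ 2)
        (a * deriv (fun s => Φ s x) t + c * t) t := fun t => by
      have := ((hasDerivAt_of_contMDiff hΦ x t).const_mul a).add
        (((hasDerivAt_id t).pow 2).const_mul (c / 2))
      refine this.congr_deriv ?_
      simp
      ring
    have h2 : ∀ t, HasDerivAt (fun t => a * deriv (fun s => Φ s x) t + c * t)
        (a * deriv (deriv fun s => Φ s x) t + c) t := fun t => by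
      have := ((hasDerivAt_of_contMDiff (Φ := fun t x => deriv (fun s => Φ s x) t)
        (contMDiff_deriv_curve hΦ) x t).const_mul a).add
        ((hasDerivAt_id t).const_mul c)
      refine this.congr_deriv ?_
      simp
    have h3 : deriv (fun t => a * Φ t x + c / 2 * t ^ 2)
        = fun t => a * deriv (fun s => Φ s x) t + c * t := funext fun t => (h1 t).deriv
    refine convexOn_of_deriv2_nonneg' hs (fun t _ => (h1 t).differentiableAt.differentiableWithinAt)
      ?_ fun t ht => ?_
    · rw [h3]
      exact fun t _ => (h2 t).differentiableAt.differentiableWithinAt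
    · simp only [Function.iterate_succ, Function.iterate_zero, Function.comp_apply, id]
      rw [h3, (h2 t).deriv]
      exact h0 t ht
  refine ⟨K, hK0, fun x => ⟨convexOn_Icc_of_forall (hu.continuousOn_curve x) fun σ hσ => ?_,
    convexOn_Icc_of_forall (((continuousOn_const.mul (continuousOn_id.pow 2))).sub
      (hu.continuousOn_curve x)) fun σ hσ => ?_⟩⟩
  · refine convexOn_of_approx (convex_Icc _ _) fun ε hε => ?_
    obtain ⟨Φ, hΦ, hΦu, -, hΦ2, -⟩ := hK σ hσ (ε / 2) (by positivity)
    refine ⟨fun t => 1 * Φ t x + ε / 2 / 2 * t ^ 2, hder (ε / 2) Φ hΦ 1 x _ (convex_Icc _ _)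
      fun t ht => ?_, fun t ht => ?_⟩
    · have := (hΦ2 x t ht.1 ht.2).1
      linarith
    · have h1 := abs_le.1 (hΦu x t ht.1 ht.2)
      have h2 : t ^ 2 ≤ 1 := by
        have h3 := ht.1
        have h4 := ht.2
        nlinarith
      have h3 : 0 ≤ t ^ 2 := sq_nonneg t
      rw [abs_le]
      constructor <;> nlinarith
  · refine convexOn_of_approx (convex_Icc _ _) fun ε hε => ?_
    obtain ⟨Φ, hΦ, hΦu, -, hΦ2, -⟩ := hK σ hσ ε hε
    refine ⟨fun t => (-1) * Φ t x + K / 2 * t ^ 2, hder K Φ hΦ (-1) x _ (convex_Icc _ _)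
      fun t ht => ?_, fun t ht => ?_⟩
    · have := (hΦ2 x t ht.1 ht.2).2
      linarith
    · have h1 := hΦu x t ht.1 ht.2
      rw [show -1 * Φ t x + K / 2 * t ^ 2 - (K / 2 * t ^ 2 - u t x) = -(Φ t x - u t x) by ring,
        abs_neg]
      exact h1

variable [MeasurableSpace X] [BorelSpace X] {μ : Measure X}

theorem IsSubgeodesic.integrable (hu : Ω.IsSubgeodesic u) [IsFiniteMeasure μ] {t : ℝ}
    (ht : t ∈ Icc (0 : ℝ) 1) : Integrable (u t) μ :=
  (hu.continuous_slice ht).integrable_of_hasCompactSupport (HasCompactSupport.of_compactSpace _)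

/-- The integrals of a subgeodesic are convex and differentiable: convexity of `u_t` and of
`K / 2 * t ^ 2 - u_t` is inherited by the integrals, and a function with both properties is
differentiable. -/
theorem IsSubgeodesic.convexOn_integral (hu : Ω.IsSubgeodesic u) [IsFiniteMeasure μ] :
    ConvexOn ℝ (Icc 0 1) (fun t => ∫ x, u t x ∂μ) ∧
      DifferentiableOn ℝ (fun t => ∫ x, u t x ∂μ) (Icc 0 1) := by
  obtain ⟨K, hK0, hK⟩ := hu.convexOn_curve
  have hconv : ConvexOn ℝ (Icc 0 1) (fun t => ∫ x, u t x ∂μ) := by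
    refine ⟨convex_Icc _ _, fun s hs t ht a b ha hb hab => ?_⟩
    have hm : a • s + b • t ∈ Icc (0 : ℝ) 1 := convex_Icc _ _ hs ht ha hb hab
    simp only [smul_eq_mul]
    rw [← integral_const_mul, ← integral_const_mul,
      ← integral_add ((hu.integrable hs).const_mul a) ((hu.integrable ht).const_mul b)]
    exact integral_mono (hu.integrable hm) (((hu.integrable hs).const_mul a).add
      ((hu.integrable ht).const_mul b)) fun x => (hK x).1.2 hs ht ha hb hab
  refine ⟨hconv, differentiableOn_of_convexOn (L := K * μ.real univ) (by positivity) hconv ?_⟩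
  have h1 : EqOn (fun t => ∫ x, (K / 2 * t ^ 2 - u t x) ∂μ)
      (fun t => K * μ.real univ / 2 * t ^ 2 - ∫ x, u t x ∂μ) (Icc 0 1) := fun t ht => by
    simp only
    rw [integral_sub (integrable_const _) (hu.integrable ht), integral_const, smul_eq_mul]
    ring
  refine ConvexOn.congr ?_ h1
  have hi : ∀ t ∈ Icc (0 : ℝ) 1, Integrable (fun x => K / 2 * t ^ 2 - u t x) μ := fun t ht =>
    (integrable_const _).sub (hu.integrable ht)
  refine ⟨convex_Icc _ _, fun s hs t ht a b ha hb hab => ?_⟩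
  have hm : a • s + b • t ∈ Icc (0 : ℝ) 1 := convex_Icc _ _ hs ht ha hb hab
  simp only [smul_eq_mul]
  rw [← integral_const_mul, ← integral_const_mul,
    ← integral_add ((hi s hs).const_mul a) ((hi t ht).const_mul b)]
  exact integral_mono (hi _ hm) (((hi s hs).const_mul a).add
    ((hi t ht).const_mul b)) fun x => (hK x).2.2 hs ht ha hb hab

/-- Subgeodesics are Lipschitz in `t`. -/
theorem IsSubgeodesic.exists_lipschitz (hu : Ω.IsSubgeodesic u) : ∃ L : ℝ, 0 ≤ L ∧
    ∀ s ∈ Icc (0 : ℝ) 1, ∀ t ∈ Icc (0 : ℝ) 1, ∀ x, |u s x - u t x| ≤ L * |s - t| := by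
  obtain ⟨K, hK0, hK⟩ := hu.convexOn_curve
  obtain ⟨B, hB⟩ := hu.exists_abs_le
  refine ⟨K + 2 * max B 0, by positivity, fun s hs t ht x => ?_⟩
  exact abs_sub_le_of_convexOn hK0 (hK x).1 (hK x).2
    ((hB 0 ⟨le_rfl, zero_le_one⟩ x).trans (le_max_left _ _))
    ((hB 1 ⟨zero_le_one, le_rfl⟩ x).trans (le_max_left _ _)) hs ht

end KahlerForm

end Subgeodesics

/-! ### Estimates for almost convex functions of one variable -/

section RealEstimates

variable {F F' F'' : ℝ → ℝ} {a b m : ℝ}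

theorem sub_le_sub_of_hasDerivAt_le {g k g' k' : ℝ → ℝ} (hab : a ≤ b)
    (hg : ∀ t, HasDerivAt g (g' t) t) (hk : ∀ t, HasDerivAt k (k' t) t)
    (h : ∀ t ∈ Icc a b, g' t ≤ k' t) : g b - g a ≤ k b - k a := by
  have hd : ∀ t, HasDerivAt (fun t => k t - g t) (k' t - g' t) t := fun t => (hk t).sub (hg t)
  have hm : MonotoneOn (fun t => k t - g t) (Icc a b) := by
    refine monotoneOn_of_deriv_nonneg (convex_Icc a b)
      (fun t _ => (hd t).continuousAt.continuousWithinAt)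
      (fun t _ => (hd t).differentiableAt.differentiableWithinAt) fun t ht => ?_
    rw [(hd t).deriv]
    exact sub_nonneg.2 (h t (interior_subset ht))
  have := hm ⟨le_rfl, hab⟩ ⟨hab, le_rfl⟩ hab
  simp only at this
  linarith

theorem convexOn_add_sq (hF : ∀ t, HasDerivAt F (F' t) t) (hF' : ∀ t, HasDerivAt F' (F'' t) t)
    (h : ∀ t ∈ Icc a b, -m ≤ F'' t) : ConvexOn ℝ (Icc a b) fun t => F t + m / 2 * t ^ 2 := by
  have h1 : ∀ t, HasDerivAt (fun t => F t + m / 2 * t ^ 2) (F' t + m * t) t := fun t => by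
    refine ((hF t).add (((hasDerivAt_id t).pow 2).const_mul (m / 2))).congr_deriv ?_
    simp
    ring
  have h2 : ∀ t, HasDerivAt (fun t => F' t + m * t) (F'' t + m) t := fun t => by
    refine ((hF' t).add ((hasDerivAt_id t).const_mul m)).congr_deriv ?_
    simp
  have h3 : deriv (fun t => F t + m / 2 * t ^ 2) = fun t => F' t + m * t :=
    funext fun t => (h1 t).deriv
  refine convexOn_of_deriv2_nonneg' (convex_Icc a b)
    (fun t _ => (h1 t).differentiableAt.differentiableWithinAt) ?_ fun t ht => ?_
  · rw [h3]
    exact fun t _ => (h2 t).differentiableAt.differentiableWithinAt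
  · simp only [Function.iterate_succ, Function.iterate_zero, Function.comp_apply, id]
    rw [h3, (h2 t).deriv]
    linarith [h t ht]

/-- The tangent at the left end point, for a function with second derivative at least `-m`. -/
theorem hasDerivAt_mul_le (hF : ∀ t, HasDerivAt F (F' t) t) (hF' : ∀ t, HasDerivAt F' (F'' t) t)
    (hab : a < b) (h : ∀ t ∈ Icc a b, -m ≤ F'' t) :
    F' a * (b - a) ≤ F b - F a + m / 2 * (b - a) ^ 2 := by
  have h1 : ∀ t, HasDerivAt (fun t => F t + m / 2 * t ^ 2) (F' t + m * t) t := fun t => by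
    refine ((hF t).add (((hasDerivAt_id t).pow 2).const_mul (m / 2))).congr_deriv ?_
    simp
    ring
  have h2 := (convexOn_add_sq hF hF' h).le_slope_of_hasDerivWithinAt ⟨le_rfl, hab.le⟩
    ⟨hab.le, le_rfl⟩ hab (h1 a).hasDerivWithinAt
  rw [slope_def_field, le_div_iff₀ (sub_pos.2 hab)] at h2
  nlinarith

/-- The tangent at the right end point, for a function with second derivative at least `-m`. -/
theorem le_hasDerivAt_mul (hF : ∀ t, HasDerivAt F (F' t) t) (hF' : ∀ t, HasDerivAt F' (F'' t) t)
    (hab : a < b) (h : ∀ t ∈ Icc a b, -m ≤ F'' t) :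
    F b - F a - m / 2 * (b - a) ^ 2 ≤ F' b * (b - a) := by
  have h1 : ∀ t, HasDerivAt (fun t => F t + m / 2 * t ^ 2) (F' t + m * t) t := fun t => by
    refine ((hF t).add (((hasDerivAt_id t).pow 2).const_mul (m / 2))).congr_deriv ?_
    simp
    ring
  have h2 := (convexOn_add_sq hF hF' h).slope_le_of_hasDerivWithinAt ⟨le_rfl, hab.le⟩
    ⟨hab.le, le_rfl⟩ hab (h1 b).hasDerivWithinAt
  rw [slope_def_field, div_le_iff₀ (sub_pos.2 hab)] at h2
  nlinarith

/-- The increment of the derivative of an almost convex function is controlled by the slopes of a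
function that is uniformly close to it. -/
theorem deriv_sub_deriv_le (hF : ∀ t, HasDerivAt F (F' t) t) (hF' : ∀ t, HasDerivAt F' (F'' t) t)
    {f : ℝ → ℝ} {p q h m' : ℝ} (hh : 0 < h) (hab : a ≤ b) (ha : 0 ≤ a - h) (hb : b + h ≤ 1)
    (hm : ∀ t ∈ Icc (a - h) (b + h), -m ≤ F'' t)
    (hFf : ∀ t ∈ Icc (a - h) (b + h), |F t - f t| ≤ m')
    (hp : ∀ x y, 0 ≤ x → x ≤ y → y ≤ 1 → p * (y - x) ≤ f y - f x)
    (hq : ∀ x y, 0 ≤ x → x ≤ y → y ≤ 1 → f y - f x ≤ q * (y - x)) :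
    F' b - F' a ≤ q - p + (4 * m' / h + m * h) := by
  have h1 := hasDerivAt_mul_le hF hF' (a := b) (b := b + h) (m := m) (by linarith)
    fun t ht => hm t ⟨by linarith [ht.1], ht.2⟩
  have h2 := le_hasDerivAt_mul hF hF' (a := a - h) (b := a) (m := m) (by linarith)
    fun t ht => hm t ⟨ht.1, by linarith [ht.2]⟩
  have h3 := hp (a - h) a ha (by linarith) (by linarith)
  have h4 := hq b (b + h) (by linarith) (by linarith) hb
  have e1 := abs_le.1 (hFf (a - h) ⟨le_rfl, by linarith⟩)
  have e2 := abs_le.1 (hFf a ⟨by linarith, by linarith⟩)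
  have e3 := abs_le.1 (hFf b ⟨by linarith, by linarith⟩)
  have e4 := abs_le.1 (hFf (b + h) ⟨by linarith, le_rfl⟩)
  have h5 : (F' b - F' a) * h ≤ (q - p + (4 * m' / h + m * h)) * h := by
    have : (q - p + (4 * m' / h + m * h)) * h = (q - p) * h + 4 * m' + m * h ^ 2 := by
      field_simp
      ring
    rw [this]
    nlinarith
  exact le_of_mul_le_mul_right h5 hh

/-- An almost convex function with Lipschitz constant `B` at the scale `h` has almost the Lipschitz
constant `B`. -/
theorem abs_hasDerivAt_le (hF : ∀ t, HasDerivAt F (F' t) t) (hF' : ∀ t, HasDerivAt F' (F'' t) t)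
    {h t B : ℝ} (hh : 0 < h) (hm : ∀ s ∈ Icc (t - h) (t + h), -m ≤ F'' s)
    (h1 : |F (t + h) - F t| ≤ B * h) (h2 : |F t - F (t - h)| ≤ B * h) :
    |F' t| ≤ B + m / 2 * h := by
  have h3 := hasDerivAt_mul_le hF hF' (a := t) (b := t + h) (m := m) (by linarith)
    fun s hs => hm s ⟨by linarith [hs.1], hs.2⟩
  have h4 := le_hasDerivAt_mul hF hF' (a := t - h) (b := t) (m := m) (by linarith)
    fun s hs => hm s ⟨hs.1, by linarith [hs.2]⟩
  have e1 := abs_le.1 h1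
  have e2 := abs_le.1 h2
  rw [abs_le]
  constructor
  · exact le_of_mul_le_mul_right (by nlinarith) hh
  · exact le_of_mul_le_mul_right (by nlinarith) hh

theorem ConvexOn.slope_bounds {f : ℝ → ℝ} (hf : ConvexOn ℝ (Icc 0 1) f)
    (hd : DifferentiableOn ℝ f (Icc 0 1)) {x y : ℝ} (hx : 0 ≤ x) (hxy : x ≤ y) (hy : y ≤ 1) :
    derivWithin f (Icc 0 1) 0 * (y - x) ≤ f y - f x ∧
      f y - f x ≤ derivWithin f (Icc 0 1) 1 * (y - x) := by
  rcases hxy.eq_or_lt with rfl | hlt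
  · simp
  have h0 : (0 : ℝ) ∈ Icc (0 : ℝ) 1 := ⟨le_rfl, zero_le_one⟩
  have h1 : (1 : ℝ) ∈ Icc (0 : ℝ) 1 := ⟨zero_le_one, le_rfl⟩
  have hxm : x ∈ Icc (0 : ℝ) 1 := ⟨hx, hxy.trans hy⟩
  have hym : y ∈ Icc (0 : ℝ) 1 := ⟨hx.trans hxy, hy⟩
  have hmono := hf.monotoneOn_derivWithin hd
  have e1 := (hmono h0 hxm hx).trans (hf.derivWithin_le_slope hxm hym hlt (hd x hxm))
  have e2 := (hf.slope_le_derivWithin hxm hym hlt (hd y hym)).trans (hmono hym h1 hy)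
  rw [slope_def_field] at e1 e2
  exact ⟨(le_div_iff₀ (sub_pos.2 hlt)).1 e1, (div_le_iff₀ (sub_pos.2 hlt)).1 e2⟩

/-- An integral over `[0, 1]` whose integrand vanishes near the end points and is bounded by `N` on
two intervals of length `σ`. -/
theorem intervalIntegral_le_of_transition {g k : ℝ → ℝ} {σ N : ℝ} (hσ : 0 < σ) (hσ8 : σ ≤ 1 / 8)
    (hN : 0 ≤ N) (hg0 : ∀ t, 0 ≤ g t) (hk : Continuous k) (hk0 : ∀ t ∈ Icc (3 * σ) (1 - 3 * σ), 0 ≤ k t)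
    (h1 : ∀ t, t < 2 * σ → g t = 0) (h2 : ∀ t, 1 - 2 * σ < t → g t = 0)
    (h3 : ∀ t ∈ Icc (2 * σ) (3 * σ), g t ≤ N)
    (h4 : ∀ t ∈ Icc (1 - 3 * σ) (1 - 2 * σ), g t ≤ N)
    (h5 : ∀ t ∈ Ioo (3 * σ) (1 - 3 * σ), g t ≤ k t) :
    ∫ t in (0 : ℝ)..1, g t ≤ (∫ t in (3 * σ)..(1 - 3 * σ), k t) + 2 * σ * N := by
  set P := Icc (3 * σ) (1 - 3 * σ) with hP
  set Q := Icc (2 * σ) (3 * σ) with hQ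
  set R := Icc (1 - 3 * σ) (1 - 2 * σ) with hR
  set G : ℝ → ℝ := fun t => P.indicator k t + (Q.indicator (fun _ => N) t + R.indicator (fun _ => N) t)
    with hG
  have i1 : Integrable (P.indicator k) :=
    (integrable_indicator_iff measurableSet_Icc).2 hk.continuousOn.integrableOn_Icc
  have i2 : Integrable (Q.indicator fun _ => N) :=
    (integrable_indicator_iff measurableSet_Icc).2 continuousOn_const.integrableOn_Icc
  have i3 : Integrable (R.indicator fun _ => N) :=
    (integrable_indicator_iff measurableSet_Icc).2 continuousOn_const.integrableOn_Icc
  have p1 : ∀ t, 0 ≤ P.indicator k t := fun t => indicator_nonneg (fun t ht => hk0 t ht) t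
  have p2 : ∀ t, 0 ≤ Q.indicator (fun _ => N) t := fun t => indicator_nonneg (fun t _ => hN) t
  have p3 : ∀ t, 0 ≤ R.indicator (fun _ => N) t := fun t => indicator_nonneg (fun t _ => hN) t
  have hGi : Integrable G := i1.add (i2.add i3)
  have hG0 : ∀ t, 0 ≤ G t := fun t => add_nonneg (p1 t) (add_nonneg (p2 t) (p3 t))
  have hgG : ∀ t, g t ≤ G t := by
    intro t
    by_cases hq : t ∈ Q
    · have := h3 t hq
      have e : Q.indicator (fun _ => N) t = N := indicator_of_mem hq _
      simp only [hG, e]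
      linarith [p1 t, p3 t]
    by_cases hr : t ∈ R
    · have := h4 t hr
      have e : R.indicator (fun _ => N) t = N := indicator_of_mem hr _
      simp only [hG, e]
      linarith [p1 t, p2 t]
    by_cases hp : t ∈ P
    · have e : P.indicator k t = k t := indicator_of_mem hp _
      have hp' : t ∈ Ioo (3 * σ) (1 - 3 * σ) := by
        refine ⟨lt_of_le_of_ne hp.1 fun h => hq ⟨by linarith, h.ge⟩, lt_of_le_of_ne hp.2 fun h =>
          hr ⟨h.ge, by linarith⟩⟩
      simp only [hG, e]
      linarith [p2 t, p3 t, h5 t hp']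
    · have : g t = 0 := by
        by_contra hne
        have c1 : 2 * σ ≤ t := not_lt.1 fun h => hne (h1 t h)
        have c2 : t ≤ 1 - 2 * σ := not_lt.1 fun h => hne (h2 t h)
        have c3 : 3 * σ < t := not_le.1 fun h => hq ⟨c1, h⟩
        have c4 : t < 1 - 3 * σ := not_le.1 fun h => hr ⟨h, c2⟩
        exact hp ⟨c3.le, c4.le⟩
      rw [this]
      exact hG0 t
  rw [intervalIntegral.integral_of_le zero_le_one, intervalIntegral.integral_of_le (by linarith)]
  calc ∫ t in Ioc 0 1, g t ≤ ∫ t in Ioc 0 1, G t :=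
        integral_mono_of_nonneg (Eventually.of_forall hg0) hGi.integrableOn (Eventually.of_forall hgG)
    _ ≤ ∫ t, G t := setIntegral_le_integral hGi (Eventually.of_forall hG0)
    _ = (∫ t in P, k t) + ((∫ t in Q, N) + ∫ t in R, N) := by
        rw [← integral_indicator measurableSet_Icc, ← integral_indicator measurableSet_Icc,
          ← integral_indicator measurableSet_Icc, ← integral_add i2 i3, ← integral_add i1]
        exact i2.add i3
    _ = _ := by
        rw [integral_Icc_eq_integral_Ioc]
        simp only [hQ, hR, setIntegral_const, smul_eq_mul, Measure.real, Real.volume_Icc]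
        rw [ENNReal.toReal_ofReal (by linarith), ENNReal.toReal_ofReal (by linarith)]
        ring

end RealEstimates

/-! ### Integrals of smooth curves over the manifold -/

section IntegralsOfCurves

variable {X : Type*} [TopologicalSpace X] [CompactSpace X] [MeasurableSpace X] [BorelSpace X]
  {μ : Measure X}

theorem Continuous.integrable_of_compactSpace [IsFiniteMeasure μ] {f : X → ℝ} (hf : Continuous f) :
    Integrable f μ :=
  hf.integrable_of_hasCompactSupport (HasCompactSupport.of_compactSpace _)

theorem hasDerivAt_integral_of_continuous [IsFiniteMeasure μ] {G G' : ℝ → X → ℝ}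
    (hG : ∀ t, Continuous (G t)) (hG' : Continuous fun p : ℝ × X => G' p.1 p.2)
    (h : ∀ x t, HasDerivAt (fun s => G s x) (G' t x) t) (t : ℝ) :
    HasDerivAt (fun t => ∫ x, G t x ∂μ) (∫ x, G' t x ∂μ) t := by
  obtain ⟨B, hB⟩ := ((isCompact_Icc (a := t - 1) (b := t + 1)).prod
    (isCompact_univ (X := X))).bddAbove_image hG'.norm.continuousOn
  have hs : Icc (t - 1) (t + 1) ∈ 𝓝 t := Icc_mem_nhds (by linarith) (by linarith)
  refine (hasDerivAt_integral_of_dominated_loc_of_deriv_le (bound := fun _ => B) hs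
    (Eventually.of_forall fun s => (hG s).integrable_of_compactSpace.aestronglyMeasurable)
    (hG t).integrable_of_compactSpace
    (hG'.comp (by fun_prop : Continuous fun x : X => (t, x))).integrable_of_compactSpace.aestronglyMeasurable
    (Eventually.of_forall fun x s hs => ?_) (integrable_const B)
    (Eventually.of_forall fun x s _ => h x s)).2
  exact hB (mem_image_of_mem (fun p : ℝ × X => ‖G' p.1 p.2‖) (mk_mem_prod hs (mem_univ x)))

/-- The mean minimizes the mean square deviation. -/
theorem integral_sub_average_sq_le [IsFiniteMeasure μ] {h : X → ℝ} (hh : Continuous h) (c : ℝ) :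
    ∫ x, (h x - ⨍ y, h y ∂μ) ^ 2 ∂μ ≤ ∫ x, (h x - c) ^ 2 ∂μ := by
  set a := ⨍ y, h y ∂μ with ha
  have h1 : ∫ x, (h x - a) ∂μ = 0 := by
    rw [ha]
    exact integral_sub_average μ h
  have i1 : Integrable (fun x => (h x - a) ^ 2) μ :=
    ((hh.sub continuous_const).pow 2).integrable_of_compactSpace
  have i2 : Integrable (fun x => 2 * (a - c) * (h x - a)) μ :=
    (continuous_const.mul (hh.sub continuous_const)).integrable_of_compactSpace
  have h2 : ∫ x, (h x - c) ^ 2 ∂μ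
      = ∫ x, (h x - a) ^ 2 ∂μ + (2 * (a - c) * ∫ x, (h x - a) ∂μ + ∫ _, (a - c) ^ 2 ∂μ) := by
    have i3 : Integrable (fun x => 2 * (a - c) * (h x - a) + (a - c) ^ 2) μ :=
      i2.add (integrable_const _)
    rw [← integral_const_mul, ← integral_add i2 (integrable_const _), ← integral_add i1 i3]
    exact integral_congr_ae (Eventually.of_forall fun x => by simp only; ring)
  rw [h2, h1]
  have : 0 ≤ ∫ _, (a - c) ^ 2 ∂μ := integral_nonneg fun _ => sq_nonneg _
  linarith

end IntegralsOfCurves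

/-! ### Speed and length of curves of potentials -/

section Speed

variable {n : ℕ} {X : Type*} [TopologicalSpace X] [ChartedSpace (Cn n) X]
  [IsManifold 𝓘(ℂ, Cn n) ∞ X] [CompactSpace X] [T2Space X] {Ω : KahlerForm n X} {Φ : ℝ → X → ℝ}

namespace KahlerForm

theorem IsPotential.convex {φ ψ : X → ℝ} (hφ : Ω.IsPotential φ) (hψ : Ω.IsPotential ψ) {s : ℝ}
    (hs0 : 0 ≤ s) (hs1 : s ≤ 1) : Ω.IsPotential fun x => φ x + s * (ψ x - φ x) := by
  refine ⟨hφ.1.add (contMDiff_const.mul (hψ.1.sub hφ.1)), fun e he z hz v hv => ?_⟩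
  have h1 := hφ.2 e he z hz v hv
  have h2 := hψ.2 e he z hz v hv
  have d1 := contDiffAt_two_chart hφ.1 he hz
  have d2 := contDiffAt_two_chart hψ.1 he hz
  rw [potForm_I_smul] at h1 h2 ⊢
  have e1 : (fun y => φ (e.symm y) + s * (ψ (e.symm y) - φ (e.symm y)))
      = fun y => (1 - s) * φ (e.symm y) + s * ψ (e.symm y) := by
    ext y; ring
  rw [e1, levi_add (contDiffAt_const.mul d1) (contDiffAt_const.mul d2), levi_const_mul _ d1,
    levi_const_mul _ d2]
  rcases hs0.eq_or_lt with rfl | h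
  · linarith
  · nlinarith

theorem continuous_velocity (hΦ : ContMDiff (𝓘(ℝ).prod 𝓘(ℝ, Cn n)) 𝓘(ℝ) ∞
    (fun p : ℝ × X => Φ p.1 p.2)) (t : ℝ) : Continuous fun x => deriv (fun s => Φ s x) t :=
  (contMDiff_deriv_curve hΦ).continuous.comp (by fun_prop : Continuous fun x : X => (t, x))

theorem contMDiff_velocity (hΦ : ContMDiff (𝓘(ℝ).prod 𝓘(ℝ, Cn n)) 𝓘(ℝ) ∞
    (fun p : ℝ × X => Φ p.1 p.2)) (t : ℝ) :
    ContMDiff 𝓘(ℝ, Cn n) 𝓘(ℝ) ∞ fun x => deriv (fun s => Φ s x) t :=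
  (contMDiff_deriv_curve hΦ).comp (contMDiff_const.prodMk contMDiff_id)

variable [MeasurableSpace X] [BorelSpace X] {μ : Measure X}

theorem hasDerivAt_integral_curve [IsFiniteMeasure μ]
    (hΦ : ContMDiff (𝓘(ℝ).prod 𝓘(ℝ, Cn n)) 𝓘(ℝ) ∞ (fun p : ℝ × X => Φ p.1 p.2)) {ψ : X → ℝ}
    (hψ : Continuous ψ) (t : ℝ) : HasDerivAt (fun t => ∫ x, Φ t x * ψ x ∂μ)
      (∫ x, deriv (fun s => Φ s x) t * ψ x ∂μ) t := by
  refine hasDerivAt_integral_of_continuous (G := fun t x => Φ t x * ψ x)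
    (G' := fun t x => deriv (fun s => Φ s x) t * ψ x) (fun t => ?_) ?_
    (fun x t => (hasDerivAt_of_contMDiff hΦ x t).mul_const _) t
  · exact (hΦ.continuous.comp (by fun_prop : Continuous fun x : X => (t, x))).mul hψ
  · exact (contMDiff_deriv_curve hΦ).continuous.mul (hψ.comp continuous_snd)

theorem hasDerivAt_integral [IsFiniteMeasure μ]
    (hΦ : ContMDiff (𝓘(ℝ).prod 𝓘(ℝ, Cn n)) 𝓘(ℝ) ∞ (fun p : ℝ × X => Φ p.1 p.2)) (t : ℝ) :
    HasDerivAt (fun t => ∫ x, Φ t x ∂μ) (∫ x, deriv (fun s => Φ s x) t ∂μ) t := by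
  simpa using hasDerivAt_integral_curve (μ := μ) hΦ (continuous_const (y := (1 : ℝ))) t

/-- The norm of the velocity of the curve `(Ω_{φ_t})` for the Mabuchi metric. -/
def speed (Ω : KahlerForm n X) (φ : ℝ → X → ℝ) (t : ℝ) : ℝ :=
  Real.sqrt (∫ x, (deriv (fun s => φ s x) t
    - ⨍ y, deriv (fun s => φ s y) t ∂(Ω.topPower (φ t))) ^ 2 ∂(Ω.topPower (φ t)))

theorem mabuchiLength_eq (Ω : KahlerForm n X) (φ : ℝ → X → ℝ) :
    Ω.mabuchiLength φ = ∫ t in (0 : ℝ)..1, Ω.speed φ t := rfl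

theorem speed_nonneg (φ : ℝ → X → ℝ) (t : ℝ) : 0 ≤ Ω.speed φ t := Real.sqrt_nonneg _

theorem speed_eq_zero {t : ℝ} (h : ∀ x, deriv (fun s => Φ s x) t = 0) : Ω.speed Φ t = 0 := by
  simp [speed, h, average]

theorem mabuchiLength_nonneg (φ : ℝ → X → ℝ) : 0 ≤ Ω.mabuchiLength φ := by
  rw [mabuchiLength_eq]
  exact intervalIntegral.integral_nonneg zero_le_one fun t _ => speed_nonneg φ t

theorem mabuchiDist_nonneg (φ ψ : X → ℝ) : 0 ≤ Ω.mabuchiDist φ ψ := by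
  refine Real.sInf_nonneg ?_
  rintro L ⟨φ, -, -, -, rfl⟩
  exact mabuchiLength_nonneg φ

theorem mabuchiDist_le_length (hΦ : Ω.IsSmoothCurve Φ) :
    Ω.mabuchiDist (Φ 0) (Φ 1) ≤ Ω.mabuchiLength Φ := by
  refine csInf_le ⟨0, ?_⟩ ⟨Φ, hΦ, ⟨0, by simp⟩, ⟨0, by simp⟩, rfl⟩
  rintro L ⟨φ, -, -, -, rfl⟩
  exact mabuchiLength_nonneg φ

/-- A bound for the velocity gives one for the speed, as all metrics have the same total mass. -/
theorem speed_le_of_abs_le (hΦ : ContMDiff (𝓘(ℝ).prod 𝓘(ℝ, Cn n)) 𝓘(ℝ) ∞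
    (fun p : ℝ × X => Φ p.1 p.2)) {t M : ℝ} (hp : Ω.IsPotential (Φ t)) (hM0 : 0 ≤ M)
    (hM : ∀ x, |deriv (fun s => Φ s x) t| ≤ M) :
    Ω.speed Φ t ≤ M * Real.sqrt ((Ω.topPower 0).real univ) := by
  have := isFiniteMeasure_topPower Ω hp.1
  have h1 := integral_sub_average_sq_le (μ := Ω.topPower (Φ t)) (continuous_velocity hΦ t) 0
  have h2 : ∫ x, (deriv (fun s => Φ s x) t - 0) ^ 2 ∂(Ω.topPower (Φ t))
      ≤ M ^ 2 * (Ω.topPower 0).real univ := by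
    calc _ ≤ ∫ x, M ^ 2 ∂(Ω.topPower (Φ t)) := by
          refine integral_mono ((continuous_velocity hΦ t).sub
            continuous_const |>.pow 2).integrable_of_compactSpace (integrable_const _) fun x => ?_
          simp only [sub_zero]
          exact sq_le_sq' (abs_le.1 (hM x)).1 (abs_le.1 (hM x)).2
      _ = _ := by
          rw [integral_const, smul_eq_mul, Measure.real, Measure.real, hp.topPower_univ, mul_comm]
  calc Ω.speed Φ t ≤ Real.sqrt (M ^ 2 * (Ω.topPower 0).real univ) :=
        Real.sqrt_le_sqrt (h1.trans h2)
    _ = _ := by rw [Real.sqrt_mul (sq_nonneg M), Real.sqrt_sq hM0]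

/-- A bound for the variance of the velocity with respect to `μ` gives one for the speed, since
`Ω_{Φ_t}^n ≤ C ^ n Ω^n ≤ C ^ n / A μ`. The free parameter `s` makes the bound linear in `D`. -/
theorem speed_le_of_integral_le (hΦ : ContMDiff (𝓘(ℝ).prod 𝓘(ℝ, Cn n)) 𝓘(ℝ) ∞
    (fun p : ℝ × X => Φ p.1 p.2)) [IsFiniteMeasure μ] {t C A c D s : ℝ} (hp : Ω.IsPotential (Φ t))
    (hC : 0 < C) (hA : 0 < A) (hAμ : ENNReal.ofReal A • Ω.topPower 0 ≤ μ) (hs : 0 < s)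
    (hle : ∀ e ∈ atlas (Cn n) X, ∀ z ∈ e.target, ∀ v : Cn n,
      Ω.potForm (Φ t) e z v (Complex.I • v) ≤ C * Ω.normSq e z v)
    (hD : ∫ x, (deriv (fun s => Φ s x) t - c) ^ 2 ∂μ ≤ D) :
    Ω.speed Φ t ≤ (C ^ n / A * D / s + s) / 2 := by
  have := isFiniteMeasure_topPower Ω hp.1
  have h0 := isPotential_zero Ω
  have hdens : Ω.topPower (Φ t) ≤ ENNReal.ofReal (C ^ n) • Ω.topPower 0 := by
    refine topPower_le hp.1 h0.1 (by positivity) fun e he z hz => hp.density_le h0 hC he hz fun v => ?_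
    have h1 : levi (fun y => (0 : X → ℝ) (e.symm y)) z v = 0 := levi_const 0 z v
    rw [potForm_I_smul Ω 0, h1, add_zero]
    exact hle e he z hz v
  have hν : Ω.topPower (Φ t) ≤ ENNReal.ofReal (C ^ n / A) • μ := by
    refine hdens.trans ?_
    calc ENNReal.ofReal (C ^ n) • Ω.topPower 0
        = ENNReal.ofReal (C ^ n / A) • ENNReal.ofReal A • Ω.topPower 0 := by
          rw [smul_smul, ← ENNReal.ofReal_mul (by positivity), div_mul_cancel₀ _ hA.ne']
      _ ≤ _ := by gcongr
  have hsq : Continuous fun x => (deriv (fun s => Φ s x) t - c) ^ 2 :=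
    ((continuous_velocity hΦ t).sub continuous_const).pow 2
  have h1 : ∫ x, (deriv (fun s => Φ s x) t - c) ^ 2 ∂(Ω.topPower (Φ t)) ≤ C ^ n / A * D := by
    have : IsFiniteMeasure (ENNReal.ofReal (C ^ n / A) • μ) :=
      Measure.smul_finite _ ENNReal.ofReal_ne_top
    refine (integral_mono_measure hν (Eventually.of_forall fun x => sq_nonneg _)
      hsq.integrable_of_compactSpace).trans ?_
    rw [integral_smul_measure, ENNReal.toReal_ofReal (by positivity), smul_eq_mul]
    gcongr
  have h2 := integral_sub_average_sq_le (μ := Ω.topPower (Φ t)) (continuous_velocity hΦ t) c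
  have h3 : Ω.speed Φ t ^ 2 ≤ C ^ n / A * D := by
    rw [speed, Real.sq_sqrt (integral_nonneg fun _ => sq_nonneg _)]
    exact h2.trans h1
  -- the inequality between the arithmetic and the geometric mean
  have h4 : 2 * Ω.speed Φ t * s ≤ C ^ n / A * D + s ^ 2 := by
    nlinarith [sq_nonneg (Ω.speed Φ t - s)]
  rw [le_div_iff₀ two_pos, div_add' _ _ _ hs.ne', le_div_iff₀ hs]
  linarith

end KahlerForm

end Speed

/-! ### Acceleration and variance of the velocity -/

section Regularization

variable {n : ℕ} {X : Type*} [TopologicalSpace X] [ChartedSpace (Cn n) X]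

/-- Smooth curves `Φ` that regularize a subgeodesic `u` on `[σ, 1 - σ]` up to an error `ε`: they
consist of Kähler potentials with `Ω_{Φ_t} ≤ (C + ε) Ω`, are almost convex in `t`, and their
acceleration controls the gradient of their velocity. -/
structure KahlerForm.IsRegularization (Ω : KahlerForm n X) (u : ℝ → X → ℝ) (C σ ε : ℝ)
    (Φ : ℝ → X → ℝ) : Prop where
  contMDiff : ContMDiff (𝓘(ℝ).prod 𝓘(ℝ, Cn n)) 𝓘(ℝ) ∞ (fun p : ℝ × X => Φ p.1 p.2)
  close : ∀ t ∈ Icc σ (1 - σ), ∀ x, |Φ t x - u t x| ≤ ε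
  isPotential : ∀ t ∈ Icc σ (1 - σ), Ω.IsPotential (Φ t)
  neg_le : ∀ t ∈ Icc σ (1 - σ), ∀ x, -ε ≤ deriv (deriv fun s => Φ s x) t
  form_le : ∀ t ∈ Icc σ (1 - σ), ∀ e ∈ atlas (Cn n) X, ∀ z ∈ e.target, ∀ v : Cn n,
    Ω.potForm (Φ t) e z v (Complex.I • v) ≤ (C + ε) * Ω.normSq e z v
  gradient_le : ∀ t ∈ Icc σ (1 - σ), ∀ e ∈ atlas (Cn n) X, ∀ z ∈ e.target, ∀ v : Cn n,
    fderiv ℝ (fun y => deriv (fun s => Φ s (e.symm y)) t) z v ^ 2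
      ≤ 4 * Real.pi * (C + ε) * (deriv (deriv fun s => Φ s (e.symm z)) t + ε) * Ω.normSq e z v

variable [IsManifold 𝓘(ℂ, Cn n) ∞ X] [CompactSpace X] [T2Space X] {Ω : KahlerForm n X}
  {u Φ : ℝ → X → ℝ} {C σ ε : ℝ}

namespace KahlerForm

theorem IsSubgeodesic.exists_isRegularization (hu : Ω.IsSubgeodesic u) (hC0 : 0 ≤ C)
    (hC : Ω.SliceLE u C) (hσ : 0 < σ) (hε : 0 < ε) : ∃ Φ, Ω.IsRegularization u C σ ε Φ := by
  obtain ⟨K, -, hK⟩ := hu.exists_potential_approx hC0 hC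
  obtain ⟨Φ, h1, h2, h3, h4, h5⟩ := hK σ hσ ε hε
  exact ⟨Φ, h1, fun t ht x => h2 x t ht.1 ht.2, fun t ht => h3 t ht.1 ht.2,
    fun t ht x => (h4 x t ht.1 ht.2).1, fun t ht e he z hz v => (h5 e he z hz t ht.1 ht.2 v).1,
    fun t ht e he z hz v => (h5 e he z hz t ht.1 ht.2 v).2⟩

namespace IsRegularization

variable (H : Ω.IsRegularization u C σ ε Φ)
include H

/-- The velocities of a regularization are bounded in terms of a Lipschitz constant of the
subgeodesic. -/
theorem abs_velocity_le (hσ : 0 < σ) {L : ℝ}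
    (hL : ∀ s ∈ Icc (0 : ℝ) 1, ∀ t ∈ Icc (0 : ℝ) 1, ∀ x, |u s x - u t x| ≤ L * |s - t|) {t : ℝ}
    (ht : t ∈ Icc (2 * σ) (1 - 2 * σ)) (x : X) :
    |deriv (fun s => Φ s x) t| ≤ L + 2 * ε / σ + ε / 2 * σ := by
  have hinc : ∀ r ∈ Icc σ (1 - σ), ∀ r' ∈ Icc σ (1 - σ), r - r' = σ →
      |Φ r x - Φ r' x| ≤ (L + 2 * ε / σ) * σ := by
    intro r hr r' hr' hrr
    have h1 := abs_le.1 (H.close r hr x)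
    have h2 := abs_le.1 (H.close r' hr' x)
    have h3 := hL r ⟨hσ.le.trans hr.1, by linarith [hr.2]⟩ r' ⟨hσ.le.trans hr'.1, by linarith [hr'.2]⟩ x
    rw [hrr, abs_of_pos hσ] at h3
    have h4 := abs_le.1 h3
    have h5 : (L + 2 * ε / σ) * σ = L * σ + 2 * ε := by field_simp
    rw [h5, abs_le]
    constructor <;> linarith
  have m0 : t ∈ Icc σ (1 - σ) := ⟨by linarith [ht.1], by linarith [ht.2]⟩
  refine abs_hasDerivAt_le (hasDerivAt_of_contMDiff H.contMDiff x)
    (hasDerivAt_of_contMDiff (Φ := fun t x => deriv (fun s => Φ s x) t)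
      (contMDiff_deriv_curve H.contMDiff) x) hσ (fun s hs => H.neg_le s ⟨by linarith [ht.1, hs.1],
        by linarith [ht.2, hs.2]⟩ x)
    (hinc _ ⟨?_, ?_⟩ _ m0 (by ring)) (hinc _ m0 _ ⟨?_, ?_⟩ (by ring)) <;>
  linarith [ht.1, ht.2]

variable [MeasurableSpace X] [BorelSpace X] {μ : Measure X} [IsFiniteMeasure μ]

theorem neg_le_integral {t : ℝ} (ht : t ∈ Icc σ (1 - σ)) :
    -(ε * μ.real univ) ≤ ∫ x, deriv (deriv fun s => Φ s x) t ∂μ := by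
  have h1 : ∫ _, -ε ∂μ = -(ε * μ.real univ) := by
    rw [integral_const, smul_eq_mul]; ring
  rw [← h1]
  exact integral_mono (integrable_const _) (continuous_velocity
    (Φ := fun t x => deriv (fun s => Φ s x) t)
    (contMDiff_deriv_curve H.contMDiff) t).integrable_of_compactSpace fun x => H.neg_le t ht x

theorem abs_integral_sub_le (hu : Ω.IsSubgeodesic u) (hσ : 0 ≤ σ) {t : ℝ}
    (ht : t ∈ Icc σ (1 - σ)) : |∫ x, Φ t x ∂μ - ∫ x, u t x ∂μ| ≤ ε * μ.real univ := by
  have ht' : t ∈ Icc (0 : ℝ) 1 := ⟨hσ.trans ht.1, by linarith [ht.2]⟩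
  rw [← integral_sub (H.isPotential t ht).1.continuous.integrable_of_compactSpace
    (hu.integrable ht')]
  have := norm_integral_le_of_norm_le_const (μ := μ) (f := fun x => Φ t x - u t x) (C := ε)
    (Eventually.of_forall fun x => H.close t ht x)
  simpa using this

/-- The total acceleration of the regularization is controlled by the slopes of the integrals of
the subgeodesic. -/
theorem integral_velocity_sub_le (hu : Ω.IsSubgeodesic u) (hσ : 0 ≤ σ) {a b h p q : ℝ} (hh : 0 < h)
    (hab : a ≤ b) (ha : σ ≤ a - h) (hb : b + h ≤ 1 - σ)
    (hp : ∀ x y, 0 ≤ x → x ≤ y → y ≤ 1 → p * (y - x) ≤ ∫ z, u y z ∂μ - ∫ z, u x z ∂μ)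
    (hq : ∀ x y, 0 ≤ x → x ≤ y → y ≤ 1 → ∫ z, u y z ∂μ - ∫ z, u x z ∂μ ≤ q * (y - x)) :
    ∫ x, deriv (fun s => Φ s x) b ∂μ - ∫ x, deriv (fun s => Φ s x) a ∂μ
      ≤ q - p + ε * μ.real univ * (4 / h + h) := by
  have h1 := deriv_sub_deriv_le (F := fun t => ∫ x, Φ t x ∂μ) (f := fun t => ∫ x, u t x ∂μ)
    (m := ε * μ.real univ) (m' := ε * μ.real univ) (hasDerivAt_integral H.contMDiff)
    (hasDerivAt_integral (Φ := fun t x => deriv (fun s => Φ s x) t)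
      (contMDiff_deriv_curve H.contMDiff)) hh hab (hσ.trans ha) (by linarith)
    (fun t ht => H.neg_le_integral ⟨ha.trans ht.1, ht.2.trans hb⟩)
    (fun t ht => H.abs_integral_sub_le hu hσ ⟨ha.trans ht.1, ht.2.trans hb⟩) hp hq
  have h2 : 4 * (ε * μ.real univ) / h + ε * μ.real univ * h = ε * μ.real univ * (4 / h + h) := by
    ring
  rw [← h2]
  exact h1

end IsRegularization

/-- The acceleration of a regularization controls the variance of its velocity: the
Poincaré inequality, applied to the gradient estimate. -/
theorem _root_.IsSmoothVolume.exists_variance_le [ConnectedSpace X] [MeasurableSpace X]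
    [BorelSpace X] {μ : Measure X} [IsFiniteMeasure μ] (hμ : IsSmoothVolume n μ)
    (Ω : KahlerForm n X) : ∃ K : ℝ, 0 ≤ K ∧ ∀ (u Φ : ℝ → X → ℝ) (C σ ε : ℝ), 0 ≤ C + ε →
      Ω.IsRegularization u C σ ε Φ → ∀ t ∈ Icc σ (1 - σ), ∃ c : ℝ,
        ∫ x, (deriv (fun s => Φ s x) t - c) ^ 2 ∂μ ≤ K * (4 * Real.pi * (C + ε))
          * (∫ x, deriv (deriv fun s => Φ s x) t ∂μ + ε * μ.real univ) := by
  obtain ⟨K, hK0, hK⟩ := hμ.poincareOn_univ Ω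
  refine ⟨K, hK0, fun u Φ C σ ε hC H t ht => ?_⟩
  have hc : Continuous fun x => deriv (deriv fun s => Φ s x) t :=
    continuous_velocity (Φ := fun t x => deriv (fun s => Φ s x) t)
      (contMDiff_deriv_curve H.contMDiff) t
  obtain ⟨c, hc'⟩ := hK (fun x => deriv (fun s => Φ s x) t)
    (fun x => 4 * Real.pi * (C + ε) * (deriv (deriv fun s => Φ s x) t + ε))
    (contMDiff_velocity H.contMDiff t) (continuous_const.mul (hc.add continuous_const))
    (fun x => mul_nonneg (by positivity) (by linarith [H.neg_le t ht x]))
    (fun e he z hz v => H.gradient_le t ht e he z hz v)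
  refine ⟨c, ?_⟩
  rw [Measure.restrict_univ, integral_const_mul,
    integral_add hc.integrable_of_compactSpace (integrable_const _), integral_const, smul_eq_mul,
    mul_comm (μ.real univ), ← mul_assoc] at hc'
  exact hc'

end KahlerForm

end Regularization

/-! ### Transitions between curves of potentials -/

section Transition

theorem exists_abs_deriv_smoothTransition_le :
    ∃ M : ℝ, 0 ≤ M ∧ ∀ x, |deriv Real.smoothTransition x| ≤ M := by
  have hc : Continuous (deriv Real.smoothTransition) :=
    (Real.smoothTransition.contDiff (n := 1)).continuous_deriv le_rfl
  obtain ⟨M, hM⟩ := (isCompact_Icc (a := (0 : ℝ)) (b := 1)).bddAbove_image hc.norm.continuousOn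
  refine ⟨max M 0, le_max_right _ _, fun x => ?_⟩
  rcases lt_or_ge x 0 with h | h
  · have : Real.smoothTransition =ᶠ[𝓝 x] fun _ => 0 := by
      filter_upwards [gt_mem_nhds h] with y hy using Real.smoothTransition.zero_of_nonpos hy.le
    rw [this.deriv_eq]
    simp
  rcases lt_or_ge 1 x with h' | h'
  · have : Real.smoothTransition =ᶠ[𝓝 x] fun _ => 1 := by
      filter_upwards [lt_mem_nhds h'] with y hy using Real.smoothTransition.one_of_one_le hy.le
    rw [this.deriv_eq]
    simp
  · exact (hM (mem_image_of_mem (fun x => ‖deriv Real.smoothTransition x‖) ⟨h, h'⟩)).trans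
      (le_max_left _ _)

/-- The velocity of a transition, with the cutoff function `smoothTransition (ℓ s)` for an affine
function `ℓ` of slope `κ`, from the curve `g` to the constant `c`. -/
theorem abs_deriv_transition_le {g : ℝ → ℝ} {g' c t κ r M : ℝ} (hg : HasDerivAt g g' t)
    (hM : ∀ x, |deriv Real.smoothTransition x| ≤ M) :
    |deriv (fun s => g s + Real.smoothTransition (κ * s + r) * (c - g s)) t|
      ≤ |g'| + M * |κ| * |c - g t| := by
  have h1 : HasDerivAt (fun s => κ * s + r) κ t := by
    simpa using ((hasDerivAt_id t).const_mul κ).add_const r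
  have h2 := ((Real.smoothTransition.contDiff (n := 1)).differentiable (by simp)
    (κ * t + r)).hasDerivAt.comp t h1
  have h3 := hg.add (h2.mul (hg.const_sub c))
  set θ := Real.smoothTransition (κ * t + r) with hθ
  have h4 : deriv (fun s => g s + Real.smoothTransition (κ * s + r) * (c - g s)) t
      = (1 - θ) * g' + deriv Real.smoothTransition (κ * t + r) * κ * (c - g t) := by
    refine (h3.deriv.trans ?_)
    simp only [Function.comp]
    ring
  have hθ0 : 0 ≤ θ := Real.smoothTransition.nonneg _
  have hθ1 : θ ≤ 1 := Real.smoothTransition.le_one _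
  rw [h4]
  refine (abs_add_le _ _).trans (add_le_add ?_ ?_)
  · rw [abs_mul, abs_of_nonneg (by linarith)]
    exact mul_le_of_le_one_left (abs_nonneg _) (by linarith)
  · rw [abs_mul, abs_mul]
    gcongr
    exact hM _

/-- The curve that stays at `a` until the time `2σ`, passes over to `Φ` until `3σ`, and from
`1 - 3σ` to `1 - 2σ` passes over to `b`. -/
def blend {X : Type*} (a b : X → ℝ) (Φ : ℝ → X → ℝ) (σ t : ℝ) (x : X) : ℝ :=
  Φ t x + Real.smoothTransition (-σ⁻¹ * t + 3) * (a x - Φ t x)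
    + Real.smoothTransition (σ⁻¹ * t + (3 - σ⁻¹)) * (b x - Φ t x)

section

variable {X : Type*} {a b : X → ℝ} {Φ : ℝ → X → ℝ} {σ t : ℝ}

theorem blend_eq_left (hσ : 0 < σ) (ht : t ≤ 1 - 3 * σ) : blend a b Φ σ t
    = fun x => Φ t x + Real.smoothTransition (-σ⁻¹ * t + 3) * (a x - Φ t x) := by
  ext x
  have : σ⁻¹ * t + (3 - σ⁻¹) = (t - (1 - 3 * σ)) / σ := by field_simp; ring
  rw [blend, Real.smoothTransition.zero_of_nonpos (x := σ⁻¹ * t + (3 - σ⁻¹))]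
  · ring
  · rw [this]
    exact div_nonpos_of_nonpos_of_nonneg (by linarith) hσ.le

theorem blend_eq_right (hσ : 0 < σ) (ht : 3 * σ ≤ t) : blend a b Φ σ t
    = fun x => Φ t x + Real.smoothTransition (σ⁻¹ * t + (3 - σ⁻¹)) * (b x - Φ t x) := by
  ext x
  have : -σ⁻¹ * t + 3 = (3 * σ - t) / σ := by field_simp; ring
  rw [blend, Real.smoothTransition.zero_of_nonpos (x := -σ⁻¹ * t + 3)]
  · ring
  · rw [this]
    exact div_nonpos_of_nonpos_of_nonneg (by linarith) hσ.le

theorem blend_eq_middle (hσ : 0 < σ) (ht : 3 * σ ≤ t) (ht' : t ≤ 1 - 3 * σ) :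
    blend a b Φ σ t = Φ t := by
  rw [blend_eq_right hσ ht]
  ext x
  have : σ⁻¹ * t + (3 - σ⁻¹) = (t - (1 - 3 * σ)) / σ := by field_simp; ring
  rw [Real.smoothTransition.zero_of_nonpos]
  · ring
  · rw [this]
    exact div_nonpos_of_nonpos_of_nonneg (by linarith) hσ.le

theorem blend_eq_start (hσ : 0 < σ) (hσ8 : σ ≤ 1 / 8) (ht : t ≤ 2 * σ) : blend a b Φ σ t = a := by
  rw [blend_eq_left hσ (by linarith)]
  ext x
  have : -σ⁻¹ * t + 3 = (3 * σ - t) / σ := by field_simp; ring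
  rw [Real.smoothTransition.one_of_one_le]
  · ring
  · rw [this, le_div_iff₀ hσ]
    linarith

theorem blend_eq_end (hσ : 0 < σ) (hσ8 : σ ≤ 1 / 8) (ht : 1 - 2 * σ ≤ t) :
    blend a b Φ σ t = b := by
  rw [blend_eq_right hσ (by linarith)]
  ext x
  have : σ⁻¹ * t + (3 - σ⁻¹) = (t - (1 - 3 * σ)) / σ := by field_simp; ring
  rw [Real.smoothTransition.one_of_one_le]
  · ring
  · rw [this, le_div_iff₀ hσ]
    linarith

end

end Transition

/-! ### The estimate of the Mabuchi distance -/

section DistanceEstimate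

variable {n : ℕ} {X : Type*} [TopologicalSpace X] [ChartedSpace (Cn n) X]
  [IsManifold 𝓘(ℂ, Cn n) ∞ X] [CompactSpace X] [T2Space X] {Ω : KahlerForm n X}
  {u Φ : ℝ → X → ℝ} {C σ ε : ℝ}

namespace KahlerForm

/-- By convexity of the space of potentials the transitions stay in it, and outside of the interval
where `Φ` is known to consist of potentials the curve is constant. -/
theorem IsRegularization.isSmoothCurve_blend (H : Ω.IsRegularization u C σ ε Φ) (hσ : 0 < σ)
    (hσ8 : σ ≤ 1 / 8) {a b : X → ℝ} (ha : Ω.IsPotential a) (hb : Ω.IsPotential b) :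
    Ω.IsSmoothCurve (blend a b Φ σ) := by
  have hcut : ∀ κ r : ℝ, ContMDiff (𝓘(ℝ).prod 𝓘(ℝ, Cn n)) 𝓘(ℝ) ∞
      fun p : ℝ × X => Real.smoothTransition (κ * p.1 + r) := fun κ r =>
    ((Real.smoothTransition.contDiff (n := ⊤)).comp
      (by fun_prop : ContDiff ℝ ∞ fun t : ℝ => κ * t + r)).contMDiff.comp contMDiff_fst
  refine ⟨?_, fun t ht => ?_⟩
  · exact (H.contMDiff.add ((hcut _ _).mul ((ha.1.comp contMDiff_snd).sub H.contMDiff))).add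
      ((hcut _ _).mul ((hb.1.comp contMDiff_snd).sub H.contMDiff))
  rcases le_total t (2 * σ) with h1 | h1
  · rwa [blend_eq_start hσ hσ8 h1]
  rcases le_total (1 - 2 * σ) t with h2 | h2
  · rwa [blend_eq_end hσ hσ8 h2]
  have hΦ := H.isPotential t ⟨by linarith, by linarith⟩
  rcases le_total t (1 - 3 * σ) with h3 | h3
  · rw [blend_eq_left hσ h3]
    exact hΦ.convex ha (Real.smoothTransition.nonneg _) (Real.smoothTransition.le_one _)
  · rw [blend_eq_right hσ (by linarith)]
    exact hΦ.convex hb (Real.smoothTransition.nonneg _) (Real.smoothTransition.le_one _)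

variable [MeasurableSpace X] [BorelSpace X] {μ : Measure X}

theorem speed_congr {φ ψ : ℝ → X → ℝ} {t : ℝ} (h : ∀ᶠ s in 𝓝 t, φ s = ψ s) :
    Ω.speed φ t = Ω.speed ψ t := by
  have h1 : ∀ x, deriv (fun s => φ s x) t = deriv (fun s => ψ s x) t := fun x =>
    EventuallyEq.deriv_eq (h.mono fun s hs => congrFun hs x)
  rw [speed, speed, h.self_of_nhds]
  simp only [h1]

theorem speed_eq_zero_of_eventually {t : ℝ} {a : X → ℝ} (h : ∀ᶠ s in 𝓝 t, Φ s = a) :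
    Ω.speed Φ t = 0 := by
  rw [speed_congr (ψ := fun _ => a) h]
  exact speed_eq_zero fun x => deriv_const _ _

/-- The length of the curve that joins potentials close to the end points of a subgeodesic through
its regularization. In the middle the speed is controlled by the acceleration; the transitions at
the ends have bounded speed and take the time `2σ`. -/
theorem IsSubgeodesic.exists_mabuchiDist_le [IsFiniteMeasure μ] (hu : Ω.IsSubgeodesic u)
    {C A K p q : ℝ} (hC : 0 < C) (hle : Ω.SliceLE u C) (hA : 0 < A)
    (hAμ : ENNReal.ofReal A • Ω.topPower 0 ≤ μ) (hK : 0 ≤ K)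
    (hvar : ∀ (u Φ : ℝ → X → ℝ) (C σ ε : ℝ), 0 ≤ C + ε →
      Ω.IsRegularization u C σ ε Φ → ∀ t ∈ Icc σ (1 - σ), ∃ c : ℝ,
        ∫ x, (deriv (fun s => Φ s x) t - c) ^ 2 ∂μ ≤ K * (4 * Real.pi * (C + ε))
          * (∫ x, deriv (deriv fun s => Φ s x) t ∂μ + ε * μ.real univ))
    (hp : ∀ x y, 0 ≤ x → x ≤ y → y ≤ 1 → p * (y - x) ≤ ∫ z, u y z ∂μ - ∫ z, u x z ∂μ)
    (hq : ∀ x y, 0 ≤ x → x ≤ y → y ≤ 1 → ∫ z, u y z ∂μ - ∫ z, u x z ∂μ ≤ q * (y - x)) :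
    ∃ N : ℝ, ∀ σ, 0 < σ → σ ≤ 1 / 8 → ∀ s, 0 < s → ∀ a b : X → ℝ, Ω.IsPotential a →
      Ω.IsPotential b → (∀ x, |a x - u 0 x| ≤ σ) → (∀ x, |b x - u 1 x| ≤ σ) →
      Ω.mabuchiDist a b ≤ (C + σ ^ 2) ^ n / A * (K * (4 * Real.pi * (C + σ ^ 2))) / (2 * s)
        * (q - p + 6 * σ * μ.real univ) + s / 2 + 2 * σ * N := by
  obtain ⟨L, hL0, hL⟩ := hu.exists_lipschitz
  obtain ⟨M, hM0, hM⟩ := exists_abs_deriv_smoothTransition_le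
  set V := μ.real univ with hV
  have hV0 : 0 ≤ V := measureReal_nonneg
  set N : ℝ := (L + 3 + M * (3 * L + 2)) * Real.sqrt ((Ω.topPower 0).real univ) with hN
  have hN0 : 0 ≤ N := by positivity
  refine ⟨N, fun σ hσ hσ8 s hs a b ha hb hau hbu => ?_⟩
  -- With `ε = σ ^ 2` the terms `ε / σ` of the velocity and acceleration bounds tend to zero with `σ`.
  set ε := σ ^ 2 with hε
  have hε0 : 0 < ε := by positivity
  have hεσ : ε ≤ σ / 8 := by rw [hε]; nlinarith
  obtain ⟨Φ, H⟩ := hu.exists_isRegularization hC.le hle hσ hε0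
  have hblend := H.isSmoothCurve_blend hσ hσ8 ha hb
  have hCε : 0 < C + ε := by positivity
  set D := (C + ε) ^ n / A * (K * (4 * Real.pi * (C + ε))) with hD
  have hD0 : 0 ≤ D := by positivity
  have m0 : (0 : ℝ) ∈ Icc (0 : ℝ) 1 := ⟨le_rfl, zero_le_one⟩
  have m1 : (1 : ℝ) ∈ Icc (0 : ℝ) 1 := ⟨zero_le_one, le_rfl⟩
  -- the speed of the transitions
  have hvel : ∀ t ∈ Icc (2 * σ) (1 - 2 * σ), ∀ x, |deriv (fun s => Φ s x) t| ≤ L + 3 := by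
    intro t ht x
    refine (H.abs_velocity_le hσ hL ht x).trans ?_
    have h1 : 2 * ε / σ = 2 * σ := by rw [hε]; field_simp
    rw [h1]
    nlinarith
  have htrans : ∀ (c : X → ℝ) (r κ t₀ : ℝ), |κ| = σ⁻¹ → t₀ ∈ Icc (0 : ℝ) 1 →
      (∀ x, |c x - u t₀ x| ≤ σ) → ∀ t ∈ Icc (2 * σ) (1 - 2 * σ), |t₀ - t| ≤ 3 * σ →
      (∀ᶠ s in 𝓝 t, blend a b Φ σ s
        = fun x => Φ s x + Real.smoothTransition (κ * s + r) * (c x - Φ s x)) →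
      Ω.speed (blend a b Φ σ) t ≤ N := by
    intro c r κ t₀ hκ ht₀ hc t ht htt hev
    refine speed_le_of_abs_le hblend.1
      (hblend.2 t ⟨by linarith [ht.1], by linarith [ht.2]⟩) (by positivity) fun x => ?_
    have h1 : deriv (fun s => blend a b Φ σ s x) t
        = deriv (fun s => Φ s x + Real.smoothTransition (κ * s + r) * (c x - Φ s x)) t :=
      EventuallyEq.deriv_eq (hev.mono fun s hs => congrFun hs x)
    rw [h1]
    refine (abs_deriv_transition_le (hasDerivAt_of_contMDiff H.contMDiff x t) hM).trans ?_
    have h2 : |c x - Φ t x| ≤ (3 * L + 2) * σ := by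
      have e1 := abs_le.1 (hc x)
      have e2 := abs_le.1 (hL t₀ ht₀ t ⟨by linarith [ht.1], by linarith [ht.2]⟩ x)
      have e3 := abs_le.1 (H.close t ⟨by linarith [ht.1], by linarith [ht.2]⟩ x)
      have e4 : L * |t₀ - t| ≤ L * (3 * σ) := by gcongr
      rw [abs_le]
      constructor <;> linarith
    have h3 : M * |κ| * |c x - Φ t x| ≤ M * σ⁻¹ * ((3 * L + 2) * σ) := by
      rw [hκ]
      gcongr
    have h4 : M * σ⁻¹ * ((3 * L + 2) * σ) = M * (3 * L + 2) := by field_simp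
    rw [h4] at h3
    exact add_le_add (hvel t ht x) h3
  -- the acceleration
  set I : ℝ → ℝ := fun t => ∫ x, deriv (deriv fun s => Φ s x) t ∂μ with hI
  have hI' : ∀ t, HasDerivAt (fun t => ∫ x, deriv (fun s => Φ s x) t ∂μ) (I t) t :=
    hasDerivAt_integral (Φ := fun t x => deriv (fun s => Φ s x) t)
      (contMDiff_deriv_curve H.contMDiff)
  have hIc : Continuous I := continuous_iff_continuousAt.2 fun t =>
    (hasDerivAt_integral (μ := μ) (Φ := fun t x => deriv (deriv fun s => Φ s x) t)
      (contMDiff_deriv_curve (Φ := fun t x => deriv (fun s => Φ s x) t)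
        (contMDiff_deriv_curve H.contMDiff)) t).continuousAt
  set k : ℝ → ℝ := fun t => D / (2 * s) * (I t + ε * V) + s / 2 with hk
  have hkc : Continuous k := by simp only [hk]; fun_prop
  have hlen : Ω.mabuchiLength (blend a b Φ σ)
      ≤ (∫ t in (3 * σ)..(1 - 3 * σ), k t) + 2 * σ * N := by
    rw [mabuchiLength_eq]
    refine intervalIntegral_le_of_transition hσ hσ8 hN0 (fun t => speed_nonneg _ t) hkc
      (fun t ht => ?_) (fun t ht => ?_) (fun t ht => ?_) (fun t ht => ?_) (fun t ht => ?_)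
      fun t ht => ?_
    · have h1 : -(ε * V) ≤ I t := H.neg_le_integral ⟨by linarith [ht.1], by linarith [ht.2]⟩
      have h2 : 0 ≤ I t + ε * V := by linarith
      simp only [hk]
      positivity
    · exact speed_eq_zero_of_eventually (a := a) ((gt_mem_nhds ht).mono fun s hs =>
        blend_eq_start hσ hσ8 (le_of_lt hs))
    · exact speed_eq_zero_of_eventually (a := b) ((lt_mem_nhds ht).mono fun s hs =>
        blend_eq_end hσ hσ8 (le_of_lt hs))
    · refine htrans a 3 (-σ⁻¹) 0 (by rw [abs_neg, abs_of_pos (by positivity)]) m0 hau t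
        ⟨ht.1, by linarith [ht.2]⟩ (by rw [abs_le]; constructor <;> linarith [ht.1, ht.2]) ?_
      have : t < 1 - 3 * σ := by linarith [ht.2]
      exact (gt_mem_nhds this).mono fun s hs => blend_eq_left hσ (le_of_lt hs)
    · refine htrans b (3 - σ⁻¹) σ⁻¹ 1 (abs_of_pos (by positivity)) m1 hbu t
        ⟨by linarith [ht.1], ht.2⟩ (by rw [abs_le]; constructor <;> linarith [ht.1, ht.2]) ?_
      have : 3 * σ < t := by linarith [ht.1]
      exact (lt_mem_nhds this).mono fun s hs => blend_eq_right hσ (le_of_lt hs)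
    · have hmid : ∀ᶠ s in 𝓝 t, blend a b Φ σ s = Φ s := by
        filter_upwards [Ioo_mem_nhds ht.1 ht.2] with s hs
        exact blend_eq_middle hσ hs.1.le hs.2.le
      have hts : t ∈ Icc σ (1 - σ) := ⟨by linarith [ht.1], by linarith [ht.2]⟩
      rw [speed_congr hmid]
      obtain ⟨c, hc⟩ := hvar u Φ C σ ε hCε.le H t hts
      refine (speed_le_of_integral_le H.contMDiff (H.isPotential t hts) hCε hA hAμ hs
        (H.form_le t hts) hc).trans (le_of_eq ?_)
      simp only [hk, hD, hI]
      field_simp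
  have hint : ∫ t in (3 * σ)..(1 - 3 * σ), k t
      ≤ D / (2 * s) * (q - p + 6 * σ * V) + s / 2 := by
    have h1 : ∀ t, HasDerivAt (fun t => D / (2 * s) * ((∫ x, deriv (fun s => Φ s x) t ∂μ) + ε * V * t)
        + s / 2 * t) (k t) t := fun t => by
      refine ((((hI' t).add ((hasDerivAt_id t).const_mul (ε * V))).const_mul (D / (2 * s))).add
        ((hasDerivAt_id t).const_mul (s / 2))).congr_deriv ?_
      simp only [hk]
      ring
    rw [intervalIntegral.integral_eq_sub_of_hasDerivAt (fun t _ => h1 t)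
      (hkc.intervalIntegrable _ _)]
    have h2 := H.integral_velocity_sub_le hu hσ.le (a := 3 * σ) (b := 1 - 3 * σ) (h := σ) hσ
      (by linarith) (by linarith) (by linarith) hp hq
    have h3 : ε * V * (4 / σ + σ) = (4 * σ + σ ^ 3) * V := by rw [hε]; field_simp
    rw [← hV, h3] at h2
    have h4 : (∫ x, deriv (fun s => Φ s x) (1 - 3 * σ) ∂μ) - (∫ x, deriv (fun s => Φ s x) (3 * σ) ∂μ)
        + ε * V * (1 - 6 * σ) ≤ q - p + 6 * σ * V := by
      have h5 : (σ ^ 3 + ε * (1 - 6 * σ)) * V ≤ (2 * σ) * V := by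
        gcongr
        rw [hε]
        nlinarith [pow_pos hσ 3]
      nlinarith
    have h6 := mul_le_mul_of_nonneg_left h4 (by positivity : 0 ≤ D / (2 * s))
    have h7 : 0 ≤ s * σ := by positivity
    nlinarith
  have h0 : blend a b Φ σ 0 = a := blend_eq_start hσ hσ8 (by linarith)
  have h1 : blend a b Φ σ 1 = b := blend_eq_end hσ hσ8 (by linarith)
  have h2 := mabuchiDist_le_length hblend
  rw [h0, h1] at h2
  linarith

/-- The extended Mabuchi distance between the end points of a subgeodesic. -/
theorem IsSubgeodesic.mul_sq_le_of_hasMabuchiDist [IsFiniteMeasure μ] (hu : Ω.IsSubgeodesic u)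
    {C A K p q d : ℝ} (hC : 0 < C) (hle : Ω.SliceLE u C) (hA : 0 < A)
    (hAμ : ENNReal.ofReal A • Ω.topPower 0 ≤ μ) (hK : 0 ≤ K)
    (hvar : ∀ (u Φ : ℝ → X → ℝ) (C σ ε : ℝ), 0 ≤ C + ε →
      Ω.IsRegularization u C σ ε Φ → ∀ t ∈ Icc σ (1 - σ), ∃ c : ℝ,
        ∫ x, (deriv (fun s => Φ s x) t - c) ^ 2 ∂μ ≤ K * (4 * Real.pi * (C + ε))
          * (∫ x, deriv (deriv fun s => Φ s x) t ∂μ + ε * μ.real univ))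
    (hp : ∀ x y, 0 ≤ x → x ≤ y → y ≤ 1 → p * (y - x) ≤ ∫ z, u y z ∂μ - ∫ z, u x z ∂μ)
    (hq : ∀ x y, 0 ≤ x → x ≤ y → y ≤ 1 → ∫ z, u y z ∂μ - ∫ z, u x z ∂μ ≤ q * (y - x))
    (hd : Ω.HasMabuchiDist (u 0) (u 1) d) :
    d ^ 2 ≤ C ^ n / A * (K * (4 * Real.pi * C)) * (q - p) := by
  obtain ⟨N, hN⟩ := hu.exists_mabuchiDist_le hC hle hA hAμ hK hvar hp hq
  obtain ⟨a, b, ha, hb, hau, hbu, hlim⟩ := hd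
  have hd0 : 0 ≤ d := ge_of_tendsto' hlim fun j => mabuchiDist_nonneg _ _
  have hpq : 0 ≤ q - p := by
    have h1 := hp 0 1 le_rfl zero_le_one le_rfl
    have h2 := hq 0 1 le_rfl zero_le_one le_rfl
    linarith
  rcases hd0.eq_or_lt with rfl | hdpos
  · rw [zero_pow two_ne_zero]
    positivity
  -- As `σ` tends to zero, the choice `s = d` gives `d ≤ D / (2 * d) + d / 2`, that is `d ^ 2 ≤ D`, where
  -- `D` is the right-hand side of the claim.
  set B : ℝ → ℝ := fun σ => (C + σ ^ 2) ^ n / A * (K * (4 * Real.pi * (C + σ ^ 2))) / (2 * d)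
        * (q - p + 6 * σ * μ.real univ) + d / 2 + 2 * σ * N with hB
  have hdB : ∀ σ, 0 < σ → σ ≤ 1 / 8 → d ≤ B σ := by
    intro σ hσ hσ8
    refine le_of_tendsto hlim ?_
    filter_upwards [Metric.tendstoUniformly_iff.1 hau σ hσ, Metric.tendstoUniformly_iff.1 hbu σ hσ]
      with j h1 h2
    refine hN σ hσ hσ8 d hdpos (a j) (b j) (ha j) (hb j) (fun x => ?_) fun x => ?_
    · have := (h1 x).le
      rwa [dist_comm, Real.dist_eq] at this
    · have := (h2 x).le
      rwa [dist_comm, Real.dist_eq] at this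
  have hBc : Tendsto B (𝓝[>] 0) (𝓝 (B 0)) := by
    have : Continuous B := by simp only [hB]; fun_prop
    exact (this.tendsto 0).mono_left nhdsWithin_le_nhds
  have h1 : d ≤ B 0 := by
    refine ge_of_tendsto hBc ?_
    filter_upwards [Ioc_mem_nhdsGT (by norm_num : (0 : ℝ) < 1 / 8)] with σ hσ
    exact hdB σ hσ.1 hσ.2
  simp only [hB] at h1
  have h2 : d * (2 * d) ≤ ((C + 0 ^ 2) ^ n / A * (K * (4 * Real.pi * (C + 0 ^ 2))) / (2 * d)
        * (q - p + 6 * 0 * μ.real univ) + d / 2 + 2 * 0 * N) * (2 * d) := by gcongr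
  have h3 : ((C + 0 ^ 2) ^ n / A * (K * (4 * Real.pi * (C + 0 ^ 2))) / (2 * d)
        * (q - p + 6 * 0 * μ.real univ) + d / 2 + 2 * 0 * N) * (2 * d)
      = C ^ n / A * (K * (4 * Real.pi * C)) * (q - p) + d ^ 2 := by
    field_simp
    simp
    ring
  nlinarith

end KahlerForm

end DistanceEstimate

/-! ### Subgeodesics along which the functional is affine -/

section AffineCase

variable {n : ℕ}

theorem integral_fderiv_apply_eq_zero {g : Cn n → ℝ} (hg : ContDiff ℝ 1 g)
    (hgc : HasCompactSupport g) (v : Cn n) : ∫ z, fderiv ℝ g z v = 0 := by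
  have h1 := integral_mul_fderiv_eq_neg_fderiv_mul_of_integrable (μ := volume)
    (f := fun _ : Cn n => (1 : ℝ)) (g := g) (v := v) (by simp)
    (by simpa using ((hg.continuous_fderiv one_ne_zero).clm_apply
      continuous_const).integrable_of_hasCompactSupport (hgc.fderiv_apply ℝ v))
    (by simpa using hg.continuous.integrable_of_hasCompactSupport hgc)
    (fun _ _ => differentiableAt_const _) fun _ _ => hg.differentiable one_ne_zero _
  simpa using h1

theorem integral_ddc_eq_zero {χ : Cn n → ℝ} (hχ : ContDiff ℝ ∞ χ) (hχc : HasCompactSupport χ)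
    (v w : Cn n) : ∫ z, ddc χ z v w = 0 := by
  have hD : ContDiff ℝ ∞ (fderiv ℝ χ) := hχ.fderiv_right (m := ∞) (by simp)
  have hDD : Continuous (fderiv ℝ (fderiv ℝ χ)) := hD.continuous_fderiv (by simp)
  have key : ∀ a b : Cn n, Integrable (fun z => fderiv ℝ (fderiv ℝ χ) z a b) ∧
      ∫ z, fderiv ℝ (fderiv ℝ χ) z a b = 0 := by
    intro a b
    have h1 : ContDiff ℝ 1 fun z => fderiv ℝ χ z b :=
      (hD.clm_apply contDiff_const).of_le (by exact_mod_cast le_top)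
    have h2 : HasCompactSupport fun z => fderiv ℝ χ z b := hχc.fderiv_apply ℝ b
    have h3 : (fun z => fderiv ℝ (fderiv ℝ χ) z a b) = fun z => fderiv ℝ (fun y => fderiv ℝ χ y b) z a := by
      ext z
      rw [fderiv_clm_apply (hD.differentiable (by simp) z) (differentiableAt_const b)]
      simp
    rw [h3]
    exact ⟨((h1.continuous_fderiv one_ne_zero).clm_apply
      continuous_const).integrable_of_hasCompactSupport (h2.fderiv_apply ℝ a),
      integral_fderiv_apply_eq_zero h1 h2 a⟩
  simp only [ddc_eq]
  rw [integral_div, integral_sub (key _ _).1 (key _ _).1, (key _ _).2, (key _ _).2]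
  simp

variable {X : Type*} [TopologicalSpace X] [ChartedSpace (Cn n) X]
  [IsManifold 𝓘(ℂ, Cn n) ∞ X] [CompactSpace X] [T2Space X] {Ω : KahlerForm n X}
  {u : ℝ → X → ℝ}

namespace KahlerForm

theorem sameCurrent_of_eq_add_const {φ ψ : X → ℝ} (hψ : Continuous ψ) {c : ℝ}
    (h : ∀ x, φ x = ψ x + c) : Ω.SameCurrent φ ψ := by
  intro e he χ hχ a b
  have i1 : Integrable fun z => Ω.coord e z a b * χ z :=
    (continuous_mul_of_tsupport_subset e.open_target (Ω.smooth e he a b).continuousOn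
      hχ.1.continuous hχ.2.2).integrable_of_hasCompactSupport hχ.2.1.mul_left
  have hc : HasCompactSupport fun z => ddc χ z a b :=
    hχ.2.1.mono' ((subset_tsupport _).trans (tsupport_ddc_subset χ a b))
  have i2 : Integrable fun z => ψ (e.symm z) * ddc χ z a b :=
    (continuous_mul_of_tsupport_subset e.open_target (hψ.comp_continuousOn e.continuousOn_symm)
      (continuous_ddc hχ.1 a b) ((tsupport_ddc_subset χ a b).trans
        hχ.2.2)).integrable_of_hasCompactSupport hc.mul_left
  have i3 : Integrable fun z => c * ddc χ z a b :=
    ((continuous_ddc hχ.1 a b).integrable_of_hasCompactSupport hc).const_mul c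
  have i4 : Integrable fun z => Ω.coord e z a b * χ z + ψ (e.symm z) * ddc χ z a b := i1.add i2
  have h1 : Ω.currentPair φ e χ a b
      = ∫ z, ((Ω.coord e z a b * χ z + ψ (e.symm z) * ddc χ z a b) + c * ddc χ z a b) :=
    integral_congr_ae (Eventually.of_forall fun z => by simp only [h]; ring)
  rw [h1, integral_add i4 i3, integral_const_mul, integral_ddc_eq_zero hχ.1 hχ.2.1, mul_zero,
    add_zero, currentPair]

variable [MeasurableSpace X] [BorelSpace X] {μ : Measure X}

/-- If the integrals of a subgeodesic have constant slope, its velocity is constant on `X`: a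
regularization has small total acceleration, hence velocities of small variance. -/
theorem IsSubgeodesic.exists_eq_add_const [IsFiniteMeasure μ] [μ.IsOpenPosMeasure]
    (hu : Ω.IsSubgeodesic u) {K p : ℝ} (hK : 0 ≤ K)
    (hvar : ∀ (u Φ : ℝ → X → ℝ) (C σ ε : ℝ), 0 ≤ C + ε →
      Ω.IsRegularization u C σ ε Φ → ∀ t ∈ Icc σ (1 - σ), ∃ c : ℝ,
        ∫ x, (deriv (fun s => Φ s x) t - c) ^ 2 ∂μ ≤ K * (4 * Real.pi * (C + ε))
          * (∫ x, deriv (deriv fun s => Φ s x) t ∂μ + ε * μ.real univ))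
    (hp : ∀ x y, 0 ≤ x → x ≤ y → y ≤ 1 → ∫ z, u y z ∂μ - ∫ z, u x z ∂μ = p * (y - x))
    {a b : ℝ} (ha : 0 < a) (hab : a ≤ b) (hb : b < 1) : ∃ c, ∀ x, u b x = u a x + c := by
  obtain ⟨C, hC0, hC⟩ := hu.exists_sliceLE
  set V := μ.real univ with hV
  have hV0 : 0 ≤ V := measureReal_nonneg
  have ma : a ∈ Icc (0 : ℝ) 1 := ⟨ha.le, hab.trans hb.le⟩
  have mb : b ∈ Icc (0 : ℝ) 1 := ⟨ha.le.trans hab, hb.le⟩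
  -- The variance `S` of the increment `w` is the integral of `w * ψ`, where `ψ` is `w` minus its mean;
  -- for a regularization this is the time integral of the pairing of the velocity with `ψ`.
  set w : X → ℝ := fun x => u b x - u a x with hw
  have hwc : Continuous w := (hu.continuous_slice mb).sub (hu.continuous_slice ma)
  set m := ⨍ y, w y ∂μ with hm
  set ψ : X → ℝ := fun x => w x - m with hψ
  have hψc : Continuous ψ := hwc.sub continuous_const
  have hψ0 : ∫ x, ψ x ∂μ = 0 := integral_sub_average μ w
  set S := ∫ x, ψ x ^ 2 ∂μ with hS
  have hwψ : ∫ x, w x * ψ x ∂μ = S := by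
    have h1 : ∫ x, w x * ψ x ∂μ = ∫ x, (ψ x ^ 2 + m * ψ x) ∂μ :=
      integral_congr_ae (Eventually.of_forall fun x => by simp only [hψ]; ring)
    have i1 : Integrable (fun x => ψ x ^ 2) μ := (hψc.pow 2).integrable_of_compactSpace
    rw [h1, integral_add i1 (hψc.integrable_of_compactSpace.const_mul m), integral_const_mul, hψ0, mul_zero, add_zero]
  set T := ∫ x, |ψ x| ∂μ with hT
  have hT0 : 0 ≤ T := integral_nonneg fun x => abs_nonneg _
  set σ := min a (1 - b) / 2 with hσ
  have hσ0 : 0 < σ := half_pos (lt_min ha (by linarith))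
  have hσa : 2 * σ ≤ a := by rw [hσ]; linarith [min_le_left a (1 - b)]
  have hσb : 2 * σ ≤ 1 - b := by rw [hσ]; linarith [min_le_right a (1 - b)]
  set D := K * (4 * Real.pi * (C + 1)) with hD
  have hD0 : 0 ≤ D := by positivity
  set Q := D * V * (4 / σ + σ + 1) + 4 * T with hQ
  have hmain : ∀ ε ∈ Ioc (0 : ℝ) 1, S ≤ ε * Q := by
    intro ε hε
    obtain ⟨Φ, H⟩ := hu.exists_isRegularization (σ := σ) hC0 hC hσ0 hε.1
    have h1 := H.integral_velocity_sub_le (μ := μ) hu hσ0.le (a := a) (b := b) (h := σ) (p := p)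
      (q := p) hσ0 hab (by linarith) (by linarith) (fun x y h1 h2 h3 => (hp x y h1 h2 h3).ge)
      fun x y h1 h2 h3 => (hp x y h1 h2 h3).le
    rw [sub_self, zero_add, ← hV] at h1
    -- Young's inequality, after subtracting a constant from the velocity
    have h2 : ∀ t ∈ Icc a b, ∫ x, deriv (fun s => Φ s x) t * ψ x ∂μ
        ≤ D / 2 * ((∫ x, deriv (deriv fun s => Φ s x) t ∂μ) + ε * V) + S / 2 := by
      intro t ht
      have hts : t ∈ Icc σ (1 - σ) := ⟨by linarith [ht.1], by linarith [ht.2]⟩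
      obtain ⟨c, hc⟩ := hvar u Φ C σ ε (by linarith [hε.1]) H t hts
      have hn := H.neg_le_integral (μ := μ) hts
      have hv := continuous_velocity H.contMDiff t
      have e1 : ∫ x, deriv (fun s => Φ s x) t * ψ x ∂μ
          = ∫ x, (deriv (fun s => Φ s x) t - c) * ψ x ∂μ := by
        have : ∫ x, (deriv (fun s => Φ s x) t - c) * ψ x ∂μ
            = ∫ x, (deriv (fun s => Φ s x) t * ψ x - c * ψ x) ∂μ :=
          integral_congr_ae (Eventually.of_forall fun x => by simp only; ring)
        have i0 : Integrable (fun x => deriv (fun s => Φ s x) t * ψ x) μ :=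
          (hv.mul hψc).integrable_of_compactSpace
        rw [this, integral_sub i0
          (hψc.integrable_of_compactSpace.const_mul c), integral_const_mul, hψ0, mul_zero, sub_zero]
      have i1 : Integrable (fun x => 1 / 2 * (deriv (fun s => Φ s x) t - c) ^ 2) μ :=
        (((hv.sub continuous_const).pow 2).integrable_of_compactSpace).const_mul _
      have i2 : Integrable (fun x => 1 / 2 * ψ x ^ 2) μ :=
        ((hψc.pow 2).integrable_of_compactSpace).const_mul _
      have e2 : ∫ x, (deriv (fun s => Φ s x) t - c) * ψ x ∂μ
          ≤ ∫ x, (1 / 2 * (deriv (fun s => Φ s x) t - c) ^ 2 + 1 / 2 * ψ x ^ 2) ∂μ :=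
        integral_mono ((hv.sub continuous_const).mul hψc).integrable_of_compactSpace (i1.add i2)
          fun x => by
            simp only
            nlinarith [sq_nonneg (deriv (fun s => Φ s x) t - c - ψ x)]
      rw [integral_add i1 i2, integral_const_mul, integral_const_mul, ← hS] at e2
      have e3 : K * (4 * Real.pi * (C + ε)) * ((∫ x, deriv (deriv fun s => Φ s x) t ∂μ) + ε * V)
          ≤ D * ((∫ x, deriv (deriv fun s => Φ s x) t ∂μ) + ε * V) := by
        refine mul_le_mul_of_nonneg_right ?_ (by linarith)
        rw [hD]
        gcongr
        exact hε.2
      rw [e1]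
      linarith
    have hd : ∀ t, HasDerivAt (fun t => D / 2 * ((∫ x, deriv (fun s => Φ s x) t ∂μ) + ε * V * t)
        + S / 2 * t) (D / 2 * ((∫ x, deriv (deriv fun s => Φ s x) t ∂μ) + ε * V) + S / 2) t := by
      intro t
      refine ((((hasDerivAt_integral (μ := μ) (Φ := fun t x => deriv (fun s => Φ s x) t)
        (contMDiff_deriv_curve H.contMDiff) t).add ((hasDerivAt_id t).const_mul (ε * V))).const_mul
        (D / 2)).add ((hasDerivAt_id t).const_mul (S / 2))).congr_deriv ?_
      ring
    have h3 := sub_le_sub_of_hasDerivAt_le hab (hasDerivAt_integral_curve H.contMDiff hψc) hd h2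
    have mΦa : a ∈ Icc σ (1 - σ) := ⟨by linarith, by linarith⟩
    have mΦb : b ∈ Icc σ (1 - σ) := ⟨by linarith, by linarith⟩
    have ca : Continuous (Φ a) := (H.isPotential a mΦa).1.continuous
    have cb : Continuous (Φ b) := (H.isPotential b mΦb).1.continuous
    have h4 : S - 2 * ε * T ≤ (∫ x, Φ b x * ψ x ∂μ) - ∫ x, Φ a x * ψ x ∂μ := by
      have i1 : Integrable (fun x => Φ b x * ψ x) μ := (cb.mul hψc).integrable_of_compactSpace
      have i2 : Integrable (fun x => Φ a x * ψ x) μ := (ca.mul hψc).integrable_of_compactSpace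
      have i3 : Integrable (fun x => w x * ψ x) μ := (hwc.mul hψc).integrable_of_compactSpace
      have i4 : Integrable (fun x => 2 * ε * |ψ x|) μ :=
        hψc.abs.integrable_of_compactSpace.const_mul _
      rw [← integral_sub i1 i2, ← hwψ, hT, ← integral_const_mul, ← integral_sub i3 i4]
      refine integral_mono (i3.sub i4) (i1.sub i2) fun x => ?_
      have e1 := abs_le.1 (H.close a mΦa x)
      have e2 := abs_le.1 (H.close b mΦb x)
      have e3 : |(w x - (Φ b x - Φ a x)) * ψ x| ≤ 2 * ε * |ψ x| := by
        rw [abs_mul]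
        gcongr
        rw [abs_le]
        simp only [hw]
        constructor <;> linarith
      have e4 := (abs_le.1 e3).2
      simp only
      linarith
    have h5 : D / 2 * ((∫ x, deriv (fun s => Φ s x) b ∂μ) + ε * V * b) + S / 2 * b
        - (D / 2 * ((∫ x, deriv (fun s => Φ s x) a ∂μ) + ε * V * a) + S / 2 * a)
        ≤ D / 2 * (ε * V * (4 / σ + σ) + ε * V) + S / 2 := by
      have hS0 : 0 ≤ S := integral_nonneg fun x => sq_nonneg _
      have e1 : S * (b - a) ≤ S * 1 := by gcongr; linarith
      have e2 : ε * V * (b - a) ≤ ε * V * 1 := by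
        have := hε.1.le
        gcongr
        linarith
      have e3 : (∫ x, deriv (fun s => Φ s x) b ∂μ) - (∫ x, deriv (fun s => Φ s x) a ∂μ)
          + ε * V * (b - a) ≤ ε * V * (4 / σ + σ) + ε * V := by linarith
      have e4 := mul_le_mul_of_nonneg_left e3 (by positivity : 0 ≤ D / 2)
      linarith
    rw [hQ]
    linarith
  have hS0 : S = 0 := by
    refine le_antisymm ?_ (integral_nonneg fun x => sq_nonneg _)
    have h1 : Tendsto (fun ε => ε * Q) (𝓝[>] 0) (𝓝 0) := by
      have : Continuous fun ε => ε * Q := by fun_prop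
      simpa using (this.tendsto 0).mono_left nhdsWithin_le_nhds
    refine ge_of_tendsto h1 ?_
    filter_upwards [Ioc_mem_nhdsGT (zero_lt_one' ℝ)] with ε hε using hmain ε hε
  have h1 := (integral_eq_zero_iff_of_nonneg (fun x => sq_nonneg (ψ x))
    (hψc.pow 2).integrable_of_compactSpace).1 hS0
  have h2 : (fun x => ψ x ^ 2) = fun _ => 0 :=
    (Continuous.ae_eq_iff_eq μ (hψc.pow 2) continuous_const).1 h1
  refine ⟨m, fun x => ?_⟩
  have h3 : ψ x = 0 := pow_eq_zero_iff two_ne_zero |>.1 (congrFun h2 x)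
  simp only [hψ, hw] at h3
  linarith

/-- Constancy of `u b - u a` on `X` extends to the end points by continuity. -/
theorem IsSubgeodesic.sub_eq_sub_of_affine (hu : Ω.IsSubgeodesic u)
    (h : ∀ a b : ℝ, 0 < a → a ≤ b → b < 1 → ∃ c, ∀ x, u b x = u a x + c) {s t : ℝ}
    (hs : s ∈ Icc (0 : ℝ) 1) (ht : t ∈ Icc (0 : ℝ) 1) (x y : X) :
    u s x - u s y = u t x - u t y := by
  set g : ℝ → ℝ := fun t => u t x - u t y with hg
  have hgc : ContinuousOn g (Icc 0 1) := (hu.continuousOn_curve x).sub (hu.continuousOn_curve y)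
  have h1 : ∀ r ∈ Ioo (0 : ℝ) 1, g r = g (1 / 2) := by
    intro r hr
    rcases le_total r (1 / 2) with h' | h'
    · obtain ⟨c, hc⟩ := h r (1 / 2) hr.1 h' (by norm_num)
      simp only [hg, hc]
      ring
    · obtain ⟨c, hc⟩ := h (1 / 2) r (by norm_num) h' hr.2
      simp only [hg, hc]
      ring
  have h2 : EqOn g (fun _ => g (1 / 2)) (Icc 0 1) := by
    refine EqOn.of_subset_closure (s := Ioo (0 : ℝ) 1) h1 hgc continuousOn_const Ioo_subset_Icc_self
      (closure_Ioo zero_ne_one).ge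
  exact (h2 hs).trans (h2 ht).symm

end KahlerForm

end AffineCase

/-! ### Strict convexity -/

theorem proposition4p1 {n : ℕ} {X : Type*} [TopologicalSpace X] [ChartedSpace (Cn n) X]
    [IsManifold 𝓘(ℂ, Cn n) ∞ X] [CompactSpace X] [T2Space X] [ConnectedSpace X]
    [MeasurableSpace X] [BorelSpace X]
    (Ω : KahlerForm n X) (μ : Measure X) (hμ : IsSmoothVolume n μ) :
    (∀ u : ℝ → X → ℝ, Ω.IsSubgeodesic u →
      DifferentiableOn ℝ (fun t : ℝ => ∫ x, u t x ∂μ) (Icc 0 1) ∧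
      ConvexOn ℝ (Icc 0 1) (fun t : ℝ => ∫ x, u t x ∂μ) ∧
      ((∃ a b : ℝ, ∀ t ∈ Icc (0 : ℝ) 1, ∫ x, u t x ∂μ = a + b * t) →
        ∀ s ∈ Icc (0 : ℝ) 1, ∀ t ∈ Icc (0 : ℝ) 1, Ω.SameCurrent (u s) (u t))) ∧
    ∃ δ : ℝ, 0 < δ ∧
      ∀ u : ℝ → X → ℝ, Ω.IsSubgeodesic u →
      ∀ C : ℝ, 0 < C → (∀ t ∈ Icc (0 : ℝ) 1, Ω.CurrentLE (u t) C) →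
      ∀ A : ℝ, 0 ≤ A → ENNReal.ofReal A • Ω.topPower 0 ≤ μ →
      ∀ d : ℝ, Ω.HasMabuchiDist (u 0) (u 1) d →
        δ * A / C ^ (n + 1) * d ^ 2 ≤
          derivWithin (fun t : ℝ => ∫ x, u t x ∂μ) (Icc 0 1) 1 -
            derivWithin (fun t : ℝ => ∫ x, u t x ∂μ) (Icc 0 1) 0 := by
  have := hμ.isLocallyFiniteMeasure Ω
  have := hμ.isOpenPosMeasure Ω
  have : IsFiniteMeasure μ := CompactSpace.isFiniteMeasure
  obtain ⟨K, hK, hvar⟩ := hμ.exists_variance_le Ω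
  -- `K` is a Poincaré constant of `μ`, and `d ^ 2 ≤ 4 π K C ^ (n + 1) / A * (f' 1 - f' 0)`. The
  -- summand `1` in `δ` takes care of the case `K = 0`.
  refine ⟨fun u hu => ⟨hu.convexOn_integral.2, hu.convexOn_integral.1, ?_⟩,
    (4 * Real.pi * K + 1)⁻¹, by positivity, fun u hu C hC hle A hA hAμ d hd => ?_⟩
  · rintro ⟨p, q, hpq⟩ s hs t ht
    have hslope : ∀ x y, 0 ≤ x → x ≤ y → y ≤ 1 →
        ∫ z, u y z ∂μ - ∫ z, u x z ∂μ = q * (y - x) := by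
      intro x y h1 h2 h3
      rw [hpq y ⟨h1.trans h2, h3⟩, hpq x ⟨h1, h2.trans h3⟩]
      ring
    have hconst := hu.sub_eq_sub_of_affine (fun a b ha hab hb =>
      hu.exists_eq_add_const hK hvar hslope ha hab hb) hs ht
    obtain ⟨x₀⟩ := (inferInstance : Nonempty X)
    refine KahlerForm.sameCurrent_of_eq_add_const (hu.continuous_slice ht)
      (c := u s x₀ - u t x₀) fun x => ?_
    linarith [hconst x x₀]
  · set f : ℝ → ℝ := fun t => ∫ x, u t x ∂μ with hf
    have hbounds := fun x y (h1 : 0 ≤ x) (h2 : x ≤ y) (h3 : y ≤ 1) =>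
      (hu.convexOn_integral (μ := μ)).1.slope_bounds (hu.convexOn_integral (μ := μ)).2 h1 h2 h3
    set p := derivWithin f (Icc 0 1) 0
    set q := derivWithin f (Icc 0 1) 1
    have hp : ∀ x y, 0 ≤ x → x ≤ y → y ≤ 1 → p * (y - x) ≤ ∫ z, u y z ∂μ - ∫ z, u x z ∂μ :=
      fun x y h1 h2 h3 => (hbounds x y h1 h2 h3).1
    have hq : ∀ x y, 0 ≤ x → x ≤ y → y ≤ 1 → ∫ z, u y z ∂μ - ∫ z, u x z ∂μ ≤ q * (y - x) :=
      fun x y h1 h2 h3 => (hbounds x y h1 h2 h3).2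
    have hpq : 0 ≤ q - p := by
      have h1 := hp 0 1 le_rfl zero_le_one le_rfl
      have h2 := hq 0 1 le_rfl zero_le_one le_rfl
      linarith
    -- For `A = 0` the claim is monotonicity of the derivative.
    rcases hA.eq_or_lt with rfl | hA
    · simpa using hpq
    have h1 := hu.mul_sq_le_of_hasMabuchiDist hC (hu.sliceLE hle) hA hAμ hK hvar hp hq hd
    have h2 : (4 * Real.pi * K + 1)⁻¹ * A / C ^ (n + 1) * d ^ 2
        ≤ (4 * Real.pi * K + 1)⁻¹ * A / C ^ (n + 1)
          * (C ^ n / A * (K * (4 * Real.pi * C)) * (q - p)) := by gcongr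
    have h3 : (4 * Real.pi * K + 1)⁻¹ * A / C ^ (n + 1)
          * (C ^ n / A * (K * (4 * Real.pi * C)) * (q - p))
        = (4 * Real.pi * K) / (4 * Real.pi * K + 1) * (q - p) := by
      field_simp
      ring
    have h4 : (4 * Real.pi * K) / (4 * Real.pi * K + 1) ≤ 1 :=
      (div_le_one (by positivity)).2 (by linarith)
    refine h2.trans (h3.le.trans ?_)
    exact mul_le_of_le_one_left hpq h4

end
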